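/- **Setting.** Let $m\ge 1$, let $\pi\colon E\to M$ be a smooth fibre bundle (or fibred manifold) with $\dim M=m$, $\dim E=m+N$, and let $\omega$ be a volume form on $M$. $J^1E$ is the first jet bundle; a point $\bar y\in J^1E$ over $y\in E$ is identified with a linear section $\bar y\colon T_{\pi(y)}M\to T_yE$ of $T_y\pi$. Let $\mathcal M\pi=\Lambda^m_1T^*E$ be the bundle of $m$-forms on $E$ that vanish when contracted with two $\pi$-vertical vectors, with canonical forms $\Theta$ and $\Omega=-d\Theta$, let $J^{1*}E=\Lambda^m_1T^*E/\Lambda^m_0T^*E$, where $\Lambda^m_0T^*E$ are the $\pi$-semibasic $m$-forms, and let $\mu\colon\mathcal M\pi\to J^{1*}E$ be the projection. A smooth Lagrangian function $L\colon J^1E\to\mathbb R$ has a Poincaré–Cartan form $\Theta_L$ on $J^1E$, locally $\frac{\partial L}{\partial v^A_\alpha}dy^A\wedge d^{m-1}x_\alpha-\bigl(\frac{\partial L}{\partial v^A_\alpha}v^A_\alpha-L\bigr)d^mx$ when $\omega=d^mx$, which is semibasic over $E$. The extended Legendre map $\widetilde{FL}\colon J^1E\to\mathcal M\pi$ sends $\bar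 y$ to the form on $T_yE$ defined by $\Theta_L(\bar y)$, and $FL=\mu\circ\widetilde{FL}$. $L$ is *almost-regular* if $\mathcal P=FL(J^1E)$ is a closed embedded submanifold $\jmath_0\colon\mathcal P\hookrightarrow J^{1*}E$, the induced map $FL_0\colon J^1E\to\mathcal P$ is a submersion, and the sets $FL^{-1}(FL(\bar y))$ are connected; it is *hyper-regular* if $FL$ is a diffeomorphism onto $J^{1*}E$ (this is a particular case, with $\mathcal P=J^{1*}E$). Assume that $L$ is almost-regular. Then $\tilde h\colon\mathcal P\to\mathcal M\pi$ is the map with $\tilde h\circ FL_0=\widetilde{FL}$, and the associated Hamiltonian system is $(J^{1*}E,\mathcal P,\Omega^0_h)$ with $\Omega^0_h=\tilde h^*\Omega$. A *jet field* on $\mathcal P$ is a section $\Psi\colon\mathcal P\to J^1\mathcal P$ (jets of sections of $\tau_0\colon\mathcal P\to M$); it is identified with linear sections of $T\tau_0$. An *Ehresmann connection form* is a section $\nabla$ of $\tau_0^*T^*M\otimes T\mathcal P$ with $i(\nabla)\xi=\xi$ for every $\tau_0$-semibasic one-form $\xi$. Two $m$-vector fields are equivalent if one is the other multiplied by a smooth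 non-vanishing function. The same notions are used along $\widetilde{FL}$, for fields on $J^1E$ with values over $\widetilde{FL}$ in $J^1\mathcal M\pi$, $(\mathcal M\pi\to M)^*T^*M\otimes T\mathcal M\pi$ and $\Lambda^mT\mathcal M\pi$. Contractions are: $i(\Psi)\Xi(Z_1,\dots,Z_m;W)=\Xi(\Psi Z_1,\dots,\Psi Z_m,W)$ for $Z_i\in T M$; the usual one for $m$-vectors; and $i(\nabla)\Xi(w_1,\dots,w_k)=\sum_i\Xi(w_1,\dots,\nabla w_i,\dots,w_k)$. "Smooth on a subset" means locally the restriction of a smooth object of the same kind defined on an open set, and all conditions "on a subset" are imposed at its points. On $P\subseteq\mathcal P$, a *Hamilton–De Donder–Weyl (HDW)* jet field, $m$-vector field, connection is, respectively, a jet field with $i(\Psi)\Omega_h^0=0$ on $P$; a non-vanishing, locally decomposable, $\tau_0$-transverse $m$-vector field with $i(X)\Omega_h^0=0$ on $P$; a connection form with $i(\nabla)\Omega_h^0=(m-1)\Omega_h^0$ on $P$. On $S\subseteq J^1E$, consider for fields along $\widetilde{FL}$ the following conditions. * *Structural condition*: being a jet field $\mathcal Y$ along $\widetilde{FL}$; being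 a non-vanishing, locally decomposable $m$-vector field $\mathcal K$ along $\widetilde{FL}$, transverse over $M$; being an Ehresmann connection form $\nabla_{\mathcal K}$ along $\widetilde{FL}$. * *Field equation condition*: $\widetilde{FL}^*[i(\mathcal Y)(\Omega\circ\widetilde{FL})]=0$; $\widetilde{FL}^*[i(\mathcal K)(\Omega\circ\widetilde{FL})]=0$; $\widetilde{FL}^*[i(\nabla_{\mathcal K})(\Omega\circ\widetilde{FL})-(m-1)\,\Omega\circ\widetilde{FL}]=0$. * *Semi-holonomy condition*: the projection to $E$ is the given jet, i.e. with $\mathrm{pr}\colon\mathcal M\pi\to E$, $T\mathrm{pr}\circ\mathcal Y(\bar y)=\bar y$; $\Lambda^mT\mathrm{pr}(\mathcal K(\bar y))$ is a nonzero multiple of $\bar y(e_1)\wedge\dots\wedge\bar y(e_m)$, $(e_i)$ a basis of $T_{\pi(y)}M$; $T\mathrm{pr}\circ\nabla_{\mathcal K}(\bar y)=\bar y$. An *extended operator* on $S$ is a field along $\widetilde{FL}$ that satisfies all three conditions on $S$. **Theorem.** Let $L$ be almost-regular. 1. (Jet fields.) Let $S\subseteq J^1E$, let $\mathcal Y$ be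 an extended jet field operator on $S$ and $\Psi$ a jet field on $\mathcal P$, smooth on $FL_0(S)$, with $$j^1\tilde h\circ\Psi\circ FL_0=\mathcal Y\quad\text{on }S.\tag{1}$$ Then $\Psi$ is an HDW jet field on $FL_0(S)$. Conversely, if $\Psi$ is an HDW jet field on $P\subseteq\mathcal P$ and $FL_0(S)=P$, then (1) defines a jet field $\mathcal Y$ along $\widetilde{FL}$ on $S$, which satisfies the structural and field equation conditions on $S$. 2. (Classes of $m$-vector fields.) Let $S\subseteq J^1E$, let $\{\mathcal K\}$ be the class on $S$ of an extended $m$-vector field operator on $S$ and $\{X\}$ the class on $FL_0(S)$ of a non-vanishing $m$-vector field, smooth on $FL_0(S)$, such that $$\Lambda^mT\tilde h\circ X\circ FL_0=\mathcal K\quad\text{on }S\tag{2}$$ for some representatives of the two classes. Then every representative of $\{X\}$ is an HDW $m$-vector field on $FL_0(S)$. Conversely, if $X$ is an HDW $m$-vector field on $P\subseteq\mathcal P$ and $FL_0(S)=P$, then (2) defines a class of $m$-vector fields along $\widetilde{FL}$ on $S$ which depends only on the class of $X$, and all representatives of it satisfy the structural and field equation conditions on $S$. 3. (Connections.) Let $S\subseteq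 J^1E$, let $\nabla_{\mathcal K}$ be an extended connection operator on $S$ and $\nabla$ a connection form on $\mathcal P$, smooth on $FL_0(S)$, with $$(\mathrm{id}\otimes T\tilde h)\circ\nabla\circ FL_0=\nabla_{\mathcal K}\quad\text{on }S.\tag{3}$$ Then $\nabla$ is an HDW connection on $FL_0(S)$. Conversely, if $\nabla$ is an HDW connection on $P\subseteq\mathcal P$ and $FL_0(S)=P$, then (3) defines a connection form along $\widetilde{FL}$ on $S$, which satisfies the structural and field equation conditions on $S$. 4. If $L$ is hyper-regular, then the objects along $\widetilde{FL}$ that are defined in the converse statements of 1, 2 and 3 also satisfy the semi-holonomy condition on $S$; so for $S=J^1E$ they are extended operators. 5. In general, the objects defined in the converse statements need not be semi-holonomic: for all $m,N\ge1$ there are an almost-regular Lagrangian on the trivial bundle $\mathbb R^m\times\mathbb R^N\to\mathbb R^m$ and an HDW jet field, an HDW $m$-vector field and an HDW connection on all of $\mathcal P$ such that the objects that they define on $S=J^1E$ through (1), (2), (3) are not semi-holonomic. -/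

import Mathlib

open scoped Manifold ContDiff Topology
open Set

noncomputable section

namespace FieldTheory

/-! ### Helper facts on spaces of alternating forms -/

section Helpers

variable {X Y : Type*} [NormedAddCommGroup X] [NormedSpace ℝ X] [FiniteDimensional ℝ X]
  [NormedAddCommGroup Y] [NormedSpace ℝ Y]

theorem finiteDimensional_multilinear (k : ℕ) :
    FiniteDimensional ℝ (ContinuousMultilinearMap ℝ (fun _ : Fin k => X) ℝ) := by
  let f : ContinuousMultilinearMap ℝ (fun _ : Fin k => X) ℝ →ₗ[ℝ]
      MultilinearMap ℝ (fun _ : Fin k => X) ℝ :=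
    { toFun := fun c => c.toMultilinearMap
      map_add' := fun _ _ => rfl
      map_smul' := fun _ _ => rfl }
  exact Module.Finite.of_injective f ContinuousMultilinearMap.toMultilinearMap_injective

instance finiteDimensional_alternating (k : ℕ) : FiniteDimensional ℝ (X [⋀^Fin k]→L[ℝ] ℝ) := by
  have := finiteDimensional_multilinear (X := X) k
  exact Module.Finite.of_injective
    (ContinuousAlternatingMap.toContinuousMultilinearMapCLM ℝ :
      (X [⋀^Fin k]→L[ℝ] ℝ) →L[ℝ] _).toLinearMap
    ContinuousAlternatingMap.toContinuousMultilinearMap_injective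

theorem contDiff_pullback (k : ℕ) :
    ContDiff ℝ ∞ (fun p : (Y [⋀^Fin k]→L[ℝ] ℝ) × (X →L[ℝ] Y) =>
      p.1.compContinuousLinearMap p.2) := by
  have := finiteDimensional_multilinear (X := X) k
  obtain ⟨g, hg⟩ := LinearMap.exists_leftInverse_of_injective
    (ContinuousAlternatingMap.toContinuousMultilinearMapCLM ℝ :
      (X [⋀^Fin k]→L[ℝ] ℝ) →L[ℝ] _).toLinearMap
    (LinearMap.ker_eq_bot.2 ContinuousAlternatingMap.toContinuousMultilinearMap_injective)
  have h : (fun p : (Y [⋀^Fin k]→L[ℝ] ℝ) × (X →L[ℝ] Y) =>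
      p.1.compContinuousLinearMap p.2) = fun p => LinearMap.toContinuousLinearMap g
        ((ContinuousMultilinearMap.compContinuousLinearMapContinuousMultilinear ℝ
          (fun _ : Fin k => X) (fun _ => Y) ℝ) (fun _ => p.2) p.1.1) := by
    funext p
    exact (LinearMap.congr_fun hg (p.1.compContinuousLinearMap p.2)).symm
  rw [h]
  refine (LinearMap.toContinuousLinearMap g).contDiff.comp (ContDiff.clm_apply ?_ ?_)
  · exact (ContinuousMultilinearMap.contDiff _).comp (contDiff_pi.2 fun _ => contDiff_snd)
  · exact (ContinuousAlternatingMap.toContinuousMultilinearMapCLM ℝ :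
      (Y [⋀^Fin k]→L[ℝ] ℝ) →L[ℝ]
        ContinuousMultilinearMap ℝ (fun _ : Fin k => Y) ℝ).contDiff.comp contDiff_fst

end Helpers

/-! ### Fibred manifolds and adapted coordinates -/

/-- The model space of the base manifold. -/
abbrev BaseModel (m : ℕ) := EuclideanSpace ℝ (Fin m)

/-- The model space of the total space: base coordinates and fibre coordinates. -/
abbrev TotalModel (m N : ℕ) := EuclideanSpace ℝ (Fin m) × EuclideanSpace ℝ (Fin N)

variable (m N : ℕ)
variable {M : Type*} [TopologicalSpace M] [ChartedSpace (BaseModel m) M]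
variable {E : Type*} [TopologicalSpace E] [ChartedSpace (TotalModel m N) E]

/-- A chart `(x, y)` of `E` adapted to `π : E → M`, that is, `x = base ∘ π` for a chart `base`
of `M`. -/
structure AdaptedChart (π : E → M) where
  tot : OpenPartialHomeomorph E (TotalModel m N)
  base : OpenPartialHomeomorph M (BaseModel m)
  tot_smooth : ContMDiffOn 𝓘(ℝ, TotalModel m N) 𝓘(ℝ, TotalModel m N) ∞ tot tot.source
  tot_symm_smooth :
    ContMDiffOn 𝓘(ℝ, TotalModel m N) 𝓘(ℝ, TotalModel m N) ∞ tot.symm tot.target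
  base_smooth : ContMDiffOn 𝓘(ℝ, BaseModel m) 𝓘(ℝ, BaseModel m) ∞ base base.source
  base_symm_smooth : ContMDiffOn 𝓘(ℝ, BaseModel m) 𝓘(ℝ, BaseModel m) ∞ base.symm base.target
  mapsTo : ∀ y ∈ tot.source, π y ∈ base.source
  fst_tot : ∀ y ∈ tot.source, (tot y).1 = base (π y)

/-- `π : E → M` is a smooth fibred manifold: it is smooth and onto, and every point of `E` has
adapted coordinates. Every smooth fibre bundle is of this kind. -/
class IsFiberedManifold (π : E → M) : Prop where
  smooth : ContMDiff 𝓘(ℝ, TotalModel m N) 𝓘(ℝ, BaseModel m) ∞ π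
  surjective : Function.Surjective π
  exists_adapted : ∀ y : E, ∃ a : AdaptedChart m N π, y ∈ a.tot.source

/-- Smooth locally trivial fibre bundles are fibred manifolds. -/
theorem IsFiberedManifold.of_trivializations
    [IsManifold 𝓘(ℝ, BaseModel m) ∞ M] [IsManifold 𝓘(ℝ, TotalModel m N) ∞ E]
    {Q : Type*} [TopologicalSpace Q] [ChartedSpace (EuclideanSpace ℝ (Fin N)) Q]
    [IsManifold 𝓘(ℝ, EuclideanSpace ℝ (Fin N)) ∞ Q] [Nonempty Q] (π : E → M)
    (h : ∀ x : M, ∃ T : Bundle.Trivialization Q π, x ∈ T.baseSet ∧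
      ContMDiffOn 𝓘(ℝ, TotalModel m N)
        (𝓘(ℝ, BaseModel m).prod 𝓘(ℝ, EuclideanSpace ℝ (Fin N))) ∞ T T.source ∧
      ContMDiffOn (𝓘(ℝ, BaseModel m).prod 𝓘(ℝ, EuclideanSpace ℝ (Fin N)))
        𝓘(ℝ, TotalModel m N) ∞ T.toOpenPartialHomeomorph.symm T.target) :
    IsFiberedManifold m N π where
  smooth := by
    intro y
    obtain ⟨T, hx, h1, -⟩ := h (π y)
    have hy : y ∈ T.source := T.mem_source.2 hx
    have h3 : ContMDiffAt 𝓘(ℝ, TotalModel m N) 𝓘(ℝ, BaseModel m) ∞ (fun z => (T z).1) y :=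
      contMDiffAt_fst.comp y (h1.contMDiffAt (T.open_source.mem_nhds hy))
    refine h3.congr_of_eventuallyEq ?_
    filter_upwards [T.open_source.mem_nhds hy] with z hz using (T.coe_fst hz).symm
  surjective := by
    intro x
    obtain ⟨T, hx, -, -⟩ := h x
    obtain ⟨q⟩ := ‹Nonempty Q›
    exact ⟨T.toOpenPartialHomeomorph.symm (x, q), T.proj_symm_apply' hx⟩
  exists_adapted := by
    intro y
    obtain ⟨T, hx, h1, h2⟩ := h (π y)
    have hy : y ∈ T.source := T.mem_source.2 hx
    let c := chartAt (BaseModel m) (π y)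
    let d := chartAt (EuclideanSpace ℝ (Fin N)) (T y).2
    have hc : ContMDiffOn 𝓘(ℝ, BaseModel m) 𝓘(ℝ, BaseModel m) ∞ c c.source :=
      contMDiffOn_chart
    have hc' : ContMDiffOn 𝓘(ℝ, BaseModel m) 𝓘(ℝ, BaseModel m) ∞ c.symm c.target :=
      contMDiffOn_chart_symm
    have hd : ContMDiffOn 𝓘(ℝ, EuclideanSpace ℝ (Fin N)) 𝓘(ℝ, EuclideanSpace ℝ (Fin N)) ∞
      d d.source := contMDiffOn_chart
    have hd' : ContMDiffOn 𝓘(ℝ, EuclideanSpace ℝ (Fin N)) 𝓘(ℝ, EuclideanSpace ℝ (Fin N)) ∞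
      d.symm d.target := contMDiffOn_chart_symm
    let e : OpenPartialHomeomorph E (TotalModel m N) :=
      T.toOpenPartialHomeomorph.trans (c.prod d)
    refine ⟨⟨e, c, ?_, ?_, hc, hc', ?_, ?_⟩, ?_⟩
    · have hm : ∀ z ∈ e.source, z ∈ T.source ∧ T z ∈ c.source ×ˢ d.source := fun z hz => by
        simpa [e, OpenPartialHomeomorph.trans_source] using hz
      have hT := h1.mono fun z hz => (hm z hz).1
      exact (hc.comp (contMDiff_fst.comp_contMDiffOn hT) fun z hz => (hm z hz).2.1).prodMk_space
        (hd.comp (contMDiff_snd.comp_contMDiffOn hT) fun z hz => (hm z hz).2.2)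
    · have hm : ∀ u ∈ e.target, u ∈ c.target ×ˢ d.target ∧ (c.symm u.1, d.symm u.2) ∈ T.target :=
        fun u hu => by
          simpa [e, OpenPartialHomeomorph.trans_target] using hu
      have hf : ContMDiff 𝓘(ℝ, TotalModel m N) 𝓘(ℝ, BaseModel m) ∞
          (Prod.fst : TotalModel m N → BaseModel m) := contDiff_fst.contMDiff
      have hs : ContMDiff 𝓘(ℝ, TotalModel m N) 𝓘(ℝ, EuclideanSpace ℝ (Fin N)) ∞
          (Prod.snd : TotalModel m N → EuclideanSpace ℝ (Fin N)) := contDiff_snd.contMDiff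
      exact h2.comp ((hc'.comp hf.contMDiffOn fun u hu => (hm u hu).1.1).prodMk
        (hd'.comp hs.contMDiffOn fun u hu => (hm u hu).1.2)) fun u hu => (hm u hu).2
    · intro z hz
      have hz' : z ∈ T.source ∧ T z ∈ c.source ×ˢ d.source := by
        simpa [e, OpenPartialHomeomorph.trans_source] using hz
      simpa [T.coe_fst hz'.1] using hz'.2.1
    · intro z hz
      have hz' : z ∈ T.source ∧ T z ∈ c.source ×ˢ d.source := by
        simpa [e, OpenPartialHomeomorph.trans_source] using hz
      show c (T z).1 = c (π z)
      rw [T.coe_fst hz'.1]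
    · simp [e, hy, c, d]

variable {m N}
variable {π : E → M}

namespace AdaptedChart

variable (a b : AdaptedChart m N π)

/-- Differential of the chart at `y`. -/
def d (y : E) : TangentSpace 𝓘(ℝ, TotalModel m N) y →L[ℝ] TotalModel m N :=
  mfderiv 𝓘(ℝ, TotalModel m N) 𝓘(ℝ, TotalModel m N) a.tot y

/-- Inverse differential of the chart at `y`. -/
def dInv (y : E) : TotalModel m N →L[ℝ] TangentSpace 𝓘(ℝ, TotalModel m N) y :=
  mfderiv 𝓘(ℝ, TotalModel m N) 𝓘(ℝ, TotalModel m N) a.tot.symm (a.tot y)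

/-- Differential of the base chart at `x`. -/
def db (x : M) : TangentSpace 𝓘(ℝ, BaseModel m) x →L[ℝ] BaseModel m :=
  mfderiv 𝓘(ℝ, BaseModel m) 𝓘(ℝ, BaseModel m) a.base x

/-- Inverse differential of the base chart at `x`. -/
def dbInv (x : M) : BaseModel m →L[ℝ] TangentSpace 𝓘(ℝ, BaseModel m) x :=
  mfderiv 𝓘(ℝ, BaseModel m) 𝓘(ℝ, BaseModel m) a.base.symm (a.base x)

theorem tot_mdifferentiable :
    a.tot.MDifferentiable 𝓘(ℝ, TotalModel m N) 𝓘(ℝ, TotalModel m N) :=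
  ⟨a.tot_smooth.mdifferentiableOn (by simp), a.tot_symm_smooth.mdifferentiableOn (by simp)⟩

theorem base_mdifferentiable : a.base.MDifferentiable 𝓘(ℝ, BaseModel m) 𝓘(ℝ, BaseModel m) :=
  ⟨a.base_smooth.mdifferentiableOn (by simp), a.base_symm_smooth.mdifferentiableOn (by simp)⟩

variable {a b}

theorem dInv_d {y : E} (hy : y ∈ a.tot.source) (v : TangentSpace 𝓘(ℝ, TotalModel m N) y) :
    a.dInv y (a.d y v) = v :=
  DFunLike.congr_fun (a.tot_mdifferentiable.symm_comp_deriv hy) v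

theorem d_dInv {y : E} (hy : y ∈ a.tot.source) (v : TotalModel m N) :
    a.d y (a.dInv y v) = v := by
  have h := DFunLike.congr_fun
    (a.tot_mdifferentiable.comp_symm_deriv (a.tot.map_source hy)) v
  have e : a.tot.symm (a.tot y) = y := a.tot.left_inv hy
  rw [e] at h
  exact h

theorem dbInv_db {x : M} (hx : x ∈ a.base.source) (v : TangentSpace 𝓘(ℝ, BaseModel m) x) :
    a.dbInv x (a.db x v) = v :=
  DFunLike.congr_fun (a.base_mdifferentiable.symm_comp_deriv hx) v

theorem db_dbInv {x : M} (hx : x ∈ a.base.source) (v : BaseModel m) :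
    a.db x (a.dbInv x v) = v := by
  have h := DFunLike.congr_fun
    (a.base_mdifferentiable.comp_symm_deriv (a.base.map_source hx)) v
  have e : a.base.symm (a.base x) = x := a.base.left_inv hx
  rw [e] at h
  exact h

theorem fst_d [IsFiberedManifold m N π] {y : E} (hy : y ∈ a.tot.source)
    (v : TangentSpace 𝓘(ℝ, TotalModel m N) y) :
    (a.d y v).1 =
      a.db (π y) (mfderiv 𝓘(ℝ, TotalModel m N) 𝓘(ℝ, BaseModel m) π y v) := by
  have hπ : MDifferentiableAt 𝓘(ℝ, TotalModel m N) 𝓘(ℝ, BaseModel m) π y :=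
    (IsFiberedManifold.smooth (m := m) (N := N) (π := π)).mdifferentiableAt (by simp)
  have h1 : mfderiv 𝓘(ℝ, TotalModel m N) 𝓘(ℝ, BaseModel m)
      ((Prod.fst : TotalModel m N → BaseModel m) ∘ a.tot) y =
      (mfderiv 𝓘(ℝ, TotalModel m N) 𝓘(ℝ, BaseModel m)
        (Prod.fst : TotalModel m N → BaseModel m) (a.tot y)).comp
        (mfderiv 𝓘(ℝ, TotalModel m N) 𝓘(ℝ, TotalModel m N) a.tot y) :=
    mfderiv_comp y (differentiableAt_fst.mdifferentiableAt)
      (a.tot_mdifferentiable.mdifferentiableAt hy)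
  have h2 : mfderiv 𝓘(ℝ, TotalModel m N) 𝓘(ℝ, BaseModel m) (a.base ∘ π) y =
      (mfderiv 𝓘(ℝ, BaseModel m) 𝓘(ℝ, BaseModel m) a.base (π y)).comp
        (mfderiv 𝓘(ℝ, TotalModel m N) 𝓘(ℝ, BaseModel m) π y) :=
    mfderiv_comp y (a.base_mdifferentiable.mdifferentiableAt (a.mapsTo y hy)) hπ
  have h3 : ((Prod.fst : TotalModel m N → BaseModel m) ∘ a.tot) =ᶠ[𝓝 y] (a.base ∘ π) := by
    filter_upwards [a.tot.open_source.mem_nhds hy] with z hz using a.fst_tot z hz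
  have h4 := h3.mfderiv_eq (I := 𝓘(ℝ, TotalModel m N)) (I' := 𝓘(ℝ, BaseModel m))
  have h5 : mfderiv 𝓘(ℝ, TotalModel m N) 𝓘(ℝ, BaseModel m)
        (Prod.fst : TotalModel m N → BaseModel m) (a.tot y) =
        ContinuousLinearMap.fst ℝ (BaseModel m) (EuclideanSpace ℝ (Fin N)) := by
    rw [mfderiv_eq_fderiv]; exact fderiv_fst
  have h6 := DFunLike.congr_fun (h1.symm.trans (h4.trans h2)) v
  rw [h5] at h6
  exact h6

/-- Coordinate change of total coordinates. -/
def change (a b : AdaptedChart m N π) : TotalModel m N → TotalModel m N := b.tot ∘ a.tot.symm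

/-- Coordinate change of base coordinates. -/
def baseChange (a b : AdaptedChart m N π) : BaseModel m → BaseModel m := b.base ∘ a.base.symm

theorem change_contDiffOn (a b : AdaptedChart m N π) :
    ContDiffOn ℝ ∞ (a.change b) (a.tot.symm.trans b.tot).source := by
  rw [← contMDiffOn_iff_contDiffOn]
  refine b.tot_smooth.comp (a.tot_symm_smooth.mono ?_) ?_
  · intro u hu; exact hu.1
  · intro u hu; exact hu.2

theorem baseChange_contDiffOn (a b : AdaptedChart m N π) :
    ContDiffOn ℝ ∞ (a.baseChange b) (a.base.symm.trans b.base).source := by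
  rw [← contMDiffOn_iff_contDiffOn]
  refine b.base_smooth.comp (a.base_symm_smooth.mono ?_) ?_
  · intro u hu; exact hu.1
  · intro u hu; exact hu.2

theorem fderiv_change {y : E} (ha : y ∈ a.tot.source) (hb : y ∈ b.tot.source)
    (v : TotalModel m N) : fderiv ℝ (a.change b) (a.tot y) v = b.d y (a.dInv y v) := by
  have e : a.tot.symm (a.tot y) = y := a.tot.left_inv ha
  have h : mfderiv 𝓘(ℝ, TotalModel m N) 𝓘(ℝ, TotalModel m N) (b.tot ∘ a.tot.symm) (a.tot y) =
      (mfderiv 𝓘(ℝ, TotalModel m N) 𝓘(ℝ, TotalModel m N) b.tot (a.tot.symm (a.tot y))).comp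
      (mfderiv 𝓘(ℝ, TotalModel m N) 𝓘(ℝ, TotalModel m N) a.tot.symm (a.tot y)) :=
    mfderiv_comp _ (b.tot_mdifferentiable.mdifferentiableAt (e.symm ▸ hb))
      (a.tot_mdifferentiable.mdifferentiableAt_symm (a.tot.map_source ha))
  rw [mfderiv_eq_fderiv, e] at h
  exact DFunLike.congr_fun h v

theorem fderiv_baseChange {x : M} (ha : x ∈ a.base.source) (hb : x ∈ b.base.source)
    (v : BaseModel m) : fderiv ℝ (a.baseChange b) (a.base x) v = b.db x (a.dbInv x v) := by
  have e : a.base.symm (a.base x) = x := a.base.left_inv ha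
  have h : mfderiv 𝓘(ℝ, BaseModel m) 𝓘(ℝ, BaseModel m) (b.base ∘ a.base.symm) (a.base x) =
      (mfderiv 𝓘(ℝ, BaseModel m) 𝓘(ℝ, BaseModel m) b.base (a.base.symm (a.base x))).comp
      (mfderiv 𝓘(ℝ, BaseModel m) 𝓘(ℝ, BaseModel m) a.base.symm (a.base x)) :=
    mfderiv_comp _ (b.base_mdifferentiable.mdifferentiableAt (e.symm ▸ hb))
      (a.base_mdifferentiable.mdifferentiableAt_symm (a.base.map_source ha))
  rw [mfderiv_eq_fderiv, e] at h
  exact DFunLike.congr_fun h v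

end AdaptedChart


/-! ### Manifold structure of a bundle given by fibre coordinates -/

variable (m N) in
/-- Fibre coordinates for a family `pt : Z → E`: every adapted chart `a` of `E` gives coordinates
`z ↦ (a (pt z), fib a z)` of `Z` over the domain of `a`, and coordinate changes are smooth. -/
structure FibreCoords (π : E → M) (Z W : Type*) [NormedAddCommGroup W] [NormedSpace ℝ W] where
  pt : Z → E
  fib : AdaptedChart m N π → Z → W
  bijOn : ∀ a : AdaptedChart m N π,
    BijOn (fun z => (a.tot (pt z), fib a z)) {z | pt z ∈ a.tot.source} (a.tot.target ×ˢ univ)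
  trans : AdaptedChart m N π → AdaptedChart m N π → TotalModel m N × W → W
  trans_smooth : ∀ a b,
    ContDiffOn ℝ ∞ (trans a b) ((a.tot.symm.trans b.tot).source ×ˢ univ)
  fib_eq : ∀ a b z, pt z ∈ a.tot.source → pt z ∈ b.tot.source →
    fib b z = trans a b (a.tot (pt z), fib a z)

namespace FibreCoords

variable {Z W : Type*} [NormedAddCommGroup W] [NormedSpace ℝ W] (c : FibreCoords m N π Z W)

/-- The chart of `Z` induced by an adapted chart of `E`. -/
def chart [Nonempty Z] (a : AdaptedChart m N π) : PartialEquiv Z (TotalModel m N × W) :=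
  (c.bijOn a).toPartialEquiv

/-- The coordinate change of `Z` between two adapted charts. -/
def change (a b : AdaptedChart m N π) (p : TotalModel m N × W) : TotalModel m N × W :=
  (a.change b p.1, c.trans a b p)

theorem chart_change_source [Nonempty Z] (a b : AdaptedChart m N π) :
    ((c.chart a).symm.trans (c.chart b)).source = (a.tot.symm.trans b.tot).source ×ˢ univ := by
  ext p
  have key : p ∈ (c.chart a).target → a.tot.symm p.1 = c.pt ((c.chart a).symm p) := fun hp => by
    have h1 := (c.chart a).right_inv hp
    have h2 : c.pt ((c.chart a).symm p) ∈ a.tot.source := (c.chart a).map_target hp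
    have h3 : a.tot (c.pt ((c.chart a).symm p)) = p.1 := congrArg Prod.fst h1
    rw [← h3, a.tot.left_inv h2]
  have ht : p ∈ (c.chart a).target ↔ p.1 ∈ a.tot.target := by
    show p ∈ a.tot.target ×ˢ univ ↔ _
    simp
  constructor
  · rintro ⟨h1, h2⟩
    refine ⟨⟨ht.1 h1, ?_⟩, trivial⟩
    show a.tot.symm p.1 ∈ b.tot.source
    rw [key h1]
    exact h2
  · rintro ⟨⟨h1, h2⟩, -⟩
    refine ⟨ht.2 h1, ?_⟩
    show c.pt ((c.chart a).symm p) ∈ b.tot.source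
    rw [← key (ht.2 h1)]
    exact h2

theorem chart_change_eqOn [Nonempty Z] (a b : AdaptedChart m N π) :
    EqOn ((c.chart a).symm.trans (c.chart b)) (c.change a b)
      ((a.tot.symm.trans b.tot).source ×ˢ univ) := by
  intro p hp
  rw [← c.chart_change_source] at hp
  obtain ⟨h1, h2⟩ := hp
  have h3 : c.pt ((c.chart a).symm p) ∈ a.tot.source := (c.chart a).map_target h1
  have h4 : (a.tot (c.pt ((c.chart a).symm p)), c.fib a ((c.chart a).symm p)) = p :=
    (c.chart a).right_inv h1
  have h5 : a.tot (c.pt ((c.chart a).symm p)) = p.1 := congrArg Prod.fst h4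
  have h6 := c.fib_eq a b _ h3 h2
  rw [h4] at h6
  refine Prod.ext ?_ h6
  show b.tot (c.pt ((c.chart a).symm p)) = b.tot (a.tot.symm p.1)
  rw [← h5, a.tot.left_inv h3]

theorem change_contDiffOn (a b : AdaptedChart m N π) :
    ContDiffOn ℝ ∞ (c.change a b) ((a.tot.symm.trans b.tot).source ×ˢ univ) :=
  ((a.change_contDiffOn b).comp contDiffOn_fst fun _ hp => hp.1).prodMk (c.trans_smooth a b)

variable [IsFiberedManifold m N π]

/-- The atlas of all induced charts, as a charted space core. -/
def core : ChartedSpaceCore (TotalModel m N × W) Z where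
  atlas := {e | ∃ (_ : Nonempty Z) (a : AdaptedChart m N π), e = c.chart a}
  chartAt z := haveI : Nonempty Z := ⟨z⟩
    c.chart (IsFiberedManifold.exists_adapted (m := m) (N := N) (π := π) (c.pt z)).choose
  mem_chart_source z :=
    (IsFiberedManifold.exists_adapted (m := m) (N := N) (π := π) (c.pt z)).choose_spec
  chart_mem_atlas z := ⟨⟨z⟩, _, rfl⟩
  open_source := by
    rintro e e' ⟨_, a, rfl⟩ ⟨_, b, rfl⟩
    rw [c.chart_change_source]
    exact (a.tot.symm.trans b.tot).open_source.prod isOpen_univ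
  continuousOn_toFun := by
    rintro e e' ⟨_, a, rfl⟩ ⟨_, b, rfl⟩
    rw [c.chart_change_source]
    exact (c.change_contDiffOn a b).continuousOn.congr (c.chart_change_eqOn a b)

/-- The induced manifold topology. -/
@[reducible] def topology : TopologicalSpace Z := c.core.toTopologicalSpace

/-- The induced charted space structure. -/
@[reducible] def chartedSpace : @ChartedSpace (TotalModel m N × W) _ Z c.topology :=
  c.core.toChartedSpace

theorem isManifold :
    @IsManifold ℝ _ (TotalModel m N × W) _ _ (TotalModel m N × W) _ 𝓘(ℝ, TotalModel m N × W) ∞ Z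
      c.topology c.chartedSpace := by
  let _ := c.topology
  let _ := c.chartedSpace
  apply isManifold_of_contDiffOn
  intro e e' he he'
  obtain ⟨f, hf, rfl⟩ : ∃ f, ∃ hf : f ∈ c.core.atlas, e = c.core.openPartialHomeomorph f hf := by
    simpa [atlas, ChartedSpace.atlas, chartedSpace, ChartedSpaceCore.toChartedSpace] using he
  obtain ⟨f', hf', rfl⟩ :
      ∃ f, ∃ hf : f ∈ c.core.atlas, e' = c.core.openPartialHomeomorph f hf := by
    simpa [atlas, ChartedSpace.atlas, chartedSpace, ChartedSpaceCore.toChartedSpace] using he'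
  obtain ⟨_, a, rfl⟩ := hf
  obtain ⟨_, b, rfl⟩ := hf'
  have h := (c.change_contDiffOn a b).congr (c.chart_change_eqOn a b)
  rw [← c.chart_change_source] at h
  simp only [modelWithCornersSelf_coe, modelWithCornersSelf_coe_symm, preimage_id, range_id,
    inter_univ, Function.id_comp, Function.comp_id]
  exact h

end FibreCoords

/-! ### First jets -/

section Jets

variable {H : Type*} [NormedAddCommGroup H] [NormedSpace ℝ H]
variable {X : Type*} [TopologicalSpace X] [ChartedSpace H X]

variable (m H) in
/-- The first jet manifold `J¹τ` of `τ : X → M` as a set: the jet at `x` of a local section `φ` is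
the pair `(φ x, T_x φ)`, that is, a point `pt` of `X` with a linear section `lin` of
`T τ : T_pt X → T_{τ pt} M`. -/
@[ext]
structure FirstJet (τ : X → M) where
  pt : X
  lin : TangentSpace 𝓘(ℝ, BaseModel m) (τ pt) →L[ℝ] TangentSpace 𝓘(ℝ, H) pt
  isSection : ∀ v, mfderiv 𝓘(ℝ, H) 𝓘(ℝ, BaseModel m) τ pt (lin v) = v

end Jets

variable (m N) in
/-- The first jet bundle `J¹E` of `π : E → M`. -/
abbrev J1 (π : E → M) := FirstJet m (TotalModel m N) π

/-- Natural coordinates `(x, y, v)` on `J¹E`, with `v` in `Hom(ℝᵐ, ℝᴺ)`. -/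
def jetCoords [IsFiberedManifold m N π] :
    FibreCoords m N π (J1 m N π) (BaseModel m →L[ℝ] EuclideanSpace ℝ (Fin N)) where
  pt := FirstJet.pt
  fib a j := (ContinuousLinearMap.snd ℝ _ _).comp
    ((a.d j.pt).comp (j.lin.comp (a.dbInv (π j.pt))))
  bijOn a := by
    refine ⟨fun j hj => ⟨a.tot.map_source hj, trivial⟩, ?_, ?_⟩
    · rintro ⟨y, s, hs⟩ hy ⟨y', s', hs'⟩ hy' h
      have e : y = y' := a.tot.injOn hy hy' (congrArg Prod.fst h)
      subst e
      have hv := congrArg Prod.snd h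
      have hx := a.mapsTo y hy
      congr 1
      ext1 w
      have h1 := DFunLike.congr_fun hv (a.db (π y) w)
      change (a.d y (s (a.dbInv (π y) (a.db (π y) w)))).2 =
        (a.d y (s' (a.dbInv (π y) (a.db (π y) w)))).2 at h1
      rw [AdaptedChart.dbInv_db hx] at h1
      have h2 : (a.d y (s w)).1 = (a.d y (s' w)).1 := by
        rw [AdaptedChart.fst_d hy, AdaptedChart.fst_d hy, hs, hs']
      have h3 := congrArg (a.dInv y) (Prod.ext h2 h1)
      rwa [AdaptedChart.dInv_d hy, AdaptedChart.dInv_d hy] at h3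
    · rintro ⟨u, v⟩ ⟨hu, -⟩
      have hy : a.tot.symm u ∈ a.tot.source := a.tot.map_target hu
      have hx := a.mapsTo _ hy
      refine ⟨⟨a.tot.symm u, (a.dInv (a.tot.symm u)).comp
        (((ContinuousLinearMap.id ℝ (BaseModel m)).prod v).comp (a.db (π (a.tot.symm u)))), ?_⟩,
        hy, ?_⟩
      · intro w
        have h1 := AdaptedChart.fst_d hy (a.dInv (a.tot.symm u)
          (a.db (π (a.tot.symm u)) w, v (a.db (π (a.tot.symm u)) w)))
        rw [AdaptedChart.d_dInv hy] at h1
        have h2 := congrArg (a.dbInv (π (a.tot.symm u))) h1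
        rw [AdaptedChart.dbInv_db hx, AdaptedChart.dbInv_db hx] at h2
        exact h2.symm
      · refine Prod.ext (a.tot.right_inv hu) ?_
        ext1 w
        change (a.d (a.tot.symm u) (a.dInv (a.tot.symm u)
          (a.db (π (a.tot.symm u)) (a.dbInv (π (a.tot.symm u)) w),
            v (a.db (π (a.tot.symm u)) (a.dbInv (π (a.tot.symm u)) w))))).2 = v w
        rw [AdaptedChart.d_dInv hy, AdaptedChart.db_dbInv hx]
  trans a b p := (ContinuousLinearMap.snd ℝ _ _).comp
    ((fderiv ℝ (a.change b) p.1).comp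
      (((ContinuousLinearMap.id ℝ (BaseModel m)).prod p.2).comp
        (fderiv ℝ (b.baseChange a) (a.change b p.1).1)))
  trans_smooth a b := by
    have h1 : ContDiffOn ℝ ∞ (fun p : TotalModel m N × (BaseModel m →L[ℝ] EuclideanSpace ℝ (Fin N)) =>
        fderiv ℝ (a.change b) p.1) ((a.tot.symm.trans b.tot).source ×ˢ univ) :=
      ((a.change_contDiffOn b).fderiv_of_isOpen (a.tot.symm.trans b.tot).open_source
        le_rfl).comp contDiffOn_fst fun p hp => hp.1
    have h2 : ContDiffOn ℝ ∞ (fun p : TotalModel m N × (BaseModel m →L[ℝ] EuclideanSpace ℝ (Fin N)) =>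
        fderiv ℝ (b.baseChange a) (a.change b p.1).1)
        ((a.tot.symm.trans b.tot).source ×ˢ univ) := by
      refine ((b.baseChange_contDiffOn a).fderiv_of_isOpen
        (b.base.symm.trans a.base).open_source le_rfl).comp
        (contDiff_fst.comp_contDiffOn ((a.change_contDiffOn b).comp contDiffOn_fst
          fun p hp => hp.1)) ?_
      rintro p ⟨⟨hp1, hp2⟩, -⟩
      have hb : a.tot.symm p.1 ∈ b.tot.source := hp2
      have ha : a.tot.symm p.1 ∈ a.tot.source := a.tot.map_target hp1
      have e : (a.change b p.1).1 = b.base (π (a.tot.symm p.1)) := b.fst_tot _ hb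
      show (a.change b p.1).1 ∈ (b.base.symm.trans a.base).source
      rw [e]
      refine ⟨b.base.map_source (b.mapsTo _ hb), ?_⟩
      show b.base.symm (b.base (π (a.tot.symm p.1))) ∈ a.base.source
      rw [b.base.left_inv (b.mapsTo _ hb)]
      exact a.mapsTo _ ha
    have h3 : ContDiffOn ℝ ∞ (fun p : TotalModel m N × (BaseModel m →L[ℝ] EuclideanSpace ℝ (Fin N)) =>
        (ContinuousLinearMap.id ℝ (BaseModel m)).prod p.2)
        ((a.tot.symm.trans b.tot).source ×ˢ univ) :=
      ((ContinuousLinearMap.prodₗᵢ ℝ (𝕜 := ℝ) (E := BaseModel m) (F := BaseModel m)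
        (G := EuclideanSpace ℝ (Fin N))).contDiff.comp
          (contDiff_const.prodMk contDiff_snd)).contDiffOn
    exact contDiffOn_const.clm_comp (h1.clm_comp (h3.clm_comp h2))
  fib_eq a b j ha hb := by
    obtain ⟨y, s, hs⟩ := j
    have hax := a.mapsTo _ ha
    have hbx := b.mapsTo _ hb
    dsimp only at ha hb hax hbx
    have e1 : (a.change b (a.tot y)).1 = b.base (π y) := by
      show (b.tot (a.tot.symm (a.tot y))).1 = _
      rw [a.tot.left_inv ha, b.fst_tot y hb]
    ext1 w
    show (b.d y (s (b.dbInv (π y) w))).2 = (fderiv ℝ (a.change b) (a.tot y)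
      (fderiv ℝ (b.baseChange a) (a.change b (a.tot y)).1 w,
        (a.d y (s (a.dbInv (π y) (fderiv ℝ (b.baseChange a) (a.change b (a.tot y)).1 w)))).2)).2
    rw [e1, AdaptedChart.fderiv_baseChange hbx hax, AdaptedChart.fderiv_change ha hb,
      AdaptedChart.dbInv_db hax]
    have e2 : (a.db (π y) (b.dbInv (π y) w), (a.d y (s (b.dbInv (π y) w))).2) =
        a.d y (s (b.dbInv (π y) w)) := by
      refine Prod.ext ?_ rfl
      rw [AdaptedChart.fst_d ha, hs]
    rw [e2, AdaptedChart.dInv_d ha]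

section

variable [IsFiberedManifold m N π]

instance : TopologicalSpace (J1 m N π) := jetCoords.topology

instance : ChartedSpace (TotalModel m N × (BaseModel m →L[ℝ] EuclideanSpace ℝ (Fin N)))
    (J1 m N π) := jetCoords.chartedSpace

instance : IsManifold 𝓘(ℝ, TotalModel m N × (BaseModel m →L[ℝ] EuclideanSpace ℝ (Fin N))) ∞
    (J1 m N π) := jetCoords.isManifold

end

/-! ### Forms with few vertical arguments -/

section Forms

variable {V U V' U' : Type*}
  [AddCommGroup V] [Module ℝ V] [TopologicalSpace V]
  [AddCommGroup U] [Module ℝ U] [TopologicalSpace U]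
  [AddCommGroup V'] [Module ℝ V'] [TopologicalSpace V']
  [AddCommGroup U'] [Module ℝ U'] [TopologicalSpace U']

/-- The `k`-forms on `V` that vanish when two of their arguments are vertical, i.e. in `ker q`. -/
def formsOne (k : ℕ) (q : V →L[ℝ] U) : Submodule ℝ (V [⋀^Fin k]→L[ℝ] ℝ) where
  carrier := {η | ∀ (v : Fin k → V) (i j : Fin k), i ≠ j → q (v i) = 0 → q (v j) = 0 → η v = 0}
  add_mem' h h' v i j hij hi hj := by simp [h v i j hij hi hj, h' v i j hij hi hj]
  zero_mem' v i j _ _ _ := by simp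
  smul_mem' r η h v i j hij hi hj := by simp [h v i j hij hi hj]

/-- The `k`-forms on `V` that vanish when one of their arguments is vertical, i.e. in `ker q`. -/
def formsZero (k : ℕ) (q : V →L[ℝ] U) : Submodule ℝ (V [⋀^Fin k]→L[ℝ] ℝ) where
  carrier := {η | ∀ (v : Fin k → V) (i : Fin k), q (v i) = 0 → η v = 0}
  add_mem' h h' v i hi := by simp [h v i hi, h' v i hi]
  zero_mem' v i _ := by simp
  smul_mem' r η h v i hi := by simp [h v i hi]

/-- Forms of type one modulo forms of type zero, as the image of the former in the quotient of all
forms by the latter. -/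
def FormsQuot (k : ℕ) (q : V →L[ℝ] U) :
    Submodule ℝ ((V [⋀^Fin k]→L[ℝ] ℝ) ⧸ formsZero k q) :=
  (formsOne k q).map (formsZero k q).mkQ

/-- The quotient map from forms of type one to their classes modulo forms of type zero. -/
def toQuot (k : ℕ) (q : V →L[ℝ] U) : formsOne k q →ₗ[ℝ] FormsQuot k q where
  toFun η := ⟨(formsZero k q).mkQ η.1, Submodule.mem_map_of_mem η.2⟩
  map_add' _ _ := rfl
  map_smul' _ _ := rfl

theorem toQuot_surjective (k : ℕ) (q : V →L[ℝ] U) : Function.Surjective (toQuot k q) := by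
  rintro ⟨c, η, hη, rfl⟩
  exact ⟨⟨η, hη⟩, rfl⟩

theorem toQuot_eq_iff {k : ℕ} {q : V →L[ℝ] U} {η ζ : formsOne k q} :
    toQuot k q η = toQuot k q ζ ↔ η.1 - ζ.1 ∈ formsZero k q := by
  rw [← Submodule.Quotient.eq]
  exact Subtype.ext_iff

variable {q : V →L[ℝ] U} {q' : V' →L[ℝ] U'}

/-- Pull-back of forms by a linear map that preserves verticality. -/
def pullOne (k : ℕ) (A : V' →L[ℝ] V) (hA : ∀ v, q' v = 0 → q (A v) = 0) :
    formsOne k q →ₗ[ℝ] formsOne k q' where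
  toFun η := ⟨η.1.compContinuousLinearMap A,
    fun v i j hij hi hj => η.2 (A ∘ v) i j hij (hA _ hi) (hA _ hj)⟩
  map_add' _ _ := rfl
  map_smul' _ _ := rfl

/-- Pull-back of forms as a linear map. -/
def pullAll (k : ℕ) (A : V' →L[ℝ] V) : (V [⋀^Fin k]→L[ℝ] ℝ) →ₗ[ℝ] (V' [⋀^Fin k]→L[ℝ] ℝ) where
  toFun η := η.compContinuousLinearMap A
  map_add' _ _ := rfl
  map_smul' _ _ := rfl

theorem pullAll_le {k : ℕ} {A : V' →L[ℝ] V} (hA : ∀ v, q' v = 0 → q (A v) = 0) :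
    formsZero k q ≤ (formsZero k q').comap (pullAll k A) :=
  fun _ hη v i hi => hη (A ∘ v) i (hA _ hi)

/-- The map induced by the pull-back on the quotients. -/
def pullQuot (k : ℕ) (A : V' →L[ℝ] V) (hA : ∀ v, q' v = 0 → q (A v) = 0) :
    FormsQuot k q →ₗ[ℝ] FormsQuot k q' where
  toFun c := ⟨(formsZero k q).mapQ (formsZero k q') (pullAll k A) (pullAll_le hA) c.1, by
    obtain ⟨_, η, hη, rfl⟩ := c
    exact ⟨_, (pullOne k A hA ⟨η, hη⟩).2, rfl⟩⟩
  map_add' _ _ := Subtype.ext (map_add _ _ _)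
  map_smul' _ _ := Subtype.ext (map_smul _ _ _)

theorem pullQuot_toQuot {k : ℕ} {A : V' →L[ℝ] V} (hA : ∀ v, q' v = 0 → q (A v) = 0)
    (η : formsOne k q) : pullQuot k A hA (toQuot k q η) = toQuot k q' (pullOne k A hA η) := rfl

theorem pullOne_pullOne {k : ℕ} {A : V' →L[ℝ] V} {hA : ∀ v, q' v = 0 → q (A v) = 0}
    {B : V →L[ℝ] V'} {hB : ∀ v, q v = 0 → q' (B v) = 0} (h : ∀ v, A (B v) = v)
    (η : formsOne k q) : pullOne k B hB (pullOne k A hA η) = η := by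
  apply Subtype.ext
  ext v
  show η.1 (A ∘ B ∘ v) = η.1 v
  congr 1
  funext i
  exact h _

theorem pullQuot_pullQuot {k : ℕ} {A : V' →L[ℝ] V} {hA : ∀ v, q' v = 0 → q (A v) = 0}
    {B : V →L[ℝ] V'} {hB : ∀ v, q v = 0 → q' (B v) = 0} (h : ∀ v, A (B v) = v)
    (c : FormsQuot k q) : pullQuot k B hB (pullQuot k A hA c) = c := by
  obtain ⟨η, rfl⟩ := toQuot_surjective _ _ c
  rw [pullQuot_toQuot, pullQuot_toQuot, pullOne_pullOne h]

end Forms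

theorem exists_coords {F : Type*} [AddCommGroup F] [Module ℝ F] [FiniteDimensional ℝ F]
    (p : Submodule ℝ F) :
    Nonempty (p ≃ₗ[ℝ] EuclideanSpace ℝ (Fin (Module.finrank ℝ p))) :=
  ⟨LinearEquiv.ofFinrankEq _ _ (by simp)⟩

section Model

variable (m N)

/-- The forms of type one on the model space. -/
abbrev modelOne : Submodule ℝ (TotalModel m N [⋀^Fin m]→L[ℝ] ℝ) :=
  formsOne m (ContinuousLinearMap.fst ℝ (BaseModel m) (EuclideanSpace ℝ (Fin N)))

/-- The classes of forms of type one modulo forms of type zero on the model space. -/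
abbrev modelQuot : Submodule ℝ ((TotalModel m N [⋀^Fin m]→L[ℝ] ℝ) ⧸
    formsZero m (ContinuousLinearMap.fst ℝ (BaseModel m) (EuclideanSpace ℝ (Fin N)))) :=
  FormsQuot m (ContinuousLinearMap.fst ℝ (BaseModel m) (EuclideanSpace ℝ (Fin N)))

/-- Model fibre of the extended multimomentum bundle. -/
abbrev ExtModel : Type := EuclideanSpace ℝ (Fin (Module.finrank ℝ (modelOne m N)))

/-- Model fibre of the restricted multimomentum bundle. -/
abbrev RestModel : Type := EuclideanSpace ℝ (Fin (Module.finrank ℝ (modelQuot m N)))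

/-- Linear coordinates on the forms of type one. -/
def extEquiv : modelOne m N ≃ₗ[ℝ] ExtModel m N := (exists_coords (modelOne m N)).some

/-- Linear coordinates on the classes of forms. -/
def restEquiv : modelQuot m N ≃ₗ[ℝ] RestModel m N := (exists_coords (modelQuot m N)).some

/-- The form with given coordinates. -/
def extIncl : ExtModel m N →L[ℝ] (TotalModel m N [⋀^Fin m]→L[ℝ] ℝ) :=
  LinearMap.toContinuousLinearMap
    { toFun := fun x => ((extEquiv m N).symm x).1
      map_add' := fun x y => by rw [map_add]; rfl
      map_smul' := fun r x => by rw [map_smul]; rfl }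

theorem extIncl_extEquiv (η : modelOne m N) : extIncl m N (extEquiv m N η) = η.1 :=
  congrArg Subtype.val ((extEquiv m N).symm_apply_apply η)

/-- A linear projection of all forms of the model space onto the model fibre. -/
theorem exists_extProj : ∃ P : (TotalModel m N [⋀^Fin m]→L[ℝ] ℝ) →L[ℝ] ExtModel m N,
    ∀ η : modelOne m N, P η.1 = extEquiv m N η := by
  have hinj : Function.Injective (extIncl m N).toLinearMap := fun x y h =>
    (extEquiv m N).symm.injective (Subtype.ext h)
  obtain ⟨g, hg⟩ := LinearMap.exists_leftInverse_of_injective (extIncl m N).toLinearMap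
    (LinearMap.ker_eq_bot.2 hinj)
  refine ⟨LinearMap.toContinuousLinearMap g, fun η => ?_⟩
  rw [← extIncl_extEquiv]
  exact LinearMap.congr_fun hg _

/-- A linear projection of all forms of the model space onto the quotient model fibre. -/
theorem exists_restProj : ∃ P : (TotalModel m N [⋀^Fin m]→L[ℝ] ℝ) →L[ℝ] RestModel m N,
    ∀ η : modelOne m N, P η.1 = restEquiv m N (toQuot m _ η) := by
  obtain ⟨P, hP⟩ := exists_extProj m N
  let f : ExtModel m N →ₗ[ℝ] RestModel m N :=
    { toFun := fun x => restEquiv m N (toQuot m _ ((extEquiv m N).symm x))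
      map_add' := fun x y => by simp only [map_add]
      map_smul' := fun r x => by simp only [map_smul, RingHom.id_apply] }
  refine ⟨(LinearMap.toContinuousLinearMap f).comp P, fun η => ?_⟩
  show f (P η.1) = _
  rw [hP]
  exact congrArg (fun ζ => restEquiv m N (toQuot m _ ζ)) ((extEquiv m N).symm_apply_apply η)

/-- A linear choice of representatives of classes of forms. -/
theorem exists_restSection : ∃ σ : RestModel m N →L[ℝ] (TotalModel m N [⋀^Fin m]→L[ℝ] ℝ),
    ∀ c : modelQuot m N, ∃ ζ : modelOne m N, σ (restEquiv m N c) = ζ.1 ∧ toQuot m _ ζ = c := by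
  let f : ExtModel m N →ₗ[ℝ] RestModel m N :=
    { toFun := fun x => restEquiv m N (toQuot m _ ((extEquiv m N).symm x))
      map_add' := fun x y => by simp only [map_add]
      map_smul' := fun r x => by simp only [map_smul, RingHom.id_apply] }
  have hf : Function.Surjective f := fun c => by
    obtain ⟨ζ, hζ⟩ := toQuot_surjective _ _ ((restEquiv m N).symm c)
    refine ⟨extEquiv m N ζ, ?_⟩
    show restEquiv m N (toQuot m _ ((extEquiv m N).symm (extEquiv m N ζ))) = c
    rw [LinearEquiv.symm_apply_apply, hζ, LinearEquiv.apply_symm_apply]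
  obtain ⟨g, hg⟩ := LinearMap.exists_rightInverse_of_surjective f (LinearMap.range_eq_top.2 hf)
  refine ⟨(extIncl m N).comp (LinearMap.toContinuousLinearMap g), fun c =>
    ⟨(extEquiv m N).symm (g (restEquiv m N c)), rfl, ?_⟩⟩
  exact (restEquiv m N).injective (LinearMap.congr_fun hg (restEquiv m N c))

/-- A chosen projection onto the model fibre. -/
def extProj : (TotalModel m N [⋀^Fin m]→L[ℝ] ℝ) →L[ℝ] ExtModel m N := (exists_extProj m N).choose

theorem extProj_eq (η : modelOne m N) : extProj m N η.1 = extEquiv m N η :=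
  (exists_extProj m N).choose_spec η

/-- A chosen projection onto the quotient model fibre. -/
def restProj : (TotalModel m N [⋀^Fin m]→L[ℝ] ℝ) →L[ℝ] RestModel m N :=
  (exists_restProj m N).choose

theorem restProj_eq (η : modelOne m N) :
    restProj m N η.1 = restEquiv m N (toQuot m _ η) :=
  (exists_restProj m N).choose_spec η

/-- A chosen section of the quotient map. -/
def restSection : RestModel m N →L[ℝ] (TotalModel m N [⋀^Fin m]→L[ℝ] ℝ) :=
  (exists_restSection m N).choose

theorem restSection_spec (c : modelQuot m N) : ∃ ζ : modelOne m N,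
    restSection m N (restEquiv m N c) = ζ.1 ∧ toQuot m _ ζ = c :=
  (exists_restSection m N).choose_spec c

end Model

/-! ### The multimomentum bundles -/

variable (m N) in
/-- The extended multimomentum bundle `Mπ = Λ₁ᵐT*E`: an `m`-form at a point of `E` that vanishes
when two of its arguments are vertical. -/
structure ExtMomentum (π : E → M) where
  pt : E
  form : formsOne m (mfderiv 𝓘(ℝ, TotalModel m N) 𝓘(ℝ, BaseModel m) π pt)

variable (m N) in
/-- The restricted multimomentum bundle `J¹*E = Λ₁ᵐT*E / Λ₀ᵐT*E`. -/
structure RestMomentum (π : E → M) where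
  pt : E
  cls : FormsQuot m (mfderiv 𝓘(ℝ, TotalModel m N) 𝓘(ℝ, BaseModel m) π pt)

/-- The projection `μ : Mπ → J¹*E`. -/
def momentumProj (q : ExtMomentum m N π) : RestMomentum m N π :=
  ⟨q.pt, toQuot m _ q.form⟩

theorem contDiffOn_pullChange {W : Type*} [NormedAddCommGroup W] [NormedSpace ℝ W]
    (f : W →L[ℝ] (TotalModel m N [⋀^Fin m]→L[ℝ] ℝ)) (a b : AdaptedChart m N π) :
    ContDiffOn ℝ ∞ (fun p : TotalModel m N × W =>
      (f p.2).compContinuousLinearMap (fderiv ℝ (b.change a) (a.change b p.1)))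
      ((a.tot.symm.trans b.tot).source ×ˢ univ) := by
  refine (contDiff_pullback m).comp_contDiffOn
    ((f.contDiff.comp contDiff_snd).contDiffOn.prodMk ?_)
  refine ((b.change_contDiffOn a).fderiv_of_isOpen (b.tot.symm.trans a.tot).open_source
    le_rfl).comp ((a.change_contDiffOn b).comp contDiffOn_fst fun p hp => hp.1) ?_
  rintro p ⟨⟨hp1, hp2⟩, -⟩
  refine ⟨b.tot.map_source hp2, ?_⟩
  show b.tot.symm (b.tot (a.tot.symm p.1)) ∈ a.tot.source
  have hb : a.tot.symm p.1 ∈ b.tot.source := hp2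
  rw [b.tot.left_inv hb]
  exact a.tot.map_target hp1

theorem AdaptedChart.fderiv_change_change {a b : AdaptedChart m N π} {y : E} (ha : y ∈ a.tot.source)
    (hb : y ∈ b.tot.source) (v : TotalModel m N) :
    fderiv ℝ (b.change a) (a.change b (a.tot y)) v = a.d y (b.dInv y v) := by
  have e : a.change b (a.tot y) = b.tot y := by
    show b.tot (a.tot.symm (a.tot y)) = _
    rw [a.tot.left_inv ha]
  rw [e, AdaptedChart.fderiv_change hb ha]

section Coordinates

variable [IsFiberedManifold m N π]

theorem AdaptedChart.vert_dInv {a : AdaptedChart m N π} {y : E} (hy : y ∈ a.tot.source)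
    (v : TotalModel m N)
    (hv : ContinuousLinearMap.fst ℝ (BaseModel m) (EuclideanSpace ℝ (Fin N)) v = 0) :
    mfderiv 𝓘(ℝ, TotalModel m N) 𝓘(ℝ, BaseModel m) π y (a.dInv y v) = 0 := by
  have h1 := AdaptedChart.fst_d hy (a.dInv y v)
  rw [AdaptedChart.d_dInv hy] at h1
  have h2 := AdaptedChart.dbInv_db (a.mapsTo y hy)
    (mfderiv 𝓘(ℝ, TotalModel m N) 𝓘(ℝ, BaseModel m) π y (a.dInv y v))
  rw [← h1] at h2
  rw [← h2]
  have h3 : v.1 = 0 := hv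
  rw [h3, map_zero]

theorem AdaptedChart.vert_d {a : AdaptedChart m N π} {y : E} (hy : y ∈ a.tot.source)
    (v : TangentSpace 𝓘(ℝ, TotalModel m N) y)
    (hv : mfderiv 𝓘(ℝ, TotalModel m N) 𝓘(ℝ, BaseModel m) π y v = 0) :
    ContinuousLinearMap.fst ℝ (BaseModel m) (EuclideanSpace ℝ (Fin N)) (a.d y v) = 0 := by
  have h1 := AdaptedChart.fst_d hy v
  rw [hv, map_zero] at h1
  exact h1

open Classical in
/-- Natural coordinates of the extended multimomentum bundle. -/
def extCoords : FibreCoords m N π (ExtMomentum m N π) (ExtModel m N) where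
  pt := ExtMomentum.pt
  fib a q := if h : q.pt ∈ a.tot.source then
    extEquiv m N (pullOne m (a.dInv q.pt) (AdaptedChart.vert_dInv h) q.form) else 0
  bijOn a := by
    refine ⟨fun j hj => ⟨a.tot.map_source hj, trivial⟩, ?_, ?_⟩
    · rintro ⟨y, η⟩ hy ⟨y', η'⟩ hy' h
      have e : y = y' := a.tot.injOn hy hy' (congrArg Prod.fst h)
      subst e
      have hy1 : y ∈ a.tot.source := hy
      have h1 := congrArg Prod.snd h
      simp only [hy1, dite_true] at h1
      have h2 := congrArg (pullOne m (a.d y) (AdaptedChart.vert_d hy1))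
        ((extEquiv m N).injective h1)
      rw [pullOne_pullOne (AdaptedChart.dInv_d hy1),
        pullOne_pullOne (AdaptedChart.dInv_d hy1)] at h2
      rw [h2]
    · rintro ⟨u, η⟩ ⟨hu, -⟩
      have hy : a.tot.symm u ∈ a.tot.source := a.tot.map_target hu
      refine ⟨⟨a.tot.symm u, pullOne m (a.d _) (AdaptedChart.vert_d hy)
        ((extEquiv m N).symm η)⟩, hy, ?_⟩
      refine Prod.ext (a.tot.right_inv hu) ?_
      simp only [hy, dite_true]
      rw [pullOne_pullOne (AdaptedChart.d_dInv hy), LinearEquiv.apply_symm_apply]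
  trans a b p := (extProj m N)
    ((extIncl m N p.2).compContinuousLinearMap (fderiv ℝ (b.change a) (a.change b p.1)))
  trans_smooth a b :=
    (extProj m N).contDiff.comp_contDiffOn (contDiffOn_pullChange (extIncl m N) a b)
  fib_eq a b q ha hb := by
    obtain ⟨y, η⟩ := q
    dsimp only at ha hb ⊢
    simp only [ha, hb, dite_true]
    rw [extIncl_extEquiv, ← extProj_eq m N (pullOne m (b.dInv y) (AdaptedChart.vert_dInv hb) η)]
    congr 1
    ext v
    show η.1 _ = η.1 _
    congr 1
    funext i
    show b.dInv y (v i) = a.dInv y (fderiv ℝ (b.change a) (a.change b (a.tot y)) (v i))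
    rw [AdaptedChart.fderiv_change_change ha hb, AdaptedChart.dInv_d ha]

theorem restTrans_eq {a b : AdaptedChart m N π} {y : E} (ha : y ∈ a.tot.source)
    (hb : y ∈ b.tot.source)
    (c : FormsQuot m (mfderiv 𝓘(ℝ, TotalModel m N) 𝓘(ℝ, BaseModel m) π y)) :
    restEquiv m N (pullQuot m (b.dInv y) (AdaptedChart.vert_dInv hb) c) =
      (restProj m N) (((restSection m N)
        (restEquiv m N (pullQuot m (a.dInv y) (AdaptedChart.vert_dInv ha) c))).compContinuousLinearMap
          (fderiv ℝ (b.change a) (a.change b (a.tot y)))) := by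
  obtain ⟨η, rfl⟩ := toQuot_surjective _ _ c
  obtain ⟨ζ, h0, h1⟩ := restSection_spec m N
    (pullQuot m (a.dInv y) (AdaptedChart.vert_dInv ha) (toQuot m _ η))
  rw [h0]
  have h2 := toQuot_eq_iff.1 (h1.trans (pullQuot_toQuot (AdaptedChart.vert_dInv ha) η))
  have hvert : ∀ v : TotalModel m N,
      ContinuousLinearMap.fst ℝ (BaseModel m) (EuclideanSpace ℝ (Fin N)) v = 0 →
      ContinuousLinearMap.fst ℝ (BaseModel m) (EuclideanSpace ℝ (Fin N))
        (fderiv ℝ (b.change a) (a.change b (a.tot y)) v) = 0 := fun v hv => by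
    rw [AdaptedChart.fderiv_change_change ha hb]
    exact AdaptedChart.vert_d ha _ (AdaptedChart.vert_dInv hb v hv)
  have h3 := restProj_eq m N (pullOne m _ hvert ζ)
  have h4 : pullOne m (b.dInv y) (AdaptedChart.vert_dInv hb) η =
      pullOne m _ hvert (pullOne m (a.dInv y) (AdaptedChart.vert_dInv ha) η) := by
    apply Subtype.ext
    ext v
    show η.1 _ = η.1 _
    congr 1
    funext i
    show b.dInv y (v i) = a.dInv y (fderiv ℝ (b.change a) (a.change b (a.tot y)) (v i))
    rw [AdaptedChart.fderiv_change_change ha hb, AdaptedChart.dInv_d ha]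
  refine Eq.trans ?_ h3.symm
  rw [pullQuot_toQuot, h4]
  have h5 : (pullOne m _ hvert ζ).1 -
      (pullOne m _ hvert (pullOne m (a.dInv y) (AdaptedChart.vert_dInv ha) η)).1 ∈
      formsZero m (ContinuousLinearMap.fst ℝ (BaseModel m) (EuclideanSpace ℝ (Fin N))) :=
    fun v i hi => h2 (fun k => fderiv ℝ (b.change a) (a.change b (a.tot y)) (v k)) i (hvert _ hi)
  exact congrArg (restEquiv m N) (toQuot_eq_iff.2 h5).symm

open Classical in
/-- Natural coordinates of the restricted multimomentum bundle. -/
def restCoords : FibreCoords m N π (RestMomentum m N π) (RestModel m N) where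
  pt := RestMomentum.pt
  fib a q := if h : q.pt ∈ a.tot.source then
    restEquiv m N (pullQuot m (a.dInv q.pt) (AdaptedChart.vert_dInv h) q.cls) else 0
  bijOn a := by
    refine ⟨fun j hj => ⟨a.tot.map_source hj, trivial⟩, ?_, ?_⟩
    · rintro ⟨y, η⟩ hy ⟨y', η'⟩ hy' h
      have e : y = y' := a.tot.injOn hy hy' (congrArg Prod.fst h)
      subst e
      have hy1 : y ∈ a.tot.source := hy
      have h1 := congrArg Prod.snd h
      simp only [hy1, dite_true] at h1
      have h2 := congrArg (pullQuot m (a.d y) (AdaptedChart.vert_d hy1))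
        ((restEquiv m N).injective h1)
      rw [pullQuot_pullQuot (AdaptedChart.dInv_d hy1),
        pullQuot_pullQuot (AdaptedChart.dInv_d hy1)] at h2
      rw [h2]
    · rintro ⟨u, η⟩ ⟨hu, -⟩
      have hy : a.tot.symm u ∈ a.tot.source := a.tot.map_target hu
      refine ⟨⟨a.tot.symm u, pullQuot m (a.d _) (AdaptedChart.vert_d hy)
        ((restEquiv m N).symm η)⟩, hy, ?_⟩
      refine Prod.ext (a.tot.right_inv hu) ?_
      simp only [hy, dite_true]
      rw [pullQuot_pullQuot (AdaptedChart.d_dInv hy), LinearEquiv.apply_symm_apply]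
  trans a b p := (restProj m N)
    (((restSection m N) p.2).compContinuousLinearMap
      (fderiv ℝ (b.change a) (a.change b p.1)))
  trans_smooth a b := (restProj m N).contDiff.comp_contDiffOn
    (contDiffOn_pullChange (restSection m N) a b)
  fib_eq a b q ha hb := by
    have ha' : q.pt ∈ a.tot.source := ha
    have hb' : q.pt ∈ b.tot.source := hb
    rw [dif_pos ha', dif_pos hb']
    exact restTrans_eq ha' hb' q.cls

instance : TopologicalSpace (ExtMomentum m N π) := extCoords.topology

instance : ChartedSpace (TotalModel m N × ExtModel m N) (ExtMomentum m N π) :=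
  extCoords.chartedSpace

instance : IsManifold 𝓘(ℝ, TotalModel m N × ExtModel m N) ∞ (ExtMomentum m N π) :=
  extCoords.isManifold

instance : TopologicalSpace (RestMomentum m N π) := restCoords.topology

instance : ChartedSpace (TotalModel m N × RestModel m N) (RestMomentum m N π) :=
  restCoords.chartedSpace

instance : IsManifold 𝓘(ℝ, TotalModel m N × RestModel m N) ∞ (RestMomentum m N π) :=
  restCoords.isManifold

end Coordinates

/-! ### Differential forms on manifolds -/

section DiffForms

variable {H : Type*} [NormedAddCommGroup H] [NormedSpace ℝ H]
variable {X : Type*} [TopologicalSpace X] [ChartedSpace H X]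

variable (H X) in
/-- Differential `k`-forms, without regularity. -/
abbrev DiffForm (k : ℕ) : Type _ := (x : X) → TangentSpace 𝓘(ℝ, H) x [⋀^Fin k]→L[ℝ] ℝ

/-- The expression of a form in the preferred chart at `x₀`. -/
def formInChart {k : ℕ} (α : DiffForm H X k) (x₀ : X) (u : H) : H [⋀^Fin k]→L[ℝ] ℝ :=
  (α ((chartAt H x₀).symm u)).compContinuousLinearMap
    (mfderiv 𝓘(ℝ, H) 𝓘(ℝ, H) (chartAt H x₀).symm u)

/-- Smoothness of a form, in charts. -/
def IsSmoothForm {k : ℕ} (α : DiffForm H X k) : Prop :=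
  ∀ x₀, ContDiffOn ℝ ∞ (formInChart α x₀) (chartAt H x₀).target

/-- The exterior derivative of a form, computed at each point in the preferred chart there. -/
def dForm {k : ℕ} (α : DiffForm H X k) : DiffForm H X (k + 1) := fun x =>
  (extDeriv (formInChart α x) (chartAt H x x)).compContinuousLinearMap
    (mfderiv 𝓘(ℝ, H) 𝓘(ℝ, H) (chartAt H x) x)

theorem injective_mfderiv_id (x : X) :
    Function.Injective (mfderiv 𝓘(ℝ, H) 𝓘(ℝ, H) (id : X → X) x) := by
  rw [mfderiv_id]
  exact Function.injective_id

end DiffForms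

/-- A volume form on the `m`-dimensional manifold `M`: a smooth, nowhere vanishing `m`-form. -/
structure IsVolumeForm (vol : DiffForm (BaseModel m) M m) : Prop where
  smooth : IsSmoothForm vol
  ne_zero : ∀ x, vol x ≠ 0

/-! ### Lagrangian systems -/

variable (m N) in
/-- Model space of `J¹E`. -/
abbrev JetModel := TotalModel m N × (BaseModel m →L[ℝ] EuclideanSpace ℝ (Fin N))

section Lagrangian

variable (m N) in
/-- The differential of `π`, as a map between model spaces. -/
def dProj (π : E → M) (y : E) : TotalModel m N →L[ℝ] BaseModel m :=
  mfderiv 𝓘(ℝ, TotalModel m N) 𝓘(ℝ, BaseModel m) π y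

variable (m N) in
/-- The vertical subspace `V_yπ` of `T_yE`. -/
def vert (π : E → M) (y : E) : Submodule ℝ (TotalModel m N) :=
  LinearMap.ker (dProj m N π y).toLinearMap

/-- The linear section of `Tπ` given by a jet, as a map between model spaces. -/
def FirstJet.horLift (j : J1 m N π) : BaseModel m →L[ℝ] TotalModel m N := j.lin

/-- The affine structure of the fibres of `J¹E → E`: the translate of a jet at `y` by an element of
`T*M ⊗ V_yπ`. -/
def FirstJet.shift (j : J1 m N π) (A : BaseModel m →L[ℝ] vert m N π j.pt) : J1 m N π where
  pt := j.pt
  lin := j.horLift + (vert m N π j.pt).subtypeL.comp A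
  isSection v := by
    have h1 : dProj m N π j.pt (j.horLift v) = v := j.isSection v
    have h2 : dProj m N π j.pt (A v : TotalModel m N) = 0 := (A v).2
    have h3 : dProj m N π j.pt (j.horLift v + (A v : TotalModel m N)) =
        dProj m N π j.pt (j.horLift v) + dProj m N π j.pt (A v : TotalModel m N) := map_add _ _ _
    exact h3.trans (by rw [h1, h2]; exact add_zero _)

/-- The derivative of `L` along the fibre of `J¹E → E`. -/
def fibreDeriv (L : J1 m N π → ℝ) (j : J1 m N π) :
    (BaseModel m →L[ℝ] vert m N π j.pt) →L[ℝ] ℝ :=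
  fderiv ℝ (fun A => L (j.shift A)) 0

/-- The fibre derivative as a linear map `V_yπ → T_xM`, `w ↦ ∑ᵢ dL(eⁱ ⊗ w) eᵢ`; in coordinates,
`∂/∂yᴬ ↦ (∂L/∂vᴬ_α) ∂/∂x^α`. -/
def momentum (L : J1 m N π → ℝ) (j : J1 m N π) : vert m N π j.pt →L[ℝ] BaseModel m :=
  ∑ i : Fin m, ((fibreDeriv L j).comp (ContinuousLinearMap.smulRightL ℝ (BaseModel m)
    (vert m N π j.pt) (EuclideanSpace.proj i))).smulRight (EuclideanSpace.single i (1 : ℝ))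

/-- The vertical projection `T_yE → V_yπ` defined by a jet at `y`. -/
def FirstJet.vertProj (j : J1 m N π) : TotalModel m N →L[ℝ] vert m N π j.pt :=
  (ContinuousLinearMap.id ℝ (TotalModel m N) - j.horLift.comp (dProj m N π j.pt)).codRestrict _
    fun v => by
      have h1 : dProj m N π j.pt (j.horLift (dProj m N π j.pt v)) = dProj m N π j.pt v :=
        j.isSection _
      show dProj m N π j.pt (v - j.horLift (dProj m N π j.pt v)) = 0
      rw [map_sub, h1, sub_self]

section

variable {B V : Type*} [NormedAddCommGroup B] [NormedSpace ℝ B] [NormedAddCommGroup V]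
  [NormedSpace ℝ V]

/-- The form `(Z₁, …, Z_k) ↦ r f(q Z₁, …, q Z_k) + ∑ᵢ f(q Z₁, …, R Zᵢ, …, q Z_k)`. -/
def polarForm {k : ℕ} (r : ℝ) (f : B [⋀^Fin k]→L[ℝ] ℝ) (q R : V →L[ℝ] B) : V [⋀^Fin k]→L[ℝ] ℝ :=
  r • f.compContinuousLinearMap q + f.fderivCompContinuousLinearMap q R

theorem polarForm_apply {k : ℕ} (r : ℝ) (f : B [⋀^Fin k]→L[ℝ] ℝ) (q R : V →L[ℝ] B)
    (v : Fin k → V) : polarForm r f q R v =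
      r * f (fun i => q (v i)) + ∑ i, f (Function.update (fun l => q (v l)) i (R (v i))) := by
  show r * f (fun i => q (v i)) + f.fderivCompContinuousLinearMap q R v = _
  rw [ContinuousAlternatingMap.fderivCompContinuousLinearMap_apply]
  congr 1
  refine Finset.sum_congr rfl fun i _ => congrArg f (funext fun l => ?_)
  by_cases h : l = i
  · subst h
    simp
  · simp [Function.update_of_ne h]

theorem polarForm_mem {k : ℕ} (r : ℝ) (f : B [⋀^Fin k]→L[ℝ] ℝ) (q R : V →L[ℝ] B) :
    polarForm r f q R ∈ formsOne k q := by
  intro v a b hab ha hb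
  rw [polarForm_apply, f.map_coord_zero a ha, mul_zero, zero_add]
  refine Finset.sum_eq_zero fun i _ => ?_
  by_cases hi : a = i
  · refine f.map_coord_zero b ?_
    rw [Function.update_of_ne (fun h => hab (hi.trans h.symm))]
    exact hb
  · refine f.map_coord_zero a ?_
    rw [Function.update_of_ne hi]
    exact ha

end

/-- The value at `j` of the Poincaré-Cartan form `Θ_L`, which is semibasic over `E`, as a form on
`T_yE`: `(Z₁, …, Z_m) ↦ L vol(Tπ Z₁, …, Tπ Z_m) + ∑ᵢ vol(Tπ Z₁, …, P(κ Zᵢ), …, Tπ Z_m)`, with `κ`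
the vertical projection and `P` the momentum. In coordinates with `vol = dᵐx`, it is
`(∂L/∂vᴬ_α) dyᴬ ∧ dᵐ⁻¹x_α - ((∂L/∂vᴬ_α) vᴬ_α - L) dᵐx`. -/
def cartanAt (vol : DiffForm (BaseModel m) M m) (L : J1 m N π → ℝ) (j : J1 m N π) :
    TotalModel m N [⋀^Fin m]→L[ℝ] ℝ :=
  polarForm (L j) (vol (π j.pt)) (dProj m N π j.pt) ((momentum L j).comp j.vertProj)

theorem cartanAt_mem (vol : DiffForm (BaseModel m) M m) (L : J1 m N π → ℝ) (j : J1 m N π) :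
    cartanAt vol L j ∈ formsOne m (dProj m N π j.pt) :=
  polarForm_mem (B := BaseModel m) (V := TotalModel m N) (L j) (vol (π j.pt)) (dProj m N π j.pt)
    ((momentum L j).comp j.vertProj)

/-- The extended Legendre map `J¹E → Mπ`. -/
def extLegendre (vol : DiffForm (BaseModel m) M m) (L : J1 m N π → ℝ) (j : J1 m N π) :
    ExtMomentum m N π :=
  ⟨j.pt, ⟨cartanAt vol L j, cartanAt_mem vol L j⟩⟩

/-- The restricted Legendre map `FL : J¹E → J¹*E`. -/
def legendre (vol : DiffForm (BaseModel m) M m) (L : J1 m N π → ℝ) (j : J1 m N π) :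
    RestMomentum m N π :=
  momentumProj (extLegendre vol L j)

end Lagrangian

/-! ### The canonical forms and Hamiltonian systems -/

section Hamiltonian

variable [IsFiberedManifold m N π]

/-- The canonical `m`-form on `Mπ`: `Θ_q(W₁, …, W_m) = q(T pr W₁, …, T pr W_m)`. -/
def canonicalForm (π : E → M) [IsFiberedManifold m N π] :
    DiffForm (TotalModel m N × ExtModel m N) (ExtMomentum m N π) m := fun q =>
  q.form.1.compContinuousLinearMap
    (mfderiv 𝓘(ℝ, TotalModel m N × ExtModel m N) 𝓘(ℝ, TotalModel m N)
      (ExtMomentum.pt : ExtMomentum m N π → E) q)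

/-- The multisymplectic form `Ω = -dΘ` on `Mπ`. -/
def multisymplecticForm (π : E → M) [IsFiberedManifold m N π] :
    DiffForm (TotalModel m N × ExtModel m N) (ExtMomentum m N π) (m + 1) := fun q =>
  -dForm (canonicalForm π) q

variable {G : Type*} [NormedAddCommGroup G] [NormedSpace ℝ G]
variable {P : Type*} [TopologicalSpace P] [ChartedSpace G P]

/-- The Lagrangian `L` is almost-regular: `FL(J¹E)` is a closed embedded submanifold of `J¹*E`, given
as the image of the closed embedding `j0 : P → J¹*E`, the map `FL0 : J¹E → P` induced by `FL` is a
surjective submersion, and the fibres of `FL` are connected. -/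
structure IsAlmostRegular (vol : DiffForm (BaseModel m) M m) (L : J1 m N π → ℝ)
    (j0 : P → RestMomentum m N π) (FL0 : J1 m N π → P) : Prop where
  smooth_emb : ContMDiff 𝓘(ℝ, G) 𝓘(ℝ, TotalModel m N × RestModel m N) ∞ j0
  isClosedEmbedding : Topology.IsClosedEmbedding j0
  immersion : ∀ p, Function.Injective
    (mfderiv 𝓘(ℝ, G) 𝓘(ℝ, TotalModel m N × RestModel m N) j0 p)
  range_eq : range j0 = range (legendre vol L)
  factor : ∀ j, j0 (FL0 j) = legendre vol L j
  smooth_leg : ContMDiff 𝓘(ℝ, JetModel m N) 𝓘(ℝ, G) ∞ FL0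
  submersion : ∀ j, Function.Surjective (mfderiv 𝓘(ℝ, JetModel m N) 𝓘(ℝ, G) FL0 j)
  connected_fibre : ∀ j, IsConnected (legendre vol L ⁻¹' {legendre vol L j})

/-- The Lagrangian is hyper-regular: `FL` is a global diffeomorphism. -/
def IsHyperRegular (vol : DiffForm (BaseModel m) M m) (L : J1 m N π → ℝ) : Prop :=
  ∃ Φ : Diffeomorph 𝓘(ℝ, JetModel m N) 𝓘(ℝ, TotalModel m N × RestModel m N)
    (J1 m N π) (RestMomentum m N π) ∞, ∀ j, Φ j = legendre vol L j

theorem IsAlmostRegular.surjective {vol : DiffForm (BaseModel m) M m} {L : J1 m N π → ℝ}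
    {j0 : P → RestMomentum m N π} {FL0 : J1 m N π → P} (h : IsAlmostRegular (G := G) vol L j0 FL0) :
    Function.Surjective FL0 := by
  intro p
  obtain ⟨j, hj⟩ : j0 p ∈ range (legendre vol L) := h.range_eq ▸ mem_range_self p
  exact ⟨j, h.isClosedEmbedding.injective ((h.factor j).trans hj)⟩

/-- Hyper-regular Lagrangians are almost-regular, with `FL(J¹E) = J¹*E`. -/
theorem IsHyperRegular.isAlmostRegular {vol : DiffForm (BaseModel m) M m} {L : J1 m N π → ℝ}
    (h : IsHyperRegular vol L) :
    IsAlmostRegular (G := TotalModel m N × RestModel m N) vol L id (legendre vol L) := by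
  obtain ⟨Φ, hΦ⟩ := h
  have e : (Φ : J1 m N π → RestMomentum m N π) = legendre vol L := funext hΦ
  have h1 : ContMDiff 𝓘(ℝ, JetModel m N) 𝓘(ℝ, TotalModel m N × RestModel m N) ∞
      (legendre vol L) := e ▸ Φ.contMDiff
  have h2 : Function.Bijective (legendre vol L) := e ▸ Φ.bijective
  have h3 : ∀ j, Function.Surjective (mfderiv 𝓘(ℝ, JetModel m N)
      𝓘(ℝ, TotalModel m N × RestModel m N) (legendre vol L) j) := e ▸ fun j =>
    (Φ.mfderivToContinuousLinearEquiv (by simp) j).surjective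
  refine ⟨contMDiff_id, Topology.IsClosedEmbedding.id, injective_mfderiv_id, ?_, fun _ => rfl, h1,
    h3, ?_⟩
  · rw [range_id, h2.surjective.range_eq]
  · intro j
    have : legendre vol L ⁻¹' {legendre vol L j} = {j} := by
      ext k
      exact h2.injective.eq_iff
    rw [this]
    exact isConnected_singleton

variable {vol : DiffForm (BaseModel m) M m} {L : J1 m N π → ℝ}
  {j0 : P → RestMomentum m N π} {FL0 : J1 m N π → P}

/-- The map `h̃ : P → Mπ` induced by the extended Legendre map `FL~`, which is constant on the fibres
of `FL0`: it is characterised by `h̃ ∘ FL0 = FL~`. -/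
def IsAlmostRegular.hamSection (h : IsAlmostRegular (G := G) vol L j0 FL0) :
    P → ExtMomentum m N π :=
  extLegendre vol L ∘ Function.surjInv h.surjective

/-- The form `Ω_h⁰ = h̃^*Ω` of the Hamiltonian system on `P = FL(J¹E)`. -/
def IsAlmostRegular.hamForm (h : IsAlmostRegular (G := G) vol L j0 FL0) :
    DiffForm G P (m + 1) := fun p =>
  (multisymplecticForm π (h.hamSection p)).compContinuousLinearMap
    (mfderiv 𝓘(ℝ, G) 𝓘(ℝ, TotalModel m N × ExtModel m N) h.hamSection p)

end Hamiltonian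

/-! ### Contractions -/

section Contractions

variable {B V : Type*} [AddCommGroup B] [Module ℝ B] [TopologicalSpace B]
  [AddCommGroup V] [Module ℝ V] [TopologicalSpace V]

/-- Contraction of an `(m+1)`-form with a jet, given by its linear map `l : T_xM → T_qX`:
`(Z₁, …, Z_m; W) ↦ Ξ(l Z₁, …, l Z_m, W)`. -/
def jetContraction (Ξ : V [⋀^Fin (m + 1)]→L[ℝ] ℝ) (l : B →L[ℝ] V) (Z : Fin m → B) (W : V) : ℝ :=
  Ξ (Fin.snoc (α := fun _ => V) (fun i => l (Z i)) W)

/-- Contraction of an `(m+1)`-form with an `m`-vector, so that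
`i(X₁ ∧ … ∧ X_m) Ξ = Ξ(X₁, …, X_m, ·)`. -/
def mvContraction (Ξ : V [⋀^Fin (m + 1)]→L[ℝ] ℝ) (X : ⋀[ℝ]^m V) (W : V) : ℝ :=
  (-1) ^ m * exteriorPower.alternatingMapLinearEquiv (Ξ.toAlternatingMap.curryLeft W) X

/-- Contraction of a `k`-form with a vector-valued one-form (a (1,1)-tensor):
`(i(A)Ξ)(w₁, …, w_k) = ∑ᵢ Ξ(w₁, …, A wᵢ, …, w_k)`. -/
def tensorContraction {k : ℕ} (Ξ : V [⋀^Fin k]→L[ℝ] ℝ) (A : V →L[ℝ] V) (w : Fin k → V) : ℝ :=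
  ∑ i, Ξ (Function.update w i (A (w i)))

end Contractions

/-! ### Jet fields, multivector fields and connections along maps -/

section Fields

variable {HQ : Type*} [NormedAddCommGroup HQ] [NormedSpace ℝ HQ]
variable {Q : Type*} [TopologicalSpace Q] [ChartedSpace HQ Q]
variable {H : Type*} [NormedAddCommGroup H] [NormedSpace ℝ H]
variable {X : Type*} [TopologicalSpace X] [ChartedSpace H X]

variable (m H) in
/-- The differential of a map `τ : X → M`. -/
abbrev dMap (τ : X → M) (x : X) :
    TangentSpace 𝓘(ℝ, H) x →L[ℝ] TangentSpace 𝓘(ℝ, BaseModel m) (τ x) :=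
  mfderiv 𝓘(ℝ, H) 𝓘(ℝ, BaseModel m) τ x

variable (HQ) in
/-- Smoothness at `n₀` of a family of linear maps `φ n : T_{f n}M → T_{g n}X`. -/
def SmoothHomAt [IsManifold 𝓘(ℝ, BaseModel m) ∞ M] [IsManifold 𝓘(ℝ, H) ∞ X]
    (f : Q → M) (g : Q → X)
    (φ : ∀ n, TangentSpace 𝓘(ℝ, BaseModel m) (f n) →L[ℝ] TangentSpace 𝓘(ℝ, H) (g n))
    (n₀ : Q) : Prop :=
  ContMDiffAt 𝓘(ℝ, HQ) 𝓘(ℝ, BaseModel m →L[ℝ] H) ∞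
    (inTangentCoordinates 𝓘(ℝ, BaseModel m) 𝓘(ℝ, H) f g (fun n => φ n) n₀) n₀

variable (HQ) in
/-- `Y` is, on the subset `S` of `Q`, a smooth jet field along `g : Q → X` for the bundle
`τ : X → M`: near each point of `S` it is the restriction of a smooth map `n ↦ Y' n ∈ J¹τ`, defined
on an open set, with `Y' n` over `g n`. -/
def IsJetFieldOn [IsManifold 𝓘(ℝ, BaseModel m) ∞ M] [IsManifold 𝓘(ℝ, H) ∞ X]
    (τ : X → M) (g : Q → X) (S : Set Q) (Y : Q → FirstJet m H τ) : Prop :=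
  ∀ n₀ ∈ S, ∃ U : Set Q, IsOpen U ∧ n₀ ∈ U ∧ ∃ Y' : Q → FirstJet m H τ,
    (∀ n ∈ U, (Y' n).pt = g n) ∧
    (∀ n ∈ U, SmoothHomAt HQ (fun n => τ (Y' n).pt) (fun n => (Y' n).pt) (fun n => (Y' n).lin) n) ∧
    ∀ n ∈ U ∩ S, Y n = Y' n

variable (HQ) in
/-- `∇` is, on the subset `S` of `Q`, a smooth Ehresmann connection form along `g : Q → X` for
`τ : X → M`: near each point of `S` it is the restriction of a smooth section `∇'` of
`T*M ⊗ TX` along `g`, defined on an open set, with `i(∇')ξ = ξ` for all semibasic one-forms `ξ`. -/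
def IsConnectionOn [IsManifold 𝓘(ℝ, BaseModel m) ∞ M] [IsManifold 𝓘(ℝ, H) ∞ X]
    (τ : X → M) (g : Q → X) (S : Set Q)
    (D : ∀ n, TangentSpace 𝓘(ℝ, BaseModel m) (τ (g n)) →L[ℝ] TangentSpace 𝓘(ℝ, H) (g n)) : Prop :=
  ∀ n₀ ∈ S, ∃ U : Set Q, IsOpen U ∧ n₀ ∈ U ∧
    ∃ D' : ∀ n, TangentSpace 𝓘(ℝ, BaseModel m) (τ (g n)) →L[ℝ] TangentSpace 𝓘(ℝ, H) (g n),
    (∀ n ∈ U, SmoothHomAt HQ (fun n => τ (g n)) g D' n) ∧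
    (∀ n ∈ U, ∀ ξ : TangentSpace 𝓘(ℝ, H) (g n) →L[ℝ] ℝ,
      (∀ v, dMap m H τ (g n) v = 0 → ξ v = 0) → ∀ v, ξ (D' n (dMap m H τ (g n) v)) = ξ v) ∧
    ∀ n ∈ U ∩ S, D n = D' n

variable (H) in
/-- An `m`-vector field along `g`, without regularity. -/
abbrev MVField (m : ℕ) (g : Q → X) : Type _ := (n : Q) → ⋀[ℝ]^m (TangentSpace 𝓘(ℝ, H) (g n))

variable (HQ) in
/-- Smoothness at `n₀` of an `m`-vector field along `g`, in a chart at `g n₀`. -/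
def SmoothMVAt (g : Q → X) (K : MVField H m g) (n₀ : Q) : Prop :=
  ∀ θ : Module.Dual ℝ (⋀[ℝ]^m H), ContMDiffAt 𝓘(ℝ, HQ) 𝓘(ℝ, ℝ) ∞ (fun n =>
    θ (exteriorPower.map m
      (mfderiv 𝓘(ℝ, H) 𝓘(ℝ, H) (chartAt H (g n₀)) (g n)).toLinearMap (K n))) n₀

variable (HQ) in
/-- `K` is, on the subset `S`, a smooth `m`-vector field along `g`: locally the restriction of a
smooth one on an open set. -/
def IsSmoothMVOn (g : Q → X) (S : Set Q) (K : MVField H m g) : Prop :=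
  ∀ n₀ ∈ S, ∃ U : Set Q, IsOpen U ∧ n₀ ∈ U ∧ ∃ K' : MVField H m g,
    (∀ n ∈ U, SmoothMVAt HQ g K' n) ∧ ∀ n ∈ U ∩ S, K n = K' n

variable (HQ) in
/-- `K` is locally decomposable on `S`: near each point of `S` it is `Y₁ ∧ … ∧ Y_m` for smooth
vector fields `Yᵢ` along `g`. -/
def IsLocallyDecomposableOn [IsManifold 𝓘(ℝ, H) ∞ X] (g : Q → X) (S : Set Q) (K : MVField H m g) : Prop :=
  ∀ n₀ ∈ S, ∃ U : Set Q, IsOpen U ∧ n₀ ∈ U ∧ ∃ Y : Fin m → ∀ n, TangentSpace 𝓘(ℝ, H) (g n),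
    (∀ i, ContMDiffOn 𝓘(ℝ, HQ) 𝓘(ℝ, H).tangent ∞
      (fun n => (⟨g n, Y i n⟩ : TangentBundle 𝓘(ℝ, H) X)) U) ∧
    ∀ n ∈ U ∩ S, K n = exteriorPower.ιMulti ℝ m (fun i => Y i n)

/-- `K` is `τ`-transverse on `S`: `i(K)(τ^*β) ≠ 0` wherever the `m`-form `β` on `M` is nonzero. -/
def IsTransverseOn (τ : X → M) (g : Q → X) (S : Set Q) (K : MVField H m g) : Prop :=
  ∀ n ∈ S, ∀ β : TangentSpace 𝓘(ℝ, BaseModel m) (τ (g n)) [⋀^Fin m]→L[ℝ] ℝ, β ≠ 0 →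
    exteriorPower.alternatingMapLinearEquiv
      (β.compContinuousLinearMap (dMap m H τ (g n))).toAlternatingMap (K n) ≠ 0

variable (HQ) in
/-- `f` is, on the subset `S`, a smooth function. -/
def IsSmoothFunOn (S : Set Q) (f : Q → ℝ) : Prop :=
  ∀ n₀ ∈ S, ∃ U : Set Q, IsOpen U ∧ n₀ ∈ U ∧ ∃ f' : Q → ℝ,
    ContMDiffOn 𝓘(ℝ, HQ) 𝓘(ℝ, ℝ) ∞ f' U ∧ ∀ n ∈ U ∩ S, f n = f' n

variable (HQ) in
/-- The equivalence on `S` of `m`-vector fields along `g`: `K' = f K` with `f` smooth and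
non-vanishing. -/
def MVEquivOn (g : Q → X) (S : Set Q) (K K' : MVField H m g) : Prop :=
  ∃ f : Q → ℝ, IsSmoothFunOn HQ S f ∧ (∀ n ∈ S, f n ≠ 0) ∧ ∀ n ∈ S, K' n = f n • K n

end Fields

/-! ### Extended field operators -/

section Operators

variable [IsManifold 𝓘(ℝ, BaseModel m) ∞ M] [IsManifold 𝓘(ℝ, TotalModel m N) ∞ E]
  [IsFiberedManifold m N π]

variable (m N) in
/-- Model space of `Mπ`. -/
abbrev MomModel := TotalModel m N × ExtModel m N

/-- The projection `Mπ → M`. -/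
def extBase (π : E → M) (q : ExtMomentum m N π) : M := π q.pt

/-- The differential of the projection `Mπ → E`. -/
def dExtPt (q : ExtMomentum m N π) :
    TangentSpace 𝓘(ℝ, MomModel m N) q →L[ℝ] TangentSpace 𝓘(ℝ, TotalModel m N) q.pt :=
  mfderiv 𝓘(ℝ, MomModel m N) 𝓘(ℝ, TotalModel m N) (ExtMomentum.pt : ExtMomentum m N π → E) q

/-- The differential of the extended Legendre map. -/
def dLegendre (vol : DiffForm (BaseModel m) M m) (L : J1 m N π → ℝ) (j : J1 m N π) :
    TangentSpace 𝓘(ℝ, JetModel m N) j →L[ℝ]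
      TangentSpace 𝓘(ℝ, MomModel m N) (extLegendre vol L j) :=
  mfderiv 𝓘(ℝ, JetModel m N) 𝓘(ℝ, MomModel m N) (extLegendre vol L) j

variable (vol : DiffForm (BaseModel m) M m) (L : J1 m N π → ℝ) (S : Set (J1 m N π))

/-- Structural condition for jet fields, on `S`: a smooth jet field along `FL~`. -/
def JetStructural (Y : J1 m N π → FirstJet m (MomModel m N) (extBase (m := m) (N := N) π)) : Prop :=
  IsJetFieldOn (JetModel m N) (extBase π) (extLegendre vol L) S Y

/-- Field equation condition `FL~^*[i(Y)(Ω ∘ FL~)] = 0` for jet fields, on `S`. -/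
def JetFieldEq (Y : J1 m N π → FirstJet m (MomModel m N) (extBase (m := m) (N := N) π)) : Prop :=
  ∀ j ∈ S, ∀ Z w, jetContraction (B := BaseModel m) (V := MomModel m N)
    (multisymplecticForm π (extLegendre vol L j)) (Y j).lin Z (dLegendre vol L j w) = 0

/-- Semi-holonomy condition for jet fields, on `S`: `j¹pr_E ∘ Y = id`. -/
def JetSemiHolonomic (Y : J1 m N π → FirstJet m (MomModel m N) (extBase (m := m) (N := N) π)) :
    Prop :=
  ∀ j ∈ S, (Y j).pt.pt = j.pt ∧ (dExtPt (Y j).pt).comp (Y j).lin = j.lin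

/-- Structural condition for `m`-vector fields, on `S`: a non-vanishing, locally decomposable and
transverse `m`-vector field along `FL~`. -/
structure MVStructural (K : MVField (MomModel m N) m (extLegendre vol L)) : Prop where
  ne_zero : ∀ j ∈ S, K j ≠ 0
  decomposable : IsLocallyDecomposableOn (JetModel m N) (extLegendre vol L) S K
  transverse : IsTransverseOn (extBase π) (extLegendre vol L) S K

/-- Field equation condition `FL~^*[i(K)(Ω ∘ FL~)] = 0` for `m`-vector fields, on `S`. -/
def MVFieldEq (K : MVField (MomModel m N) m (extLegendre vol L)) : Prop :=
  ∀ j ∈ S, ∀ w, mvContraction (multisymplecticForm π (extLegendre vol L j)) (K j)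
    (dLegendre vol L j w) = 0

/-- Semi-holonomy condition for `m`-vector fields, on `S`: the image of `K j` in `Λᵐ T_yE` spans the
same line as the image of `j`, that is, `j(e₁) ∧ … ∧ j(e_m)` for a basis `e` of `T_xM`. -/
def MVSemiHolonomic (K : MVField (MomModel m N) m (extLegendre vol L)) : Prop :=
  ∀ j ∈ S, ∃ c : ℝ, c ≠ 0 ∧
    exteriorPower.map m (dExtPt (extLegendre vol L j)).toLinearMap (K j) =
      c • exteriorPower.ιMulti ℝ m (fun i => j.horLift (EuclideanSpace.single i (1 : ℝ)))

/-- Connection forms along `FL~`, without regularity. -/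
abbrev ExtConn : Type _ := (j : J1 m N π) →
  TangentSpace 𝓘(ℝ, BaseModel m) (extBase π (extLegendre vol L j)) →L[ℝ]
    TangentSpace 𝓘(ℝ, MomModel m N) (extLegendre vol L j)

/-- Structural condition for connections, on `S`: an Ehresmann connection form along `FL~`. -/
def ConnStructural (D : ExtConn vol L) : Prop :=
  IsConnectionOn (JetModel m N) (extBase π) (extLegendre vol L) S D

/-- Field equation condition `FL~^*[i(D)(Ω ∘ FL~) - (m-1)(Ω ∘ FL~)] = 0` for connections, on `S`. -/
def ConnFieldEq (D : ExtConn vol L) : Prop :=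
  ∀ j ∈ S, ∀ w : Fin (m + 1) → TangentSpace 𝓘(ℝ, JetModel m N) j,
    tensorContraction (multisymplecticForm π (extLegendre vol L j))
      ((D j).comp (dMap m (MomModel m N) (extBase π) (extLegendre vol L j)))
      (fun i => dLegendre vol L j (w i)) =
    ((m : ℝ) - 1) * multisymplecticForm π (extLegendre vol L j) (fun i => dLegendre vol L j (w i))

/-- Semi-holonomy condition for connections, on `S`: the connection projects to the jet `j`. -/
def ConnSemiHolonomic (D : ExtConn vol L) : Prop :=
  ∀ j ∈ S, (dExtPt (extLegendre vol L j)).comp (D j) = j.lin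

end Operators

/-! ### Hamilton-De Donder-Weyl jet fields, multivector fields and connections -/

section HDW

variable [IsManifold 𝓘(ℝ, BaseModel m) ∞ M] [IsManifold 𝓘(ℝ, TotalModel m N) ∞ E]
  [IsFiberedManifold m N π]
variable {G : Type*} [NormedAddCommGroup G] [NormedSpace ℝ G]
variable {P : Type*} [TopologicalSpace P] [ChartedSpace G P] [IsManifold 𝓘(ℝ, G) ∞ P]

/-- The projection `τ₀ : P → M`. -/
def hamBase (j0 : P → RestMomentum m N π) (p : P) : M := π (j0 p).pt

variable {vol : DiffForm (BaseModel m) M m} {L : J1 m N π → ℝ}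
  {j0 : P → RestMomentum m N π} {FL0 : J1 m N π → P}

namespace IsAlmostRegular

variable (h : IsAlmostRegular (G := G) vol L j0 FL0) (C : Set P) (S : Set (J1 m N π))

/-- The differential of `h̃ : P → Mπ`. -/
def dHam (p : P) :
    TangentSpace 𝓘(ℝ, G) p →L[ℝ] TangentSpace 𝓘(ℝ, MomModel m N) (h.hamSection p) :=
  mfderiv 𝓘(ℝ, G) 𝓘(ℝ, MomModel m N) h.hamSection p

/-- `Ψ` is a Hamilton-De Donder-Weyl jet field on `C`: a jet field `P → J¹P` with
`i(Ψ)Ω_h⁰ = 0` on `C`. -/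
structure HDWJet (Ψ : P → FirstJet m G (hamBase j0)) : Prop where
  jetField : IsJetFieldOn G (hamBase j0) id C Ψ
  fieldEq : ∀ p ∈ C, ∀ Z W,
    jetContraction (B := BaseModel m) (V := G) (h.hamForm p) (Ψ p).lin Z W = 0

/-- `X` is a Hamilton-De Donder-Weyl `m`-vector field on `C`: non-vanishing, locally decomposable,
`τ₀`-transverse, and `i(X)Ω_h⁰ = 0` on `C`. -/
structure HDWMV (X : MVField G m (id : P → P)) : Prop where
  ne_zero : ∀ p ∈ C, X p ≠ 0
  decomposable : IsLocallyDecomposableOn G id C X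
  transverse : IsTransverseOn (hamBase j0) id C X
  fieldEq : ∀ p ∈ C, ∀ W, mvContraction (h.hamForm p) (X p) W = 0

variable (j0) in
/-- Connection forms of `τ₀ : P → M`, without regularity. -/
abbrev HamConn : Type _ := (p : P) →
  TangentSpace 𝓘(ℝ, BaseModel m) (hamBase j0 p) →L[ℝ] TangentSpace 𝓘(ℝ, G) p

/-- `D` is a Hamilton-De Donder-Weyl connection on `C`: an Ehresmann connection form of `τ₀` with
`i(D)Ω_h⁰ = (m-1)Ω_h⁰` on `C`. -/
structure HDWConn (D : HamConn (G := G) j0) : Prop where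
  connection : IsConnectionOn G (hamBase j0) id C D
  fieldEq : ∀ p ∈ C, ∀ w : Fin (m + 1) → TangentSpace 𝓘(ℝ, G) p,
    tensorContraction (h.hamForm p) ((D p).comp (dMap m G (hamBase j0) p)) w =
      ((m : ℝ) - 1) * h.hamForm p w

/-- The relation `j¹h̃ ∘ Ψ ∘ FL0 = Y` on `S`, for jet fields. -/
def JetRel (Ψ : P → FirstJet m G (hamBase j0))
    (Y : J1 m N π → FirstJet m (MomModel m N) (extBase (m := m) (N := N) π)) : Prop :=
  ∀ j ∈ S, (Y j).pt = h.hamSection (Ψ (FL0 j)).pt ∧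
    (Y j).lin = (h.dHam (Ψ (FL0 j)).pt).comp (Ψ (FL0 j)).lin

/-- The relation `Λᵐ Th̃ ∘ X ∘ FL0 = K` on `S`, for `m`-vector fields. -/
def MVRel (X : MVField G m (id : P → P)) (K : MVField (MomModel m N) m (extLegendre vol L)) :
    Prop :=
  ∀ j ∈ S, K j = exteriorPower.map m (h.dHam (FL0 j)).toLinearMap (X (FL0 j))

/-- The relation `(id ⊗ Th̃) ∘ D ∘ FL0 = D'` on `S`, for connections. -/
def ConnRel (D : HamConn (G := G) j0) (D' : ExtConn vol L) : Prop :=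
  ∀ j ∈ S, D' j = (h.dHam (FL0 j)).comp (D (FL0 j))

end IsAlmostRegular

end HDW

/-! ### The trivial bundle `ℝᵐ × ℝᴺ → ℝᵐ` -/

variable (m N) in
/-- The projection of the trivial bundle `ℝᵐ × ℝᴺ → ℝᵐ`. -/
abbrev trivialBundle : TotalModel m N → BaseModel m := Prod.fst

instance : IsFiberedManifold m N (trivialBundle m N) where
  smooth := contDiff_fst.contMDiff
  surjective := Prod.fst_surjective
  exists_adapted _ := ⟨{
    tot := OpenPartialHomeomorph.refl _
    base := OpenPartialHomeomorph.refl _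
    tot_smooth := contMDiff_id.contMDiffOn
    tot_symm_smooth := contMDiff_id.contMDiffOn
    base_smooth := contMDiff_id.contMDiffOn
    base_symm_smooth := contMDiff_id.contMDiffOn
    mapsTo := fun _ _ => trivial
    fst_tot := fun _ _ => rfl }, trivial⟩

end FieldTheory

end

open FieldTheory

/-! Everything rests on the factorisation of the extended Legendre map as `h̃ ∘ FL0`.
Differentiating it (`dLegendre_eq`) shows that the contraction of `Ω` with the image under `T h̃` of
a field on `P`, pulled back by the extended Legendre map and evaluated at `w`, is the contraction of
`Ω_h⁰` with the field itself, evaluated at `T FL0 w`. Since `FL0` is a submersion, the vectors `T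
FL0 w` exhaust the tangent spaces of `P`, so the two field equations are equivalent:
`jetFieldEq_iff`, `connFieldEq_iff`, `extMVAt_iff`. The structural conditions carry over because
`h̃` covers the identity of `M` and `T h̃` is injective, the composite `μ ∘ h̃ = j0` being an
immersion. For `m`-vectors all conditions survive multiplication by nonzero scalars. A smooth field
on `P` whose values are nonzero and decomposable has smooth local factors by Cramer's rule
(`exists_local_factors`), which supplies local decomposability.

The factorisation itself needs the kernel of `T FL` to lie in the kernel of the differential of the
extended Legendre map. In adapted coordinates the derivative of the Poincaré-Cartan form in a fibre
direction `B` involves only the Hessian `Hess L (B, ·)`: the terms with first derivatives of `L`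
cancel (`fderiv_cartanCoord_vert`). The class of this derivative modulo semibasic forms already
determines `Hess L (B, ·)`, so nothing is lost by applying `μ` (`dLegendre_eq_zero`). The extended
Legendre map is therefore locally constant on the fibres of `FL0`, and constant because they are
connected; local sections of the submersion make `h̃` smooth.

For a hyper-regular Lagrangian, let a solution at a jet with coordinate `v` project to a linear
section with coordinate `k`. Testing the field equation on the images of vertical vectors `(0, B)`
gives `Hess L (B, k - v) = 0` for all `B`. By symmetry of the Hessian, `k - v` gives a vector in the
kernel of `T FL`, which is zero, so `k = v` (`IsHyperRegular.dExtPt_eq`). An `m`-vector or a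
connection is reduced to this case through the linear section that it defines.

The counterexample is `L = 0`. Then `FL` is the projection to `E` followed by the zero section, `P`
is a copy of `E` and `Ω_h⁰ = 0`, so the flat horizontal lift solves every field equation. Its image
along the Legendre map projects to the same horizontal space at all jets over a point of `E`, and so
cannot agree with each of these jets. -/

noncomputable section

namespace FieldTheory

/-! ### Linear algebra of top-degree forms -/

section TopForms

variable {m : ℕ}

/-- The left side is again alternating of top degree in `w`, hence a multiple of the determinant.
The factor is read off on the standard basis, where only the diagonal coefficient of each `A eᵢ`
survives. -/
theorem sum_update_eq_trace_mul (f : BaseModel m [⋀^Fin m]→L[ℝ] ℝ) (A : BaseModel m →L[ℝ] BaseModel m)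
    (w : Fin m → BaseModel m) :
    ∑ i, f (Function.update w i (A (w i))) =
      (∑ i, A (EuclideanSpace.single i (1 : ℝ)) i) * f w := by
  set e := (EuclideanSpace.basisFun (Fin m) ℝ).toBasis with he
  have hei : ∀ i, e i = EuclideanSpace.single i (1 : ℝ) := fun i => by simp [he]
  -- The sum is the derivative, at the identity and in the direction `A`, of the pull-back of `f` by
  -- linear maps; in this guise it is visibly alternating.
  set g := f.fderivCompContinuousLinearMap (ContinuousLinearMap.id ℝ (BaseModel m)) A with hg
  have hgw : ∀ w, g w = ∑ i, f (Function.update w i (A (w i))) := fun w => by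
    have h := polarForm_apply 0 f (ContinuousLinearMap.id ℝ (BaseModel m)) A w
    rw [zero_mul, zero_add] at h
    rw [polarForm, zero_smul, zero_add] at h
    exact h
  have h1 := AlternatingMap.eq_smul_basis_det e g.toAlternatingMap
  have h2 := AlternatingMap.eq_smul_basis_det e f.toAlternatingMap
  have h1w : g w = g e * e.det w := DFunLike.congr_fun h1 w
  have h2w : f w = f e * e.det w := DFunLike.congr_fun h2 w
  have h3 : g e = (∑ i, A (EuclideanSpace.single i (1 : ℝ)) i) * f e := by
    rw [hgw, Finset.sum_mul]
    refine Finset.sum_congr rfl fun i _ => ?_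
    have h4 : A (e i) = ∑ k, (A (e i)) k • e k := by
      conv_lhs => rw [← e.sum_repr (A (e i))]
      simp [he]
    rw [h4, ← ContinuousAlternatingMap.coe_toAlternatingMap, AlternatingMap.map_update_sum,
      Finset.sum_eq_single i]
    · rw [AlternatingMap.map_update_smul, Function.update_eq_self, hei]
      rfl
    · intro k _ hk
      rw [AlternatingMap.map_update_smul, AlternatingMap.map_update_self _ _ hk.symm, smul_zero]
    · simp
  rw [← hgw, h1w, h2w, h3]
  ring

/-- A nonzero top-degree form detects vectors. -/
theorem eq_zero_of_forall_update (f : BaseModel m [⋀^Fin m]→L[ℝ] ℝ) (hf : f ≠ 0)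
    (b : BaseModel m) (h : ∀ (w : Fin m → BaseModel m) i, f (Function.update w i b) = 0) : b = 0 := by
  ext k
  -- The rank-one map `x ↦ x_k b` has trace `b_k`, while by hypothesis each term of its sum of
  -- insertions vanishes.
  have h1 := sum_update_eq_trace_mul f
    ((EuclideanSpace.proj k : BaseModel m →L[ℝ] ℝ).smulRight b)
  obtain ⟨w, hw⟩ : ∃ w, f w ≠ 0 := by
    by_contra! hc
    exact hf (by ext w; exact hc w)
  have h2 := h1 w
  have h3 : ∑ i, f (Function.update w i
      (((EuclideanSpace.proj k : BaseModel m →L[ℝ] ℝ).smulRight b) (w i))) = 0 := by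
    refine Finset.sum_eq_zero fun i _ => ?_
    rw [ContinuousLinearMap.smulRight_apply, ← ContinuousAlternatingMap.coe_toAlternatingMap,
      AlternatingMap.map_update_smul]
    have := h w i
    rw [← ContinuousAlternatingMap.coe_toAlternatingMap] at this
    rw [this, smul_zero]
  rw [h3] at h2
  have h4 := (mul_eq_zero.1 h2.symm).resolve_right hw
  rw [Finset.sum_eq_single k] at h4
  · simpa using h4
  · intro i _ hik
    simp [hik.symm]
  · simp

end TopForms

/-! ### The momentum attached to a functional on `Hom(ℝᵐ, F)` -/

section Momentum

variable {m : ℕ} {F : Type*} [NormedAddCommGroup F] [NormedSpace ℝ F]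

/-- The contraction `Hom(ℝᵐ, F)* → Hom(F, ℝᵐ)`. -/
def momOf (l : (BaseModel m →L[ℝ] F) →L[ℝ] ℝ) : F →L[ℝ] BaseModel m :=
  ∑ i : Fin m, (l.comp (ContinuousLinearMap.smulRightL ℝ (BaseModel m) F
    (EuclideanSpace.proj i))).smulRight (EuclideanSpace.single i (1 : ℝ))

theorem momOf_apply (l : (BaseModel m →L[ℝ] F) →L[ℝ] ℝ) (f : F) (i : Fin m) :
    momOf l f i = l ((EuclideanSpace.proj i : BaseModel m →L[ℝ] ℝ).smulRight f) := by
  have h : momOf l f = ∑ k : Fin m,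
      l ((EuclideanSpace.proj k : BaseModel m →L[ℝ] ℝ).smulRight f) •
        EuclideanSpace.single k (1 : ℝ) := by
    simp [momOf]
  rw [h]
  simp [Pi.single_apply]

theorem eq_sum_smulRight (C : BaseModel m →L[ℝ] F) :
    C = ∑ i, (EuclideanSpace.proj i : BaseModel m →L[ℝ] ℝ).smulRight
      (C (EuclideanSpace.single i (1 : ℝ))) := by
  ext w
  conv_lhs => rw [← (EuclideanSpace.basisFun (Fin m) ℝ).sum_repr w]
  simp

/-- The trace of `momOf l ∘ C` recovers `l C`, by expansion of `C` into rank-one maps. Combined with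
`sum_update_eq_trace_mul`, it turns sums of insertions into a top form into values of derivatives of
the Lagrangian. -/
theorem sum_momOf (l : (BaseModel m →L[ℝ] F) →L[ℝ] ℝ) (C : BaseModel m →L[ℝ] F) :
    ∑ i, momOf l (C (EuclideanSpace.single i (1 : ℝ))) i = l C := by
  conv_rhs => rw [eq_sum_smulRight C, map_sum]
  exact Finset.sum_congr rfl fun i _ => momOf_apply _ _ _

/-- This description by arbitrary covectors does not involve the standard basis, so it is what makes
the momentum comparable in different charts. -/
theorem momOf_dual (l : (BaseModel m →L[ℝ] F) →L[ℝ] ℝ) (f : F) (ξ : BaseModel m →L[ℝ] ℝ) :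
    ξ (momOf l f) = l (ξ.smulRight f) := by
  conv_rhs => rw [eq_sum_smulRight (ξ.smulRight f), map_sum]
  have h : momOf l f = ∑ i, momOf l f i • EuclideanSpace.single i (1 : ℝ) := by
    conv_lhs => rw [← (EuclideanSpace.basisFun (Fin m) ℝ).sum_repr (momOf l f)]
    simp
  rw [h, map_sum]
  refine Finset.sum_congr rfl fun i _ => ?_
  rw [map_smul, momOf_apply, ContinuousLinearMap.smulRight_apply]
  have h2 : (EuclideanSpace.proj i : BaseModel m →L[ℝ] ℝ).smulRight
      (ξ (EuclideanSpace.single i (1 : ℝ)) • f) = ξ (EuclideanSpace.single i (1 : ℝ)) •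
      (EuclideanSpace.proj i : BaseModel m →L[ℝ] ℝ).smulRight f := by
    ext w
    simp [smul_smul, mul_comm]
  rw [h2, map_smul, smul_eq_mul, smul_eq_mul, mul_comm]

variable (m F) in
/-- `momOf` as a continuous linear map. -/
def momCLM [FiniteDimensional ℝ F] :
    ((BaseModel m →L[ℝ] F) →L[ℝ] ℝ) →L[ℝ] (F →L[ℝ] BaseModel m) :=
  LinearMap.toContinuousLinearMap
    { toFun := momOf
      map_add' := fun l l' => by
        ext f i
        simp [momOf_apply]
      map_smul' := fun r l => by
        ext f i
        simp [momOf_apply] }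

@[simp]
theorem momCLM_apply [FiniteDimensional ℝ F] (l : (BaseModel m →L[ℝ] F) →L[ℝ] ℝ) :
    momCLM m F l = momOf l := rfl

end Momentum

/-! ### Differentiation of polar forms -/

section PolarForm

variable {B V : Type*} [NormedAddCommGroup B] [NormedSpace ℝ B] [NormedAddCommGroup V]
  [NormedSpace ℝ V] {k : ℕ}

/-- For fixed `f` and `q`, `polarForm` is linear in the pair `(r, R)`. Fixed `f` is enough, because
only derivatives along the fibres over `E` will be taken. -/
theorem hasFDerivAt_polarForm {X : Type*} [NormedAddCommGroup X] [NormedSpace ℝ X]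
    (q : V →L[ℝ] B) {r : X → ℝ} {f : B [⋀^Fin k]→L[ℝ] ℝ} {R : X → V →L[ℝ] B} {x : X}
    {r' : X →L[ℝ] ℝ} {R' : X →L[ℝ] V →L[ℝ] B}
    (hr : HasFDerivAt r r' x) (hR : HasFDerivAt R R' x) :
    HasFDerivAt (fun x => polarForm (r x) f q (R x))
      (r'.smulRight (f.compContinuousLinearMap q) +
        (f.fderivCompContinuousLinearMap q).comp R') x := by
  refine (hr.smul_const (f.compContinuousLinearMap q)).add ?_
  exact (f.fderivCompContinuousLinearMap q).hasFDerivAt.comp x hR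

theorem contDiffOn_polarForm [FiniteDimensional ℝ V] {X : Type*} [NormedAddCommGroup X]
    [NormedSpace ℝ X]
    (q : V →L[ℝ] B) {r : X → ℝ} {f : X → B [⋀^Fin k]→L[ℝ] ℝ} {R : X → V →L[ℝ] B} {s : Set X}
    (hr : ContDiffOn ℝ ∞ r s) (hf : ContDiffOn ℝ ∞ f s) (hR : ContDiffOn ℝ ∞ R s) :
    ContDiffOn ℝ ∞ (fun x => polarForm (r x) (f x) q (R x)) s := by
  refine ContDiffOn.add (hr.smul ?_) ?_
  · exact (contDiff_pullback k).comp_contDiffOn (hf.prodMk contDiffOn_const)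
  · exact ((ContinuousAlternatingMap.fderivCompContinuousLinearMapCLM
      (ι := Fin k) (G := ℝ) q).contDiff.comp_contDiffOn hf).clm_apply hR

end PolarForm

end FieldTheory

end

noncomputable section

namespace FieldTheory

/-! ### Submersions -/

section Submersions

variable {A G Z : Type*} [NormedAddCommGroup A] [NormedSpace ℝ A] [FiniteDimensional ℝ A]
  [NormedAddCommGroup G] [NormedSpace ℝ G] [FiniteDimensional ℝ G]
  [NormedAddCommGroup Z] [NormedSpace ℝ Z]

/-- Adapted coordinates of a submersion between vector spaces. -/
theorem exists_submersion_coords {n : WithTop ℕ∞} (hn : n ≠ 0) {f : A → G} {x₀ : A}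
    (hf : ContDiffAt ℝ n f x₀) (hs : Function.Surjective (fderiv ℝ f x₀)) :
    ∃ (K : Submodule ℝ A) (e : OpenPartialHomeomorph A (G × K)), x₀ ∈ e.source ∧
      (∀ x, (e x).1 = f x) ∧ ContDiffAt ℝ n e.symm (e x₀) := by
  have : CompleteSpace A := FiniteDimensional.complete ℝ A
  have : CompleteSpace G := FiniteDimensional.complete ℝ G
  -- A linear projection onto the kernel of the derivative completes `f` to a map with invertible
  -- derivative at `x₀`, to which the inverse function theorem applies.
  obtain ⟨pr, hpr⟩ := LinearMap.exists_leftInverse_of_injective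
    (LinearMap.ker (fderiv ℝ f x₀).toLinearMap).subtype
    (LinearMap.ker_eq_bot.2 (Submodule.injective_subtype _))
  set prc : A →L[ℝ] LinearMap.ker (fderiv ℝ f x₀).toLinearMap := LinearMap.toContinuousLinearMap pr
  have hpr' : ∀ x : LinearMap.ker (fderiv ℝ f x₀).toLinearMap, pr x = x := LinearMap.congr_fun hpr
  let e' := ContinuousLinearMap.equivProdOfSurjectiveOfIsCompl (fderiv ℝ f x₀) prc
    (LinearMap.range_eq_top.2 hs)
    (LinearMap.range_eq_top.2 fun x => ⟨x, hpr' x⟩) (LinearMap.isCompl_of_proj hpr')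
  have hE : ContDiffAt ℝ n (fun x => (f x, prc x)) x₀ := hf.prodMk prc.contDiff.contDiffAt
  have hE' : HasFDerivAt (fun x => (f x, prc x)) (e' : A →L[ℝ] _) x₀ :=
    (hf.differentiableAt hn).hasFDerivAt.prodMk prc.hasFDerivAt
  refine ⟨_, hE.toOpenPartialHomeomorph _ hE' hn, hE.mem_toOpenPartialHomeomorph_source hE' hn, ?_, ?_⟩
  · intro x
    rw [hE.toOpenPartialHomeomorph_coe]
  · exact hE.to_localInverse hE' hn

/-- In submersion coordinates `f` is the first projection, and the section keeps the second
coordinate frozen at its value for `x₀`. -/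
theorem exists_local_section {n : WithTop ℕ∞} (hn : n ≠ 0) {f : A → G} {x₀ : A}
    (hf : ContDiffAt ℝ n f x₀) (hs : Function.Surjective (fderiv ℝ f x₀)) :
    ∃ σ : G → A, ContDiffAt ℝ n σ (f x₀) ∧ σ (f x₀) = x₀ ∧ ∀ᶠ g in 𝓝 (f x₀), f (σ g) = g := by
  obtain ⟨K, e, he, h1, h2⟩ := exists_submersion_coords hn hf hs
  have h3 : (f x₀, (e x₀).2) = e x₀ := Prod.ext (h1 x₀).symm rfl
  have h4 : ContDiffAt ℝ n (fun g : G => (g, (e x₀).2)) (f x₀) := contDiffAt_id.prodMk contDiffAt_const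
  rw [← h3] at h2
  refine ⟨fun g => e.symm (g, (e x₀).2), h2.comp (f x₀) h4, ?_, ?_⟩
  · show e.symm (f x₀, (e x₀).2) = x₀
    rw [h3, e.left_inv he]
  · have h5 : ∀ᶠ g in 𝓝 (f x₀), (g, (e x₀).2) ∈ e.target := by
      refine h4.continuousAt.eventually_mem ?_
      rw [h3]
      exact e.open_target.mem_nhds (e.map_source he)
    filter_upwards [h5] with g hg
    rw [← h1, e.right_inv hg]

/-- A map whose derivative vanishes on the kernel of the derivative of a submersion is locally
constant on the fibres of the submersion. -/
theorem eventually_eq_of_ker_le {f : A → G} {k : A → Z} {x₀ : A}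
    (hf : ContDiffAt ℝ 1 f x₀) (hk : ContDiffAt ℝ 1 k x₀)
    (hs : Function.Surjective (fderiv ℝ f x₀))
    (hker : ∀ᶠ x in 𝓝 x₀, ∀ w, fderiv ℝ f x w = 0 → fderiv ℝ k x w = 0) :
    ∀ᶠ x in 𝓝 x₀, f x = f x₀ → k x = k x₀ := by
  obtain ⟨K, e, he, h1, h2⟩ := exists_submersion_coords one_ne_zero hf hs
  have hx₀ : e.symm (e x₀) = x₀ := e.left_inv he
  have hc : Filter.Tendsto e.symm (𝓝 (e x₀)) (𝓝 x₀) := by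
    have := e.continuousAt_symm (e.map_source he)
    rw [ContinuousAt, hx₀] at this
    exact this
  have hev : ∀ᶠ z in 𝓝 (e x₀), z ∈ e.target ∧ DifferentiableAt ℝ e.symm z ∧
      DifferentiableAt ℝ f (e.symm z) ∧ DifferentiableAt ℝ k (e.symm z) ∧
      ∀ w, fderiv ℝ f (e.symm z) w = 0 → fderiv ℝ k (e.symm z) w = 0 := by
    filter_upwards [e.open_target.mem_nhds (e.map_source he), h2.eventually (by simp),
      hc.eventually (hf.eventually (by simp)), hc.eventually (hk.eventually (by simp)),
      hc.eventually hker] with z a1 a2 a3 a4 a5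
    exact ⟨a1, a2.differentiableAt one_ne_zero, a3.differentiableAt one_ne_zero,
      a4.differentiableAt one_ne_zero, a5⟩
  obtain ⟨ε, hε, hball⟩ := Metric.eventually_nhds_iff_ball.1 hev
  have hx : ∀ᶠ x in 𝓝 x₀, x ∈ e.source ∧ e x ∈ Metric.ball (e x₀) ε :=
    Filter.Eventually.and (e.open_source.mem_nhds he)
      ((e.continuousAt he).eventually_mem (Metric.ball_mem_nhds _ hε))
  filter_upwards [hx] with x hx hfx
  set g := f x₀ with hg
  have hpair : ∀ t, t ∈ Metric.ball (e x₀).2 ε → (g, t) ∈ Metric.ball (e x₀) ε := by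
    intro t ht
    rw [← Prod.mk.eta (p := e x₀), ← ball_prod_same, h1 x₀]
    exact ⟨Metric.mem_ball_self hε, ht⟩
  -- Along the slice with first coordinate `g` the map `f` is constant, so vectors tangent to the
  -- slice lie in the kernel of its derivative and, by `hker`, in that of the derivative of `k`. As
  -- the slice is taken in a ball, `k` is then constant on it.
  have hd : ∀ t ∈ Metric.ball (e x₀).2 ε,
      HasFDerivAt (fun t => k (e.symm (g, t))) (0 : K →L[ℝ] Z) t := by
    intro t ht
    obtain ⟨b1, b2, b3, b4, b5⟩ := hball _ (hpair t ht)
    have hi : HasFDerivAt (fun t : K => (g, t)) (ContinuousLinearMap.inr ℝ G K) t :=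
      hasFDerivAt_prodMk_right g t
    have hes := b2.hasFDerivAt.comp t hi
    have hks := b4.hasFDerivAt.comp t hes
    have hfs := b3.hasFDerivAt.comp t hes
    have hfe : (fun t => f (e.symm (g, t))) =ᶠ[𝓝 t] fun _ => g := by
      have : ∀ᶠ t' in 𝓝 t, t' ∈ Metric.ball (e x₀).2 ε := Metric.isOpen_ball.mem_nhds ht
      filter_upwards [this] with t' ht'
      rw [← h1, e.right_inv (hball _ (hpair t' ht')).1]
    have hz := hfs.unique (((hasFDerivAt_const g t).congr_of_eventuallyEq hfe))
    have : (fderiv ℝ k (e.symm (g, t))).comp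
        ((fderiv ℝ e.symm (g, t)).comp (ContinuousLinearMap.inr ℝ G K)) = 0 := by
      ext w
      exact b5 _ (DFunLike.congr_fun hz w)
    rw [← this]
    exact hks
  have hmem : (e x).2 ∈ Metric.ball (e x₀).2 ε := by
    have := hx.2
    rw [← Prod.mk.eta (p := e x₀), ← ball_prod_same] at this
    exact this.2
  have key := Metric.isOpen_ball.is_const_of_fderiv_eq_zero
    (convex_ball (e x₀).2 ε).isPreconnected
    (fun t ht => (hd t ht).differentiableAt.differentiableWithinAt)
    (fun t ht => (hd t ht).fderiv) hmem (Metric.mem_ball_self hε)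
  have e1 : (g, (e x).2) = e x := Prod.ext (by rw [h1, hfx]) rfl
  have e2 : (g, (e x₀).2) = e x₀ := Prod.ext (h1 x₀).symm rfl
  rw [e1, e2, e.left_inv hx.1, hx₀] at key
  exact key

end Submersions

section ManifoldSubmersions

variable {A G : Type*} [NormedAddCommGroup A] [NormedSpace ℝ A]
  [NormedAddCommGroup G] [NormedSpace ℝ G]
variable {X P : Type*} [TopologicalSpace X] [ChartedSpace A X]
  [TopologicalSpace P] [ChartedSpace G P]

/-- The derivative of the coordinate expression of a map, for arbitrary charts. -/
theorem fderiv_chart_expr {f : X → P} (e : OpenPartialHomeomorph X A)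
    (he : e.MDifferentiable 𝓘(ℝ, A) 𝓘(ℝ, A)) (e' : OpenPartialHomeomorph P G)
    (he' : e'.MDifferentiable 𝓘(ℝ, G) 𝓘(ℝ, G)) {u : A} (hu : u ∈ e.target)
    (hf : MDifferentiableAt 𝓘(ℝ, A) 𝓘(ℝ, G) f (e.symm u)) (hfu : f (e.symm u) ∈ e'.source) :
    fderiv ℝ (e' ∘ f ∘ e.symm) u = (mfderiv 𝓘(ℝ, G) 𝓘(ℝ, G) e' (f (e.symm u))).comp
      ((mfderiv 𝓘(ℝ, A) 𝓘(ℝ, G) f (e.symm u)).comp (mfderiv 𝓘(ℝ, A) 𝓘(ℝ, A) e.symm u)) := by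
  rw [← mfderiv_eq_fderiv]
  have h1 := he.mdifferentiableAt_symm hu
  have h2 := hf.comp u h1
  exact (mfderiv_comp u (he'.mdifferentiableAt hfu) h2).trans
    (congrArg _ (mfderiv_comp u hf h1))

theorem chart_mdifferentiable [IsManifold 𝓘(ℝ, A) ∞ X] (x : X) :
    (chartAt A x).MDifferentiable 𝓘(ℝ, A) 𝓘(ℝ, A) :=
  mdifferentiable_of_mem_atlas (chart_mem_atlas A x)

/-- The vector space case read in charts. It is what makes `h̃` smooth: near a point, `h̃` is the
extended Legendre map after a local section of `FL0`. -/
theorem exists_local_section_manifold [FiniteDimensional ℝ A] [FiniteDimensional ℝ G]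
    [IsManifold 𝓘(ℝ, A) ∞ X] [IsManifold 𝓘(ℝ, G) ∞ P] {f : X → P} (hf : ContMDiff 𝓘(ℝ, A) 𝓘(ℝ, G) ∞ f) {x₀ : X}
    (hs : Function.Surjective (mfderiv 𝓘(ℝ, A) 𝓘(ℝ, G) f x₀)) :
    ∃ σ : P → X, ContMDiffAt 𝓘(ℝ, G) 𝓘(ℝ, A) ∞ σ (f x₀) ∧ σ (f x₀) = x₀ ∧
      ∀ᶠ p in 𝓝 (f x₀), f (σ p) = p := by
  set e := chartAt A x₀ with he
  set e' := chartAt G (f x₀) with he'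
  have hx : x₀ ∈ e.source := mem_chart_source A x₀
  have hp : f x₀ ∈ e'.source := mem_chart_source G (f x₀)
  have hinv : e.symm (e x₀) = x₀ := e.left_inv hx
  have h1 : ContDiffAt ℝ ∞ (e' ∘ f ∘ e.symm) (e x₀) := by
    rw [← contMDiffAt_iff_contDiffAt]
    have a1 : ContMDiffAt 𝓘(ℝ, A) 𝓘(ℝ, A) ∞ e.symm (e x₀) :=
      contMDiffOn_chart_symm.contMDiffAt (e.open_target.mem_nhds (e.map_source hx))
    have a2 : ContMDiffAt 𝓘(ℝ, G) 𝓘(ℝ, G) ∞ e' (f (e.symm (e x₀))) := by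
      rw [hinv]
      exact contMDiffOn_chart.contMDiffAt (e'.open_source.mem_nhds hp)
    exact a2.comp (e x₀) ((hf _).comp (e x₀) a1)
  have h2 : Function.Surjective (fderiv ℝ (e' ∘ f ∘ e.symm) (e x₀)) := by
    rw [fderiv_chart_expr e (chart_mdifferentiable x₀) e' (chart_mdifferentiable (f x₀))
      (e.map_source hx) ((hf _).mdifferentiableAt (by simp)) (by rw [hinv]; exact hp)]
    have s1 : Function.Surjective (mfderiv 𝓘(ℝ, G) 𝓘(ℝ, G) e' (f (e.symm (e x₀)))) := by
      rw [hinv]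
      exact (chart_mdifferentiable (f x₀)).mfderiv_surjective hp
    have s2 : Function.Surjective (mfderiv 𝓘(ℝ, A) 𝓘(ℝ, G) f (e.symm (e x₀))) := by
      rw [hinv]
      exact hs
    have s3 : Function.Surjective (mfderiv 𝓘(ℝ, A) 𝓘(ℝ, A) e.symm (e x₀)) :=
      (chart_mdifferentiable (A := A) x₀).symm.mfderiv_surjective (e.map_source hx)
    exact s1.comp (s2.comp s3)
  obtain ⟨σ, b1, b2, b3⟩ := exists_local_section (by simp) h1 h2
  have e0 : (e' ∘ f ∘ e.symm) (e x₀) = e' (f x₀) := by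
    simp only [Function.comp_apply, hinv]
  rw [e0] at b1 b2 b3
  have c1 : ContMDiffAt 𝓘(ℝ, G) 𝓘(ℝ, G) ∞ e' (f x₀) :=
    contMDiffOn_chart.contMDiffAt (e'.open_source.mem_nhds hp)
  have c2 : ContMDiffAt 𝓘(ℝ, A) 𝓘(ℝ, A) ∞ e.symm (σ (e' (f x₀))) := by
    rw [b2]
    exact contMDiffOn_chart_symm.contMDiffAt (e.open_target.mem_nhds (e.map_source hx))
  have c3 : ContMDiffAt 𝓘(ℝ, G) 𝓘(ℝ, A) ∞ (e.symm ∘ σ ∘ e') (f x₀) :=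
    ContMDiffAt.comp (f x₀) c2 (b1.contMDiffAt.comp (f x₀) c1)
  have c4 : (e.symm ∘ σ ∘ e') (f x₀) = x₀ := by
    simp only [Function.comp_apply, b2, hinv]
  refine ⟨_, c3, c4, ?_⟩
  have d1 : ∀ᶠ p in 𝓝 (f x₀), (f ((e.symm ∘ σ ∘ e') p)) ∈ e'.source := by
    refine (hf.continuous.continuousAt.comp c3.continuousAt).eventually_mem ?_
    simp only [Function.comp_apply] at c4 ⊢
    rw [c4]
    exact e'.open_source.mem_nhds hp
  filter_upwards [d1, e'.open_source.mem_nhds hp, c1.continuousAt.eventually b3] with p q1 q2 q3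
  exact e'.injOn q1 q2 q3

end ManifoldSubmersions

end FieldTheory

end

noncomputable section

namespace FieldTheory

/-! ### Adapted coordinates on bundles over `E` -/

namespace FibreCoords

variable {m N : ℕ} {M : Type*} [TopologicalSpace M] [ChartedSpace (BaseModel m) M]
  {E : Type*} [TopologicalSpace E] [ChartedSpace (TotalModel m N) E]
  {π : E → M} [IsFiberedManifold m N π]
  {Z W : Type*} [NormedAddCommGroup W] [NormedSpace ℝ W]

variable (m N π) in
/-- The chosen adapted chart at a point. -/
def adaptedAt (y : E) : AdaptedChart m N π :=
  (IsFiberedManifold.exists_adapted (m := m) (N := N) (π := π) y).choose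

theorem mem_adaptedAt (y : E) : y ∈ (adaptedAt m N π y).tot.source :=
  (IsFiberedManifold.exists_adapted (m := m) (N := N) (π := π) y).choose_spec

/-- The manifold structure of `Z` is the one defined by the fibre coordinates `c`. -/
structure Compatible (c : FibreCoords m N π Z W) [TopologicalSpace Z]
    [ChartedSpace (TotalModel m N × W) Z] : Prop where
  exists_chart : ∀ a : AdaptedChart m N π, Nonempty Z →
    ∃ e ∈ IsManifold.maximalAtlas 𝓘(ℝ, TotalModel m N × W) ∞ Z,
      e.source = {z | c.pt z ∈ a.tot.source} ∧ e.target = a.tot.target ×ˢ univ ∧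
      ∀ z, e z = (a.tot (c.pt z), c.fib a z)
  chartAt_source : ∀ z, (chartAt (TotalModel m N × W) z).source =
    {z' | c.pt z' ∈ (adaptedAt m N π (c.pt z)).tot.source}
  chartAt_apply : ∀ z z', chartAt (TotalModel m N × W) z z' =
    ((adaptedAt m N π (c.pt z)).tot (c.pt z'), c.fib (adaptedAt m N π (c.pt z)) z')

/-- The preferred charts of the core are by construction those of `c`, and every adapted chart
belongs to its atlas. From here on, only these properties of the atlas are used. -/
theorem compatible_chartedSpace (c : FibreCoords m N π Z W) :
    @Compatible m N M _ _ E _ _ π _ Z W _ _ c c.topology c.chartedSpace := by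
  let _ := c.topology
  let _ := c.chartedSpace
  have hI := c.isManifold
  refine ⟨fun a hZ => ?_, fun z => rfl, fun z z' => rfl⟩
  have ha : c.chart a ∈ c.core.atlas := ⟨hZ, a, rfl⟩
  refine ⟨c.core.openPartialHomeomorph _ ha, ?_, rfl, rfl, fun z => rfl⟩
  refine IsManifold.subset_maximalAtlas ?_
  show _ ∈ c.core.toChartedSpace.atlas
  exact mem_iUnion.2 ⟨_, mem_iUnion.2 ⟨ha, rfl⟩⟩

namespace Compatible

variable [TopologicalSpace Z] [ChartedSpace (TotalModel m N × W) Z]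
  {c : FibreCoords m N π Z W}

section Nonempty

variable (hc : c.Compatible)

/-- The chart of `Z` induced by an adapted chart. -/
def chart [Nonempty Z] (a : AdaptedChart m N π) :
    OpenPartialHomeomorph Z (TotalModel m N × W) := (hc.exists_chart a ‹_›).choose

variable [Nonempty Z] (a : AdaptedChart m N π)

theorem chart_mem : hc.chart a ∈ IsManifold.maximalAtlas 𝓘(ℝ, TotalModel m N × W) ∞ Z :=
  (hc.exists_chart a ‹_›).choose_spec.1

theorem chart_source : (hc.chart a).source = {z | c.pt z ∈ a.tot.source} :=
  (hc.exists_chart a ‹_›).choose_spec.2.1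

theorem chart_target : (hc.chart a).target = a.tot.target ×ˢ univ :=
  (hc.exists_chart a ‹_›).choose_spec.2.2.1

theorem chart_apply (z : Z) : hc.chart a z = (a.tot (c.pt z), c.fib a z) :=
  (hc.exists_chart a ‹_›).choose_spec.2.2.2 z

variable {a}

theorem mem_chart_source {z : Z} : z ∈ (hc.chart a).source ↔ c.pt z ∈ a.tot.source := by
  rw [chart_source]
  rfl

theorem mem_chart_target {u : TotalModel m N × W} :
    u ∈ (hc.chart a).target ↔ u.1 ∈ a.tot.target := by
  rw [chart_target]
  simp

theorem pt_chart_symm {u : TotalModel m N × W} (hu : u.1 ∈ a.tot.target) :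
    c.pt ((hc.chart a).symm u) = a.tot.symm u.1 := by
  have hu' := hc.mem_chart_target.2 hu
  have h1 : c.pt ((hc.chart a).symm u) ∈ a.tot.source :=
    hc.mem_chart_source.1 ((hc.chart a).map_target hu')
  have h2 := (hc.chart a).right_inv hu'
  rw [chart_apply] at h2
  rw [← congrArg Prod.fst h2]
  exact (a.tot.left_inv h1).symm

variable (a) in
theorem contMDiffOn_chart : ContMDiffOn 𝓘(ℝ, TotalModel m N × W) 𝓘(ℝ, TotalModel m N × W) ∞
    (hc.chart a) (hc.chart a).source :=
  contMDiffOn_of_mem_maximalAtlas (hc.chart_mem a)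

variable (a) in
theorem contMDiffOn_chart_symm : ContMDiffOn 𝓘(ℝ, TotalModel m N × W) 𝓘(ℝ, TotalModel m N × W) ∞
    (hc.chart a).symm (hc.chart a).target :=
  contMDiffOn_symm_of_mem_maximalAtlas (hc.chart_mem a)

variable (a) in
theorem chart_mdifferentiable :
    (hc.chart a).MDifferentiable 𝓘(ℝ, TotalModel m N × W) 𝓘(ℝ, TotalModel m N × W) :=
  ⟨(hc.contMDiffOn_chart a).mdifferentiableOn (by simp),
    (hc.contMDiffOn_chart_symm a).mdifferentiableOn (by simp)⟩

theorem contMDiffAt_chart {z : Z} (hz : c.pt z ∈ a.tot.source) :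
    ContMDiffAt 𝓘(ℝ, TotalModel m N × W) 𝓘(ℝ, TotalModel m N × W) ∞ (hc.chart a) z :=
  (hc.contMDiffOn_chart a).contMDiffAt
    ((hc.chart a).open_source.mem_nhds (hc.mem_chart_source.2 hz))

theorem contMDiffAt_chart_symm {u : TotalModel m N × W} (hu : u.1 ∈ a.tot.target) :
    ContMDiffAt 𝓘(ℝ, TotalModel m N × W) 𝓘(ℝ, TotalModel m N × W) ∞ (hc.chart a).symm u :=
  (hc.contMDiffOn_chart_symm a).contMDiffAt
    ((hc.chart a).open_target.mem_nhds (hc.mem_chart_target.2 hu))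

end Nonempty

variable {a : AdaptedChart m N π}

theorem contMDiff_pt (hc : c.Compatible) : ContMDiff 𝓘(ℝ, TotalModel m N × W) 𝓘(ℝ, TotalModel m N) ∞ c.pt := by
  intro z
  have : Nonempty Z := ⟨z⟩
  set a := adaptedAt m N π (c.pt z)
  have hz : c.pt z ∈ a.tot.source := mem_adaptedAt _
  have h1 : ContMDiffAt 𝓘(ℝ, TotalModel m N × W) 𝓘(ℝ, TotalModel m N) ∞
      (fun z' => (hc.chart a z').1) z :=
    contDiff_fst.contMDiff.contMDiffAt.comp z (hc.contMDiffAt_chart hz)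
  have h2 : ContMDiffAt 𝓘(ℝ, TotalModel m N) 𝓘(ℝ, TotalModel m N) ∞ a.tot.symm
      ((hc.chart a z).1) := by
    refine a.tot_symm_smooth.contMDiffAt (a.tot.open_target.mem_nhds ?_)
    rw [chart_apply]
    exact a.tot.map_source hz
  refine (h2.comp z h1).congr_of_eventuallyEq ?_
  filter_upwards [(hc.chart a).open_source.mem_nhds (hc.mem_chart_source.2 hz)] with z' hz'
  simp only [Function.comp_apply, chart_apply]
  exact (a.tot.left_inv (hc.mem_chart_source.1 hz')).symm

variable {H Q : Type*} [NormedAddCommGroup H] [NormedSpace ℝ H] [TopologicalSpace Q]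
  [ChartedSpace H Q]

/-- A map into `Z` is smooth if its adapted coordinates are. -/
theorem contMDiffAt_of_coords (hc : c.Compatible) {f : Q → Z} {q : Q} (hq : c.pt (f q) ∈ a.tot.source)
    (h1 : ContMDiffAt 𝓘(ℝ, H) 𝓘(ℝ, TotalModel m N) ∞ (fun q => c.pt (f q)) q)
    (h2 : ContMDiffAt 𝓘(ℝ, H) 𝓘(ℝ, W) ∞ (fun q => c.fib a (f q)) q) :
    ContMDiffAt 𝓘(ℝ, H) 𝓘(ℝ, TotalModel m N × W) ∞ f q := by
  have : Nonempty Z := ⟨f q⟩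
  have h3 : ContMDiffAt 𝓘(ℝ, H) 𝓘(ℝ, TotalModel m N × W) ∞
      (fun q => (a.tot (c.pt (f q)), c.fib a (f q))) q :=
    ((a.tot_smooth.contMDiffAt (a.tot.open_source.mem_nhds hq)).comp q h1).prodMk_space h2
  have h4 : ContMDiffAt 𝓘(ℝ, TotalModel m N × W) 𝓘(ℝ, TotalModel m N × W) ∞ (hc.chart a).symm
      (a.tot (c.pt (f q)), c.fib a (f q)) :=
    hc.contMDiffAt_chart_symm (a.tot.map_source hq)
  refine (h4.comp q h3).congr_of_eventuallyEq ?_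
  filter_upwards [h1.continuousAt.eventually_mem (a.tot.open_source.mem_nhds hq)] with q' hq'
  simp only [Function.comp_apply]
  rw [← hc.chart_apply, (hc.chart a).left_inv (hc.mem_chart_source.2 hq')]

theorem contMDiffAt_fib (hc : c.Compatible) {z : Z} (hz : c.pt z ∈ a.tot.source) :
    ContMDiffAt 𝓘(ℝ, TotalModel m N × W) 𝓘(ℝ, W) ∞ (c.fib a) z := by
  have : Nonempty Z := ⟨z⟩
  have h1 : ContMDiffAt 𝓘(ℝ, TotalModel m N × W) 𝓘(ℝ, W) ∞
      (fun z' => (hc.chart a z').2) z :=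
    contDiff_snd.contMDiff.contMDiffAt.comp z (hc.contMDiffAt_chart hz)
  exact h1.congr_of_eventuallyEq (Filter.Eventually.of_forall fun z' => by simp only [hc.chart_apply])

/-- Obtained by differentiating the identity `fst ∘ chart = a.tot ∘ pt`. -/
theorem fst_mfderiv_chart [Nonempty Z] (hc : c.Compatible) {z : Z} (hz : c.pt z ∈ a.tot.source)
    (w : TangentSpace 𝓘(ℝ, TotalModel m N × W) z) :
    (mfderiv 𝓘(ℝ, TotalModel m N × W) 𝓘(ℝ, TotalModel m N × W) (hc.chart a) z w).1 =
      a.d (c.pt z) (mfderiv 𝓘(ℝ, TotalModel m N × W) 𝓘(ℝ, TotalModel m N) c.pt z w) := by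
  have h1 : mfderiv 𝓘(ℝ, TotalModel m N × W) 𝓘(ℝ, TotalModel m N)
      ((Prod.fst : TotalModel m N × W → TotalModel m N) ∘ hc.chart a) z =
      (mfderiv 𝓘(ℝ, TotalModel m N × W) 𝓘(ℝ, TotalModel m N)
        (Prod.fst : TotalModel m N × W → TotalModel m N) (hc.chart a z)).comp
      (mfderiv 𝓘(ℝ, TotalModel m N × W) 𝓘(ℝ, TotalModel m N × W) (hc.chart a) z) :=
    mfderiv_comp z (differentiableAt_fst.mdifferentiableAt)
      ((hc.contMDiffAt_chart hz).mdifferentiableAt (by simp))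
  have h2 : mfderiv 𝓘(ℝ, TotalModel m N × W) 𝓘(ℝ, TotalModel m N) (a.tot ∘ c.pt) z =
      (a.d (c.pt z)).comp (mfderiv 𝓘(ℝ, TotalModel m N × W) 𝓘(ℝ, TotalModel m N) c.pt z) :=
    mfderiv_comp z (a.tot_mdifferentiable.mdifferentiableAt hz)
      (hc.contMDiff_pt.mdifferentiableAt (x := z) (by simp))
  have h3 : (Prod.fst ∘ hc.chart a : Z → TotalModel m N) = a.tot ∘ c.pt :=
    funext fun z' => by simp [chart_apply]
  have h4 : mfderiv 𝓘(ℝ, TotalModel m N × W) 𝓘(ℝ, TotalModel m N)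
      (Prod.fst : TotalModel m N × W → TotalModel m N) (hc.chart a z) =
      ContinuousLinearMap.fst ℝ (TotalModel m N) W := by
    rw [mfderiv_eq_fderiv]
    exact fderiv_fst
  rw [h3, h2, h4] at h1
  exact (DFunLike.congr_fun h1 w).symm

end Compatible

end FibreCoords

section Instances

variable {m N : ℕ} {M : Type*} [TopologicalSpace M] [ChartedSpace (BaseModel m) M]
  {E : Type*} [TopologicalSpace E] [ChartedSpace (TotalModel m N) E]
  {π : E → M} [IsFiberedManifold m N π]

theorem jetCoords_compatible : (jetCoords (m := m) (N := N) (π := π)).Compatible :=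
  FibreCoords.compatible_chartedSpace _

theorem extCoords_compatible : (extCoords (m := m) (N := N) (π := π)).Compatible :=
  FibreCoords.compatible_chartedSpace _

theorem restCoords_compatible : (restCoords (m := m) (N := N) (π := π)).Compatible :=
  FibreCoords.compatible_chartedSpace _

theorem contMDiff_jet_pt : ContMDiff 𝓘(ℝ, JetModel m N) 𝓘(ℝ, TotalModel m N) ∞
    (FirstJet.pt : J1 m N π → E) := jetCoords_compatible.contMDiff_pt

theorem contMDiff_ext_pt : ContMDiff 𝓘(ℝ, TotalModel m N × ExtModel m N) 𝓘(ℝ, TotalModel m N) ∞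
    (ExtMomentum.pt : ExtMomentum m N π → E) := extCoords_compatible.contMDiff_pt

theorem contMDiff_rest_pt : ContMDiff 𝓘(ℝ, TotalModel m N × RestModel m N) 𝓘(ℝ, TotalModel m N) ∞
    (RestMomentum.pt : RestMomentum m N π → E) := restCoords_compatible.contMDiff_pt

end Instances

end FieldTheory

end

noncomputable section

namespace FieldTheory

/-! ### The Legendre map in coordinates -/

section ModelExpression

variable {m N : ℕ}

/-- The derivative of a function on a product along the second factor. -/
def vertDeriv {U W : Type*} [NormedAddCommGroup U] [NormedSpace ℝ U] [NormedAddCommGroup W]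
    [NormedSpace ℝ W] (Λ : U × W → ℝ) (p : U × W) : W →L[ℝ] ℝ :=
  (fderiv ℝ Λ p).comp (ContinuousLinearMap.inr ℝ U W)

/-- The vertical projection `(x, y) ↦ y - v x` of the model space. -/
def vertCoord (v : BaseModel m →L[ℝ] EuclideanSpace ℝ (Fin N)) :
    TotalModel m N →L[ℝ] EuclideanSpace ℝ (Fin N) :=
  ContinuousLinearMap.snd ℝ _ _ - v.comp (ContinuousLinearMap.fst ℝ _ _)

@[simp]
theorem vertCoord_apply (v : BaseModel m →L[ℝ] EuclideanSpace ℝ (Fin N)) (z : TotalModel m N) :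
    vertCoord v z = z.2 - v z.1 := rfl

/-- The coordinate expression of the Poincaré-Cartan form, for a Lagrangian `Λ` and a volume
form `ν`. -/
def cartanCoord (ν : BaseModel m → BaseModel m [⋀^Fin m]→L[ℝ] ℝ) (Λ : JetModel m N → ℝ)
    (p : JetModel m N) : TotalModel m N [⋀^Fin m]→L[ℝ] ℝ :=
  polarForm (Λ p) (ν p.1.1) (ContinuousLinearMap.fst ℝ (BaseModel m) (EuclideanSpace ℝ (Fin N)))
    ((momCLM m _ (vertDeriv Λ p)).comp (vertCoord p.2))

theorem contDiffOn_vertDeriv {Λ : JetModel m N → ℝ} {s : Set (JetModel m N)} (hs : IsOpen s)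
    (hΛ : ContDiffOn ℝ ∞ Λ s) : ContDiffOn ℝ ∞ (vertDeriv Λ) s :=
  (hΛ.fderiv_of_isOpen hs le_rfl).clm_comp contDiffOn_const

theorem contDiff_vertCoord : ContDiff ℝ ∞
    (vertCoord : (BaseModel m →L[ℝ] EuclideanSpace ℝ (Fin N)) → _) :=
  contDiff_const.sub (contDiff_id.clm_comp contDiff_const)

theorem contDiffOn_cartanCoord {ν : BaseModel m → BaseModel m [⋀^Fin m]→L[ℝ] ℝ}
    {Λ : JetModel m N → ℝ} {s : Set (JetModel m N)} (hs : IsOpen s) (hΛ : ContDiffOn ℝ ∞ Λ s)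
    (hν : ContDiffOn ℝ ∞ (fun p : JetModel m N => ν p.1.1) s) :
    ContDiffOn ℝ ∞ (cartanCoord ν Λ) s := by
  have h1 : ContDiffOn ℝ ∞
      (fun p : JetModel m N => momCLM m (EuclideanSpace ℝ (Fin N)) (vertDeriv Λ p)) s := by
    have h0 : ContDiff ℝ ∞ (momCLM m (EuclideanSpace ℝ (Fin N))) := ContinuousLinearMap.contDiff _
    exact h0.comp_contDiffOn (contDiffOn_vertDeriv hs hΛ)
  have h2 : ContDiffOn ℝ ∞ (fun p : JetModel m N => vertCoord p.2) s :=
    contDiff_vertCoord.comp_contDiffOn contDiffOn_snd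
  exact contDiffOn_polarForm _ hΛ hν (h1.clm_comp h2)

theorem fderiv_comp_translate {V X : Type*} [NormedAddCommGroup V] [NormedSpace ℝ V]
    [NormedAddCommGroup X] [NormedSpace ℝ X] {f : X → ℝ} (T : V →L[ℝ] X) {p : X}
    (hf : DifferentiableAt ℝ f p) : fderiv ℝ (fun A => f (p + T A)) 0 = (fderiv ℝ f p).comp T := by
  have h1 : HasFDerivAt (fun A => p + T A) T 0 := T.hasFDerivAt.const_add p
  have h2 : HasFDerivAt f (fderiv ℝ f p) (p + T 0) := by
    rw [map_zero, add_zero]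
    exact hf.hasFDerivAt
  exact (h2.comp 0 h1).fderiv

/-- Naturality of the polar form. The maps `φ` and `ψ` are bare functions, so that differentials of
charts, whose sources or targets are tangent spaces, can be inserted directly. -/
theorem polarForm_congr {B V B' V' : Type*} [NormedAddCommGroup B] [NormedSpace ℝ B]
    [NormedAddCommGroup V] [NormedSpace ℝ V] [NormedAddCommGroup B'] [NormedSpace ℝ B']
    [NormedAddCommGroup V'] [NormedSpace ℝ V'] {k : ℕ} {r r' : ℝ} {f : B [⋀^Fin k]→L[ℝ] ℝ}
    {f' : B' [⋀^Fin k]→L[ℝ] ℝ} {q R : V →L[ℝ] B} {q' R' : V' →L[ℝ] B'} {φ : V' → V} {ψ : B' → B}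
    (hr : r = r') (hf : ∀ w, f' w = f (fun i => ψ (w i))) (hq : ∀ z, q (φ z) = ψ (q' z))
    (hR : ∀ z, R (φ z) = ψ (R' z)) (z : Fin k → V') :
    polarForm r f q R (fun i => φ (z i)) = polarForm r' f' q' R' z := by
  rw [polarForm_apply, polarForm_apply, hr, hf]
  congr 1
  · congr 2
    funext i
    exact hq _
  · refine Finset.sum_congr rfl fun i _ => ?_
    rw [hf]
    congr 1
    funext l
    by_cases hl : l = i
    · subst hl
      rw [Function.update_self, Function.update_self, hR]
    · rw [Function.update_of_ne hl, Function.update_of_ne hl, hq]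

end ModelExpression

section Coordinates

variable {m N : ℕ} {M : Type*} [TopologicalSpace M] [ChartedSpace (BaseModel m) M]
  {E : Type*} [TopologicalSpace E] [ChartedSpace (TotalModel m N) E]
  {π : E → M}

/-- The volume form in an adapted chart. -/
def volCoord (vol : DiffForm (BaseModel m) M m) (a : AdaptedChart m N π) (x : BaseModel m) :
    BaseModel m [⋀^Fin m]→L[ℝ] ℝ :=
  (vol (a.base.symm x)).compContinuousLinearMap
    (mfderiv 𝓘(ℝ, BaseModel m) 𝓘(ℝ, BaseModel m) a.base.symm x)

theorem volCoord_base (vol : DiffForm (BaseModel m) M m) (a : AdaptedChart m N π) {x : M}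
    (hx : x ∈ a.base.source) (w : Fin m → BaseModel m) :
    volCoord vol a (a.base x) w = vol x (fun i => a.dbInv x (w i)) := by
  -- Reading the forms in the one fixed model space lets an equality of base points be transported
  -- to their values; the same device recurs below wherever tangent spaces at equal points have to
  -- be matched.
  let vol' : M → BaseModel m [⋀^Fin m]→L[ℝ] ℝ := vol
  have h1 : vol' (a.base.symm (a.base x)) = vol' x := congrArg vol' (a.base.left_inv hx)
  exact DFunLike.congr_fun h1 (fun i => a.dbInv x (w i))

/-- Smoothness of `vol` is given in the preferred charts only; the base of an adapted chart differs
from such a chart by a smooth transition map, and forms pull back smoothly. -/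
theorem contDiffOn_volCoord [IsManifold 𝓘(ℝ, BaseModel m) ∞ M] {vol : DiffForm (BaseModel m) M m}
    (hvol : IsSmoothForm vol) (a : AdaptedChart m N π) :
    ContDiffOn ℝ ∞ (volCoord vol a) a.base.target := by
  intro x hx
  refine ContDiffAt.contDiffWithinAt ?_
  set x' := a.base.symm x with hx'
  set c := chartAt (BaseModel m) x' with hc
  have hxc : x' ∈ c.source := mem_chart_source _ x'
  set s := (a.base.symm.trans c).source with hs
  have hsx : x ∈ s := ⟨hx, hxc⟩
  have hso : IsOpen s := (a.base.symm.trans c).open_source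
  have ht : ContDiffOn ℝ ∞ (c ∘ a.base.symm) s := by
    rw [← contMDiffOn_iff_contDiffOn]
    exact (contMDiffOn_chart (x := x')).comp (a.base_symm_smooth.mono fun u hu => hu.1)
      fun u hu => hu.2
  have h1 : ContDiffAt ℝ ∞ (fun u => (formInChart vol x' (c (a.base.symm u))).compContinuousLinearMap
      (fderiv ℝ (c ∘ a.base.symm) u)) x := by
    refine (contDiff_pullback m).contDiffAt.comp x (ContDiffAt.prodMk ?_ ?_)
    · exact ((hvol x').contDiffAt (c.open_target.mem_nhds (c.map_source hxc))).comp x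
        (ht.contDiffAt (hso.mem_nhds hsx))
    · exact (ht.fderiv_of_isOpen hso le_rfl).contDiffAt (hso.mem_nhds hsx)
  refine h1.congr_of_eventuallyEq ?_
  filter_upwards [hso.mem_nhds hsx] with u hu
  have hu1 : u ∈ a.base.target := hu.1
  have hu2 : a.base.symm u ∈ c.source := hu.2
  let vol' : M → BaseModel m [⋀^Fin m]→L[ℝ] ℝ := vol
  have h2 : vol' (c.symm (c (a.base.symm u))) = vol' (a.base.symm u) :=
    congrArg vol' (c.left_inv hu2)
  ext w
  have h3 : ∀ i, mfderiv 𝓘(ℝ, BaseModel m) 𝓘(ℝ, BaseModel m) a.base.symm u (w i) =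
      mfderiv 𝓘(ℝ, BaseModel m) 𝓘(ℝ, BaseModel m) c.symm (c (a.base.symm u))
        (fderiv ℝ (c ∘ a.base.symm) u (w i)) := by
    intro i
    have h4 : mfderiv 𝓘(ℝ, BaseModel m) 𝓘(ℝ, BaseModel m) (c ∘ a.base.symm) u =
        (mfderiv 𝓘(ℝ, BaseModel m) 𝓘(ℝ, BaseModel m) c (a.base.symm u)).comp
        (mfderiv 𝓘(ℝ, BaseModel m) 𝓘(ℝ, BaseModel m) a.base.symm u) :=
      mfderiv_comp u ((chart_mdifferentiable x').mdifferentiableAt hu2)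
        (a.base_mdifferentiable.mdifferentiableAt_symm hu1)
    rw [← mfderiv_eq_fderiv, h4]
    exact (DFunLike.congr_fun ((chart_mdifferentiable x').symm_comp_deriv hu2) _).symm
  show vol' (a.base.symm u) _ = vol' (c.symm (c (a.base.symm u))) _
  rw [h2]
  congr 1
  funext i
  exact h3 i

theorem AdaptedChart.fst_mem (a : AdaptedChart m N π) {u : TotalModel m N}
    (hu : u ∈ a.tot.target) : u.1 ∈ a.base.target := by
  have h := a.fst_tot _ (a.tot.map_target hu)
  rw [a.tot.right_inv hu] at h
  rw [h]
  exact a.base.map_source (a.mapsTo _ (a.tot.map_target hu))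

/-- Translations of jets in coordinates. -/
def shiftCoord (a : AdaptedChart m N π) (y : E) :
    (BaseModel m →L[ℝ] vert m N π y) →L[ℝ] (BaseModel m →L[ℝ] EuclideanSpace ℝ (Fin N)) :=
  let P : TotalModel m N →L[ℝ] TotalModel m N := a.d y
  let Q : BaseModel m →L[ℝ] BaseModel m := a.dbInv (π y)
  (ContinuousLinearMap.compL ℝ (BaseModel m) (vert m N π y) (EuclideanSpace ℝ (Fin N))
    (((ContinuousLinearMap.snd ℝ (BaseModel m) (EuclideanSpace ℝ (Fin N))).comp P).comp
      (vert m N π y).subtypeL)).comp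
    ((ContinuousLinearMap.compL ℝ (BaseModel m) (BaseModel m) (vert m N π y)).flip Q)

theorem shiftCoord_apply (a : AdaptedChart m N π) (y : E) (A : BaseModel m →L[ℝ] vert m N π y)
    (x : BaseModel m) :
    shiftCoord a y A x = (a.d y (A (a.dbInv (π y) x) : TotalModel m N)).2 := rfl

variable [IsFiberedManifold m N π]

theorem AdaptedChart.dProj_dInv {a : AdaptedChart m N π} {y : E} (hy : y ∈ a.tot.source)
    (z : TotalModel m N) : dProj m N π y (a.dInv y z) = a.dbInv (π y) z.1 := by
  have h1 := AdaptedChart.fst_d hy (a.dInv y z)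
  rw [AdaptedChart.d_dInv hy] at h1
  rw [h1, AdaptedChart.dbInv_db (a.mapsTo y hy)]
  rfl

variable {L : J1 m N π → ℝ}

/-- The Lagrangian in an adapted chart. -/
def lagCoord [Nonempty (J1 m N π)] (L : J1 m N π → ℝ) (a : AdaptedChart m N π) :
    JetModel m N → ℝ := L ∘ (jetCoords_compatible.chart a).symm

theorem contDiffOn_lagCoord [Nonempty (J1 m N π)] (hL : ContMDiff 𝓘(ℝ, JetModel m N) 𝓘(ℝ, ℝ) ∞ L)
    (a : AdaptedChart m N π) : ContDiffOn ℝ ∞ (lagCoord L a) (a.tot.target ×ˢ univ) := by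
  rw [← contMDiffOn_iff_contDiffOn, ← jetCoords_compatible.chart_target a]
  exact hL.comp_contMDiffOn (jetCoords_compatible.contMDiffOn_chart_symm a)

theorem lagCoord_chart [Nonempty (J1 m N π)] {a : AdaptedChart m N π} {j : J1 m N π}
    (hj : j.pt ∈ a.tot.source) : lagCoord L a (jetCoords_compatible.chart a j) = L j := by
  show L _ = L j
  rw [(jetCoords_compatible.chart a).left_inv (jetCoords_compatible.mem_chart_source.2 hj)]

/-- The fibre coordinate is affine on the fibres of `J¹E → E`, so the derivative of `L` along a
fibre becomes a partial derivative of `lagCoord L a`. -/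
theorem fib_shift (a : AdaptedChart m N π) (j : J1 m N π) (A : BaseModel m →L[ℝ] vert m N π j.pt) :
    jetCoords.fib a (j.shift A) = jetCoords.fib a j + shiftCoord a j.pt A := by
  ext1 x
  show (a.d j.pt (j.horLift (a.dbInv (π j.pt) x) + (A (a.dbInv (π j.pt) x) : TotalModel m N))).2 =
    (a.d j.pt (j.horLift (a.dbInv (π j.pt) x))).2 +
      (a.d j.pt (A (a.dbInv (π j.pt) x) : TotalModel m N)).2
  rw [← Prod.snd_add]
  exact congrArg Prod.snd (map_add (a.d j.pt) _ _)

theorem fibreDeriv_eq [Nonempty (J1 m N π)] (hL : ContMDiff 𝓘(ℝ, JetModel m N) 𝓘(ℝ, ℝ) ∞ L)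
    {a : AdaptedChart m N π} {j : J1 m N π} (hj : j.pt ∈ a.tot.source) :
    fibreDeriv L j = (vertDeriv (lagCoord L a) (jetCoords_compatible.chart a j)).comp
      (shiftCoord a j.pt) := by
  set p := jetCoords_compatible.chart a j with hp
  have hpe : p = (a.tot j.pt, jetCoords.fib a j) := jetCoords_compatible.chart_apply a j
  have h1 : (fun A => L (j.shift A)) = fun A => lagCoord L a (p + (0, shiftCoord a j.pt A)) := by
    funext A
    rw [← lagCoord_chart (L := L) (a := a) (j := j.shift A) hj, jetCoords_compatible.chart_apply, fib_shift,
      hpe, Prod.mk_add_mk, add_zero]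
    rfl
  have hpt : p ∈ a.tot.target ×ˢ (univ : Set (BaseModel m →L[ℝ] EuclideanSpace ℝ (Fin N))) :=
    ⟨by rw [hpe]; exact a.tot.map_source hj, trivial⟩
  have h2 : DifferentiableAt ℝ (lagCoord L a) p :=
    ((contDiffOn_lagCoord hL a).contDiffAt
      ((a.tot.open_target.prod isOpen_univ).mem_nhds hpt)).differentiableAt (by simp)
  let T : (BaseModel m →L[ℝ] vert m N π j.pt) →L[ℝ] JetModel m N :=
    (ContinuousLinearMap.inr ℝ (TotalModel m N)
    (BaseModel m →L[ℝ] EuclideanSpace ℝ (Fin N))).comp (shiftCoord a j.pt)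
  have h5 := fderiv_comp_translate (V := BaseModel m →L[ℝ] vert m N π j.pt) (X := JetModel m N) T h2
  have h6 : (fun A => L (j.shift A)) = fun A => lagCoord L a (p + T A) := h1
  have h7 : fibreDeriv L j = fderiv ℝ (fun A => L (j.shift A)) 0 := rfl
  rw [h7, h6, h5]
  ext A
  rfl

theorem momentum_eq [Nonempty (J1 m N π)] (hL : ContMDiff 𝓘(ℝ, JetModel m N) 𝓘(ℝ, ℝ) ∞ L)
    {a : AdaptedChart m N π} {j : J1 m N π} (hj : j.pt ∈ a.tot.source) (w : vert m N π j.pt) :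
    momentum L j w = a.dbInv (π j.pt)
      (momOf (vertDeriv (lagCoord L a) (jetCoords_compatible.chart a j))
        (a.d j.pt (w : TotalModel m N)).2) := by
  -- Both vectors are tested with a covector `ξ`; by `momOf_dual` each side becomes the fibre
  -- derivative on one rank-one element, written intrinsically on the left and in coordinates on the
  -- right.
  have key : ∀ ξ : BaseModel m →L[ℝ] ℝ, ξ (momentum L j w) = ξ (a.dbInv (π j.pt)
      (momOf (vertDeriv (lagCoord L a) (jetCoords_compatible.chart a j))
        (a.d j.pt (w : TotalModel m N)).2)) := by
    intro ξ
    have h1 : ξ (momentum L j w) = fibreDeriv L j (ξ.smulRight w) := momOf_dual _ _ _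
    have h2 := momOf_dual (vertDeriv (lagCoord L a) (jetCoords_compatible.chart a j))
      (a.d j.pt (w : TotalModel m N)).2
      (ξ.comp (a.dbInv (π j.pt) : BaseModel m →L[ℝ] BaseModel m))
    refine h1.trans (Eq.trans ?_ h2.symm)
    rw [fibreDeriv_eq hL hj]
    show vertDeriv _ _ (shiftCoord a j.pt (ξ.smulRight w)) = _
    congr 1
    ext1 x
    rw [shiftCoord_apply]
    show (a.d j.pt (ξ (a.dbInv (π j.pt) x) • (w : TotalModel m N))).2 =
      ξ (a.dbInv (π j.pt) x) • (a.d j.pt (w : TotalModel m N)).2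
    rw [← Prod.smul_snd]
    exact congrArg Prod.snd (map_smul (a.d j.pt) _ _)
  ext k
  exact key (EuclideanSpace.proj k)

/-- Every ingredient of the polar form is carried to its coordinate version by the differentials of
the total and the base chart, so `polarForm_congr` applies. -/
theorem cartanAt_dInv [Nonempty (J1 m N π)] (vol : DiffForm (BaseModel m) M m)
    (hL : ContMDiff 𝓘(ℝ, JetModel m N) 𝓘(ℝ, ℝ) ∞ L)
    {a : AdaptedChart m N π} {j : J1 m N π} (hj : j.pt ∈ a.tot.source)
    (z : Fin m → TotalModel m N) :
    cartanAt vol L j (fun i => a.dInv j.pt (z i)) =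
      cartanCoord (volCoord vol a) (lagCoord L a) (jetCoords_compatible.chart a j) z := by
  have hp : jetCoords_compatible.chart a j = (a.tot j.pt, jetCoords.fib a j) :=
    jetCoords_compatible.chart_apply a j
  have hx : π j.pt ∈ a.base.source := a.mapsTo _ hj
  let B : BaseModel m →L[ℝ] BaseModel m := a.dbInv (π j.pt)
  have hν : ∀ w : Fin m → BaseModel m, volCoord vol a (jetCoords_compatible.chart a j).1.1 w =
      vol (π j.pt) (fun i => B (w i)) := by
    intro w
    rw [hp]
    show volCoord vol a (a.tot j.pt).1 w = _
    rw [a.fst_tot _ hj, volCoord_base vol a hx]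
    rfl
  -- In coordinates the vertical projection of the jet `v` is `(x, y) ↦ y - v x`, because the
  -- horizontal lift of `x` is `(x, v x)`.
  have hR : ∀ z : TotalModel m N, momentum L j (j.vertProj (a.dInv j.pt z)) =
      B (momOf (vertDeriv (lagCoord L a) (jetCoords_compatible.chart a j))
        (vertCoord (jetCoords_compatible.chart a j).2 z)) := by
    intro z
    rw [momentum_eq hL hj]
    congr 2
    let P : TotalModel m N →L[ℝ] TotalModel m N := a.d j.pt
    let P' : TotalModel m N →L[ℝ] TotalModel m N := a.dInv j.pt
    have h1 : ((j.vertProj (a.dInv j.pt z) : vert m N π j.pt) : TotalModel m N) =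
        P' z - j.horLift (B z.1) := by
      show P' z - j.horLift (dProj m N π j.pt (a.dInv j.pt z)) = _
      rw [AdaptedChart.dProj_dInv hj]
      rfl
    have h2 : P (P' z - j.horLift (B z.1)) = z - P (j.horLift (B z.1)) := by
      rw [map_sub]
      exact congrArg (· - P (j.horLift (B z.1))) (AdaptedChart.d_dInv hj z)
    rw [h1]
    show (P (P' z - j.horLift (B z.1))).2 = _
    rw [h2, hp]
    rfl
  exact polarForm_congr (B := BaseModel m) (V := TotalModel m N) (φ := fun z => a.dInv j.pt z)
    (ψ := fun x => B x) (lagCoord_chart hj).symm hν (fun z => AdaptedChart.dProj_dInv hj z) hR z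

variable (vol : DiffForm (BaseModel m) M m)

/-- Since `extProj` is defined on all forms, the fibre coordinates of the Legendre map are a fixed
continuous linear map after `cartanCoord`, and only the latter has to be differentiated. -/
theorem fib_extLegendre [Nonempty (J1 m N π)] (hL : ContMDiff 𝓘(ℝ, JetModel m N) 𝓘(ℝ, ℝ) ∞ L)
    {a : AdaptedChart m N π} {j : J1 m N π} (hj : j.pt ∈ a.tot.source) :
    extCoords.fib a (extLegendre vol L j) =
      extProj m N (cartanCoord (volCoord vol a) (lagCoord L a)
        (jetCoords_compatible.chart a j)) := by
  have hj' : (extLegendre vol L j).pt ∈ a.tot.source := hj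
  have h1 : extCoords.fib a (extLegendre vol L j) = extEquiv m N (pullOne m (a.dInv j.pt)
      (AdaptedChart.vert_dInv hj) (extLegendre vol L j).form) := dif_pos hj'
  rw [h1, ← extProj_eq]
  congr 1
  ext z
  exact cartanAt_dInv vol hL hj z

theorem fib_legendre [Nonempty (J1 m N π)] (hL : ContMDiff 𝓘(ℝ, JetModel m N) 𝓘(ℝ, ℝ) ∞ L)
    {a : AdaptedChart m N π} {j : J1 m N π} (hj : j.pt ∈ a.tot.source) :
    restCoords.fib a (legendre vol L j) =
      restProj m N (cartanCoord (volCoord vol a) (lagCoord L a)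
        (jetCoords_compatible.chart a j)) := by
  have hj' : (legendre vol L j).pt ∈ a.tot.source := hj
  have h1 : restCoords.fib a (legendre vol L j) = restEquiv m N (toQuot m _ (pullOne m
      (a.dInv j.pt) (AdaptedChart.vert_dInv hj) (extLegendre vol L j).form)) := dif_pos hj'
  rw [h1, ← restProj_eq]
  congr 1
  ext z
  exact cartanAt_dInv vol hL hj z

variable {vol}

theorem contDiffOn_cartanCoord_chart [IsManifold 𝓘(ℝ, BaseModel m) ∞ M] [Nonempty (J1 m N π)]
    (hvol : IsSmoothForm vol)
    (hL : ContMDiff 𝓘(ℝ, JetModel m N) 𝓘(ℝ, ℝ) ∞ L) (a : AdaptedChart m N π) :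
    ContDiffOn ℝ ∞ (cartanCoord (volCoord vol a) (lagCoord L a)) (a.tot.target ×ˢ univ) :=
  contDiffOn_cartanCoord (a.tot.open_target.prod isOpen_univ) (contDiffOn_lagCoord hL a)
    ((contDiffOn_volCoord hvol a).comp (contDiff_fst.comp contDiff_fst).contDiffOn
      fun _ hp => a.fst_mem hp.1)

/-- The extended Legendre map is smooth. -/
theorem contMDiff_extLegendre [IsManifold 𝓘(ℝ, BaseModel m) ∞ M] (hvol : IsSmoothForm vol)
    (hL : ContMDiff 𝓘(ℝ, JetModel m N) 𝓘(ℝ, ℝ) ∞ L) :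
    ContMDiff 𝓘(ℝ, JetModel m N) 𝓘(ℝ, TotalModel m N × ExtModel m N) ∞ (extLegendre vol L) := by
  intro j
  have : Nonempty (J1 m N π) := ⟨j⟩
  set a := FibreCoords.adaptedAt m N π j.pt
  have hj : j.pt ∈ a.tot.source := FibreCoords.mem_adaptedAt _
  refine extCoords_compatible.contMDiffAt_of_coords (a := a) hj (contMDiff_jet_pt j) ?_
  have h1 : ContMDiffAt 𝓘(ℝ, JetModel m N) 𝓘(ℝ, ExtModel m N) ∞ (fun k =>
      extProj m N (cartanCoord (volCoord vol a) (lagCoord L a)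
        (jetCoords_compatible.chart a k))) j := by
    have h2 : ContMDiffAt 𝓘(ℝ, JetModel m N) 𝓘(ℝ, ExtModel m N) ∞ (fun p =>
        extProj m N (cartanCoord (volCoord vol a) (lagCoord L a) p))
        (jetCoords_compatible.chart a j) := by
      refine ContDiffAt.contMDiffAt ((extProj m N).contDiff.contDiffAt.comp _
        ((contDiffOn_cartanCoord_chart hvol hL a).contDiffAt
          ((a.tot.open_target.prod isOpen_univ).mem_nhds ⟨?_, trivial⟩)))
      rw [jetCoords_compatible.chart_apply]
      exact a.tot.map_source hj
    exact h2.comp j (jetCoords_compatible.contMDiffAt_chart hj)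
  refine h1.congr_of_eventuallyEq ?_
  filter_upwards [contMDiff_jet_pt.continuous.continuousAt.eventually_mem
    (a.tot.open_source.mem_nhds hj)] with k hk
  exact fib_extLegendre vol hL hk

end Coordinates

end FieldTheory

end

noncomputable section

namespace FieldTheory

/-! ### The derivative of the Legendre map along the fibres -/

section ProductDerivative

variable {U W Z : Type*} [NormedAddCommGroup U] [NormedSpace ℝ U] [NormedAddCommGroup W]
  [NormedSpace ℝ W] [NormedAddCommGroup Z] [NormedSpace ℝ Z] {Λ : U × W → ℝ} {p : U × W}

/-- The Hessian of a function on a product along the second factor. -/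
def vertHess (Λ : U × W → ℝ) (p : U × W) : W →L[ℝ] W →L[ℝ] ℝ :=
  (fderiv ℝ (vertDeriv Λ) p).comp (ContinuousLinearMap.inr ℝ U W)

theorem contDiffAt_fderiv (hΛ : ContDiffAt ℝ ∞ Λ p) : ContDiffAt ℝ ∞ (fderiv ℝ Λ) p :=
  hΛ.fderiv_right (by simp)

theorem contDiffAt_vertDeriv (hΛ : ContDiffAt ℝ ∞ Λ p) : ContDiffAt ℝ ∞ (vertDeriv Λ) p :=
  (contDiffAt_fderiv hΛ).clm_comp contDiffAt_const

theorem vertHess_apply (hΛ : ContDiffAt ℝ ∞ Λ p) (B C : W) :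
    vertHess Λ p B C = fderiv ℝ (fderiv ℝ Λ) p (0, B) (0, C) := by
  have h1 : HasFDerivAt (fderiv ℝ Λ) (fderiv ℝ (fderiv ℝ Λ) p) p :=
    ((contDiffAt_fderiv hΛ).differentiableAt (by simp)).hasFDerivAt
  have h2 := h1.clm_comp (hasFDerivAt_const (ContinuousLinearMap.inr ℝ U W) p)
  have h3 : vertHess Λ p = (fderiv ℝ (vertDeriv Λ) p).comp (ContinuousLinearMap.inr ℝ U W) := rfl
  have h4 : vertDeriv Λ = fun p => (fderiv ℝ Λ p).comp (ContinuousLinearMap.inr ℝ U W) := rfl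
  rw [h3, h4, h2.fderiv]
  simp

/-- Symmetry is what allows the unknown `k - v` in the semi-holonomy argument to move from the slot
of the Hessian paired by the field equation to the slot seen by the Legendre map. -/
theorem vertHess_symm (hΛ : ContDiffAt ℝ ∞ Λ p) (B C : W) :
    vertHess Λ p B C = vertHess Λ p C B := by
  rw [vertHess_apply hΛ, vertHess_apply hΛ]
  refine (hΛ.isSymmSndFDerivAt ?_).eq _ _
  rw [minSmoothness_of_isRCLikeNormedField]
  exact WithTop.coe_le_coe.2 (le_top : (2 : ℕ∞) ≤ ⊤)

theorem hasFDerivAt_slice {k : U × W → Z} {u : U} {v : W} (hk : DifferentiableAt ℝ k (u, v)) :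
    HasFDerivAt (fun v' => k (u, v')) ((fderiv ℝ k (u, v)).comp (ContinuousLinearMap.inr ℝ U W)) v :=
  hk.hasFDerivAt.comp v (hasFDerivAt_prodMk_right u v)

/-- The product rule for the Poincaré-Cartan form along a fibre, stated for abstract linear data:
`T` stands for `momCLM`, `c` for the second projection and `K` for `v ↦ v ∘ fst`. The two terms
under the last sum come from varying the momentum and from varying the vertical projection. -/
theorem exists_hasFDerivAt_polarForm_slice {V F B : Type*} [NormedAddCommGroup V] [NormedSpace ℝ V]
    [NormedAddCommGroup F] [NormedSpace ℝ F] [NormedAddCommGroup B] [NormedSpace ℝ B] {k : ℕ}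
    (f : B [⋀^Fin k]→L[ℝ] ℝ) (q : V →L[ℝ] B) (T : (W →L[ℝ] ℝ) →L[ℝ] (F →L[ℝ] B))
    (c : V →L[ℝ] F) (K : W →L[ℝ] V →L[ℝ] F) {u : U} {v : W} (hΛ : ContDiffAt ℝ ∞ Λ (u, v)) :
    ∃ D : W →L[ℝ] (V [⋀^Fin k]→L[ℝ] ℝ), HasFDerivAt (fun v' => polarForm (Λ (u, v')) f q
        ((T (vertDeriv Λ (u, v'))).comp (c - K v'))) D v ∧
      ∀ b z, D b z = vertDeriv Λ (u, v) b * f (fun i => q (z i)) +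
        ∑ i, f (Function.update (fun l => q (z l)) i
          (T (vertHess Λ (u, v) b) (c (z i) - K v (z i)) -
            T (vertDeriv Λ (u, v)) (K b (z i)))) := by
  have hr : HasFDerivAt (fun v' => Λ (u, v')) (vertDeriv Λ (u, v)) v :=
    hasFDerivAt_slice (hΛ.differentiableAt (by simp))
  have hl : HasFDerivAt (fun v' => T (vertDeriv Λ (u, v'))) (T.comp (vertHess Λ (u, v))) v :=
    T.hasFDerivAt.comp v (hasFDerivAt_slice ((contDiffAt_vertDeriv hΛ).differentiableAt (by simp)))
  have hR := hl.clm_comp (K.hasFDerivAt.const_sub c (x := v))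
  refine ⟨_, hasFDerivAt_polarForm (f := f) q hr hR, fun b z => ?_⟩
  refine (polarForm_apply (vertDeriv Λ (u, v) b) f q _ z).trans ?_
  congr 1
  refine Finset.sum_congr rfl fun i _ => ?_
  congr 2
  simp
  abel

end ProductDerivative

section ModelDerivative

variable {m N : ℕ} {ν : BaseModel m → BaseModel m [⋀^Fin m]→L[ℝ] ℝ} {Λ : JetModel m N → ℝ}
  {p : JetModel m N}

/-- Varying the value of `Λ` contributes `ℓ B` times the volume form, with `ℓ` the fibre derivative;
varying the vertical projection contributes minus the trace of `momOf ℓ ∘ B` times the volume form.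
These cancel, and only the Hessian term is left, as in `∂(p v - L)/∂v = (∂p/∂v) v`. -/
theorem fderiv_cartanCoord_vert (hΛ : ContDiffAt ℝ ∞ Λ p)
    (hΦ : DifferentiableAt ℝ (cartanCoord ν Λ) p)
    (B : BaseModel m →L[ℝ] EuclideanSpace ℝ (Fin N)) :
    fderiv ℝ (cartanCoord ν Λ) p (0, B) =
      polarForm 0 (ν p.1.1) (ContinuousLinearMap.fst ℝ (BaseModel m) (EuclideanSpace ℝ (Fin N)))
        ((momOf (vertHess Λ p B)).comp (vertCoord p.2)) := by
  obtain ⟨u, v⟩ := p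
  let K : (BaseModel m →L[ℝ] EuclideanSpace ℝ (Fin N)) →L[ℝ]
      (TotalModel m N →L[ℝ] EuclideanSpace ℝ (Fin N)) :=
    (ContinuousLinearMap.compL ℝ (TotalModel m N) (BaseModel m)
      (EuclideanSpace ℝ (Fin N))).flip (ContinuousLinearMap.fst ℝ _ _)
  obtain ⟨D, h1, h2⟩ := exists_hasFDerivAt_polarForm_slice (ν u.1)
    (ContinuousLinearMap.fst ℝ (BaseModel m) (EuclideanSpace ℝ (Fin N)))
    (momCLM m (EuclideanSpace ℝ (Fin N)))
    (ContinuousLinearMap.snd ℝ (BaseModel m) (EuclideanSpace ℝ (Fin N))) K hΛ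
  have h3 := DFunLike.congr_fun ((hasFDerivAt_slice hΦ).unique h1) B
  refine Eq.trans (b := D B) h3 ?_
  set ℓ := vertDeriv Λ (u, v) with hℓ
  ext z
  rw [h2, polarForm_apply, zero_mul, zero_add]
  have h5 : ∀ i, ν u.1 (Function.update (fun l => (z l).1) i
      (momOf (vertHess Λ (u, v) B) (vertCoord v (z i)) - (momOf ℓ).comp B (z i).1)) =
      ν u.1 (Function.update (fun l => (z l).1) i (momOf (vertHess Λ (u, v) B) (vertCoord v (z i)))) -
      ν u.1 (Function.update (fun l => (z l).1) i ((momOf ℓ).comp B (z i).1)) := fun i => by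
    rw [ContinuousAlternatingMap.map_update_sub]
  -- The insertions of `momOf ℓ ∘ B` act on the base components only, so they sum to a trace; by
  -- `sum_momOf` this trace is `ℓ B`.
  have h6 := sum_update_eq_trace_mul (ν u.1) ((momOf ℓ).comp B) (fun l => (z l).1)
  have h7 : ∑ i, (momOf ℓ).comp B (EuclideanSpace.single i (1 : ℝ)) i = ℓ B := sum_momOf ℓ B
  rw [h7] at h6
  have h9 : ∑ i, ν u.1 (Function.update (fun l => (z l).1) i
      (momOf (vertHess Λ (u, v) B) (vertCoord v (z i)) - (momOf ℓ).comp B (z i).1)) =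
      ∑ i, ν u.1 (Function.update (fun l => (z l).1) i
        (momOf (vertHess Λ (u, v) B) (vertCoord v (z i)))) - ℓ B * ν u.1 fun l => (z l).1 := by
    rw [← h6, ← Finset.sum_sub_distrib]
    exact Finset.sum_congr rfl fun i _ => h5 i
  refine Eq.trans (congrArg (ℓ B * (ν u.1 fun l => (z l).1) + ·) h9) ?_
  rw [add_sub_cancel]
  rfl

/-- A semibasic form vanishes as soon as one argument is vertical. With a single vertical argument,
the derivative of the Cartan form is the volume form with one entry replaced by the momentum, so the
momentum vanishes by nondegeneracy. -/
theorem momOf_vertHess_eq_zero (hΛ : ContDiffAt ℝ ∞ Λ p)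
    (hΦ : DifferentiableAt ℝ (cartanCoord ν Λ) p) (hν : ν p.1.1 ≠ 0)
    {B : BaseModel m →L[ℝ] EuclideanSpace ℝ (Fin N)}
    (h : restProj m N (fderiv ℝ (cartanCoord ν Λ) p (0, B)) = 0) : momOf (vertHess Λ p B) = 0 := by
  rw [fderiv_cartanCoord_vert hΛ hΦ] at h
  set η : modelOne m N := ⟨_, polarForm_mem 0 (ν p.1.1)
    (ContinuousLinearMap.fst ℝ (BaseModel m) (EuclideanSpace ℝ (Fin N)))
    ((momOf (vertHess Λ p B)).comp (vertCoord p.2))⟩ with hη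
  have h1 : toQuot m _ η = toQuot m _ 0 := by
    apply (restEquiv m N).injective
    rw [← restProj_eq, map_zero, map_zero]
    exact h
  have h2 := toQuot_eq_iff.1 h1
  ext1 f
  refine eq_zero_of_forall_update (ν p.1.1) hν _ fun w i => ?_
  -- The arguments are horizontal for the flat splitting, except for the vertical vector `(0, f)` in
  -- place `i`.
  have h3 := h2 (Function.update (fun l => (w l, 0)) i (0, f)) i (by simp)
  have h4 : η.1 (Function.update (fun l => (w l, 0)) i (0, f)) = 0 := by
    simpa using h3
  rw [hη] at h4
  have h5 := polarForm_apply 0 (ν p.1.1)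
    (ContinuousLinearMap.fst ℝ (BaseModel m) (EuclideanSpace ℝ (Fin N)))
    ((momOf (vertHess Λ p B)).comp (vertCoord p.2))
    (Function.update (fun l => (w l, (0 : EuclideanSpace ℝ (Fin N)))) i (0, f))
  have h6 := h5.symm.trans h4
  -- In the terms with insertion in another place, the entry `i` is the base component of `(0, f)`,
  -- which is zero.
  rw [zero_mul, zero_add, Finset.sum_eq_single i] at h6
  · rw [← h6]
    congr 1
    funext l
    by_cases hl : l = i
    · subst hl
      simp
    · simp [Function.update_of_ne hl]
  · intro l _ hl
    refine (ν p.1.1).map_coord_zero i ?_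
    rw [Function.update_of_ne hl.symm]
    simp
  · simp

theorem fderiv_cartanCoord_eq_zero (hΛ : ContDiffAt ℝ ∞ Λ p)
    (hΦ : DifferentiableAt ℝ (cartanCoord ν Λ) p) 
    {B : BaseModel m →L[ℝ] EuclideanSpace ℝ (Fin N)}
    (h : momOf (vertHess Λ p B) = 0) : fderiv ℝ (cartanCoord ν Λ) p (0, B) = 0 := by
  rw [fderiv_cartanCoord_vert hΛ hΦ, h]
  ext z
  rw [polarForm_apply, zero_mul, zero_add]
  refine Finset.sum_eq_zero fun i _ => (ν p.1.1).map_coord_zero i ?_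
  simp

/-- The vertical derivative of the Poincaré-Cartan form on the image of a jet. -/
theorem fderiv_cartanCoord_jet (hΛ : ContDiffAt ℝ ∞ Λ p)
    (hΦ : DifferentiableAt ℝ (cartanCoord ν Λ) p)
    (B l : BaseModel m →L[ℝ] EuclideanSpace ℝ (Fin N)) (w : Fin m → BaseModel m) :
    fderiv ℝ (cartanCoord ν Λ) p (0, B) (fun i => (w i, l (w i))) =
      vertHess Λ p B (l - p.2) * ν p.1.1 w := by
  rw [fderiv_cartanCoord_vert hΛ hΦ, polarForm_apply, zero_mul, zero_add, ← sum_momOf]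
  exact sum_update_eq_trace_mul (ν p.1.1) ((momOf (vertHess Λ p B)).comp (l - p.2)) w

end ModelDerivative

end FieldTheory

end

noncomputable section

namespace FieldTheory

/-! ### The Hamiltonian section -/

section ManifoldKernel

variable {A G Z : Type*} [NormedAddCommGroup A] [NormedSpace ℝ A]
  [NormedAddCommGroup G] [NormedSpace ℝ G]
  [NormedAddCommGroup Z] [NormedSpace ℝ Z]
variable {X P Y : Type*} [TopologicalSpace X] [ChartedSpace A X] [IsManifold 𝓘(ℝ, A) ∞ X]
  [TopologicalSpace P] [ChartedSpace G P] [IsManifold 𝓘(ℝ, G) ∞ P]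
  [TopologicalSpace Y] [ChartedSpace Z Y] [IsManifold 𝓘(ℝ, Z) ∞ Y]

theorem contDiffAt_chart_expr {f : X → P} (hf : ContMDiff 𝓘(ℝ, A) 𝓘(ℝ, G) ∞ f) (x₀ : X) :
    ContDiffAt ℝ ∞ (chartAt G (f x₀) ∘ f ∘ (chartAt A x₀).symm) (chartAt A x₀ x₀) := by
  set e := chartAt A x₀
  have hx : x₀ ∈ e.source := mem_chart_source A x₀
  have hinv : e.symm (e x₀) = x₀ := e.left_inv hx
  rw [← contMDiffAt_iff_contDiffAt]
  have a1 : ContMDiffAt 𝓘(ℝ, A) 𝓘(ℝ, A) ∞ e.symm (e x₀) :=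
    contMDiffOn_chart_symm.contMDiffAt (e.open_target.mem_nhds (e.map_source hx))
  have a2 : ContMDiffAt 𝓘(ℝ, G) 𝓘(ℝ, G) ∞ (chartAt G (f x₀)) (f (e.symm (e x₀))) := by
    rw [hinv]
    exact contMDiffOn_chart.contMDiffAt ((chartAt G (f x₀)).open_source.mem_nhds
      (mem_chart_source G (f x₀)))
  exact a2.comp (e x₀) ((hf _).comp (e x₀) a1)

variable [FiniteDimensional ℝ A] [FiniteDimensional ℝ G]

/-- The differentials of the charts are bijective, so surjectivity and the inclusion of kernels pass
to the coordinate expressions, where `eventually_eq_of_ker_le` applies. -/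
theorem eventually_eq_of_mfderiv_ker_le {f : X → P} {k : X → Y}
    (hf : ContMDiff 𝓘(ℝ, A) 𝓘(ℝ, G) ∞ f) (hk : ContMDiff 𝓘(ℝ, A) 𝓘(ℝ, Z) ∞ k)
    (hs : ∀ x, Function.Surjective (mfderiv 𝓘(ℝ, A) 𝓘(ℝ, G) f x))
    (hker : ∀ x w, mfderiv 𝓘(ℝ, A) 𝓘(ℝ, G) f x w = 0 → mfderiv 𝓘(ℝ, A) 𝓘(ℝ, Z) k x w = 0)
    (x₀ : X) : ∀ᶠ x in 𝓝 x₀, f x = f x₀ → k x = k x₀ := by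
  set e := chartAt A x₀ with he
  set e' := chartAt G (f x₀) with he'
  set e'' := chartAt Z (k x₀) with he''
  have hx : x₀ ∈ e.source := mem_chart_source A x₀
  have hp : f x₀ ∈ e'.source := mem_chart_source G (f x₀)
  have hq : k x₀ ∈ e''.source := mem_chart_source Z (k x₀)
  have hinv : e.symm (e x₀) = x₀ := e.left_inv hx
  have mf : ∀ x, MDifferentiableAt 𝓘(ℝ, A) 𝓘(ℝ, G) f x := fun x =>
    (hf x).mdifferentiableAt (by simp)
  have mk : ∀ x, MDifferentiableAt 𝓘(ℝ, A) 𝓘(ℝ, Z) k x := fun x =>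
    (hk x).mdifferentiableAt (by simp)
  have mem : ∀ᶠ u in 𝓝 (e x₀), u ∈ e.target ∧ f (e.symm u) ∈ e'.source ∧
      k (e.symm u) ∈ e''.source := by
    have hc := e.continuousAt_symm (e.map_source hx)
    refine Filter.Eventually.and (e.open_target.mem_nhds (e.map_source hx))
      (Filter.Eventually.and ?_ ?_)
    · refine (hf.continuous.continuousAt.comp hc).eventually_mem ?_
      simp only [Function.comp_apply, hinv]
      exact e'.open_source.mem_nhds hp
    · refine (hk.continuous.continuousAt.comp hc).eventually_mem ?_
      simp only [Function.comp_apply, hinv]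
      exact e''.open_source.mem_nhds hq
  have key := eventually_eq_of_ker_le (f := e' ∘ f ∘ e.symm) (k := e'' ∘ k ∘ e.symm) (x₀ := e x₀)
    ((contDiffAt_chart_expr hf x₀).of_le (by simp)) ((contDiffAt_chart_expr hk x₀).of_le (by simp))
    (by
      obtain ⟨m1, m2, m3⟩ := mem.self_of_nhds
      rw [fderiv_chart_expr e (chart_mdifferentiable x₀) e' (chart_mdifferentiable (f x₀)) m1
        (mf _) m2]
      exact ((chart_mdifferentiable (f x₀)).mfderiv_surjective m2).comp ((hs _).comp
        ((chart_mdifferentiable (A := A) x₀).symm.mfderiv_surjective m1)))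
    (by
      filter_upwards [mem] with u hu w
      obtain ⟨m1, m2, m3⟩ := hu
      rw [fderiv_chart_expr e (chart_mdifferentiable x₀) e' (chart_mdifferentiable (f x₀)) m1
        (mf _) m2, fderiv_chart_expr e (chart_mdifferentiable x₀) e''
        (chart_mdifferentiable (k x₀)) m1 (mk _) m3]
      intro h0
      have h1 := hker _ _ (((chart_mdifferentiable (f x₀)).mfderiv_injective m2)
        (h0.trans (map_zero _).symm))
      exact (congrArg (mfderiv 𝓘(ℝ, Z) 𝓘(ℝ, Z) e'' (k (e.symm u))) h1).trans (map_zero _))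
  have h2 := (e.continuousAt hx).eventually key
  filter_upwards [h2, e.open_source.mem_nhds hx,
    hk.continuous.continuousAt.eventually_mem (e''.open_source.mem_nhds hq)] with x h3 h4 h5 h6
  simp only [Function.comp_apply, hinv, e.left_inv h4] at h3
  exact e''.injOn h5 hq (h3 (by rw [h6]))

/-- The restriction of `k` to the fibre is locally constant at each of its points, and the fibre is
connected. -/
theorem eq_of_mfderiv_ker_le {f : X → P} {k : X → Y}
    (hf : ContMDiff 𝓘(ℝ, A) 𝓘(ℝ, G) ∞ f) (hk : ContMDiff 𝓘(ℝ, A) 𝓘(ℝ, Z) ∞ k)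
    (hs : ∀ x, Function.Surjective (mfderiv 𝓘(ℝ, A) 𝓘(ℝ, G) f x))
    (hker : ∀ x w, mfderiv 𝓘(ℝ, A) 𝓘(ℝ, G) f x w = 0 → mfderiv 𝓘(ℝ, A) 𝓘(ℝ, Z) k x w = 0)
    {p : P} (hc : IsPreconnected (f ⁻¹' {p})) {x y : X} (hx : f x = p) (hy : f y = p) :
    k x = k y := by
  have := isPreconnected_iff_preconnectedSpace.1 hc
  have h1 : IsLocallyConstant (fun x : f ⁻¹' {p} => k x) := by
    rw [IsLocallyConstant.iff_eventually_eq]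
    intro z
    have h2 := continuous_subtype_val.continuousAt.eventually
      (eventually_eq_of_mfderiv_ker_le hf hk hs hker z.1)
    filter_upwards [h2] with z' h3
    exact h3 (z'.2.trans z.2.symm)
  exact h1.apply_eq_of_preconnectedSpace ⟨x, hx⟩ ⟨y, hy⟩

end ManifoldKernel

namespace FibreCoords.Compatible

variable {m N : ℕ} {M : Type*} [TopologicalSpace M] [ChartedSpace (BaseModel m) M]
  {E : Type*} [TopologicalSpace E] [ChartedSpace (TotalModel m N) E]
  {π : E → M} [IsFiberedManifold m N π]
  {Z W : Type*} [NormedAddCommGroup W] [NormedSpace ℝ W]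
  [TopologicalSpace Z] [ChartedSpace (TotalModel m N × W) Z]
  {c : FibreCoords m N π Z W} {a : AdaptedChart m N π}

theorem snd_mfderiv_chart [Nonempty Z] (hc : c.Compatible) {z : Z} (hz : c.pt z ∈ a.tot.source)
    (w : TangentSpace 𝓘(ℝ, TotalModel m N × W) z) :
    (mfderiv 𝓘(ℝ, TotalModel m N × W) 𝓘(ℝ, TotalModel m N × W) (hc.chart a) z w).2 =
      mfderiv 𝓘(ℝ, TotalModel m N × W) 𝓘(ℝ, W) (c.fib a) z w := by
  have h1 : mfderiv 𝓘(ℝ, TotalModel m N × W) 𝓘(ℝ, W)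
      ((Prod.snd : TotalModel m N × W → W) ∘ hc.chart a) z =
      (mfderiv 𝓘(ℝ, TotalModel m N × W) 𝓘(ℝ, W)
        (Prod.snd : TotalModel m N × W → W) (hc.chart a z)).comp
      (mfderiv 𝓘(ℝ, TotalModel m N × W) 𝓘(ℝ, TotalModel m N × W) (hc.chart a) z) :=
    mfderiv_comp z (differentiableAt_snd.mdifferentiableAt)
      ((hc.contMDiffAt_chart hz).mdifferentiableAt (by simp))
  have h3 : (Prod.snd ∘ hc.chart a : Z → W) = c.fib a :=
    funext fun z' => by simp [chart_apply]
  have h4 : mfderiv 𝓘(ℝ, TotalModel m N × W) 𝓘(ℝ, W)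
      (Prod.snd : TotalModel m N × W → W) (hc.chart a z) =
      ContinuousLinearMap.snd ℝ (TotalModel m N) W := by
    rw [mfderiv_eq_fderiv]
    exact fderiv_snd
  rw [h3, h4] at h1
  exact (DFunLike.congr_fun h1 w).symm

/-- The two differentials are the components of the differential of a chart, which is injective. -/
theorem eq_zero_of_mfderiv (hc : c.Compatible) {z : Z} (hz : c.pt z ∈ a.tot.source)
    {w : TangentSpace 𝓘(ℝ, TotalModel m N × W) z}
    (h1 : mfderiv 𝓘(ℝ, TotalModel m N × W) 𝓘(ℝ, TotalModel m N) c.pt z w = 0)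
    (h2 : mfderiv 𝓘(ℝ, TotalModel m N × W) 𝓘(ℝ, W) (c.fib a) z w = 0) : w = 0 := by
  have : Nonempty Z := ⟨z⟩
  apply (hc.chart_mdifferentiable a).mfderiv_injective (hc.mem_chart_source.2 hz)
  refine Eq.trans ?_ (map_zero _).symm
  refine Prod.ext ?_ ?_
  · rw [hc.fst_mfderiv_chart hz, h1]
    exact map_zero _
  · rw [hc.snd_mfderiv_chart hz, h2]
    rfl

end FibreCoords.Compatible

/-! ### Kernels of the differentials of the two Legendre maps -/

section Legendre

variable {m N : ℕ} {M : Type*} [TopologicalSpace M] [ChartedSpace (BaseModel m) M]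
  [IsManifold 𝓘(ℝ, BaseModel m) ∞ M]
  {E : Type*} [TopologicalSpace E] [ChartedSpace (TotalModel m N) E]
  {π : E → M} [IsFiberedManifold m N π]

theorem fib_momentumProj {a : AdaptedChart m N π} {q : ExtMomentum m N π}
    (hq : q.pt ∈ a.tot.source) :
    restCoords.fib a (momentumProj q) = restProj m N (extIncl m N (extCoords.fib a q)) := by
  have h1 : restCoords.fib a (momentumProj q) = restEquiv m N (toQuot m _ (pullOne m
      (a.dInv q.pt) (AdaptedChart.vert_dInv hq) q.form)) :=
    dif_pos (show (momentumProj q).pt ∈ a.tot.source from hq)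
  have h2 : extCoords.fib a q = extEquiv m N (pullOne m (a.dInv q.pt)
      (AdaptedChart.vert_dInv hq) q.form) := dif_pos hq
  rw [h1, h2, extIncl_extEquiv, restProj_eq]

/-- The projection `Mπ → J¹*E` is smooth. -/
theorem contMDiff_momentumProj : ContMDiff 𝓘(ℝ, MomModel m N)
    𝓘(ℝ, TotalModel m N × RestModel m N) ∞
    (momentumProj : ExtMomentum m N π → RestMomentum m N π) := by
  intro q
  set a := FibreCoords.adaptedAt m N π q.pt
  have hq : q.pt ∈ a.tot.source := FibreCoords.mem_adaptedAt _
  refine restCoords_compatible.contMDiffAt_of_coords (a := a) hq (contMDiff_ext_pt q) ?_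
  have h1 : ContMDiffAt 𝓘(ℝ, MomModel m N) 𝓘(ℝ, RestModel m N) ∞
      (fun q => ((restProj m N).comp (extIncl m N)) (extCoords.fib a q)) q :=
    ((restProj m N).comp (extIncl m N)).contDiff.contMDiff.contMDiffAt.comp q
      (extCoords_compatible.contMDiffAt_fib hq)
  refine h1.congr_of_eventuallyEq ?_
  filter_upwards [contMDiff_ext_pt.continuous.continuousAt.eventually_mem
    (a.tot.open_source.mem_nhds hq)] with k hk
  exact fib_momentumProj hk

variable {vol : DiffForm (BaseModel m) M m} {L : J1 m N π → ℝ}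

theorem contMDiff_legendre (hvol : IsSmoothForm vol) (hL : ContMDiff 𝓘(ℝ, JetModel m N) 𝓘(ℝ, ℝ) ∞ L) :
    ContMDiff 𝓘(ℝ, JetModel m N) 𝓘(ℝ, TotalModel m N × RestModel m N) ∞ (legendre vol L) :=
  contMDiff_momentumProj.comp (contMDiff_extLegendre hvol hL)

section Derivatives

variable (hvol : IsSmoothForm vol) (hL : ContMDiff 𝓘(ℝ, JetModel m N) 𝓘(ℝ, ℝ) ∞ L)

theorem chart_fst_mem [Nonempty (J1 m N π)] {a : AdaptedChart m N π} {j : J1 m N π}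
    (hj : j.pt ∈ a.tot.source) :
    jetCoords_compatible.chart a j ∈ a.tot.target ×ˢ
      (univ : Set (BaseModel m →L[ℝ] EuclideanSpace ℝ (Fin N))) := by
  rw [jetCoords_compatible.chart_apply]
  exact ⟨a.tot.map_source hj, trivial⟩

include hvol hL in
theorem contDiffAt_cartanCoord_chart [Nonempty (J1 m N π)] {a : AdaptedChart m N π} {j : J1 m N π}
    (hj : j.pt ∈ a.tot.source) :
    ContDiffAt ℝ ∞ (cartanCoord (volCoord vol a) (lagCoord L a))
      (jetCoords_compatible.chart a j) :=
  (contDiffOn_cartanCoord_chart hvol hL a).contDiffAt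
    ((a.tot.open_target.prod isOpen_univ).mem_nhds (chart_fst_mem hj))

include hL in
theorem contDiffAt_lagCoord_chart [Nonempty (J1 m N π)] {a : AdaptedChart m N π} {j : J1 m N π}
    (hj : j.pt ∈ a.tot.source) :
    ContDiffAt ℝ ∞ (lagCoord L a) (jetCoords_compatible.chart a j) :=
  (contDiffOn_lagCoord hL a).contDiffAt
    ((a.tot.open_target.prod isOpen_univ).mem_nhds (chart_fst_mem hj))

include hvol hL in
-- The chain rule shared by the two Legendre maps: `T` will be `restProj` for one and `extProj` for
-- the other.
theorem mfderiv_linear_cartanCoord [Nonempty (J1 m N π)] {a : AdaptedChart m N π} {j : J1 m N π}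
    (hj : j.pt ∈ a.tot.source) {V : Type*} [NormedAddCommGroup V] [NormedSpace ℝ V]
    (T : (TotalModel m N [⋀^Fin m]→L[ℝ] ℝ) →L[ℝ] V) {F : J1 m N π → V}
    (hF : ∀ k : J1 m N π, k.pt ∈ a.tot.source → F k = T (cartanCoord (volCoord vol a) (lagCoord L a)
      (jetCoords_compatible.chart a k))) (w : TangentSpace 𝓘(ℝ, JetModel m N) j) :
    mfderiv 𝓘(ℝ, JetModel m N) 𝓘(ℝ, V) F j w =
      T (fderiv ℝ (cartanCoord (volCoord vol a) (lagCoord L a)) (jetCoords_compatible.chart a j)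
        (mfderiv 𝓘(ℝ, JetModel m N) 𝓘(ℝ, JetModel m N) (jetCoords_compatible.chart a) j w)) := by
  set Φ := cartanCoord (volCoord vol a) (lagCoord L a) with hΦ
  have h1 : F =ᶠ[𝓝 j] (T ∘ Φ) ∘ jetCoords_compatible.chart a := by
    filter_upwards [contMDiff_jet_pt.continuous.continuousAt.eventually_mem
      (a.tot.open_source.mem_nhds hj)] with k hk
    exact hF k hk
  have h2 : DifferentiableAt ℝ Φ (jetCoords_compatible.chart a j) :=
    (contDiffAt_cartanCoord_chart hvol hL hj).differentiableAt (by simp)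
  have h3 : HasFDerivAt (T ∘ Φ) (T.comp (fderiv ℝ Φ (jetCoords_compatible.chart a j)))
      (jetCoords_compatible.chart a j) := T.hasFDerivAt.comp _ h2.hasFDerivAt
  have h4 : mfderiv 𝓘(ℝ, JetModel m N) 𝓘(ℝ, V) ((T ∘ Φ) ∘ jetCoords_compatible.chart a) j =
      (mfderiv 𝓘(ℝ, JetModel m N) 𝓘(ℝ, V) (T ∘ Φ) (jetCoords_compatible.chart a j)).comp
        (mfderiv 𝓘(ℝ, JetModel m N) 𝓘(ℝ, JetModel m N) (jetCoords_compatible.chart a) j) :=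
    mfderiv_comp j h3.differentiableAt.mdifferentiableAt
      ((jetCoords_compatible.contMDiffAt_chart hj).mdifferentiableAt (by simp))
  have h5 := h1.mfderiv_eq (I := 𝓘(ℝ, JetModel m N)) (I' := 𝓘(ℝ, V))
  have h6 : mfderiv 𝓘(ℝ, JetModel m N) 𝓘(ℝ, V) (T ∘ Φ) (jetCoords_compatible.chart a j) =
      T.comp (fderiv ℝ Φ (jetCoords_compatible.chart a j)) := by
    rw [mfderiv_eq_fderiv]
    exact h3.fderiv
  rw [h6] at h4
  exact DFunLike.congr_fun (h5.trans h4) w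

include hvol hL in
theorem mfderiv_fib_legendre [Nonempty (J1 m N π)] {a : AdaptedChart m N π} {j : J1 m N π}
    (hj : j.pt ∈ a.tot.source) (w : TangentSpace 𝓘(ℝ, JetModel m N) j) :
    mfderiv 𝓘(ℝ, TotalModel m N × RestModel m N) 𝓘(ℝ, RestModel m N) (restCoords.fib a)
      (legendre vol L j)
      (mfderiv 𝓘(ℝ, JetModel m N) 𝓘(ℝ, TotalModel m N × RestModel m N) (legendre vol L) j w) =
    restProj m N (fderiv ℝ (cartanCoord (volCoord vol a) (lagCoord L a))
      (jetCoords_compatible.chart a j)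
      (mfderiv 𝓘(ℝ, JetModel m N) 𝓘(ℝ, JetModel m N) (jetCoords_compatible.chart a) j w)) := by
  refine Eq.trans ?_ (mfderiv_linear_cartanCoord hvol hL hj (restProj m N)
    (F := restCoords.fib a ∘ legendre vol L) (fun k hk => fib_legendre vol hL hk) w)
  exact (DFunLike.congr_fun (mfderiv_comp j
    ((restCoords_compatible.contMDiffAt_fib (z := legendre vol L j) hj).mdifferentiableAt (by simp))
    ((contMDiff_legendre hvol hL).mdifferentiableAt (by simp))) w).symm

include hvol hL in
theorem mfderiv_fib_extLegendre [Nonempty (J1 m N π)] {a : AdaptedChart m N π} {j : J1 m N π}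
    (hj : j.pt ∈ a.tot.source) (w : TangentSpace 𝓘(ℝ, JetModel m N) j) :
    mfderiv 𝓘(ℝ, MomModel m N) 𝓘(ℝ, ExtModel m N) (extCoords.fib a)
      (extLegendre vol L j) (dLegendre vol L j w) =
    extProj m N (fderiv ℝ (cartanCoord (volCoord vol a) (lagCoord L a))
      (jetCoords_compatible.chart a j)
      (mfderiv 𝓘(ℝ, JetModel m N) 𝓘(ℝ, JetModel m N) (jetCoords_compatible.chart a) j w)) := by
  refine Eq.trans ?_ (mfderiv_linear_cartanCoord hvol hL hj (extProj m N)
    (F := extCoords.fib a ∘ extLegendre vol L) (fun k hk => fib_extLegendre vol hL hk) w)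
  exact (DFunLike.congr_fun (mfderiv_comp j
    ((extCoords_compatible.contMDiffAt_fib (z := extLegendre vol L j) hj).mdifferentiableAt
      (by simp))
    ((contMDiff_extLegendre hvol hL).mdifferentiableAt (by simp))) w).symm

include hvol hL in
theorem dExtPt_dLegendre (j : J1 m N π) (w : TangentSpace 𝓘(ℝ, JetModel m N) j) :
    dExtPt (extLegendre vol L j) (dLegendre vol L j w) =
      mfderiv 𝓘(ℝ, JetModel m N) 𝓘(ℝ, TotalModel m N) (FirstJet.pt : J1 m N π → E) j w :=
  (DFunLike.congr_fun (mfderiv_comp (g := (ExtMomentum.pt : ExtMomentum m N π → E)) j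
    (contMDiff_ext_pt.mdifferentiableAt (by simp))
    ((contMDiff_extLegendre hvol hL).mdifferentiableAt (by simp))) w).symm

include hvol hL in
theorem mfderiv_rest_pt_legendre (j : J1 m N π) (w : TangentSpace 𝓘(ℝ, JetModel m N) j) :
    mfderiv 𝓘(ℝ, TotalModel m N × RestModel m N) 𝓘(ℝ, TotalModel m N)
      (RestMomentum.pt : RestMomentum m N π → E) (legendre vol L j)
      (mfderiv 𝓘(ℝ, JetModel m N) 𝓘(ℝ, TotalModel m N × RestModel m N) (legendre vol L) j w) =
      mfderiv 𝓘(ℝ, JetModel m N) 𝓘(ℝ, TotalModel m N) (FirstJet.pt : J1 m N π → E) j w :=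
  (DFunLike.congr_fun (mfderiv_comp (g := (RestMomentum.pt : RestMomentum m N π → E)) j
    (contMDiff_rest_pt.mdifferentiableAt (by simp))
    ((contMDiff_legendre hvol hL).mdifferentiableAt (by simp))) w).symm

theorem volCoord_ne_zero {a : AdaptedChart m N π} (hv : ∀ x, vol x ≠ 0) {y : E}
    (hy : y ∈ a.tot.source) : volCoord vol a (a.tot y).1 ≠ 0 := by
  intro h0
  rw [a.fst_tot y hy] at h0
  refine hv (π y) ?_
  ext w
  have h1 := volCoord_base vol a (a.mapsTo y hy) (fun i => a.db (π y) (w i))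
  rw [h0] at h1
  simp only [AdaptedChart.dbInv_db (a.mapsTo y hy)] at h1
  exact h1.symm

/-- In a direction vertical over `E`, the class of the derivative modulo semibasic forms determines
the momentum of the Hessian, which in turn determines the whole derivative. -/
theorem fderiv_cartanCoord_eq_zero_of_restProj {ν : BaseModel m → BaseModel m [⋀^Fin m]→L[ℝ] ℝ}
    {Λ : JetModel m N → ℝ} {p : JetModel m N} (hΛ : ContDiffAt ℝ ∞ Λ p)
    (hΦ : DifferentiableAt ℝ (cartanCoord ν Λ) p) (hν : ν p.1.1 ≠ 0) {u : JetModel m N}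
    (hu : u.1 = 0) (h : restProj m N (fderiv ℝ (cartanCoord ν Λ) p u) = 0) :
    fderiv ℝ (cartanCoord ν Λ) p u = 0 := by
  obtain ⟨u, B⟩ := u
  dsimp only at hu
  subst hu
  exact fderiv_cartanCoord_eq_zero hΛ hΦ (momOf_vertHess_eq_zero hΛ hΦ hν h)

include hvol hL in
/-- The kernel of the differential of the Legendre map is contained in that of the extended one. -/
theorem dLegendre_eq_zero (hv : ∀ x, vol x ≠ 0) {j : J1 m N π}
    {w : TangentSpace 𝓘(ℝ, JetModel m N) j}
    (h : mfderiv 𝓘(ℝ, JetModel m N) 𝓘(ℝ, TotalModel m N × RestModel m N) (legendre vol L) j w = 0) :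
    dLegendre vol L j w = 0 := by
  have : Nonempty (J1 m N π) := ⟨j⟩
  obtain ⟨a, hj⟩ := IsFiberedManifold.exists_adapted (m := m) (N := N) (π := π) j.pt
  -- The Legendre map preserves the point of `E`, so vectors in the kernel of its differential are
  -- vertical over `E`.
  have h2 : mfderiv 𝓘(ℝ, JetModel m N) 𝓘(ℝ, TotalModel m N) (FirstJet.pt : J1 m N π → E) j w = 0 :=
    (mfderiv_rest_pt_legendre hvol hL j w).symm.trans ((congrArg _ h).trans (map_zero _))
  have h3 : restProj m N (fderiv ℝ (cartanCoord (volCoord vol a) (lagCoord L a))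
      (jetCoords_compatible.chart a j)
      (mfderiv 𝓘(ℝ, JetModel m N) 𝓘(ℝ, JetModel m N) (jetCoords_compatible.chart a) j w)) = 0 :=
    (mfderiv_fib_legendre hvol hL hj w).symm.trans ((congrArg _ h).trans (map_zero _))
  have h4 : (mfderiv 𝓘(ℝ, JetModel m N) 𝓘(ℝ, JetModel m N) (jetCoords_compatible.chart a) j w).1 =
      0 :=
    (jetCoords_compatible.fst_mfderiv_chart hj w).trans
      ((congrArg (a.d j.pt) h2).trans (map_zero _))
  have hν : volCoord vol a (jetCoords_compatible.chart a j).1.1 ≠ 0 := by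
    rw [jetCoords_compatible.chart_apply]
    exact volCoord_ne_zero hv hj
  have h8 := fderiv_cartanCoord_eq_zero_of_restProj (contDiffAt_lagCoord_chart hL hj)
    ((contDiffAt_cartanCoord_chart hvol hL hj).differentiableAt (by simp)) hν h4 h3
  refine extCoords_compatible.eq_zero_of_mfderiv (a := a) (z := extLegendre vol L j) hj ?_ ?_
  · exact (dExtPt_dLegendre hvol hL j w).trans h2
  · refine (mfderiv_fib_extLegendre hvol hL hj w).trans ?_
    exact (congrArg (extProj m N) h8).trans (map_zero _)

end Derivatives

end Legendre

end FieldTheory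

end

noncomputable section

namespace FieldTheory

/-! ### Properties of the Hamiltonian section -/

section HamSection

variable {m N : ℕ} {M : Type*} [TopologicalSpace M] [ChartedSpace (BaseModel m) M]
  [IsManifold 𝓘(ℝ, BaseModel m) ∞ M]
  {E : Type*} [TopologicalSpace E] [ChartedSpace (TotalModel m N) E]
  {π : E → M} [IsFiberedManifold m N π]
  {G : Type*} [NormedAddCommGroup G] [NormedSpace ℝ G]
  {P : Type*} [TopologicalSpace P] [ChartedSpace G P]
  {vol : DiffForm (BaseModel m) M m} {L : J1 m N π → ℝ}
  {j0 : P → RestMomentum m N π} {FL0 : J1 m N π → P}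

theorem contMDiff_extBase : ContMDiff 𝓘(ℝ, MomModel m N) 𝓘(ℝ, BaseModel m) ∞
    (extBase (m := m) (N := N) π) :=
  (IsFiberedManifold.smooth (m := m) (N := N) (π := π)).comp contMDiff_ext_pt

theorem mfderiv_proj_surjective (y : E) :
    Function.Surjective (mfderiv 𝓘(ℝ, TotalModel m N) 𝓘(ℝ, BaseModel m) π y) := by
  obtain ⟨a, hy⟩ := IsFiberedManifold.exists_adapted (m := m) (N := N) (π := π) y
  intro v
  refine ⟨a.dInv y (a.db (π y) v, 0), ?_⟩
  refine (AdaptedChart.dProj_dInv hy _).trans ?_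
  exact AdaptedChart.dbInv_db (a.mapsTo y hy) v

theorem mfderiv_jet_pt_surjective (j : J1 m N π) : Function.Surjective
    (mfderiv 𝓘(ℝ, JetModel m N) 𝓘(ℝ, TotalModel m N) (FirstJet.pt : J1 m N π → E) j) := by
  have : Nonempty (J1 m N π) := ⟨j⟩
  obtain ⟨a, hj⟩ := IsFiberedManifold.exists_adapted (m := m) (N := N) (π := π) j.pt
  intro v
  obtain ⟨w, hw⟩ := (jetCoords_compatible.chart_mdifferentiable a).mfderiv_surjective
    (jetCoords_compatible.mem_chart_source.2 hj) (a.d j.pt v, 0)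
  refine ⟨w, ?_⟩
  have h1 := jetCoords_compatible.fst_mfderiv_chart hj w
  rw [hw] at h1
  exact (AdaptedChart.dInv_d hj _).symm.trans ((congrArg (a.dInv j.pt) h1.symm).trans
    (AdaptedChart.dInv_d hj v))

namespace IsAlmostRegular

variable (h : IsAlmostRegular (G := G) vol L j0 FL0)

section Smooth

theorem contMDiff_hamBase (h : IsAlmostRegular (G := G) vol L j0 FL0) :
    ContMDiff 𝓘(ℝ, G) 𝓘(ℝ, BaseModel m) ∞ (hamBase j0) :=
  (IsFiberedManifold.smooth (m := m) (N := N) (π := π)).comp (contMDiff_rest_pt.comp h.smooth_emb)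

theorem hamBase_leg (h : IsAlmostRegular (G := G) vol L j0 FL0) (j : J1 m N π) :
    hamBase j0 (FL0 j) = π j.pt := by
  show π (j0 (FL0 j)).pt = _
  rw [h.factor]
  rfl

/-- The composite `τ₀ ∘ FL0` equals `π ∘ pt`, a composite of submersions. -/
theorem mfderiv_hamBase_surjective (h : IsAlmostRegular (G := G) vol L j0 FL0) (p : P) :
    Function.Surjective (dMap m G (hamBase j0) p) := by
  obtain ⟨j, rfl⟩ := h.surjective p
  have h1 : mfderiv 𝓘(ℝ, JetModel m N) 𝓘(ℝ, BaseModel m) (hamBase j0 ∘ FL0) j =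
      (mfderiv 𝓘(ℝ, G) 𝓘(ℝ, BaseModel m) (hamBase j0) (FL0 j)).comp
        (mfderiv 𝓘(ℝ, JetModel m N) 𝓘(ℝ, G) FL0 j) :=
    mfderiv_comp j (h.contMDiff_hamBase.mdifferentiableAt (by simp))
      (h.smooth_leg.mdifferentiableAt (by simp))
  have h2 : mfderiv 𝓘(ℝ, JetModel m N) 𝓘(ℝ, BaseModel m) (π ∘ FirstJet.pt) j =
      (mfderiv 𝓘(ℝ, TotalModel m N) 𝓘(ℝ, BaseModel m) π j.pt).comp
        (mfderiv 𝓘(ℝ, JetModel m N) 𝓘(ℝ, TotalModel m N) (FirstJet.pt : J1 m N π → E) j) :=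
    mfderiv_comp j ((IsFiberedManifold.smooth (m := m) (N := N) (π := π)).mdifferentiableAt
      (by simp)) (contMDiff_jet_pt.mdifferentiableAt (by simp))
  have h3 : hamBase j0 ∘ FL0 = π ∘ FirstJet.pt := funext h.hamBase_leg
  rw [h3] at h1
  intro v
  obtain ⟨y, hy⟩ := mfderiv_proj_surjective (m := m) (N := N) (π := π) j.pt v
  obtain ⟨w, hw⟩ := mfderiv_jet_pt_surjective j y
  refine ⟨mfderiv 𝓘(ℝ, JetModel m N) 𝓘(ℝ, G) FL0 j w, ?_⟩
  refine (DFunLike.congr_fun (h1.symm.trans h2) w).trans ?_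
  exact (congrArg (mfderiv 𝓘(ℝ, TotalModel m N) 𝓘(ℝ, BaseModel m) π j.pt) hw).trans hy

end Smooth

variable [FiniteDimensional ℝ G] [IsManifold 𝓘(ℝ, G) ∞ P]
  [IsManifold 𝓘(ℝ, TotalModel m N) ∞ E]
variable (hvol : IsVolumeForm vol) (hL : ContMDiff 𝓘(ℝ, JetModel m N) 𝓘(ℝ, ℝ) ∞ L)

include hvol hL in
/-- The extended Legendre map is constant on the fibres of the Legendre map. -/
theorem extLegendre_eq_of_leg_eq (h : IsAlmostRegular (G := G) vol L j0 FL0) {j k : J1 m N π}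
    (hjk : FL0 j = FL0 k) : extLegendre vol L j = extLegendre vol L k := by
  -- As `j0` is injective, `FL0` has the same fibres as the Legendre map, and these are connected by
  -- hypothesis.
  have hpre : FL0 ⁻¹' {FL0 k} = legendre vol L ⁻¹' {legendre vol L k} := by
    ext i
    simp only [mem_preimage, mem_singleton_iff]
    rw [← h.factor, ← h.factor, h.isClosedEmbedding.injective.eq_iff]
  refine eq_of_mfderiv_ker_le (f := FL0) (p := FL0 k) h.smooth_leg
    (contMDiff_extLegendre hvol.smooth hL) h.submersion (fun i w hw => ?_) ?_ hjk rfl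
  · refine dLegendre_eq_zero hvol.smooth hL hvol.ne_zero ?_
    have h1 : mfderiv 𝓘(ℝ, JetModel m N) 𝓘(ℝ, TotalModel m N × RestModel m N) (j0 ∘ FL0) i =
        (mfderiv 𝓘(ℝ, G) 𝓘(ℝ, TotalModel m N × RestModel m N) j0 (FL0 i)).comp
          (mfderiv 𝓘(ℝ, JetModel m N) 𝓘(ℝ, G) FL0 i) :=
      mfderiv_comp i (h.smooth_emb.mdifferentiableAt (by simp))
        (h.smooth_leg.mdifferentiableAt (by simp))
    have h2 : j0 ∘ FL0 = legendre vol L := funext h.factor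
    rw [h2] at h1
    refine (DFunLike.congr_fun h1 w).trans ?_
    exact (congrArg (mfderiv 𝓘(ℝ, G) 𝓘(ℝ, TotalModel m N × RestModel m N) j0 (FL0 i)) hw).trans
      (map_zero _)
  · rw [hpre]
    exact (h.connected_fibre k).isPreconnected

include hvol hL in
/-- The characteristic property of `h̃`. -/
theorem hamSection_leg (j : J1 m N π) : h.hamSection (FL0 j) = extLegendre vol L j :=
  h.extLegendre_eq_of_leg_eq hvol hL (Function.surjInv_eq h.surjective (FL0 j))

include hvol hL in
-- The choice of preimages in the definition of `h̃` is arbitrary, but by `hamSection_leg` it may be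
-- replaced near any point by a smooth local section of `FL0`.
theorem contMDiff_hamSection : ContMDiff 𝓘(ℝ, G) 𝓘(ℝ, MomModel m N) ∞ h.hamSection := by
  intro p
  obtain ⟨j, rfl⟩ := h.surjective p
  obtain ⟨σ, h1, h2, h3⟩ := exists_local_section_manifold h.smooth_leg (h.submersion j)
  have h4 := ((contMDiff_extLegendre hvol.smooth hL) (σ (FL0 j))).comp (FL0 j) h1
  refine h4.congr_of_eventuallyEq ?_
  filter_upwards [h3] with p hp
  show h.hamSection p = extLegendre vol L (σ p)
  rw [← h.hamSection_leg hvol hL, hp]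

include hvol hL in
theorem momentumProj_hamSection (p : P) : momentumProj (h.hamSection p) = j0 p := by
  obtain ⟨j, rfl⟩ := h.surjective p
  rw [h.hamSection_leg hvol hL, h.factor]
  rfl

include hvol hL in
theorem extBase_hamSection (p : P) : extBase π (h.hamSection p) = hamBase j0 p :=
  congrArg (fun q : RestMomentum m N π => π q.pt) (h.momentumProj_hamSection hvol hL p)

include hvol hL in
-- Since `μ ∘ h̃ = j0` and `j0` is an immersion.
theorem dHam_injective (p : P) : Function.Injective (h.dHam p) := by
  have h1 : mfderiv 𝓘(ℝ, G) 𝓘(ℝ, TotalModel m N × RestModel m N)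
      (momentumProj ∘ h.hamSection) p =
      (mfderiv 𝓘(ℝ, MomModel m N) 𝓘(ℝ, TotalModel m N × RestModel m N)
        (momentumProj : ExtMomentum m N π → RestMomentum m N π) (h.hamSection p)).comp
      (mfderiv 𝓘(ℝ, G) 𝓘(ℝ, MomModel m N) h.hamSection p) :=
    mfderiv_comp p (contMDiff_momentumProj.mdifferentiableAt (by simp))
      ((h.contMDiff_hamSection hvol hL).mdifferentiableAt (by simp))
  have h2 : momentumProj ∘ h.hamSection = j0 := funext (h.momentumProj_hamSection hvol hL)
  rw [h2] at h1
  intro v w hvw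
  apply h.immersion p
  refine (DFunLike.congr_fun h1 v).trans (Eq.trans ?_ (DFunLike.congr_fun h1 w).symm)
  exact congrArg (mfderiv 𝓘(ℝ, MomModel m N) 𝓘(ℝ, TotalModel m N × RestModel m N)
        (momentumProj : ExtMomentum m N π → RestMomentum m N π) (h.hamSection p)) hvw

include hvol hL in
theorem dMap_dHam (p : P) (v : TangentSpace 𝓘(ℝ, G) p) :
    dMap m (MomModel m N) (extBase π) (h.hamSection p) (h.dHam p v) =
      dMap m G (hamBase j0) p v := by
  have h1 : mfderiv 𝓘(ℝ, G) 𝓘(ℝ, BaseModel m) (extBase π ∘ h.hamSection) p =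
      (mfderiv 𝓘(ℝ, MomModel m N) 𝓘(ℝ, BaseModel m) (extBase π) (h.hamSection p)).comp
      (mfderiv 𝓘(ℝ, G) 𝓘(ℝ, MomModel m N) h.hamSection p) :=
    mfderiv_comp p (contMDiff_extBase.mdifferentiableAt (by simp))
      ((h.contMDiff_hamSection hvol hL).mdifferentiableAt (by simp))
  have h2 : extBase π ∘ h.hamSection = hamBase j0 := funext (h.extBase_hamSection hvol hL)
  rw [h2] at h1
  exact (DFunLike.congr_fun h1 v).symm

include hvol hL in
-- The identity behind all three transfers: it turns pull-backs by the extended Legendre map into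
-- pull-backs by the submersion `FL0` of objects on `P`.
theorem dLegendre_eq (j : J1 m N π) (w : TangentSpace 𝓘(ℝ, JetModel m N) j) :
    dLegendre vol L j w = h.dHam (FL0 j) (mfderiv 𝓘(ℝ, JetModel m N) 𝓘(ℝ, G) FL0 j w) := by
  have h1 : mfderiv 𝓘(ℝ, JetModel m N) 𝓘(ℝ, MomModel m N) (h.hamSection ∘ FL0) j =
      (mfderiv 𝓘(ℝ, G) 𝓘(ℝ, MomModel m N) h.hamSection (FL0 j)).comp
      (mfderiv 𝓘(ℝ, JetModel m N) 𝓘(ℝ, G) FL0 j) :=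
    mfderiv_comp j ((h.contMDiff_hamSection hvol hL).mdifferentiableAt (by simp))
      (h.smooth_leg.mdifferentiableAt (by simp))
  have h2 : h.hamSection ∘ FL0 = extLegendre vol L := funext (h.hamSection_leg hvol hL)
  rw [h2] at h1
  exact DFunLike.congr_fun h1 w

/-- The form `Ω ∘ FL~` with values in the alternating forms on the model space. -/
theorem multisymplecticForm_hamSection (hvol : IsVolumeForm vol)
    (hL : ContMDiff 𝓘(ℝ, JetModel m N) 𝓘(ℝ, ℝ) ∞ L) (j : J1 m N π)
    (w : Fin (m + 1) → MomModel m N) :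
    multisymplecticForm π (extLegendre vol L j) w =
      multisymplecticForm π (h.hamSection (FL0 j)) w :=
  let Ω : ExtMomentum m N π → MomModel m N [⋀^Fin (m + 1)]→L[ℝ] ℝ := multisymplecticForm π
  congrArg (fun q => Ω q w) (h.hamSection_leg hvol hL j).symm

end IsAlmostRegular

end HamSection

end FieldTheory

end

noncomputable section

namespace FieldTheory

/-! ### Families of linear maps between tangent spaces -/

section HomFamilies

variable {H₀ H₁ H₂ H₃ : Type*} [NormedAddCommGroup H₀] [NormedSpace ℝ H₀]
  [NormedAddCommGroup H₁] [NormedSpace ℝ H₁] [NormedAddCommGroup H₂] [NormedSpace ℝ H₂]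
  [NormedAddCommGroup H₃] [NormedSpace ℝ H₃]
  {Q X₁ X₂ X₃ : Type*} [TopologicalSpace Q] [ChartedSpace H₀ Q]
  [TopologicalSpace X₁] [ChartedSpace H₁ X₁] [IsManifold 𝓘(ℝ, H₁) ∞ X₁]
  [TopologicalSpace X₂] [ChartedSpace H₂ X₂] [IsManifold 𝓘(ℝ, H₂) ∞ X₂]
  [TopologicalSpace X₃] [ChartedSpace H₃ X₃] [IsManifold 𝓘(ℝ, H₃) ∞ X₃]

instance isManifold_one_of_infty [IsManifold 𝓘(ℝ, H₁) ∞ X₁] : IsManifold 𝓘(ℝ, H₁) 1 X₁ :=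
  IsManifold.of_le (n := ∞) (by simp)

/-- The coordinate changes at the intermediate point `g n` are inverse to each other and cancel.
This needs `n` so close to `n₀` that the three points stay in the charts chosen at `n₀`. -/
theorem inTangentCoordinates_comp {f : Q → X₁} {g : Q → X₂} {k : Q → X₃} {φ : Q → H₁ →L[ℝ] H₂}
    {η : Q → H₂ →L[ℝ] H₃} {n₀ n : Q} (hf : f n ∈ (chartAt H₁ (f n₀)).source)
    (hg : g n ∈ (chartAt H₂ (g n₀)).source) (hk : k n ∈ (chartAt H₃ (k n₀)).source) :
    inTangentCoordinates 𝓘(ℝ, H₁) 𝓘(ℝ, H₃) f k (fun n => (η n).comp (φ n)) n₀ n =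
      (inTangentCoordinates 𝓘(ℝ, H₂) 𝓘(ℝ, H₃) g k η n₀ n).comp
        (inTangentCoordinates 𝓘(ℝ, H₁) 𝓘(ℝ, H₂) f g φ n₀ n) := by
  rw [inTangentCoordinates_eq _ _ _ hf hk, inTangentCoordinates_eq _ _ _ hg hk,
    inTangentCoordinates_eq _ _ _ hf hg]
  ext v
  simp only [ContinuousLinearMap.comp_apply]
  congr 2
  have hg' : g n ∈ (chartAt H₂ (g n)).source := mem_chart_source _ _
  have h1 := (tangentBundleCore 𝓘(ℝ, H₂) X₂).coordChange_comp (achart H₂ (g n))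
    (achart H₂ (g n₀)) (achart H₂ (g n)) (g n) ⟨⟨hg', hg⟩, hg'⟩
    (φ n ((tangentBundleCore 𝓘(ℝ, H₁) X₁).coordChange (achart H₁ (f n₀)) (achart H₁ (f n)) (f n) v))
  rw [(tangentBundleCore 𝓘(ℝ, H₂) X₂).coordChange_self _ _ hg'] at h1
  exact h1.symm

theorem contMDiffAt_inTangentCoordinates_congr {f f' : Q → X₁} {g g' : Q → X₂}
    {φ φ' : Q → H₁ →L[ℝ] H₂} {n₀ : Q}
    (h : ContMDiffAt 𝓘(ℝ, H₀) 𝓘(ℝ, H₁ →L[ℝ] H₂) ∞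
      (inTangentCoordinates 𝓘(ℝ, H₁) 𝓘(ℝ, H₂) f g φ n₀) n₀)
    (hf : ∀ᶠ n in 𝓝 n₀, f' n = f n) (hg : ∀ᶠ n in 𝓝 n₀, g' n = g n)
    (hφ : ∀ᶠ n in 𝓝 n₀, φ' n = φ n) :
    ContMDiffAt 𝓘(ℝ, H₀) 𝓘(ℝ, H₁ →L[ℝ] H₂) ∞
      (inTangentCoordinates 𝓘(ℝ, H₁) 𝓘(ℝ, H₂) f' g' φ' n₀) n₀ := by
  refine h.congr_of_eventuallyEq ?_
  filter_upwards [hf, hg, hφ] with n h1 h2 h3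
  unfold inTangentCoordinates
  rw [h1, h2, h3, hf.self_of_nhds, hg.self_of_nhds]

theorem contMDiffAt_inTangentCoordinates_comp {f : Q → X₁} {g : Q → X₂} {k : Q → X₃}
    {φ : Q → H₁ →L[ℝ] H₂} {η : Q → H₂ →L[ℝ] H₃} {n₀ : Q} (hf : ContinuousAt f n₀)
    (hg : ContinuousAt g n₀) (hk : ContinuousAt k n₀)
    (hη : ContMDiffAt 𝓘(ℝ, H₀) 𝓘(ℝ, H₂ →L[ℝ] H₃) ∞
      (inTangentCoordinates 𝓘(ℝ, H₂) 𝓘(ℝ, H₃) g k η n₀) n₀)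
    (hφ : ContMDiffAt 𝓘(ℝ, H₀) 𝓘(ℝ, H₁ →L[ℝ] H₂) ∞
      (inTangentCoordinates 𝓘(ℝ, H₁) 𝓘(ℝ, H₂) f g φ n₀) n₀) :
    ContMDiffAt 𝓘(ℝ, H₀) 𝓘(ℝ, H₁ →L[ℝ] H₃) ∞
      (inTangentCoordinates 𝓘(ℝ, H₁) 𝓘(ℝ, H₃) f k (fun n => (η n).comp (φ n)) n₀) n₀ := by
  refine (hη.clm_comp hφ).congr_of_eventuallyEq ?_
  filter_upwards [hf.eventually_mem ((chartAt H₁ (f n₀)).open_source.mem_nhds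
      (mem_chart_source _ _)), hg.eventually_mem ((chartAt H₂ (g n₀)).open_source.mem_nhds
      (mem_chart_source _ _)), hk.eventually_mem ((chartAt H₃ (k n₀)).open_source.mem_nhds
      (mem_chart_source _ _))] with n h1 h2 h3
  exact inTangentCoordinates_comp h1 h2 h3

variable {H' : Type*} [NormedAddCommGroup H'] [NormedSpace ℝ H'] {Q' : Type*}
  [TopologicalSpace Q'] [ChartedSpace H' Q'] [IsManifold 𝓘(ℝ, H') ∞ Q']

/-- The image under a differential of a smooth family of linear maps is smooth. -/
theorem contMDiffAt_inTangentCoordinates_push {f : Q → X₁} {g : Q → X₂} {φ : Q → H₁ →L[ℝ] H₂}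
    {F : Q' → Q} {k : X₂ → X₃} {n₀ : Q'} (hf : ContinuousAt f (F n₀))
    (hg : ContMDiffAt 𝓘(ℝ, H₀) 𝓘(ℝ, H₂) ∞ g (F n₀)) (hF : ContMDiffAt 𝓘(ℝ, H') 𝓘(ℝ, H₀) ∞ F n₀)
    (hk : ContMDiff 𝓘(ℝ, H₂) 𝓘(ℝ, H₃) ∞ k)
    (hφ : ContMDiffAt 𝓘(ℝ, H₀) 𝓘(ℝ, H₁ →L[ℝ] H₂) ∞
      (inTangentCoordinates 𝓘(ℝ, H₁) 𝓘(ℝ, H₂) f g φ (F n₀)) (F n₀)) :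
    ContMDiffAt 𝓘(ℝ, H') 𝓘(ℝ, H₁ →L[ℝ] H₃) ∞
      (inTangentCoordinates 𝓘(ℝ, H₁) 𝓘(ℝ, H₃) (fun n => f (F n)) (fun n => k (g (F n)))
        (fun n => (mfderiv 𝓘(ℝ, H₂) 𝓘(ℝ, H₃) k (g (F n))).comp (φ (F n))) n₀) n₀ := by
  have h1 : ContMDiffAt 𝓘(ℝ, H') 𝓘(ℝ, H₂) ∞ (fun n => g (F n)) n₀ := hg.comp n₀ hF
  -- The differential of the smooth map `k`, taken along `g ∘ F`, is itself a smooth family; the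
  -- rest is composition of families.
  have h2 : ContMDiffAt 𝓘(ℝ, H') 𝓘(ℝ, H₂ →L[ℝ] H₃) ∞
      (inTangentCoordinates 𝓘(ℝ, H₂) 𝓘(ℝ, H₃) (fun n => g (F n)) (fun n => k (g (F n)))
        (fun n => mfderiv 𝓘(ℝ, H₂) 𝓘(ℝ, H₃) k (g (F n))) n₀) n₀ :=
    ContMDiffAt.mfderiv (n := ∞) (fun _ => k) (fun n => g (F n))
      ((hk _).comp (n₀, g (F n₀)) contMDiffAt_snd) h1 (by simp)
  have h3 : ContMDiffAt 𝓘(ℝ, H') 𝓘(ℝ, H₁ →L[ℝ] H₂) ∞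
      (inTangentCoordinates 𝓘(ℝ, H₁) 𝓘(ℝ, H₂) (fun n => f (F n)) (fun n => g (F n))
        (fun n => φ (F n)) n₀) n₀ := hφ.comp n₀ hF
  exact contMDiffAt_inTangentCoordinates_comp (hf.comp hF.continuousAt) h1.continuousAt
    ((hk _).continuousAt.comp h1.continuousAt) h2 h3

end HomFamilies

theorem comp_snoc {V W : Type*} {k : ℕ} (T : V → W) (a : Fin k → V) (x : V) :
    (fun i => T (Fin.snoc (α := fun _ => V) a x i)) =
      Fin.snoc (α := fun _ => W) (fun i => T (a i)) (T x) := by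
  funext i
  refine Fin.lastCases ?_ (fun i => ?_) i
  · simp
  · simp

/-- The linear parts belong to tangent spaces at points not yet identified, so they are compared
through a common map `l` of model spaces. -/
theorem FirstJet.ext_of_eq {m : ℕ} {M : Type*} [TopologicalSpace M] [ChartedSpace (BaseModel m) M]
    {H : Type*} [NormedAddCommGroup H] [NormedSpace ℝ H] {X : Type*} [TopologicalSpace X]
    [ChartedSpace H X] {τ : X → M} {j k : FirstJet m H τ} {l : BaseModel m →L[ℝ] H}
    (h1 : j.pt = k.pt) (h2 : j.lin = l) (h3 : k.lin = l) : j = k := by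
  obtain ⟨x, s, hs⟩ := j
  obtain ⟨y, t, ht⟩ := k
  dsimp only at h1
  subst h1
  congr 1
  exact h2.trans h3.symm

/-- The linear section given by a jet, as a map between model spaces. -/
def FirstJet.modelLin {m : ℕ} {M : Type*} [TopologicalSpace M] [ChartedSpace (BaseModel m) M]
    {H : Type*} [NormedAddCommGroup H] [NormedSpace ℝ H] {X : Type*} [TopologicalSpace X]
    [ChartedSpace H X] {τ : X → M} (j : FirstJet m H τ) : BaseModel m →L[ℝ] H := j.lin

theorem IsJetFieldOn.pt_eq {m : ℕ} {M : Type*} [TopologicalSpace M] [ChartedSpace (BaseModel m) M]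
    [IsManifold 𝓘(ℝ, BaseModel m) ∞ M] {HQ : Type*} [NormedAddCommGroup HQ] [NormedSpace ℝ HQ]
    {Q : Type*} [TopologicalSpace Q] [ChartedSpace HQ Q]
    {H : Type*} [NormedAddCommGroup H] [NormedSpace ℝ H] {X : Type*} [TopologicalSpace X]
    [ChartedSpace H X] [IsManifold 𝓘(ℝ, H) ∞ X] {τ : X → M} {g : Q → X} {S : Set Q}
    {Y : Q → FirstJet m H τ} (hY : IsJetFieldOn HQ τ g S Y) {n : Q} (hn : n ∈ S) :
    (Y n).pt = g n := by
  obtain ⟨U, hU, hnU, Y', h1, h2, h3⟩ := hY n hn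
  rw [h3 n ⟨hnU, hn⟩, h1 n hnU]

/-! ### Transfer of jet fields and of their field equations -/

section JetFields

variable {m N : ℕ} {M : Type*} [TopologicalSpace M] [ChartedSpace (BaseModel m) M]
  [IsManifold 𝓘(ℝ, BaseModel m) ∞ M]
  {E : Type*} [TopologicalSpace E] [ChartedSpace (TotalModel m N) E]
  [IsManifold 𝓘(ℝ, TotalModel m N) ∞ E]
  {π : E → M} [IsFiberedManifold m N π]
  {G : Type*} [NormedAddCommGroup G] [NormedSpace ℝ G] [FiniteDimensional ℝ G]
  {P : Type*} [TopologicalSpace P] [ChartedSpace G P] [IsManifold 𝓘(ℝ, G) ∞ P]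
  {vol : DiffForm (BaseModel m) M m} {L : J1 m N π → ℝ}
  {j0 : P → RestMomentum m N π} {FL0 : J1 m N π → P}

namespace IsAlmostRegular

variable (h : IsAlmostRegular (G := G) vol L j0 FL0) (hvol : IsVolumeForm vol)
  (hL : ContMDiff 𝓘(ℝ, JetModel m N) 𝓘(ℝ, ℝ) ∞ L)

/-- The differential of `h̃`, as a map between model spaces. -/
def dHamModel (p : P) : G →L[ℝ] MomModel m N := h.dHam p

/-- An Ehresmann connection form is a linear section of the projection. -/
theorem dMap_connection (h : IsAlmostRegular (G := G) vol L j0 FL0) {p : P}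
    {D : BaseModel m →L[ℝ] G}
    (hD : ∀ ξ : TangentSpace 𝓘(ℝ, G) p →L[ℝ] ℝ,
      (∀ v, dMap m G (hamBase j0) p v = 0 → ξ v = 0) →
        ∀ v, ξ (D (dMap m G (hamBase j0) p v)) = ξ v) (x : BaseModel m) :
    dMap m G (hamBase j0) p (D x) = x := by
  obtain ⟨v, hv⟩ := h.mfderiv_hamBase_surjective p x
  let T : G →L[ℝ] BaseModel m := dMap m G (hamBase j0) p
  have hv' : T v = x := hv
  show T (D x) = x
  ext i
  -- The coordinate covectors of the base, pulled back by the projection, are semibasic; testing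
  -- with them gives the equality of the components.
  have h1 := hD ((EuclideanSpace.proj i).comp T)
    (fun v hv => (congrArg (fun x : BaseModel m => x i) hv)) v
  have h2 : (T (D (T v))) i = (T v) i := h1
  rwa [hv'] at h2

include hvol hL

theorem hamForm_leg (j : J1 m N π) (V : Fin (m + 1) → G) :
    h.hamForm (FL0 j) V =
      multisymplecticForm π (extLegendre vol L j) (fun i => h.dHam (FL0 j) (V i)) :=
  (h.multisymplecticForm_hamSection hvol hL j _).symm

/-- By definition `Ω_h⁰` is `Ω` on images under `T h̃`, and the last argument is also such an image,
by `dLegendre_eq`. -/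
theorem jetContraction_leg (j : J1 m N π) (l : BaseModel m →L[ℝ] G) (Z : Fin m → BaseModel m)
    (w : TangentSpace 𝓘(ℝ, JetModel m N) j) :
    jetContraction (B := BaseModel m) (V := MomModel m N)
      (multisymplecticForm π (extLegendre vol L j)) ((h.dHam (FL0 j)).comp l) Z
      (dLegendre vol L j w) =
    jetContraction (B := BaseModel m) (V := G) (h.hamForm (FL0 j)) l Z
      (mfderiv 𝓘(ℝ, JetModel m N) 𝓘(ℝ, G) FL0 j w) := by
  refine Eq.trans ?_ (h.hamForm_leg hvol hL j _).symm
  let T : G →L[ℝ] MomModel m N := h.dHam (FL0 j)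
  let Ω : MomModel m N [⋀^Fin (m + 1)]→L[ℝ] ℝ := multisymplecticForm π (extLegendre vol L j)
  refine (congrArg (fun W => jetContraction Ω (T.comp l) Z W) (h.dLegendre_eq hvol hL j w)).trans ?_
  exact congrArg Ω (comp_snoc T (fun i => l (Z i)) _).symm

/-- The image of a jet under `j¹h̃`. -/
def mapJet (ψ : FirstJet m G (hamBase j0)) :
    FirstJet m (MomModel m N) (extBase (m := m) (N := N) π) where
  pt := h.hamSection ψ.pt
  lin := (h.dHam ψ.pt).comp ψ.lin
  isSection v := (h.dMap_dHam hvol hL _ _).trans (ψ.isSection v)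

/-- The jet field along `FL~` defined by a jet field on `P`. -/
def pushJet (Ψ : P → FirstJet m G (hamBase j0)) (j : J1 m N π) :
    FirstJet m (MomModel m N) (extBase (m := m) (N := N) π) := h.mapJet hvol hL (Ψ (FL0 j))

theorem pushJet_rel (S : Set (J1 m N π)) (Ψ : P → FirstJet m G (hamBase j0)) :
    h.JetRel S Ψ (h.pushJet hvol hL Ψ) := fun _ _ => ⟨rfl, rfl⟩

theorem jetRel_unique {S : Set (J1 m N π)} {Ψ : P → FirstJet m G (hamBase j0)}
    {Y : J1 m N π → FirstJet m (MomModel m N) (extBase (m := m) (N := N) π)}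
    (hY : h.JetRel S Ψ Y) {j : J1 m N π} (hj : j ∈ S) : Y j = h.pushJet hvol hL Ψ j :=
  FirstJet.ext_of_eq (hY j hj).1 (hY j hj).2 rfl

/-- A local extension of `Ψ` to an open set `U` of `P` gives one of the image on the open set `FL0
⁻¹' U`, smooth because `h̃` and `FL0` are. -/
theorem jetStructural_pushJet {S : Set (J1 m N π)} {Ψ : P → FirstJet m G (hamBase j0)}
    (hΨ : IsJetFieldOn G (hamBase j0) id (FL0 '' S) Ψ) :
    JetStructural vol L S (h.pushJet hvol hL Ψ) := by
  intro j hj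
  obtain ⟨U, hU, hjU, Ψ', h1, h2, h3⟩ := hΨ (FL0 j) (mem_image_of_mem _ hj)
  refine ⟨FL0 ⁻¹' U, hU.preimage h.smooth_leg.continuous, hjU, h.pushJet hvol hL Ψ', ?_, ?_, ?_⟩
  · intro k hk
    show h.hamSection (Ψ' (FL0 k)).pt = _
    rw [h1 _ hk]
    exact h.hamSection_leg hvol hL k
  · intro k hk
    have hg : ∀ᶠ p in 𝓝 (FL0 k), (Ψ' p).pt = p := by
      filter_upwards [hU.mem_nhds hk] with p hp using h1 p hp
    have hg' : ContMDiffAt 𝓘(ℝ, G) 𝓘(ℝ, G) ∞ (fun p => (Ψ' p).pt) (FL0 k) :=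
      contMDiffAt_id.congr_of_eventuallyEq hg
    have key := contMDiffAt_inTangentCoordinates_push
      (f := fun p => hamBase j0 (Ψ' p).pt) (g := fun p => (Ψ' p).pt) (φ := fun p => (Ψ' p).lin)
      (F := FL0) (k := h.hamSection) (n₀ := k)
      (ContinuousAt.comp (g := hamBase j0) h.contMDiff_hamBase.continuous.continuousAt
        hg'.continuousAt) hg' (h.smooth_leg k) (h.contMDiff_hamSection hvol hL) (h2 _ hk)
    exact contMDiffAt_inTangentCoordinates_congr key
      (Filter.Eventually.of_forall fun n => h.extBase_hamSection hvol hL _)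
      (Filter.Eventually.of_forall fun _ => rfl) (Filter.Eventually.of_forall fun _ => rfl)
  · intro k hk
    exact congrArg (h.mapJet hvol hL) (h3 _ ⟨hk.1, mem_image_of_mem _ hk.2⟩)

theorem jetStructural_of_rel {S : Set (J1 m N π)} {Ψ : P → FirstJet m G (hamBase j0)}
    (hΨ : IsJetFieldOn G (hamBase j0) id (FL0 '' S) Ψ)
    {Y : J1 m N π → FirstJet m (MomModel m N) (extBase (m := m) (N := N) π)}
    (hY : h.JetRel S Ψ Y) : JetStructural vol L S Y := by
  intro j hj
  obtain ⟨U, hU, hjU, Y', h1, h2, h3⟩ := h.jetStructural_pushJet hvol hL hΨ j hj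
  exact ⟨U, hU, hjU, Y', h1, h2, fun k hk =>
    (h.jetRel_unique hvol hL hY hk.2).trans (h3 k hk)⟩

/-- The relation involves `T h̃` at the point of the jet `Ψ (FL0 j)`. On `FL0 '' S` this point is
`FL0 j`, because there `Ψ` agrees with a field along the identity. -/
theorem jetRel_lin {S : Set (J1 m N π)} {Ψ : P → FirstJet m G (hamBase j0)}
    (hΨ : IsJetFieldOn G (hamBase j0) id (FL0 '' S) Ψ)
    {Y : J1 m N π → FirstJet m (MomModel m N) (extBase (m := m) (N := N) π)}
    (hY : h.JetRel S Ψ Y) {j : J1 m N π} (hj : j ∈ S) :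
    (Y j).modelLin = (h.dHamModel (FL0 j)).comp (Ψ (FL0 j)).modelLin := by
  have h1 : (Ψ (FL0 j)).pt = FL0 j := hΨ.pt_eq (mem_image_of_mem _ hj)
  exact Eq.trans (b := (h.dHamModel (Ψ (FL0 j)).pt).comp (Ψ (FL0 j)).modelLin) (hY j hj).2
    (congrArg (fun p => (h.dHamModel p).comp (Ψ (FL0 j)).modelLin) h1)

/-- The two contractions agree when their last arguments are `w` and `T FL0 w`; surjectivity of `T
FL0` makes the equation on `P` follow from that along the Legendre map. -/
theorem jetFieldEq_iff {S : Set (J1 m N π)} {Ψ : P → FirstJet m G (hamBase j0)}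
    (hΨ : IsJetFieldOn G (hamBase j0) id (FL0 '' S) Ψ)
    {Y : J1 m N π → FirstJet m (MomModel m N) (extBase (m := m) (N := N) π)}
    (hY : h.JetRel S Ψ Y) : JetFieldEq vol L S Y ↔ ∀ p ∈ FL0 '' S, ∀ Z W,
      jetContraction (B := BaseModel m) (V := G) (h.hamForm p) (Ψ p).lin Z W = 0 := by
  have key : ∀ j ∈ S, ∀ Z w, jetContraction (B := BaseModel m) (V := MomModel m N)
      (multisymplecticForm π (extLegendre vol L j)) (Y j).lin Z (dLegendre vol L j w) =
      jetContraction (B := BaseModel m) (V := G) (h.hamForm (FL0 j)) (Ψ (FL0 j)).lin Z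
        (mfderiv 𝓘(ℝ, JetModel m N) 𝓘(ℝ, G) FL0 j w) := by
    intro j hj Z w
    refine Eq.trans ?_ (h.jetContraction_leg hvol hL j (Ψ (FL0 j)).modelLin Z w)
    exact congrArg (fun l : BaseModel m →L[ℝ] MomModel m N =>
      jetContraction (B := BaseModel m) (V := MomModel m N)
        (multisymplecticForm π (extLegendre vol L j)) l Z (dLegendre vol L j w))
      (h.jetRel_lin hvol hL hΨ hY hj)
  constructor
  · rintro hE _ ⟨j, hj, rfl⟩ Z W
    obtain ⟨w, rfl⟩ := h.submersion j W
    exact (key j hj Z w).symm.trans (hE j hj Z w)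
  · intro hE j hj Z w
    exact (key j hj Z w).trans (hE _ (mem_image_of_mem _ hj) Z _)

/-! ### Connections -/

/-- As `h̃` covers the identity of `M`, `T h̃` intertwines the endomorphism `D ∘ T τ₀` with the one
defined by `T h̃ ∘ D`, so each insertion is carried to the corresponding one. -/
theorem tensorContraction_leg (j : J1 m N π) (D : BaseModel m →L[ℝ] G)
    (w : Fin (m + 1) → TangentSpace 𝓘(ℝ, JetModel m N) j) :
    tensorContraction (V := MomModel m N) (multisymplecticForm π (extLegendre vol L j))
      (((h.dHam (FL0 j)).comp D).comp
        (dMap m (MomModel m N) (extBase π) (extLegendre vol L j)))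
      (fun i => dLegendre vol L j (w i)) =
    tensorContraction (V := G) (h.hamForm (FL0 j)) (D.comp (dMap m G (hamBase j0) (FL0 j)))
      (fun i => mfderiv 𝓘(ℝ, JetModel m N) 𝓘(ℝ, G) FL0 j (w i)) := by
  let T : G →L[ℝ] MomModel m N := h.dHam (FL0 j)
  let Ω : MomModel m N [⋀^Fin (m + 1)]→L[ℝ] ℝ := multisymplecticForm π (extLegendre vol L j)
  let B : ExtMomentum m N π → MomModel m N →L[ℝ] BaseModel m := dMap m (MomModel m N) (extBase π)
  let B₀ : G →L[ℝ] BaseModel m := dMap m G (hamBase j0) (FL0 j)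
  let W : Fin (m + 1) → G := fun i => mfderiv 𝓘(ℝ, JetModel m N) 𝓘(ℝ, G) FL0 j (w i)
  have h1 : (fun i => dLegendre vol L j (w i)) = fun i => T (W i) :=
    funext fun i => h.dLegendre_eq hvol hL j (w i)
  have h2 : ∀ v, B (extLegendre vol L j) (T v) = B₀ v := fun v =>
    (congrArg (fun q => B q (T v)) (h.hamSection_leg hvol hL j).symm).trans
      (h.dMap_dHam hvol hL (FL0 j) v)
  refine (congrArg (tensorContraction Ω ((T.comp D).comp (B (extLegendre vol L j)))) h1).trans ?_
  refine Finset.sum_congr rfl fun i _ => ?_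
  refine Eq.trans ?_ (h.hamForm_leg hvol hL j (Function.update W i (D (B₀ (W i))))).symm
  refine congrArg Ω ?_
  refine Eq.trans ?_ (Function.comp_update T W i (D (B₀ (W i)))).symm
  exact congrArg (fun x => Function.update (fun i => T (W i)) i (T (D x))) (h2 (W i))

theorem connFieldEq_iff {S : Set (J1 m N π)} {D : IsAlmostRegular.HamConn (G := G) j0}
    {D' : ExtConn vol L} (hD : h.ConnRel S D D') :
    ConnFieldEq vol L S D' ↔ ∀ p ∈ FL0 '' S, ∀ w : Fin (m + 1) → TangentSpace 𝓘(ℝ, G) p,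
      tensorContraction (h.hamForm p) ((D p).comp (dMap m G (hamBase j0) p)) w =
        ((m : ℝ) - 1) * h.hamForm p w := by
  have key : ∀ j ∈ S, ∀ w : Fin (m + 1) → TangentSpace 𝓘(ℝ, JetModel m N) j,
      tensorContraction (multisymplecticForm π (extLegendre vol L j))
        ((D' j).comp (dMap m (MomModel m N) (extBase π) (extLegendre vol L j)))
        (fun i => dLegendre vol L j (w i)) =
      tensorContraction (h.hamForm (FL0 j)) ((D (FL0 j)).comp (dMap m G (hamBase j0) (FL0 j)))
        (fun i => mfderiv 𝓘(ℝ, JetModel m N) 𝓘(ℝ, G) FL0 j (w i)) := by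
    intro j hj w
    rw [hD j hj]
    exact h.tensorContraction_leg hvol hL j (D (FL0 j)) w
  have key2 : ∀ j, ∀ w : Fin (m + 1) → TangentSpace 𝓘(ℝ, JetModel m N) j,
      multisymplecticForm π (extLegendre vol L j) (fun i => dLegendre vol L j (w i)) =
      h.hamForm (FL0 j) (fun i => mfderiv 𝓘(ℝ, JetModel m N) 𝓘(ℝ, G) FL0 j (w i)) := by
    intro j w
    refine Eq.trans ?_ (h.hamForm_leg hvol hL j _).symm
    congr 1
    funext i
    exact h.dLegendre_eq hvol hL j (w i)
  constructor
  · rintro hE _ ⟨j, hj, rfl⟩ W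
    -- Here all `m + 1` arguments are pulled back, so each of them is lifted through the submersion.
    choose w hw using fun i => h.submersion j (W i)
    obtain rfl : (fun i => mfderiv 𝓘(ℝ, JetModel m N) 𝓘(ℝ, G) FL0 j (w i)) = W := funext hw
    rw [← key2]
    exact (key j hj w).symm.trans (hE j hj w)
  · intro hE j hj w
    rw [key2]
    exact (key j hj w).trans (hE _ (mem_image_of_mem _ hj) _)

/-- The connection along `FL~` defined by a connection on `P`. -/
def pushConn (_ : IsVolumeForm vol) (_ : ContMDiff 𝓘(ℝ, JetModel m N) 𝓘(ℝ, ℝ) ∞ L)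
    (D : IsAlmostRegular.HamConn (G := G) j0) : ExtConn vol L := fun j =>
  (h.dHam (FL0 j)).comp (D (FL0 j) : BaseModel m →L[ℝ] G)

theorem connStructural_of_rel {S : Set (J1 m N π)} {D : IsAlmostRegular.HamConn (G := G) j0}
    (hC : IsConnectionOn G (hamBase j0) id (FL0 '' S) D) {D' : ExtConn vol L}
    (hD : h.ConnRel S D D') : ConnStructural vol L S D' := by
  intro j hj
  obtain ⟨U, hU, hjU, D₁, h1, h2, h3⟩ := hC (FL0 j) (mem_image_of_mem _ hj)
  refine ⟨FL0 ⁻¹' U, hU.preimage h.smooth_leg.continuous, hjU, h.pushConn hvol hL D₁, ?_, ?_, ?_⟩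
  · intro k hk
    have key := contMDiffAt_inTangentCoordinates_push
      (f := hamBase j0) (g := id) (φ := fun p => D₁ p)
      (F := FL0) (k := h.hamSection) (n₀ := k)
      h.contMDiff_hamBase.continuous.continuousAt contMDiffAt_id (h.smooth_leg k)
      (h.contMDiff_hamSection hvol hL) (h1 _ hk)
    exact contMDiffAt_inTangentCoordinates_congr key
      (Filter.Eventually.of_forall fun n => (congrArg (extBase π)
        (h.hamSection_leg hvol hL n).symm).trans (h.extBase_hamSection hvol hL _))
      (Filter.Eventually.of_forall fun n => (h.hamSection_leg hvol hL n).symm)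
      (Filter.Eventually.of_forall fun _ => rfl)
  · intro k hk ξ hξ (v : MomModel m N)
    have hs : ∀ x : BaseModel m, dMap m (MomModel m N) (extBase π) (extLegendre vol L k)
        (h.dHam (FL0 k) (D₁ (FL0 k) x)) = x := by
      intro x
      let T : ExtMomentum m N π → MomModel m N →L[ℝ] BaseModel m :=
        dMap m (MomModel m N) (extBase π)
      refine Eq.trans ?_ (h.dMap_connection (h2 _ hk) x)
      refine Eq.trans ?_ (h.dMap_dHam hvol hL (FL0 k) _)
      exact congrArg (fun q => T q (h.dHam (FL0 k) (D₁ (FL0 k) x)))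
        (h.hamSection_leg hvol hL k).symm
    let T : MomModel m N →L[ℝ] BaseModel m := dMap m (MomModel m N) (extBase π) (extLegendre vol L k)
    let ξ' : MomModel m N →L[ℝ] ℝ := ξ
    let D₂ : BaseModel m →L[ℝ] MomModel m N := h.pushConn hvol hL D₁ k
    -- As `D₂` is a section of `T`, this difference is vertical, and a semibasic covector
    -- annihilates it.
    have h4 : T (D₂ (T v) - v) = 0 := by
      rw [map_sub, sub_eq_zero]
      exact hs _
    have h5 : ξ' (D₂ (T v) - v) = 0 := hξ _ h4
    rw [map_sub, sub_eq_zero] at h5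
    exact h5
  · intro k hk
    rw [hD k hk.2]
    have h4 := h3 (FL0 k) ⟨hk.1, mem_image_of_mem _ hk.2⟩
    rw [h4]
    rfl

end IsAlmostRegular

end JetFields

end FieldTheory

end

noncomputable section

namespace FieldTheory

/-! ### Exterior powers -/

section ExteriorPowers

variable {V V' F : Type*} [AddCommGroup V] [Module ℝ V] [AddCommGroup V'] [Module ℝ V']
  [AddCommGroup F] [Module ℝ F] {m : ℕ}

theorem alternatingMapLinearEquiv_map (f : V' [⋀^Fin m]→ₗ[ℝ] F) (T : V →ₗ[ℝ] V') (X : ⋀[ℝ]^m V) :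
    exteriorPower.alternatingMapLinearEquiv f (exteriorPower.map m T X) =
      exteriorPower.alternatingMapLinearEquiv (f.compLinearMap T) X := by
  have h : (exteriorPower.alternatingMapLinearEquiv f).comp (exteriorPower.map m T) =
      exteriorPower.alternatingMapLinearEquiv (f.compLinearMap T) := by
    apply exteriorPower.linearMap_ext
    ext x
    simp
    rfl
  exact LinearMap.congr_fun h X

/-- Both sides are alternating in the rows of `A`, so it suffices to compare them on permutations of
the standard basis, where both give the sign. -/
theorem ιMulti_sum_smul (A : Matrix (Fin m) (Fin m) ℝ) (x : Fin m → V) :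
    exteriorPower.ιMulti ℝ m (fun i => ∑ l, A i l • x l) =
      A.det • exteriorPower.ιMulti ℝ m x := by
  let T : (Fin m → ℝ) →ₗ[ℝ] V := Fintype.linearCombination ℝ x
  have h : (exteriorPower.ιMulti ℝ m).compLinearMap T =
      (LinearMap.toSpanSingleton ℝ _ (exteriorPower.ιMulti ℝ m x)).compAlternatingMap
        (Matrix.detRowAlternating (n := Fin m) (R := ℝ)) := by
    refine Module.Basis.ext_alternating (Pi.basisFun ℝ (Fin m)) fun v hv => ?_
    obtain ⟨σ, rfl⟩ : ∃ σ : Equiv.Perm (Fin m), ⇑σ = v :=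
      ⟨Equiv.ofBijective v (Finite.injective_iff_bijective.1 hv), rfl⟩
    have h1 : ∀ i, T (Pi.basisFun ℝ (Fin m) (σ i)) = x (σ i) := fun i => by
      simp [T, Fintype.linearCombination_apply, Pi.single_apply]
    have h2 : (fun i => Pi.basisFun ℝ (Fin m) (σ i)) = (Pi.basisFun ℝ (Fin m)) ∘ σ := rfl
    rw [AlternatingMap.compLinearMap_apply, LinearMap.compAlternatingMap_apply, h2,
      AlternatingMap.map_perm]
    have h3 : (Matrix.detRowAlternating (n := Fin m) (R := ℝ)) (Pi.basisFun ℝ (Fin m)) = 1 := by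
      have : (Pi.basisFun ℝ (Fin m) : Fin m → Fin m → ℝ) = (1 : Matrix (Fin m) (Fin m) ℝ) := by
        ext i j
        simp [Matrix.one_apply, Pi.single_apply, eq_comm]
      rw [this]
      exact Matrix.det_one
    rw [h3]
    have h4 : (fun i => T ((Pi.basisFun ℝ (Fin m) ∘ σ) i)) = x ∘ σ := funext h1
    have h5 : (exteriorPower.ιMulti ℝ m) (fun i => T ((Pi.basisFun ℝ (Fin m) ∘ σ) i)) =
      (exteriorPower.ιMulti ℝ m) (x ∘ σ) := congrArg _ h4
    refine h5.trans ?_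
    rw [AlternatingMap.map_perm, LinearMap.toSpanSingleton_apply]
    rcases Int.units_eq_one_or (Equiv.Perm.sign σ) with h | h <;> simp [h]
  have h1 := DFunLike.congr_fun h (fun i => A i)
  refine Eq.trans ?_ h1
  simp [T, Fintype.linearCombination_apply]

/-- The scalar is absorbed by the first factor, which exists because `m ≥ 1`. -/
theorem smul_ιMulti (hm : 0 < m) (c : ℝ) (x : Fin m → V) :
    c • exteriorPower.ιMulti ℝ m x =
      exteriorPower.ιMulti ℝ m (Function.update x ⟨0, hm⟩ (c • x ⟨0, hm⟩)) := by
  rw [AlternatingMap.map_update_smul, Function.update_eq_self]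

/-- The `i`-th vector of the dual frame of the covectors `ξ` in the space spanned by a decomposable
`m`-vector, multiplied by the value of `ξ₁ ∧ … ∧ ξ_m`. -/
def cofactorVec {κ : Type*} [Fintype κ] (b : Module.Basis κ ℝ V) (ξ : Fin m → Module.Dual ℝ V)
    (i : Fin m) (X : ⋀[ℝ]^m V) : V :=
  ∑ k, exteriorPower.pairingDual ℝ V m (exteriorPower.ιMulti ℝ m (Function.update ξ i (b.coord k))) X
    • b k

/-- Cramer's rule: replacing the covector `ξᵢ` by a coordinate covector replaces column `i` of the
matrix `ξ_c(x_a)`, and the resulting determinants are given by the adjugate. -/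
theorem cofactorVec_ιMulti {κ : Type*} [Fintype κ] (b : Module.Basis κ ℝ V)
    (ξ : Fin m → Module.Dual ℝ V) (i : Fin m) (x : Fin m → V) :
    cofactorVec b ξ i (exteriorPower.ιMulti ℝ m x) =
      ∑ l, (Matrix.of fun a c => ξ c (x a)).adjugate i l • x l := by
  set A : Matrix (Fin m) (Fin m) ℝ := Matrix.of fun a c => ξ c (x a) with hA
  have h1 : ∀ k, exteriorPower.pairingDual ℝ V m
      (exteriorPower.ιMulti ℝ m (Function.update ξ i (b.coord k))) (exteriorPower.ιMulti ℝ m x) =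
      ∑ l, A.adjugate i l * b.coord k (x l) := by
    intro k
    rw [exteriorPower.pairingDual_ιMulti_ιMulti]
    have h2 : (Matrix.of fun a c => (Function.update ξ i (b.coord k)) c (x a)) =
        A.updateCol i (fun a => b.coord k (x a)) := by
      ext a c
      by_cases hc : c = i
      · subst hc
        simp
      · simp [Matrix.updateCol_ne hc, Function.update_of_ne hc, hA]
    rw [h2, ← Matrix.cramer_apply, Matrix.cramer_eq_adjugate_mulVec]
    rfl
  unfold cofactorVec
  simp only [h1, Finset.sum_smul]
  rw [Finset.sum_comm]
  refine Finset.sum_congr rfl fun l _ => ?_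
  simp only [mul_smul]
  rw [← Finset.smul_sum]
  congr 1
  exact b.sum_repr (x l)

/-- By `det (adj A) = (det A)^(m-1)`, with `det A` the pairing of `ξ` with `X`. The cofactor vectors
are linear in `X`, so where the pairing is nonzero they provide smooth factors of `X`. -/
theorem ιMulti_cofactorVec {κ : Type*} [Fintype κ] (b : Module.Basis κ ℝ V)
    (ξ : Fin m → Module.Dual ℝ V) {X : ⋀[ℝ]^m V} (hX : ∃ x, X = exteriorPower.ιMulti ℝ m x) :
    exteriorPower.ιMulti ℝ m (fun i => cofactorVec b ξ i X) =
      (exteriorPower.pairingDual ℝ V m (exteriorPower.ιMulti ℝ m ξ) X) ^ (m - 1) • X := by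
  obtain ⟨x, rfl⟩ := hX
  simp only [cofactorVec_ιMulti]
  rw [ιMulti_sum_smul, Matrix.det_adjugate, Fintype.card_fin,
    exteriorPower.pairingDual_ιMulti_ιMulti]

theorem mvContraction_map [TopologicalSpace V] [TopologicalSpace V']
    {Ξ : V [⋀^Fin (m + 1)]→L[ℝ] ℝ} {Ξ' : V' [⋀^Fin (m + 1)]→L[ℝ] ℝ} (T : V →ₗ[ℝ] V')
    (h : ∀ u : Fin (m + 1) → V, Ξ u = Ξ' (fun i => T (u i))) (X : ⋀[ℝ]^m V) (W : V) :
    mvContraction Ξ' (exteriorPower.map m T X) (T W) = mvContraction Ξ X W := by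
  unfold mvContraction
  rw [alternatingMapLinearEquiv_map]
  congr 3
  ext u
  show Ξ' (Matrix.vecCons (T W) (fun i => T (u i))) = Ξ (Matrix.vecCons W u)
  rw [h]
  congr 1
  funext i
  refine Fin.cases ?_ (fun i => ?_) i <;> rfl

theorem mvContraction_smul [TopologicalSpace V] (Ξ : V [⋀^Fin (m + 1)]→L[ℝ] ℝ) (c : ℝ)
    (X : ⋀[ℝ]^m V) (W : V) : mvContraction Ξ (c • X) W = c * mvContraction Ξ X W := by
  unfold mvContraction
  rw [map_smul, smul_eq_mul]
  ring

/-- The contraction with an `m`-vector inserts `W` in the first place, that with a jet in the last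
one. A cyclic permutation relates them; its sign is irrelevant for vanishing. -/
theorem mvContraction_ιMulti_eq_zero_iff [TopologicalSpace V] (Ξ : V [⋀^Fin (m + 1)]→L[ℝ] ℝ)
    (x : Fin m → V) (W : V) : mvContraction Ξ (exteriorPower.ιMulti ℝ m x) W = 0 ↔
      Ξ (Fin.snoc (α := fun _ => V) x W) = 0 := by
  have h1 : Ξ (Fin.snoc (α := fun _ => V) x W) =
      Equiv.Perm.sign (finRotate (m + 1)) • Ξ (Fin.cons (α := fun _ => V) W x) := by
    have h2 : Fin.snoc (α := fun _ => V) x W = Fin.cons (α := fun _ => V) W x ∘ finRotate (m + 1) := by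
      rw [Fin.snoc_eq_cons_rotate]
      rfl
    rw [h2]
    exact Ξ.toAlternatingMap.map_perm _ _
  rw [h1, smul_eq_zero_iff_eq]
  unfold mvContraction
  rw [mul_eq_zero, or_iff_right (pow_ne_zero _ (by norm_num)),
    exteriorPower.alternatingMapLinearEquiv_apply_ιMulti]
  rfl

end ExteriorPowers

/-! ### Smooth dependence of images of multivectors -/

section Smoothness

variable {H H₁ H₂ : Type*} [NormedAddCommGroup H] [NormedSpace ℝ H]
  [NormedAddCommGroup H₁] [NormedSpace ℝ H₁] [FiniteDimensional ℝ H₁]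
  [NormedAddCommGroup H₂] [NormedSpace ℝ H₂] [FiniteDimensional ℝ H₂]
  {Q : Type*} [TopologicalSpace Q] [ChartedSpace H Q] {m : ℕ}

/-- In a basis, a multilinear map on a finite-dimensional space is a polynomial in the coordinates.
-/
theorem contDiff_multilinear (f : MultilinearMap ℝ (fun _ : Fin m => H₁) ℝ) :
    ContDiff ℝ ∞ (fun v : Fin m → H₁ => f v) := by
  let b := Module.finBasis ℝ H₁
  have h1 : (fun v : Fin m → H₁ => f v) = fun v => ∑ r : Fin m → Fin (Module.finrank ℝ H₁),
      (∏ i, b.coord (r i) (v i)) * f (fun i => b (r i)) := by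
    funext v
    have h2 : v = fun i => ∑ k, b.coord k (v i) • b k := funext fun i => (b.sum_repr (v i)).symm
    conv_lhs => rw [h2]
    rw [MultilinearMap.map_sum]
    refine Finset.sum_congr rfl fun r _ => ?_
    rw [MultilinearMap.map_smul_univ, smul_eq_mul]
  rw [h1]
  refine ContDiff.sum fun r _ => ContDiff.mul (contDiff_prod fun i _ => ?_) contDiff_const
  exact (LinearMap.toContinuousLinearMap (b.coord (r i))).contDiff.comp (contDiff_apply ℝ H₁ i)

/-- In the induced basis of the exterior power, `K` has smooth coefficients, and `θ` of the image of
a basis element is multilinear in the images of finitely many fixed vectors under `A n`. -/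
theorem contMDiffAt_exteriorPower_map {A : Q → H₁ →L[ℝ] H₂} {K : Q → ⋀[ℝ]^m H₁} {n : Q}
    (hA : ContMDiffAt 𝓘(ℝ, H) 𝓘(ℝ, H₁ →L[ℝ] H₂) ∞ A n)
    (hK : ∀ θ : Module.Dual ℝ (⋀[ℝ]^m H₁), ContMDiffAt 𝓘(ℝ, H) 𝓘(ℝ, ℝ) ∞ (fun n => θ (K n)) n)
    (θ : Module.Dual ℝ (⋀[ℝ]^m H₂)) :
    ContMDiffAt 𝓘(ℝ, H) 𝓘(ℝ, ℝ) ∞ (fun n => θ (exteriorPower.map m (A n).toLinearMap (K n))) n := by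
  let b := Module.finBasis ℝ H₁
  let B := b.exteriorPower m
  have h1 : (fun n => θ (exteriorPower.map m (A n).toLinearMap (K n))) = fun n =>
      ∑ s, B.coord s (K n) * θ (exteriorPower.ιMulti ℝ m
        (fun i => A n (b (Set.powersetCard.ofFinEmbEquiv.symm s i)))) := by
    funext n
    conv_lhs => rw [← B.sum_repr (K n)]
    rw [map_sum, map_sum]
    refine Finset.sum_congr rfl fun s _ => ?_
    rw [map_smul, map_smul, smul_eq_mul]
    congr 2
    have h2 : B s = exteriorPower.ιMulti_family ℝ m b s := exteriorPower.basis_apply ..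
    rw [h2, exteriorPower.map_apply_ιMulti_family]
    rfl
  rw [h1]
  refine contMDiffAt_finsetSum fun s _ => ContMDiffAt.mul (hK _) ?_
  have h3 := contDiff_multilinear (θ.compAlternatingMap (exteriorPower.ιMulti ℝ m)).toMultilinearMap
  refine h3.contMDiff.contMDiffAt.comp n (contMDiffAt_pi_space.2 fun i => ?_)
  exact hA.clm_apply contMDiffAt_const

end Smoothness

end FieldTheory

end

noncomputable section

namespace FieldTheory

/-! ### Smooth vector and multivector fields along maps -/

section VectorFields

variable {H H₁ H₂ H' : Type*} [NormedAddCommGroup H] [NormedSpace ℝ H]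
  [NormedAddCommGroup H₁] [NormedSpace ℝ H₁]
  [NormedAddCommGroup H₂] [NormedSpace ℝ H₂]
  [NormedAddCommGroup H'] [NormedSpace ℝ H']
  {Q X X' Q' : Type*} [TopologicalSpace Q] [ChartedSpace H Q]
  [TopologicalSpace X] [ChartedSpace H₁ X] [IsManifold 𝓘(ℝ, H₁) ∞ X]
  [TopologicalSpace X'] [ChartedSpace H₂ X'] [IsManifold 𝓘(ℝ, H₂) ∞ X']
  [TopologicalSpace Q'] [ChartedSpace H' Q']

theorem tangentBundle_mk_congr {x x' : X} (h : x = x') (v : H₁) :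
    (⟨x, v⟩ : TangentBundle 𝓘(ℝ, H₁) X) = ⟨x', v⟩ := by
  subst h
  rfl

theorem contMDiffAt_tangentBundle_model {e y : Q → H₁} {n : Q}
    (he : ContMDiffAt 𝓘(ℝ, H) 𝓘(ℝ, H₁) ∞ e n) (hy : ContMDiffAt 𝓘(ℝ, H) 𝓘(ℝ, H₁) ∞ y n) :
    ContMDiffAt 𝓘(ℝ, H) 𝓘(ℝ, H₁).tangent ∞
      (fun n => (⟨e n, y n⟩ : TangentBundle 𝓘(ℝ, H₁) H₁)) n := by
  rw [Bundle.contMDiffAt_totalSpace]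
  refine ⟨he, ?_⟩
  simpa using hy

/-- A vector field along `g` with smooth components in a chart is the tangent map of the inverse
chart applied to a smooth map into the tangent bundle of the model space. -/
theorem contMDiffAt_chart_vectorField {g : Q → X} {y : Q → H₁} {x₀ : X} {n : Q}
    (hg : ContMDiffAt 𝓘(ℝ, H) 𝓘(ℝ, H₁) ∞ g n) (hn : g n ∈ (chartAt H₁ x₀).source)
    (hy : ContMDiffAt 𝓘(ℝ, H) 𝓘(ℝ, H₁) ∞ y n) :
    ContMDiffAt 𝓘(ℝ, H) 𝓘(ℝ, H₁).tangent ∞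
      (fun n => (⟨g n, mfderiv 𝓘(ℝ, H₁) 𝓘(ℝ, H₁) (chartAt H₁ x₀).symm (chartAt H₁ x₀ (g n)) (y n)⟩ :
        TangentBundle 𝓘(ℝ, H₁) X)) n := by
  set e := chartAt H₁ x₀ with he
  have h1 : ContMDiffAt 𝓘(ℝ, H) 𝓘(ℝ, H₁).tangent ∞
      (fun n => (⟨e (g n), y n⟩ : TangentBundle 𝓘(ℝ, H₁) H₁)) n :=
    contMDiffAt_tangentBundle_model ((contMDiffOn_chart.contMDiffAt
      (e.open_source.mem_nhds hn)).comp n hg) hy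
  -- The inverse chart is smooth on its target only, hence the tangent map within that open set; at
  -- its points this is the ordinary tangent map.
  have h2 : ContMDiffOn 𝓘(ℝ, H₁).tangent 𝓘(ℝ, H₁).tangent ∞
      (tangentMapWithin 𝓘(ℝ, H₁) 𝓘(ℝ, H₁) e.symm e.target)
      (Bundle.TotalSpace.proj ⁻¹' e.target) :=
    (contMDiffOn_chart_symm (I := 𝓘(ℝ, H₁)) (n := ∞) (x := x₀)).contMDiffOn_tangentMapWithin
      (by simp) e.open_target.uniqueMDiffOn
  have ho : IsOpen (Bundle.TotalSpace.proj ⁻¹' e.target : Set (TangentBundle 𝓘(ℝ, H₁) H₁)) :=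
    e.open_target.preimage (FiberBundle.continuous_proj H₁ (TangentSpace 𝓘(ℝ, H₁)))
  have hm : (⟨e (g n), y n⟩ : TangentBundle 𝓘(ℝ, H₁) H₁) ∈
      (Bundle.TotalSpace.proj ⁻¹' e.target : Set (TangentBundle 𝓘(ℝ, H₁) H₁)) := e.map_source hn
  have h3 := (h2.contMDiffAt (ho.mem_nhds hm)).comp n h1
  refine h3.congr_of_eventuallyEq ?_
  filter_upwards [hg.continuousAt.eventually_mem (e.open_source.mem_nhds hn)] with k hk
  have h4 : MDifferentiableAt 𝓘(ℝ, H₁) 𝓘(ℝ, H₁) e.symm (e (g k)) :=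
    (chart_mdifferentiable x₀).mdifferentiableAt_symm (e.map_source hk)
  simp only [Function.comp_apply]
  rw [tangentMapWithin_eq_tangentMap (e.open_target.uniqueMDiffWithinAt (e.map_source hk)) h4]
  exact tangentBundle_mk_congr (e.left_inv hk).symm _

theorem contMDiffOn_push_vectorField {g : Q → X} {Y : Q → H₁} {U : Set Q}
    (hY : ContMDiffOn 𝓘(ℝ, H) 𝓘(ℝ, H₁).tangent ∞
      (fun n => (⟨g n, Y n⟩ : TangentBundle 𝓘(ℝ, H₁) X)) U) {F : Q' → Q}
    (hF : ContMDiff 𝓘(ℝ, H') 𝓘(ℝ, H) ∞ F) {k : X → X'} (hk : ContMDiff 𝓘(ℝ, H₁) 𝓘(ℝ, H₂) ∞ k) :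
    ContMDiffOn 𝓘(ℝ, H') 𝓘(ℝ, H₂).tangent ∞ (fun n => (⟨k (g (F n)),
      mfderiv 𝓘(ℝ, H₁) 𝓘(ℝ, H₂) k (g (F n)) (Y (F n))⟩ : TangentBundle 𝓘(ℝ, H₂) X')) (F ⁻¹' U) :=
  (hk.contMDiff_tangentMap (m := ∞) (by simp)).comp_contMDiffOn
    (hY.comp hF.contMDiffOn (fun _ hn => hn))

theorem contMDiffOn_smul_vectorField {g : Q → X} {Y : Q → H₁} {f : Q → ℝ} {U : Set Q} (hU : IsOpen U)
    (hf : ContMDiffOn 𝓘(ℝ, H) 𝓘(ℝ, ℝ) ∞ f U)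
    (hY : ContMDiffOn 𝓘(ℝ, H) 𝓘(ℝ, H₁).tangent ∞
      (fun n => (⟨g n, Y n⟩ : TangentBundle 𝓘(ℝ, H₁) X)) U) :
    ContMDiffOn 𝓘(ℝ, H) 𝓘(ℝ, H₁).tangent ∞
      (fun n => (⟨g n, f n • Y n⟩ : TangentBundle 𝓘(ℝ, H₁) X)) U := by
  intro n hn
  refine ContMDiffAt.contMDiffWithinAt ?_
  have h1 := hY.contMDiffAt (hU.mem_nhds hn)
  rw [Bundle.contMDiffAt_totalSpace] at h1 ⊢
  refine ⟨h1.1, ((hf.contMDiffAt (hU.mem_nhds hn)).smul h1.2).congr_of_eventuallyEq ?_⟩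
  set t := trivializationAt H₁ (TangentSpace 𝓘(ℝ, H₁)) (g n) with ht
  filter_upwards [h1.1.continuousAt.eventually_mem (t.open_baseSet.mem_nhds
    (FiberBundle.mem_baseSet_trivializationAt H₁ (TangentSpace 𝓘(ℝ, H₁)) (g n)))] with k hk
  exact (t.linear ℝ hk).map_smul (f k) (Y k)

variable {m : ℕ}

/-- The `m`-vectors of a model space. -/
abbrev ModelMV (m : ℕ) (V : Type*) [NormedAddCommGroup V] [NormedSpace ℝ V] := ⋀[ℝ]^m V

/-- The image of an `m`-vector of a model space. -/
def mvPush (T : H₁ →L[ℝ] H₂) (K : ⋀[ℝ]^m H₁) : ⋀[ℝ]^m H₂ := exteriorPower.map m T.toLinearMap K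

theorem mvPush_comp {H₃ : Type*} [NormedAddCommGroup H₃] [NormedSpace ℝ H₃] (T₂ : H₂ →L[ℝ] H₃)
    (T₁ : H₁ →L[ℝ] H₂) (K : ⋀[ℝ]^m H₁) : mvPush (T₂.comp T₁) K = mvPush T₂ (mvPush T₁ K) :=
  LinearMap.congr_fun (exteriorPower.map_comp (n := m) T₁.toLinearMap T₂.toLinearMap) K

theorem mvPush_id (K : ⋀[ℝ]^m H₁) : mvPush (ContinuousLinearMap.id ℝ H₁) K = K :=
  LinearMap.congr_fun (exteriorPower.map_id (R := ℝ) (M := H₁) (n := m)) K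

theorem mvPush_ιMulti (T : H₁ →L[ℝ] H₂) (x : Fin m → H₁) :
    mvPush T (exteriorPower.ιMulti ℝ m x) = exteriorPower.ιMulti ℝ m (fun i => T (x i)) :=
  exteriorPower.map_apply_ιMulti _ _

theorem mvPush_smul (T : H₁ →L[ℝ] H₂) (c : ℝ) (K : ⋀[ℝ]^m H₁) :
    mvPush T (c • K) = c • mvPush T K := map_smul _ _ _

/-- `SmoothMVAt` for values in the exterior power of the model space. -/
def ModelSmoothMVAt (g : Q → X) (K : Q → ⋀[ℝ]^m H₁) (n : Q) : Prop :=
  ∀ θ : Module.Dual ℝ (⋀[ℝ]^m H₁), ContMDiffAt 𝓘(ℝ, H) 𝓘(ℝ, ℝ) ∞ (fun n' =>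
    θ (mvPush (H₁ := H₁) (H₂ := H₁) (mfderiv 𝓘(ℝ, H₁) 𝓘(ℝ, H₁) (chartAt H₁ (g n)) (g n')) (K n'))) n

/-- `IsSmoothMVOn` for values in the exterior power of the model space. -/
def IsModelSmoothMVOn (g : Q → X) (S : Set Q) (K : Q → ⋀[ℝ]^m H₁) : Prop :=
  ∀ n₀ ∈ S, ∃ U : Set Q, IsOpen U ∧ n₀ ∈ U ∧ ∃ K' : Q → ⋀[ℝ]^m H₁,
    (∀ n ∈ U, ModelSmoothMVAt (H := H) g K' n) ∧ ∀ n ∈ U ∩ S, K n = K' n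

/-- `IsLocallyDecomposableOn` for values in the exterior power of the model space. -/
def IsModelDecomposableOn (g : Q → X) (S : Set Q) (K : Q → ⋀[ℝ]^m H₁) : Prop :=
  ∀ n₀ ∈ S, ∃ U : Set Q, IsOpen U ∧ n₀ ∈ U ∧ ∃ Y : Fin m → Q → H₁,
    (∀ i, ContMDiffOn 𝓘(ℝ, H) 𝓘(ℝ, H₁).tangent ∞
      (fun n => (⟨g n, Y i n⟩ : TangentBundle 𝓘(ℝ, H₁) X)) U) ∧
    ∀ n ∈ U ∩ S, K n = exteriorPower.ιMulti ℝ m (fun i => Y i n)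

/-- Smoothness on a subset of `m`-vectors in a family of spaces with maps to a model space. The
instances are explicit so that tangent spaces can be replaced by the model space. -/
def SmoothMultivectorOn (V : Q → Type*) (_ : ∀ n, AddCommGroup (V n)) (_ : ∀ n, Module ℝ (V n))
    (T : Q → ∀ n, V n →ₗ[ℝ] H₁) (S : Set Q) (K : ∀ n, ⋀[ℝ]^m (V n)) : Prop :=
  ∀ n₀ ∈ S, ∃ U : Set Q, IsOpen U ∧ n₀ ∈ U ∧ ∃ K' : ∀ n, ⋀[ℝ]^m (V n),
    (∀ n ∈ U, ∀ θ : Module.Dual ℝ (⋀[ℝ]^m H₁), ContMDiffAt 𝓘(ℝ, H) 𝓘(ℝ, ℝ) ∞ (fun n' =>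
      θ (exteriorPower.map m (T n n') (K' n'))) n) ∧ ∀ n ∈ U ∩ S, K n = K' n

omit [IsManifold 𝓘(ℝ, H₁) ∞ X] in
-- Tangent spaces are the model space by definition. Stating the condition with the instances as
-- arguments makes the passage from one to the other a matter of definition.
theorem IsSmoothMVOn.model {g : Q → X} {S : Set Q} {K : Q → ⋀[ℝ]^m H₁}
    (hK : IsSmoothMVOn H (H := H₁) g S K) : IsModelSmoothMVOn (H := H) g S K :=
  have h1 : SmoothMultivectorOn (H := H) (H₁ := H₁) (fun n => TangentSpace 𝓘(ℝ, H₁) (g n))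
      inferInstance inferInstance (fun n n' =>
        (mfderiv 𝓘(ℝ, H₁) 𝓘(ℝ, H₁) (chartAt H₁ (g n)) (g n')).toLinearMap) S K := hK
  have h2 : SmoothMultivectorOn (H := H) (H₁ := H₁) (fun _ => H₁)
      inferInstance inferInstance (fun n n' =>
        (mfderiv 𝓘(ℝ, H₁) 𝓘(ℝ, H₁) (chartAt H₁ (g n)) (g n')).toLinearMap) S K := h1
  h2

theorem isLocallyDecomposableOn_iff {g : Q → X} {S : Set Q} {K : Q → ⋀[ℝ]^m H₁} :
    IsLocallyDecomposableOn H (H := H₁) g S K ↔ IsModelDecomposableOn (H := H) g S K := Iff.rfl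

/-- A locally decomposable multivector field is decomposable at each point. -/
theorem IsLocallyDecomposableOn.exists_eq_ιMulti {g : Q → X} {S : Set Q} {K : MVField H₁ m g}
    (hK : IsLocallyDecomposableOn H g S K) {n : Q} (hn : n ∈ S) :
    ∃ x : Fin m → TangentSpace 𝓘(ℝ, H₁) (g n), K n = exteriorPower.ιMulti ℝ m x := by
  obtain ⟨U, -, hU, Y, -, h⟩ := hK n hn
  exact ⟨fun i => Y i n, h n ⟨hU, hn⟩⟩

/-- Smoothness of a multivector field can be tested in any preferred chart. -/
theorem contMDiffAt_mvPush_chart [FiniteDimensional ℝ H₁] {g : Q → X} {K : Q → ⋀[ℝ]^m H₁} {n : Q}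
    (hK : ModelSmoothMVAt (H := H) g K n)
    (hg : ContMDiffAt 𝓘(ℝ, H) 𝓘(ℝ, H₁) ∞ g n) {x₀ : X} (hn : g n ∈ (chartAt H₁ x₀).source)
    (θ : Module.Dual ℝ (⋀[ℝ]^m H₁)) : ContMDiffAt 𝓘(ℝ, H) 𝓘(ℝ, ℝ) ∞ (fun n' =>
      θ (mvPush (H₁ := H₁) (H₂ := H₁) (mfderiv 𝓘(ℝ, H₁) 𝓘(ℝ, H₁) (chartAt H₁ x₀) (g n')) (K n'))) n := by
  set e₀ := chartAt H₁ x₀ with he₀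
  set e := chartAt H₁ (g n) with he
  have hne : g n ∈ e.source := mem_chart_source H₁ (g n)
  set s := (e.symm.trans e₀).source with hs
  have hso : IsOpen s := (e.symm.trans e₀).open_source
  have hns : e (g n) ∈ s := by
    refine ⟨e.map_source hne, ?_⟩
    show e.symm (e (g n)) ∈ e₀.source
    rw [e.left_inv hne]
    exact hn
  have ht : ContDiffOn ℝ ∞ (e₀ ∘ e.symm) s := by
    rw [← contMDiffOn_iff_contDiffOn]
    exact (contMDiffOn_chart (x := x₀)).comp ((contMDiffOn_chart_symm (x := g n)).mono
      fun u hu => hu.1) fun u hu => hu.2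
  -- The expressions of `K` in the two charts differ by the differential of the transition map,
  -- which depends smoothly on the point.
  have hA : ContMDiffAt 𝓘(ℝ, H) 𝓘(ℝ, H₁ →L[ℝ] H₁) ∞
      (fun n' => fderiv ℝ (e₀ ∘ e.symm) (e (g n'))) n := by
    have h1 : ContMDiffAt 𝓘(ℝ, H₁) 𝓘(ℝ, H₁ →L[ℝ] H₁) ∞ (fderiv ℝ (e₀ ∘ e.symm)) (e (g n)) :=
      ((ht.fderiv_of_isOpen hso le_rfl).contDiffAt (hso.mem_nhds hns)).contMDiffAt
    exact h1.comp n ((contMDiffOn_chart.contMDiffAt (e.open_source.mem_nhds hne)).comp n hg)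
  refine (contMDiffAt_exteriorPower_map hA hK θ).congr_of_eventuallyEq ?_
  filter_upwards [hg.continuousAt.eventually_mem (e.open_source.mem_nhds hne),
    hg.continuousAt.eventually_mem (e₀.open_source.mem_nhds hn)] with k h1 h2
  have h3 : mfderiv 𝓘(ℝ, H₁) 𝓘(ℝ, H₁) ((e₀ ∘ e.symm) ∘ e) (g k) =
      (mfderiv 𝓘(ℝ, H₁) 𝓘(ℝ, H₁) (e₀ ∘ e.symm) (e (g k))).comp
        (mfderiv 𝓘(ℝ, H₁) 𝓘(ℝ, H₁) e (g k)) := by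
    have hks : e (g k) ∈ s := by
      refine ⟨e.map_source h1, ?_⟩
      show e.symm (e (g k)) ∈ e₀.source
      rw [e.left_inv h1]
      exact h2
    exact mfderiv_comp (g k) ((ht.contDiffAt (hso.mem_nhds hks)).differentiableAt
      (by simp)).mdifferentiableAt ((chart_mdifferentiable (g n)).mdifferentiableAt h1)
  have h4 : (e₀ ∘ e.symm) ∘ e =ᶠ[𝓝 (g k)] e₀ := by
    filter_upwards [e.open_source.mem_nhds h1] with x hx
    exact congrArg e₀ (e.left_inv hx)
  have h5 := (h4.mfderiv_eq (I := 𝓘(ℝ, H₁)) (I' := 𝓘(ℝ, H₁))).symm.trans h3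
  rw [mfderiv_eq_fderiv] at h5
  exact (congrArg (fun T : H₁ →L[ℝ] H₁ => θ (mvPush (H₁ := H₁) (H₂ := H₁) T (K k))) h5).trans
    (congrArg θ (mvPush_comp (H₁ := H₁) (H₂ := H₁) (H₃ := H₁) _ _ _))

/-- The coordinates of an `m`-vector in the basis induced by `b` are pairings with exterior products
of dual basis covectors, and one of them is nonzero. -/
theorem exists_pairingDual_ne_zero {V : Type*} [AddCommGroup V] [Module ℝ V] [FiniteDimensional ℝ V]
    {A : ⋀[ℝ]^m V} (hA : A ≠ 0) : ∃ ξ : Fin m → Module.Dual ℝ V,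
      exteriorPower.pairingDual ℝ V m (exteriorPower.ιMulti ℝ m ξ) A ≠ 0 := by
  let b := Module.finBasis ℝ V
  by_contra! h
  apply hA
  refine (b.exteriorPower m).ext_elem fun s => ?_
  rw [map_zero, exteriorPower.basis_repr_apply]
  exact h _

theorem contMDiffAt_cofactorVec {ι : Type*} [Fintype ι] (b : Module.Basis ι ℝ H₁)
    (ξ : Fin m → Module.Dual ℝ H₁) (i : Fin m) {A : Q → ⋀[ℝ]^m H₁} {n : Q}
    (hA : ∀ θ : Module.Dual ℝ (⋀[ℝ]^m H₁),
      ContMDiffAt 𝓘(ℝ, H) 𝓘(ℝ, ℝ) ∞ (fun n => θ (A n)) n) :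
    ContMDiffAt 𝓘(ℝ, H) 𝓘(ℝ, H₁) ∞ (fun n => cofactorVec b ξ i (A n)) n := by
  refine contMDiffAt_finsetSum fun k _ => ?_
  have h2 : ContMDiffAt 𝓘(ℝ, H) 𝓘(ℝ, H₁) ∞ (fun _ : Q => b k) n := contMDiffAt_const
  exact (hA _).smul h2

/-- A smooth multivector is, near a point where it is not zero, the exterior product of smooth vectors
at the points where it is decomposable. -/
theorem exists_local_factors [FiniteDimensional ℝ H₁] (hm : 0 < m) {A : Q → ⋀[ℝ]^m H₁} {U : Set Q}
    (hU : IsOpen U) (hA : ∀ θ : Module.Dual ℝ (⋀[ℝ]^m H₁), ∀ n ∈ U,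
      ContMDiffAt 𝓘(ℝ, H) 𝓘(ℝ, ℝ) ∞ (fun n => θ (A n)) n) {n₀ : Q} (hn₀ : n₀ ∈ U) (h0 : A n₀ ≠ 0) :
    ∃ V ⊆ U, IsOpen V ∧ n₀ ∈ V ∧ ∃ z : Fin m → Q → H₁,
      (∀ i, ∀ n ∈ V, ContMDiffAt 𝓘(ℝ, H) 𝓘(ℝ, H₁) ∞ (z i) n) ∧
      ∀ n ∈ V, (∃ x, A n = exteriorPower.ιMulti ℝ m x) →
        A n = exteriorPower.ιMulti ℝ m (fun i => z i n) := by
  obtain ⟨ξ, hξ⟩ := exists_pairingDual_ne_zero h0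
  let b := Module.finBasis ℝ H₁
  let d : Q → ℝ := fun n => exteriorPower.pairingDual ℝ H₁ m (exteriorPower.ιMulti ℝ m ξ) (A n)
  have hdc : ContinuousOn d U := fun n hn => (hA _ n hn).continuousAt.continuousWithinAt
  let y : Fin m → Q → H₁ := fun i n => cofactorVec b ξ i (A n)
  have hy : ∀ i, ∀ n ∈ U, ContMDiffAt 𝓘(ℝ, H) 𝓘(ℝ, H₁) ∞ (y i) n := fun i n hn =>
    contMDiffAt_cofactorVec b ξ i (fun θ => hA θ n hn)
  -- Dividing one cofactor vector by `d ^ (m - 1)` compensates the factor in `ιMulti_cofactorVec`.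
  -- The set where `d` does not vanish is open and contains `n₀` by the choice of `ξ`.
  let z : Fin m → Q → H₁ := Function.update y ⟨0, hm⟩ (fun n => (d n ^ (m - 1))⁻¹ • y ⟨0, hm⟩ n)
  refine ⟨U ∩ d ⁻¹' {0}ᶜ, inter_subset_left, hdc.isOpen_inter_preimage hU isOpen_compl_singleton,
    ⟨hn₀, hξ⟩, z, ?_, ?_⟩
  · intro i n hn
    have hd : ContMDiffAt 𝓘(ℝ, H) 𝓘(ℝ, ℝ) ∞ d n := hA _ n hn.1
    have hp : ContMDiffAt 𝓘(ℝ, H) 𝓘(ℝ, ℝ) ∞ (fun n => (d n ^ (m - 1))⁻¹) n :=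
      (hd.pow (m - 1)).inv₀ (pow_ne_zero _ hn.2)
    by_cases hi : i = ⟨0, hm⟩
    · subst hi
      simp only [z, Function.update_self]
      exact hp.smul (hy _ n hn.1)
    · simp only [z, Function.update_of_ne hi]
      exact hy _ n hn.1
  · rintro n ⟨hn, hdn⟩ hx
    have h7 : (fun i => z i n) = Function.update (fun i => y i n) ⟨0, hm⟩
        ((d n ^ (m - 1))⁻¹ • y ⟨0, hm⟩ n) := by
      funext i
      by_cases hi : i = ⟨0, hm⟩
      · subst hi
        simp [z]
      · simp [z, Function.update_of_ne hi]
    rw [h7, ← smul_ιMulti hm, ιMulti_cofactorVec b ξ hx, smul_smul,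
      inv_mul_cancel₀ (pow_ne_zero _ hdn), one_smul]

/-- A smooth multivector field that is decomposable at the points of a set is locally decomposable
on it. -/
theorem isModelDecomposableOn_of_pointwise [FiniteDimensional ℝ H₁] (hm : 0 < m) {g : Q → X}
    (hg : ContMDiff 𝓘(ℝ, H) 𝓘(ℝ, H₁) ∞ g) {S : Set Q} {K : Q → ⋀[ℝ]^m H₁}
    (hs : IsModelSmoothMVOn (H := H) g S K)
    (hd : ∀ n ∈ S, ∃ x : Fin m → H₁, K n = exteriorPower.ιMulti ℝ m x)
    (h0 : ∀ n ∈ S, K n ≠ 0) : IsModelDecomposableOn (H := H) g S K := by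
  intro n₀ hn₀
  obtain ⟨U, hU, hnU, K', h1, h2⟩ := hs n₀ hn₀
  have hne : g n₀ ∈ (chartAt H₁ (g n₀)).source := mem_chart_source H₁ (g n₀)
  -- The factors are found for the image of the field under the differential `T` of the chart at `g
  -- n₀`, and carried back by the differential `R` of its inverse.
  obtain ⟨T, hT⟩ : ∃ T : Q → H₁ →L[ℝ] H₁,
    T = fun n => mfderiv 𝓘(ℝ, H₁) 𝓘(ℝ, H₁) (chartAt H₁ (g n₀)) (g n) := ⟨_, rfl⟩
  obtain ⟨R, hR⟩ : ∃ R : Q → H₁ →L[ℝ] H₁, R = fun n =>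
    mfderiv 𝓘(ℝ, H₁) 𝓘(ℝ, H₁) (chartAt H₁ (g n₀)).symm (chartAt H₁ (g n₀) (g n)) := ⟨_, rfl⟩
  have hRT : ∀ n, g n ∈ (chartAt H₁ (g n₀)).source →
      (R n).comp (T n) = ContinuousLinearMap.id ℝ H₁ := by
    intro n hn
    rw [hR, hT]
    exact (chart_mdifferentiable (g n₀)).symm_comp_deriv hn
  have hRA : ∀ n, g n ∈ (chartAt H₁ (g n₀)).source → mvPush (R n) (mvPush (T n) (K' n)) = K' n := by
    intro n hn
    rw [← mvPush_comp, hRT n hn, mvPush_id]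
  have hAs : ∀ θ : Module.Dual ℝ (⋀[ℝ]^m H₁), ∀ n ∈ U ∩ g ⁻¹' (chartAt H₁ (g n₀)).source,
      ContMDiffAt 𝓘(ℝ, H) 𝓘(ℝ, ℝ) ∞ (fun n => θ (mvPush (T n) (K' n))) n := by
    intro θ n hn
    rw [hT]
    exact contMDiffAt_mvPush_chart (h1 n hn.1) (hg n) hn.2 θ
  have hA0 : mvPush (T n₀) (K' n₀) ≠ 0 := by
    intro hz
    have h3 := hRA n₀ hne
    rw [hz] at h3
    exact h0 n₀ hn₀ ((h2 n₀ ⟨hnU, hn₀⟩).trans (h3.symm.trans (map_zero _)))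
  obtain ⟨V, hVU, hV, hnV, z, hz, hAz⟩ := exists_local_factors hm
    (hU.inter ((chartAt H₁ (g n₀)).open_source.preimage hg.continuous)) hAs ⟨hnU, hne⟩ hA0
  refine ⟨V, hV, hnV, fun i n => R n (z i n), ?_, ?_⟩
  · intro i n hn
    rw [hR]
    exact (contMDiffAt_chart_vectorField (hg n) (hVU hn).2 (hz i n hn)).contMDiffWithinAt
  · rintro n ⟨hn, hnS⟩
    have hKn : K n = K' n := h2 n ⟨(hVU hn).1, hnS⟩
    obtain ⟨x, hx⟩ := hd n hnS
    have h4 := hAz n hn ⟨fun i => T n (x i), by rw [← hKn, hx, mvPush_ιMulti]⟩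
    have h5 : K n = exteriorPower.ιMulti ℝ m (fun i => R n (z i n)) := by
      rw [hKn, ← hRA n (hVU hn).2, h4, mvPush_ιMulti]
    exact h5

end VectorFields

end FieldTheory

end

noncomputable section

namespace FieldTheory

/-! ### Multivector fields -/

section MultivectorFields

variable {m N : ℕ} {M : Type*} [TopologicalSpace M] [ChartedSpace (BaseModel m) M]
  [IsManifold 𝓘(ℝ, BaseModel m) ∞ M]
  {E : Type*} [TopologicalSpace E] [ChartedSpace (TotalModel m N) E]
  [IsManifold 𝓘(ℝ, TotalModel m N) ∞ E]
  {π : E → M} [IsFiberedManifold m N π]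
  {G : Type*} [NormedAddCommGroup G] [NormedSpace ℝ G] [FiniteDimensional ℝ G]
  {P : Type*} [TopologicalSpace P] [ChartedSpace G P] [IsManifold 𝓘(ℝ, G) ∞ P]
  {vol : DiffForm (BaseModel m) M m} {L : J1 m N π → ℝ}
  {j0 : P → RestMomentum m N π} {FL0 : J1 m N π → P}

/-- The value of an `m`-form of the base on an `m`-vector that is projected to it. -/
def mvPair {H : Type*} [TopologicalSpace H] [AddCommGroup H] [Module ℝ H]
    (β : BaseModel m [⋀^Fin m]→L[ℝ] ℝ) (T : H →L[ℝ] BaseModel m) (A : ⋀[ℝ]^m H) : ℝ :=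
  exteriorPower.alternatingMapLinearEquiv (β.compContinuousLinearMap T).toAlternatingMap A

theorem mvPair_smul {H : Type*} [NormedAddCommGroup H] [NormedSpace ℝ H]
    (β : BaseModel m [⋀^Fin m]→L[ℝ] ℝ) (T : H →L[ℝ] BaseModel m) (c : ℝ) (A : ⋀[ℝ]^m H) :
    mvPair β T (c • A) = c * mvPair β T A :=
  map_smul _ c A

theorem mvPair_push {H H' : Type*} [NormedAddCommGroup H] [NormedSpace ℝ H]
    [NormedAddCommGroup H'] [NormedSpace ℝ H']
    (β : BaseModel m [⋀^Fin m]→L[ℝ] ℝ) (T : H' →L[ℝ] BaseModel m) (F : H →L[ℝ] H') (A : ⋀[ℝ]^m H) :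
    mvPair β T (mvPush F A) = mvPair β (T.comp F) A :=
  alternatingMapLinearEquiv_map _ _ _

/-- The conditions at a point on an `m`-vector field with values in `V`, with the projection `T` to
the base, annihilating the values of the form `Ξ` on the range of `R`. The instances are explicit so
that the tangent spaces of a model space can be replaced by the model space. -/
structure MVConditions (V W : Type*) (_ : TopologicalSpace V) (_ : AddCommGroup V) (_ : Module ℝ V)
    (T : V →L[ℝ] BaseModel m) (Ξ : V [⋀^Fin (m + 1)]→L[ℝ] ℝ) (R : W → V) (A : ⋀[ℝ]^m V) : Prop where
  ne_zero : A ≠ 0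
  decomposable : ∃ x : Fin m → V, A = exteriorPower.ιMulti ℝ m x
  transverse : ∀ β : BaseModel m [⋀^Fin m]→L[ℝ] ℝ, β ≠ 0 → mvPair β T A ≠ 0
  fieldEq : ∀ w, mvContraction Ξ A (R w) = 0

/-- `MVConditions` for values in a model space. -/
abbrev MVAt {H H' : Type*} [NormedAddCommGroup H] [NormedSpace ℝ H] [NormedAddCommGroup H']
    [NormedSpace ℝ H'] (T : H →L[ℝ] BaseModel m) (Ξ : H [⋀^Fin (m + 1)]→L[ℝ] ℝ) (R : H' →L[ℝ] H)
    (A : ⋀[ℝ]^m H) : Prop :=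
  MVConditions H H' inferInstance inferInstance inferInstance T Ξ R A

section Pointwise

variable {H H' H₁ : Type*} [NormedAddCommGroup H] [NormedSpace ℝ H] [NormedAddCommGroup H']
    [NormedSpace ℝ H'] [NormedAddCommGroup H₁] [NormedSpace ℝ H₁]
    {T : H →L[ℝ] BaseModel m} {Ξ : H [⋀^Fin (m + 1)]→L[ℝ] ℝ} {R : H' →L[ℝ] H}

theorem MVAt.smul (hm : 0 < m) {A : ⋀[ℝ]^m H} (hA : MVAt T Ξ R A) {c : ℝ} (hc : c ≠ 0) :
    MVAt T Ξ R (c • A) where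
  ne_zero := smul_ne_zero hc hA.ne_zero
  decomposable := by
    obtain ⟨x, rfl⟩ := hA.decomposable
    exact ⟨_, smul_ιMulti hm c x⟩
  transverse β hβ := by
    rw [mvPair_smul]
    exact mul_ne_zero hc (hA.transverse β hβ)
  fieldEq w := by rw [mvContraction_smul, hA.fieldEq, mul_zero]

/-- The conditions on an `m`-vector are those on its image under an injective linear map that is
compatible with projections and forms. -/
theorem mvAt_push_iff [FiniteDimensional ℝ H] {T₁ : H₁ →L[ℝ] BaseModel m}
    {Ξ₁ : H₁ [⋀^Fin (m + 1)]→L[ℝ] ℝ} {F : H →L[ℝ] H₁} {R₁ : H' →L[ℝ] H₁}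
    (hF : Function.Injective F) (hT : T₁.comp F = T)
    (hΞ : ∀ u : Fin (m + 1) → H, Ξ u = Ξ₁ (fun i => F (u i))) (hR : R₁ = F.comp R) (A : ⋀[ℝ]^m H) :
    MVAt T₁ Ξ₁ R₁ (mvPush F A) ↔ MVAt T Ξ R A := by
  have h1 : ∀ w, mvContraction Ξ₁ (mvPush F A) (R₁ w) = mvContraction Ξ A (R w) := by
    intro w
    rw [hR]
    exact mvContraction_map F.toLinearMap hΞ A (R w)
  -- A linear left inverse `g` of `F` induces a left inverse on `m`-vectors. Hence no nonzero
  -- `m`-vector is lost, and factors of the image are sent by `g` to factors of `A`.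
  obtain ⟨g, hg⟩ := LinearMap.exists_leftInverse_of_injective F.toLinearMap
    (LinearMap.ker_eq_bot.2 hF)
  have h2 : ∀ B : ⋀[ℝ]^m H, exteriorPower.map m g (mvPush F B) = B := by
    intro B
    have h3 := LinearMap.congr_fun (exteriorPower.map_comp (n := m) F.toLinearMap g) B
    rw [hg, exteriorPower.map_id] at h3
    exact h3.symm
  constructor
  · intro hA
    refine ⟨?_, ?_, fun β hβ => ?_, fun w => (h1 w).symm.trans (hA.fieldEq w)⟩
    · intro h0
      apply hA.ne_zero
      rw [h0]
      exact map_zero _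
    · obtain ⟨x, hx⟩ := hA.decomposable
      refine ⟨fun i => g (x i), ?_⟩
      rw [← h2 A, hx]
      exact exteriorPower.map_apply_ιMulti _ _
    · have := hA.transverse β hβ
      rwa [mvPair_push, hT] at this
  · intro hA
    refine ⟨?_, ?_, fun β hβ => ?_, fun w => (h1 w).trans (hA.fieldEq w)⟩
    · intro h0
      apply hA.ne_zero
      rw [← h2 A, h0, map_zero]
    · obtain ⟨x, hx⟩ := hA.decomposable
      exact ⟨_, by rw [hx, mvPush_ιMulti]⟩
    · rw [mvPair_push, hT]
      exact hA.transverse β hβ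

end Pointwise

/-- The conditions on the values of an `m`-vector field along `FL~`. -/
def ExtMVAt (vol : DiffForm (BaseModel m) M m) (L : J1 m N π → ℝ) (j : J1 m N π)
    (A : ModelMV m (MomModel m N)) : Prop :=
  MVAt (H := MomModel m N) (H' := JetModel m N)
    (dMap m (MomModel m N) (extBase π) (extLegendre vol L j))
    (multisymplecticForm π (extLegendre vol L j)) (dLegendre vol L j) A

set_option maxHeartbeats 4000000 in
theorem extMVAt_of_structural {S : Set (J1 m N π)} {K : MVField (MomModel m N) m (extLegendre vol L)}
    (h1 : MVStructural vol L S K) (h2 : MVFieldEq vol L S K) {j : J1 m N π} (hj : j ∈ S) :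
    ExtMVAt vol L j (K j) :=
  MVConditions.mk (h1.ne_zero j hj) (h1.decomposable.exists_eq_ιMulti hj) (h1.transverse j hj) (h2 j hj)

namespace IsAlmostRegular

variable (h : IsAlmostRegular (G := G) vol L j0 FL0) (hvol : IsVolumeForm vol)
  (hL : ContMDiff 𝓘(ℝ, JetModel m N) 𝓘(ℝ, ℝ) ∞ L)

/-- The conditions on the values of an `m`-vector field on `P`. -/
def HamMVAt (p : P) (B : ⋀[ℝ]^m G) : Prop :=
  MVAt (H := G) (H' := G) (dMap m G (hamBase j0) p) (h.hamForm p) (ContinuousLinearMap.id ℝ G) B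

set_option maxHeartbeats 4000000 in
theorem HDWMV.hamMVAt {C : Set P} {X : MVField G m (id : P → P)} (hX : h.HDWMV C X) {p : P} (hp : p ∈ C) :
    h.HamMVAt p (X p) :=
  have h1 : MVConditions (TangentSpace 𝓘(ℝ, G) p) (TangentSpace 𝓘(ℝ, G) p) inferInstance
      inferInstance inferInstance (dMap m G (hamBase j0) p) (h.hamForm p) id (X p) :=
    ⟨hX.ne_zero p hp, hX.decomposable.exists_eq_ιMulti hp, hX.transverse p hp, hX.fieldEq p hp⟩
  h1

include hvol hL in
-- Since `T FL0` is onto, the field equation on `P` may be tested on its range alone; then all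
-- conditions pass through the injective map `T h̃` by `mvAt_push_iff`.
theorem extMVAt_iff (j : J1 m N π) (B : ⋀[ℝ]^m G) :
    ExtMVAt vol L j (mvPush (h.dHamModel (FL0 j)) B) ↔ h.HamMVAt (FL0 j) B := by
  have h1 : h.HamMVAt (FL0 j) B ↔ MVAt (H := G) (H' := JetModel m N)
      (dMap m G (hamBase j0) (FL0 j)) (h.hamForm (FL0 j))
      (mfderiv 𝓘(ℝ, JetModel m N) 𝓘(ℝ, G) FL0 j) B := by
    refine ⟨fun hB => ⟨hB.ne_zero, hB.decomposable, hB.transverse, fun w => hB.fieldEq _⟩,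
      fun hB => ⟨hB.ne_zero, hB.decomposable, hB.transverse, fun W => ?_⟩⟩
    obtain ⟨w, hw⟩ := h.submersion j W
    have h2 := hB.fieldEq w
    exact (congrArg (mvContraction (V := G) (h.hamForm (FL0 j)) B) hw).symm.trans h2
  rw [h1]
  refine mvAt_push_iff (h.dHam_injective hvol hL (FL0 j)) ?_ (h.hamForm_leg hvol hL j) ?_ B
  · let D : ExtMomentum m N π → MomModel m N →L[ℝ] BaseModel m := dMap m (MomModel m N) (extBase π)
    ext1 v
    exact (congrArg (fun q => D q (h.dHamModel (FL0 j) v)) (h.hamSection_leg hvol hL j).symm).trans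
      (h.dMap_dHam hvol hL (FL0 j) v)
  · refine ContinuousLinearMap.ext fun w => ?_
    exact h.dLegendre_eq hvol hL j w

end IsAlmostRegular

end MultivectorFields

end FieldTheory

end

noncomputable section

namespace FieldTheory

/-! ### Classes of multivector fields and their images -/

section MultivectorRelations

variable {HQ H : Type*} [NormedAddCommGroup HQ] [NormedSpace ℝ HQ]
  [NormedAddCommGroup H] [NormedSpace ℝ H]
  {Q X : Type*} [TopologicalSpace Q] [ChartedSpace HQ Q]
  [TopologicalSpace X] [ChartedSpace H X] [IsManifold 𝓘(ℝ, H) ∞ X] {m : ℕ}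

variable (HQ) in
/-- The equivalence of functions with values in `m`-vectors by smooth non-vanishing factors on a
subset. The instances are explicit so that tangent spaces can be replaced by the model space. -/
def MultivectorEquivOn (V : Q → Type*) (_ : ∀ n, AddCommGroup (V n)) (_ : ∀ n, Module ℝ (V n))
    (S : Set Q) (K K' : ∀ n, ⋀[ℝ]^m (V n)) : Prop :=
  ∃ f : Q → ℝ, IsSmoothFunOn HQ S f ∧ (∀ n ∈ S, f n ≠ 0) ∧ ∀ n ∈ S, K' n = f n • K n

variable (HQ) in
/-- `MultivectorEquivOn` for values in a model space. -/
abbrev EquivOn {V : Type*} [NormedAddCommGroup V] [NormedSpace ℝ V] (S : Set Q)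
    (K K' : Q → ModelMV m V) : Prop :=
  MultivectorEquivOn HQ (fun _ => V) inferInstance inferInstance S K K'

/-- The `m`-vector `B` is the image of `A`. The instances are explicit so that tangent spaces can be
replaced by the model space. -/
def IsMultivectorImage (V W : Type*) (_ : AddCommGroup V) (_ : Module ℝ V) (_ : AddCommGroup W)
    (_ : Module ℝ W) (T : V →ₗ[ℝ] W) (A : ⋀[ℝ]^m V) (B : ⋀[ℝ]^m W) : Prop :=
  B = exteriorPower.map m T A

theorem isMultivectorImage_iff {V W : Type*} [NormedAddCommGroup V] [NormedSpace ℝ V]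
    [NormedAddCommGroup W] [NormedSpace ℝ W] {T : V →L[ℝ] W} {A : ⋀[ℝ]^m V} {B : ⋀[ℝ]^m W} :
    IsMultivectorImage V W NormedAddCommGroup.toAddCommGroup NormedSpace.toModule
      NormedAddCommGroup.toAddCommGroup NormedSpace.toModule T.toLinearMap A B ↔ B = mvPush T A :=
  Iff.rfl

theorem MVAt.of_eq_smul {V W : Type*} [NormedAddCommGroup V] [NormedSpace ℝ V]
    [NormedAddCommGroup W] [NormedSpace ℝ W] {T : V →L[ℝ] BaseModel m}
    {Ξ : V [⋀^Fin (m + 1)]→L[ℝ] ℝ} {R : W →L[ℝ] V} (hm : 0 < m) {A B : ⋀[ℝ]^m V}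
    (hA : MVAt T Ξ R A) {c : ℝ} (hc : c ≠ 0) (hB : B = c • A) : MVAt T Ξ R B :=
  hB ▸ hA.smul hm hc

omit [IsManifold 𝓘(ℝ, H) ∞ X] in
theorem mvEquivOn_iff {g : Q → X} {S : Set Q} {K K' : Q → ⋀[ℝ]^m H} :
    MVEquivOn HQ (H := H) g S K K' ↔ EquivOn HQ S K K' :=
  have h1 : MVEquivOn HQ (H := H) g S K K' ↔ MultivectorEquivOn HQ
      (fun n => TangentSpace 𝓘(ℝ, H) (g n)) inferInstance inferInstance S K K' := Iff.rfl
  h1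

theorem isModelSmoothMVOn_smul {g : Q → X} {S : Set Q} {K : Q → ⋀[ℝ]^m H} {f : Q → ℝ}
    (hf : IsSmoothFunOn HQ S f) (hK : IsModelSmoothMVOn (H := HQ) g S K) :
    IsModelSmoothMVOn (H := HQ) g S (fun n => f n • K n) := by
  intro n₀ hn₀
  obtain ⟨U, hU, hnU, K', h1, h2⟩ := hK n₀ hn₀
  obtain ⟨V, hV, hnV, f', h3, h4⟩ := hf n₀ hn₀
  refine ⟨U ∩ V, hU.inter hV, ⟨hnU, hnV⟩, fun n => f' n • K' n, ?_, ?_⟩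
  · intro n hn θ
    refine ((h3.contMDiffAt (hV.mem_nhds hn.2)).mul (h1 n hn.1 θ)).congr_of_eventuallyEq ?_
    refine Filter.Eventually.of_forall fun k => ?_
    exact (congrArg θ (mvPush_smul (H₁ := H) (H₂ := H) _ (f' k) (K' k))).trans (map_smul θ _ _)
  · rintro n ⟨hn, hnS⟩
    show f n • K n = f' n • K' n
    rw [h2 n ⟨hn.1, hnS⟩, h4 n ⟨hn.2, hnS⟩]

theorem isModelSmoothMVOn_of_equiv {g : Q → X} {S : Set Q} {K K' : Q → ⋀[ℝ]^m H}
    (hK : IsModelSmoothMVOn (H := HQ) g S K) (hKK : EquivOn HQ S K K') :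
    IsModelSmoothMVOn (H := HQ) g S K' := by
  obtain ⟨f, hf, -, hfK⟩ := hKK
  intro n hn
  obtain ⟨U, hU, hnU, K₁, h1, h2⟩ := isModelSmoothMVOn_smul hf hK n hn
  exact ⟨U, hU, hnU, K₁, h1, fun k hk => (hfK k hk.2).trans (h2 k hk)⟩

theorem isSmoothFunOn_comp {HQ' Q' : Type*} [NormedAddCommGroup HQ'] [NormedSpace ℝ HQ']
    [TopologicalSpace Q'] [ChartedSpace HQ' Q'] {F : Q' → Q}
    (hF : ContMDiff 𝓘(ℝ, HQ') 𝓘(ℝ, HQ) ∞ F) {S : Set Q'} {f : Q → ℝ}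
    (hf : IsSmoothFunOn HQ (F '' S) f) : IsSmoothFunOn HQ' S (fun n => f (F n)) := by
  intro n hn
  obtain ⟨U, hU, hnU, f', h1, h2⟩ := hf (F n) (mem_image_of_mem F hn)
  exact ⟨F ⁻¹' U, hU.preimage hF.continuous, hnU, fun n => f' (F n),
    h1.comp hF.contMDiffOn (fun _ hn => hn), fun k hk => h2 _ ⟨hk.1, mem_image_of_mem F hk.2⟩⟩

theorem isModelDecomposableOn_smul (hm : 0 < m) {g : Q → X} {S : Set Q} {K : Q → ⋀[ℝ]^m H}
    {f : Q → ℝ} (hf : IsSmoothFunOn HQ S f) (hK : IsModelDecomposableOn (H := HQ) g S K) :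
    IsModelDecomposableOn (H := HQ) g S (fun n => f n • K n) := by
  intro n₀ hn₀
  obtain ⟨U, hU, hnU, Y, h1, h2⟩ := hK n₀ hn₀
  obtain ⟨V, hV, hnV, f', h3, h4⟩ := hf n₀ hn₀
  refine ⟨U ∩ V, hU.inter hV, ⟨hnU, hnV⟩,
    Function.update Y ⟨0, hm⟩ (fun n => f' n • Y ⟨0, hm⟩ n), ?_, ?_⟩
  · intro i
    by_cases hi : i = ⟨0, hm⟩
    · subst hi
      rw [Function.update_self]
      exact contMDiffOn_smul_vectorField (hU.inter hV) (h3.mono inter_subset_right)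
        ((h1 _).mono inter_subset_left)
    · rw [Function.update_of_ne hi]
      exact (h1 i).mono inter_subset_left
  · rintro n ⟨hn, hnS⟩
    show f n • K n = _
    rw [h2 n ⟨hn.1, hnS⟩, h4 n ⟨hn.2, hnS⟩, smul_ιMulti hm]
    congr 1
    funext i
    by_cases hi : i = ⟨0, hm⟩
    · subst hi
      simp
    · simp [Function.update_of_ne hi]

theorem isModelDecomposableOn_of_equiv (hm : 0 < m) {g : Q → X} {S : Set Q} {K K' : Q → ⋀[ℝ]^m H}
    (hK : IsModelDecomposableOn (H := HQ) g S K) (hKK : EquivOn HQ S K K') :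
    IsModelDecomposableOn (H := HQ) g S K' := by
  obtain ⟨f, hf, -, hfK⟩ := hKK
  intro n hn
  obtain ⟨U, hU, hnU, Y, h1, h2⟩ := isModelDecomposableOn_smul hm hf hK n hn
  exact ⟨U, hU, hnU, Y, h1, fun k hk => (hfK k hk.2).trans (h2 k hk)⟩

variable {HQ' H' Q' X' : Type*} [NormedAddCommGroup HQ'] [NormedSpace ℝ HQ']
  [TopologicalSpace Q'] [ChartedSpace HQ' Q'] [NormedAddCommGroup H'] [NormedSpace ℝ H']
  [TopologicalSpace X'] [ChartedSpace H' X'] [IsManifold 𝓘(ℝ, H') ∞ X'] {F : Q' → X} {S : Set Q'}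

/-- The factor between the images is the pull-back by `F` of the factor between the fields; this
gives the independence of the class along the Legendre map from the representative. -/
theorem equivOn_push (hF : ContMDiff 𝓘(ℝ, HQ') 𝓘(ℝ, H) ∞ F) {T : Q' → H →L[ℝ] H'}
    {A A' : X → ⋀[ℝ]^m H} {K K' : Q' → ⋀[ℝ]^m H'} (hR : ∀ n ∈ S, K n = mvPush (T n) (A (F n)))
    (hA : EquivOn H (F '' S) A A') (hR' : ∀ n ∈ S, K' n = mvPush (T n) (A' (F n))) :
    EquivOn HQ' S K K' := by
  obtain ⟨f, hf, hf0, hfA⟩ := hA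
  refine ⟨fun n => f (F n), isSmoothFunOn_comp hF hf,
    fun n hn => hf0 _ (mem_image_of_mem _ hn), fun n hn => ?_⟩
  rw [hR' n hn, hR n hn, hfA _ (mem_image_of_mem _ hn), mvPush_smul]

theorem isModelDecomposableOn_push (hF : ContMDiff 𝓘(ℝ, HQ') 𝓘(ℝ, H) ∞ F) {k : X → X'}
    (hk : ContMDiff 𝓘(ℝ, H) 𝓘(ℝ, H') ∞ k) {g : Q' → X'} (hg : ∀ n, k (F n) = g n)
    {A : X → ⋀[ℝ]^m H} (hA : IsModelDecomposableOn (H := H) (id : X → X) (F '' S) A)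
    {K : Q' → ⋀[ℝ]^m H'}
    (hR : ∀ n ∈ S, K n = mvPush (H₁ := H) (H₂ := H') (mfderiv 𝓘(ℝ, H) 𝓘(ℝ, H') k (F n)) (A (F n))) :
    IsModelDecomposableOn (H := HQ') g S K := by
  intro n hn
  obtain ⟨U, hU, hnU, Y, h3, h4⟩ := hA (F n) (mem_image_of_mem _ hn)
  refine ⟨F ⁻¹' U, hU.preimage hF.continuous, hnU,
    fun i n => mfderiv 𝓘(ℝ, H) 𝓘(ℝ, H') k (F n) (Y i (F n)), ?_, ?_⟩
  · intro i
    refine (contMDiffOn_push_vectorField (h3 i) hF hk).congr fun n hn => ?_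
    exact tangentBundle_mk_congr (hg n).symm _
  · intro n hn
    rw [hR n hn.2, h4 _ ⟨hn.1, mem_image_of_mem _ hn.2⟩]
    exact mvPush_ιMulti (H₁ := H) (H₂ := H') _ _

end MultivectorRelations

/-! ### The multivector field equations in both directions -/

section MultivectorFields

variable {m N : ℕ} {M : Type*} [TopologicalSpace M] [ChartedSpace (BaseModel m) M]
  [IsManifold 𝓘(ℝ, BaseModel m) ∞ M]
  {E : Type*} [TopologicalSpace E] [ChartedSpace (TotalModel m N) E]
  [IsManifold 𝓘(ℝ, TotalModel m N) ∞ E]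
  {π : E → M} [IsFiberedManifold m N π]
  {G : Type*} [NormedAddCommGroup G] [NormedSpace ℝ G] [FiniteDimensional ℝ G]
  {P : Type*} [TopologicalSpace P] [ChartedSpace G P] [IsManifold 𝓘(ℝ, G) ∞ P]
  {vol : DiffForm (BaseModel m) M m} {L : J1 m N π → ℝ}
  {j0 : P → RestMomentum m N π} {FL0 : J1 m N π → P}

namespace IsAlmostRegular

variable (h : IsAlmostRegular (G := G) vol L j0 FL0) (hvol : IsVolumeForm vol)
  (hL : ContMDiff 𝓘(ℝ, JetModel m N) 𝓘(ℝ, ℝ) ∞ L)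

/-- `MVRel` for values in the exterior powers of the model spaces. -/
def ModelMVRel (S : Set (J1 m N π)) (X : P → ⋀[ℝ]^m G) (K : J1 m N π → ModelMV m (MomModel m N)) :
    Prop := ∀ j ∈ S, K j = mvPush (h.dHamModel (FL0 j)) (X (FL0 j))

omit [IsManifold 𝓘(ℝ, BaseModel m) ∞ M] [IsManifold 𝓘(ℝ, TotalModel m N) ∞ E]
  [FiniteDimensional ℝ G] in
theorem equivOn_of_rel (h : IsAlmostRegular (G := G) vol L j0 FL0) {S : Set (J1 m N π)}
    {X X' : P → ⋀[ℝ]^m G} {K K' : J1 m N π → ModelMV m (MomModel m N)} (hR : h.ModelMVRel S X K)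
    (hXX : EquivOn G (FL0 '' S) X X') (hR' : h.ModelMVRel S X' K') :
    EquivOn (JetModel m N) S K K' :=
  equivOn_push h.smooth_leg hR hXX hR'

omit [IsManifold 𝓘(ℝ, BaseModel m) ∞ M] [IsManifold 𝓘(ℝ, TotalModel m N) ∞ E]
  [IsManifold 𝓘(ℝ, G) ∞ P] [FiniteDimensional ℝ G] in
theorem MVRel.model {h : IsAlmostRegular (G := G) vol L j0 FL0} {S : Set (J1 m N π)}
    {X : P → ⋀[ℝ]^m G} {K : J1 m N π → ModelMV m (MomModel m N)} (hR : h.MVRel S X K) :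
    h.ModelMVRel S X K := fun j hj =>
  have h1 : IsMultivectorImage (TangentSpace 𝓘(ℝ, G) (FL0 j))
      (TangentSpace 𝓘(ℝ, MomModel m N) (extLegendre vol L j)) inferInstance inferInstance
      inferInstance inferInstance (h.dHam (FL0 j)).toLinearMap (X (FL0 j)) (K j) := hR j hj
  have h2 : IsMultivectorImage G (MomModel m N) NormedAddCommGroup.toAddCommGroup
      NormedSpace.toModule NormedAddCommGroup.toAddCommGroup NormedSpace.toModule
      (h.dHamModel (FL0 j)).toLinearMap (X (FL0 j)) (K j) := h1
  isMultivectorImage_iff.1 h2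

include hvol hL

/-- The conditions pass from `K` to its multiple `K'`, from there to `X₁` through `extMVAt_iff`, and
finally to any other representative of the class of `X`. -/
theorem hamMVAt_of_rel (hm : 0 < m) {S : Set (J1 m N π)}
    {K K' : J1 m N π → ModelMV m (MomModel m N)}
    {X X₁ X₂ : P → ⋀[ℝ]^m G} (hK : ∀ j ∈ S, ExtMVAt vol L j (K j))
    (hKK : EquivOn (JetModel m N) S K K') (h1 : EquivOn G (FL0 '' S) X X₁)
    (hR : h.ModelMVRel S X₁ K') (h2 : EquivOn G (FL0 '' S) X X₂) :
    ∀ p ∈ FL0 '' S, h.HamMVAt p (X₂ p) := by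
  obtain ⟨f, -, hf0, hf⟩ := hKK
  obtain ⟨g₁, -, hg0, hg⟩ := h1
  obtain ⟨g₂, -, hk0, hk⟩ := h2
  rintro _ ⟨j, hj, rfl⟩
  have hj' := mem_image_of_mem FL0 hj
  have h3 : h.HamMVAt (FL0 j) (X₁ (FL0 j)) :=
    (h.extMVAt_iff hvol hL j _).1 ((congrArg (ExtMVAt vol L j) (hR j hj)).mp
      (MVAt.of_eq_smul hm (hK j hj) (hf0 j hj) (hf j hj)))
  -- Both `X₁` and `X₂` are known only as multiples of `X`, so they are compared through the
  -- quotient of the two factors.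
  have h4 : X₂ (FL0 j) = (g₂ (FL0 j) * (g₁ (FL0 j))⁻¹) • X₁ (FL0 j) := by
    rw [hk _ hj', hg _ hj', smul_smul, mul_assoc, inv_mul_cancel₀ (hg0 _ hj'), mul_one]
  rw [h4]
  exact h3.smul hm (mul_ne_zero (hk0 _ hj') (inv_ne_zero (hg0 _ hj')))

theorem isModelDecomposableOn_of_rel (hm : 0 < m) {S : Set (J1 m N π)} {X : P → ⋀[ℝ]^m G}
    (hX : IsModelDecomposableOn (H := G) (id : P → P) (FL0 '' S) X)
    {K K' : J1 m N π → ModelMV m (MomModel m N)} (hR : h.ModelMVRel S X K)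
    (hKK : EquivOn (JetModel m N) S K K') :
    IsModelDecomposableOn (H := JetModel m N) (extLegendre vol L) S K' :=
  isModelDecomposableOn_of_equiv hm (isModelDecomposableOn_push h.smooth_leg
    (h.contMDiff_hamSection hvol hL) (h.hamSection_leg hvol hL) hX hR) hKK

theorem extMVAt_of_rel (hm : 0 < m) {S : Set (J1 m N π)} {X : P → ⋀[ℝ]^m G}
    (hX : ∀ p ∈ FL0 '' S, h.HamMVAt p (X p))
    {K K' : J1 m N π → ModelMV m (MomModel m N)} (hR : h.ModelMVRel S X K)
    (hKK : EquivOn (JetModel m N) S K K') {j : J1 m N π} (hj : j ∈ S) : ExtMVAt vol L j (K' j) := by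
  obtain ⟨f, hf, hf0, hfK⟩ := hKK
  refine MVAt.of_eq_smul hm ?_ (hf0 j hj) (hfK j hj)
  exact (congrArg (ExtMVAt vol L j) (hR j hj)).mpr
    ((h.extMVAt_iff hvol hL j _).2 (hX _ (mem_image_of_mem _ hj)))

end IsAlmostRegular

set_option maxHeartbeats 4000000 in
theorem mvStructural_of_extMVAt {S : Set (J1 m N π)}
    {K : MVField (MomModel m N) m (extLegendre vol L)}
    (hd : IsLocallyDecomposableOn (JetModel m N) (extLegendre vol L) S K)
    (hK : ∀ j ∈ S, ExtMVAt vol L j (K j)) : MVStructural vol L S K where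
  ne_zero j hj := (hK j hj).ne_zero
  decomposable := hd
  transverse j hj := (hK j hj).transverse

set_option maxHeartbeats 4000000 in
theorem IsAlmostRegular.hdwMV_of_hamMVAt (h : IsAlmostRegular (G := G) vol L j0 FL0) {C : Set P}
    {X : MVField G m (id : P → P)} (hd : IsLocallyDecomposableOn G id C X)
    (hX : ∀ p ∈ C, h.HamMVAt p (X p)) : h.HDWMV C X :=
  have h1 : ∀ p ∈ C, MVConditions (TangentSpace 𝓘(ℝ, G) p) (TangentSpace 𝓘(ℝ, G) p) inferInstance
      inferInstance inferInstance (dMap m G (hamBase j0) p) (h.hamForm p) id (X p) := hX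
  ⟨fun p hp => (h1 p hp).ne_zero, hd, fun p hp => (h1 p hp).transverse,
    fun p hp => (h1 p hp).fieldEq⟩

set_option maxHeartbeats 4000000 in
-- The pointwise conditions descend from `K`. Local decomposability on `FL0 '' S` is obtained on `P`
-- itself, from smoothness, non-vanishing and decomposability of the values: factors along the
-- Legendre map could vary on the fibres of `FL0`.
theorem IsAlmostRegular.hdwMV_of_rel (h : IsAlmostRegular (G := G) vol L j0 FL0)
    (hvol : IsVolumeForm vol) (hL : ContMDiff 𝓘(ℝ, JetModel m N) 𝓘(ℝ, ℝ) ∞ L)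
    (hm : 0 < m) {S : Set (J1 m N π)} {K K' : MVField (MomModel m N) m (extLegendre vol L)}
    {X X₁ X₂ : MVField G m (id : P → P)} (hK1 : MVStructural vol L S K) (hK2 : MVFieldEq vol L S K)
    (hX : IsSmoothMVOn G id (FL0 '' S) X)
    (hKK : MVEquivOn (JetModel m N) (extLegendre vol L) S K K')
    (h1 : MVEquivOn G id (FL0 '' S) X X₁) (hR : h.MVRel S X₁ K')
    (h2 : MVEquivOn G id (FL0 '' S) X X₂) : h.HDWMV (FL0 '' S) X₂ := by
  have h3 : ∀ p ∈ FL0 '' S, h.HamMVAt p (X₂ p) :=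
    h.hamMVAt_of_rel hvol hL hm (fun j hj => extMVAt_of_structural hK1 hK2 hj)
      (mvEquivOn_iff.1 hKK) (mvEquivOn_iff.1 h1) hR.model (mvEquivOn_iff.1 h2)
  refine h.hdwMV_of_hamMVAt (isLocallyDecomposableOn_iff.2 ?_) h3
  refine isModelDecomposableOn_of_pointwise hm contMDiff_id ?_
    (fun p hp => (h3 p hp).decomposable) (fun p hp => (h3 p hp).ne_zero)
  exact isModelSmoothMVOn_of_equiv hX.model (mvEquivOn_iff.1 h2)

set_option maxHeartbeats 4000000 in
-- In this direction smooth local factors of `X` are available, and `T h̃` carries them to factors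
-- along the Legendre map.
theorem IsAlmostRegular.mvStructural_of_rel (h : IsAlmostRegular (G := G) vol L j0 FL0)
    (hvol : IsVolumeForm vol) (hL : ContMDiff 𝓘(ℝ, JetModel m N) 𝓘(ℝ, ℝ) ∞ L)
    (hm : 0 < m) {S : Set (J1 m N π)} {X : MVField G m (id : P → P)} (hX : h.HDWMV (FL0 '' S) X)
    {K K' : MVField (MomModel m N) m (extLegendre vol L)} (hR : h.MVRel S X K)
    (hKK : MVEquivOn (JetModel m N) (extLegendre vol L) S K K') :
    MVStructural vol L S K' ∧ ∀ j ∈ S, ExtMVAt vol L j (K' j) := by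
  have h1 : ∀ j ∈ S, ExtMVAt vol L j (K' j) := fun j hj =>
    h.extMVAt_of_rel hvol hL hm (fun p hp => HDWMV.hamMVAt h hX hp) hR.model
      (mvEquivOn_iff.1 hKK) hj
  refine ⟨mvStructural_of_extMVAt (isLocallyDecomposableOn_iff.2 ?_) h1, h1⟩
  exact h.isModelDecomposableOn_of_rel hvol hL hm (isLocallyDecomposableOn_iff.1 hX.decomposable)
    hR.model (mvEquivOn_iff.1 hKK)

end MultivectorFields

end FieldTheory

end

noncomputable section

namespace FieldTheory

/-! ### The multisymplectic form in coordinates -/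

section Multisymplectic

variable {m N : ℕ} {M : Type*} [TopologicalSpace M] [ChartedSpace (BaseModel m) M]
  {E : Type*} [TopologicalSpace E] [ChartedSpace (TotalModel m N) E]
  {π : E → M} [IsFiberedManifold m N π]

theorem FibreCoords.Compatible.exists_chartAt {Z W : Type*} [NormedAddCommGroup W] [NormedSpace ℝ W]
    [TopologicalSpace Z] [ChartedSpace (TotalModel m N × W) Z] {c : FibreCoords m N π Z W}
    (hc : c.Compatible) (z : Z) : ∃ a : AdaptedChart m N π, c.pt z ∈ a.tot.source ∧
      (∀ z' ∈ (chartAt (TotalModel m N × W) z).source, c.pt z' ∈ a.tot.source) ∧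
      ∀ z', chartAt (TotalModel m N × W) z z' = (a.tot (c.pt z'), c.fib a z') :=
  ⟨adaptedAt m N π (c.pt z), mem_adaptedAt _, fun z' hz' => by
    rw [hc.chartAt_source] at hz'
    exact hz', hc.chartAt_apply z⟩

theorem extIncl_fib {a : AdaptedChart m N π} {q : ExtMomentum m N π} (hq : q.pt ∈ a.tot.source)
    (z : Fin m → TotalModel m N) :
    extIncl m N (extCoords.fib a q) z = q.form.1 (fun i => a.dInv q.pt (z i)) := by
  have h1 : extCoords.fib a q =
      extEquiv m N (pullOne m (a.dInv q.pt) (AdaptedChart.vert_dInv hq) q.form) := dif_pos hq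
  rw [h1, extIncl_extEquiv]
  rfl

/-- The pull-back of an `m`-form by the projection of the model space to the coordinates of `E`. -/
def liftForm (m N : ℕ) : MomModel m N →L[ℝ] (MomModel m N [⋀^Fin m]→L[ℝ] ℝ) :=
  (ContinuousAlternatingMap.compContinuousLinearMapCLM
    (ContinuousLinearMap.fst ℝ (TotalModel m N) (ExtModel m N))).comp
    ((extIncl m N).comp (ContinuousLinearMap.snd ℝ (TotalModel m N) (ExtModel m N)))

theorem liftForm_apply (u : MomModel m N) (v : Fin m → MomModel m N) :
    liftForm m N u v = extIncl m N u.2 (fun i => (v i).1) := rfl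

/-- The last argument has no component along `E`, so each term that keeps it among the arguments of
the `m`-form vanishes. What remains is the term differentiating in its direction, with the sign of
the last place. -/
theorem alternatizeUncurryFin_liftForm_snoc (x : Fin m → MomModel m N) {w : MomModel m N}
    (hw : w.1 = 0) : ContinuousAlternatingMap.alternatizeUncurryFin (liftForm m N)
      (Fin.snoc (α := fun _ => MomModel m N) x w) =
      (-1) ^ m * extIncl m N w.2 (fun i => (x i).1) := by
  rw [ContinuousAlternatingMap.alternatizeUncurryFin_apply, Fin.sum_univ_castSucc,
    Finset.sum_eq_zero, zero_add]
  · rw [Fin.val_last, zsmul_eq_mul, liftForm_apply, Fin.snoc_last]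
    push_cast
    congr 2
    funext i
    simp [Fin.removeNth]
  · intro i _
    obtain ⟨k, hk⟩ := Fin.exists_succAbove_eq (x := Fin.last m) (y := i.castSucc)
      (Fin.castSucc_lt_last i).ne'
    rw [liftForm_apply, (extIncl m N _).map_coord_zero k, smul_zero]
    show (Fin.snoc (α := fun _ => MomModel m N) x w (i.castSucc.succAbove k)).1 = 0
    rw [hk, Fin.snoc_last, hw]

/-- In natural coordinates the canonical form at `(y, η)` is `η` on the `E`-components. It is linear
in the point, so its derivative is constant and `Ω` is explicit. -/
theorem formInChart_canonicalForm {q : ExtMomentum m N π} {a : AdaptedChart m N π}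
    (hs : ∀ q' ∈ (chartAt (MomModel m N) q).source, q'.pt ∈ a.tot.source)
    (ha : ∀ q', chartAt (MomModel m N) q q' = (a.tot q'.pt, extCoords.fib a q')) {u : MomModel m N}
    (hu : u ∈ (chartAt (MomModel m N) q).target) :
    formInChart (canonicalForm π) q u = liftForm m N u := by
  have : Nonempty (ExtMomentum m N π) := ⟨q⟩
  obtain ⟨q', hq', rfl⟩ : ∃ q' ∈ (chartAt (MomModel m N) q).source, chartAt (MomModel m N) q q' = u :=
    ⟨_, (chartAt (MomModel m N) q).map_target hu, (chartAt (MomModel m N) q).right_inv hu⟩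
  have hqs := hs q' hq'
  have he : (chartAt (MomModel m N) q : ExtMomentum m N π → MomModel m N) =
      extCoords_compatible.chart a := by
    funext z
    rw [ha, FibreCoords.Compatible.chart_apply]
    rfl
  let Θ : ExtMomentum m N π → (Fin m → TotalModel m N) → ℝ := fun q v => q.form.1 v
  let D : ExtMomentum m N π → MomModel m N →L[ℝ] TotalModel m N := dExtPt
  let R : MomModel m N →L[ℝ] MomModel m N := mfderiv 𝓘(ℝ, MomModel m N) 𝓘(ℝ, MomModel m N)
    (chartAt (MomModel m N) q).symm (chartAt (MomModel m N) q q')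
  have hR : ∀ v, (D q' (R v)) = a.dInv q'.pt v.1 := by
    intro v
    have h1 : mfderiv 𝓘(ℝ, MomModel m N) 𝓘(ℝ, MomModel m N) (chartAt (MomModel m N) q) q' (R v) =
        v := by
      have h2 := DFunLike.congr_fun ((chart_mdifferentiable (A := MomModel m N) q).comp_symm_deriv hu) v
      rw [(chartAt (MomModel m N) q).left_inv hq'] at h2
      exact h2
    have h3 := extCoords_compatible.fst_mfderiv_chart (a := a) (z := q') hqs (R v)
    rw [← he] at h3
    refine (AdaptedChart.dInv_d hqs (D q' (R v))).symm.trans (congrArg (a.dInv q'.pt) ?_)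
    exact h3.symm.trans (congrArg Prod.fst h1)
  ext v
  have h9 : (chartAt (MomModel m N) q q').2 = extCoords.fib a q' := congrArg Prod.snd (ha q')
  rw [liftForm_apply, h9]
  refine Eq.trans ?_ (extIncl_fib hqs _).symm
  refine Eq.trans (b := Θ q' (fun i => D q' (R (v i)))) ?_ ?_
  · exact congrArg (fun q'' => Θ q'' (fun i => D q'' (R (v i))))
      ((chartAt (MomModel m N) q).left_inv hq')
  · exact congrArg (Θ q') (funext fun i => hR (v i))

/-- The coordinate expression of the multisymplectic form. -/
theorem exists_multisymplecticForm_eq (q : ExtMomentum m N π) :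
    ∃ a : AdaptedChart m N π, q.pt ∈ a.tot.source ∧ ∃ T : MomModel m N →L[ℝ] MomModel m N,
      (∀ v, (T v).1 = a.d q.pt (dExtPt q v)) ∧
      (∀ v, (T v).2 = mfderiv 𝓘(ℝ, MomModel m N) 𝓘(ℝ, ExtModel m N) (extCoords.fib a) q v) ∧
      ∀ v : Fin (m + 1) → MomModel m N, multisymplecticForm π q v =
        -(ContinuousAlternatingMap.alternatizeUncurryFin (liftForm m N) (fun i => T (v i))) := by
  have : Nonempty (ExtMomentum m N π) := ⟨q⟩
  obtain ⟨a, haq, hs, ha⟩ := extCoords_compatible.exists_chartAt (π := π) q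
  have he : (chartAt (MomModel m N) q : ExtMomentum m N π → MomModel m N) =
      extCoords_compatible.chart a := by
    funext z
    rw [ha, FibreCoords.Compatible.chart_apply]
  have h1 : fderiv ℝ (formInChart (canonicalForm π) q) (chartAt (MomModel m N) q q) =
      liftForm m N := by
    have h2 : formInChart (canonicalForm π) q =ᶠ[𝓝 (chartAt (MomModel m N) q q)] liftForm m N := by
      filter_upwards [(chartAt (MomModel m N) q).open_target.mem_nhds
        ((chartAt (MomModel m N) q).map_source (mem_chart_source _ q))] with u hu
      exact formInChart_canonicalForm hs ha hu
    rw [h2.fderiv_eq]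
    exact (liftForm m N).fderiv
  let D : (ExtMomentum m N π → MomModel m N) → MomModel m N →L[ℝ] MomModel m N :=
    fun f => mfderiv 𝓘(ℝ, MomModel m N) 𝓘(ℝ, MomModel m N) f q
  let T : MomModel m N →L[ℝ] MomModel m N := D (chartAt (MomModel m N) q)
  have hT : T = D (extCoords_compatible.chart a) := congrArg D he
  have h5 : ∀ v : Fin (m + 1) → MomModel m N, multisymplecticForm π q v =
      -(ContinuousAlternatingMap.alternatizeUncurryFin (fderiv ℝ (formInChart (canonicalForm π) q)
        (chartAt (MomModel m N) q q)) (fun i => T (v i))) := by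
    intro v
    unfold multisymplecticForm dForm
    rfl
  refine ⟨a, haq, T, fun v => ?_, fun v => ?_, fun v => (h5 v).trans ?_⟩
  · exact (congrArg (fun R : MomModel m N →L[ℝ] MomModel m N => (R v).1) hT).trans
      (extCoords_compatible.fst_mfderiv_chart (a := a) (z := q) haq v)
  · exact (congrArg (fun R : MomModel m N →L[ℝ] MomModel m N => (R v).2) hT).trans
      (extCoords_compatible.snd_mfderiv_chart (a := a) (z := q) haq v)
  · exact congrArg (fun f : MomModel m N →L[ℝ] (MomModel m N [⋀^Fin m]→L[ℝ] ℝ) =>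
      -(ContinuousAlternatingMap.alternatizeUncurryFin f (fun i => T (v i)))) h1

/-- The multisymplectic form with one vertical argument. -/
theorem multisymplecticForm_snoc (q : ExtMomentum m N π) :
    ∃ a : AdaptedChart m N π, q.pt ∈ a.tot.source ∧ ∀ (x : Fin m → MomModel m N) (w : MomModel m N)
      (e : ExtModel m N) (z : Fin m → TotalModel m N), dExtPt q w = 0 →
      mfderiv 𝓘(ℝ, MomModel m N) 𝓘(ℝ, ExtModel m N) (extCoords.fib a) q w = e →
      (∀ i, a.d q.pt (dExtPt q (x i)) = z i) →
      multisymplecticForm π q (Fin.snoc (α := fun _ => MomModel m N) x w) =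
        -((-1) ^ m * extIncl m N e z) := by
  obtain ⟨a, haq, T, hT1, hT2, hT⟩ := exists_multisymplecticForm_eq q
  refine ⟨a, haq, fun x w e z hw he hz => ?_⟩
  have hw1 : (T w).1 = 0 := (hT1 w).trans ((congrArg (a.d q.pt) hw).trans (map_zero _))
  have h6 : (T w).2 = e := (hT2 w).trans he
  have h7 : (fun i => (T (x i)).1) = z := funext fun i => (hT1 (x i)).trans (hz i)
  refine (hT _).trans (congrArg Neg.neg ?_)
  refine (congrArg (fun v : Fin (m + 1) → MomModel m N =>
    ContinuousAlternatingMap.alternatizeUncurryFin (liftForm m N) v)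
    (comp_snoc (fun v => T v) x w)).trans ?_
  rw [alternatizeUncurryFin_liftForm_snoc _ hw1, h6, h7]

/-- Each term of the alternating sum for `Ω` is linear in the fibre component of one of the
arguments. This applies to vectors tangent to the zero section. -/
theorem multisymplecticForm_eq_zero {q : ExtMomentum m N π} {v : Fin (m + 1) → MomModel m N}
    (h : ∀ a : AdaptedChart m N π, q.pt ∈ a.tot.source → ∀ i,
      mfderiv 𝓘(ℝ, MomModel m N) 𝓘(ℝ, ExtModel m N) (extCoords.fib a) q (v i) = 0) :
    multisymplecticForm π q v = 0 := by
  obtain ⟨a, haq, T, -, hT2, hT⟩ := exists_multisymplecticForm_eq q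
  refine (hT v).trans ?_
  rw [ContinuousAlternatingMap.alternatizeUncurryFin_apply, neg_eq_zero]
  refine Finset.sum_eq_zero fun i _ => ?_
  have h2 : (T (v i)).2 = 0 := (hT2 _).trans (h a haq i)
  rw [liftForm_apply, h2, map_zero]
  simp

end Multisymplectic

end FieldTheory

end

noncomputable section

namespace FieldTheory

/-! ### Hyper-regular Lagrangians -/

section ModelHyperRegular

variable {m N : ℕ} {ν : BaseModel m → BaseModel m [⋀^Fin m]→L[ℝ] ℝ} {Λ : JetModel m N → ℝ}
  {p : JetModel m N}

/-- The projection `extProj` is arbitrary off the forms of type one, but the vertical derivative is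
again a polar form and so of that type. -/
theorem extIncl_extProj_fderiv_cartanCoord (hΛ : ContDiffAt ℝ ∞ Λ p)
    (hΦ : DifferentiableAt ℝ (cartanCoord ν Λ) p)
    (B : BaseModel m →L[ℝ] EuclideanSpace ℝ (Fin N)) :
    extIncl m N (extProj m N (fderiv ℝ (cartanCoord ν Λ) p (0, B))) =
      fderiv ℝ (cartanCoord ν Λ) p (0, B) := by
  obtain ⟨η, hη⟩ : ∃ η : modelOne m N, η.1 = fderiv ℝ (cartanCoord ν Λ) p (0, B) := by
    rw [fderiv_cartanCoord_vert hΛ hΦ]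
    exact ⟨⟨_, polarForm_mem _ _ _ _⟩, rfl⟩
  rw [← hη, extProj_eq, extIncl_extEquiv]

/-- By `fderiv_cartanCoord_jet` the hypothesis says that the Hessian vanishes on all pairs `(B, l -
v)`. By symmetry `l - v` lies in its kernel, and the derivative of the Cartan form in that direction
depends on the Hessian only. -/
theorem fderiv_cartanCoord_sub_eq_zero (hΛ : ContDiffAt ℝ ∞ Λ p)
    (hΦ : DifferentiableAt ℝ (cartanCoord ν Λ) p) (hν : ν p.1.1 ≠ 0)
    {l : BaseModel m →L[ℝ] EuclideanSpace ℝ (Fin N)}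
    (hl : ∀ (B : BaseModel m →L[ℝ] EuclideanSpace ℝ (Fin N)) (w : Fin m → BaseModel m),
      fderiv ℝ (cartanCoord ν Λ) p (0, B) (fun i => (w i, l (w i))) = 0) :
    fderiv ℝ (cartanCoord ν Λ) p (0, l - p.2) = 0 := by
  obtain ⟨w, hw⟩ : ∃ w, ν p.1.1 w ≠ 0 := by
    by_contra! h
    exact hν (ContinuousAlternatingMap.ext h)
  have h1 : vertHess Λ p (l - p.2) = 0 := by
    refine ContinuousLinearMap.ext fun B => ?_
    have h2 := hl B w
    rw [fderiv_cartanCoord_jet hΛ hΦ] at h2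
    rw [vertHess_symm hΛ]
    exact (mul_eq_zero.1 h2).resolve_right hw
  refine fderiv_cartanCoord_eq_zero hΛ hΦ ?_
  rw [h1, ← momCLM_apply, map_zero]

end ModelHyperRegular

section HyperRegular

variable {m N : ℕ} {M : Type*} [TopologicalSpace M] [ChartedSpace (BaseModel m) M]
  [IsManifold 𝓘(ℝ, BaseModel m) ∞ M]
  {E : Type*} [TopologicalSpace E] [ChartedSpace (TotalModel m N) E]
  [IsManifold 𝓘(ℝ, TotalModel m N) ∞ E]
  {π : E → M} [IsFiberedManifold m N π] {vol : DiffForm (BaseModel m) M m} {L : J1 m N π → ℝ}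

theorem dMap_extBase (q : ExtMomentum m N π) (v : MomModel m N) :
    dMap m (MomModel m N) (extBase π) q v = dProj m N π q.pt (dExtPt q v) :=
  DFunLike.congr_fun (mfderiv_comp (g := π) (f := (ExtMomentum.pt : ExtMomentum m N π → E)) q
    ((IsFiberedManifold.smooth (m := m) (N := N) (π := π)).mdifferentiableAt (by simp))
    (contMDiff_ext_pt.mdifferentiableAt (by simp))) v

theorem IsHyperRegular.mfderiv_injective (hh : IsHyperRegular vol L) (j : J1 m N π) :
    Function.Injective (mfderiv 𝓘(ℝ, JetModel m N) 𝓘(ℝ, TotalModel m N × RestModel m N)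
      (legendre vol L) j) := by
  obtain ⟨Φ, hΦ⟩ := hh
  have h1 : (Φ : J1 m N π → RestMomentum m N π) = legendre vol L := funext hΦ
  rw [← h1]
  exact (Φ.mfderivToContinuousLinearEquiv (by simp) j).injective

theorem exists_vertical {a : AdaptedChart m N π} {j : J1 m N π} [Nonempty (J1 m N π)]
    (hj : j.pt ∈ a.tot.source) (B : BaseModel m →L[ℝ] EuclideanSpace ℝ (Fin N)) :
    ∃ w : JetModel m N, mfderiv 𝓘(ℝ, JetModel m N) 𝓘(ℝ, JetModel m N)
      (jetCoords_compatible.chart a) j w = ((0, B) : JetModel m N) ∧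
      mfderiv 𝓘(ℝ, JetModel m N) 𝓘(ℝ, TotalModel m N) (FirstJet.pt : J1 m N π → E) j w = 0 := by
  obtain ⟨w, hw⟩ := (jetCoords_compatible.chart_mdifferentiable a).mfderiv_surjective
    (jetCoords_compatible.mem_chart_source.2 hj) (0, B)
  refine ⟨w, hw, ?_⟩
  have h1 := jetCoords_compatible.fst_mfderiv_chart hj w
  rw [hw] at h1
  exact (AdaptedChart.dInv_d hj _).symm.trans ((congrArg (a.dInv j.pt) h1.symm).trans
    (map_zero _))

theorem AdaptedChart.d_horLift {a : AdaptedChart m N π} {j : J1 m N π} (hj : j.pt ∈ a.tot.source)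
    (x : BaseModel m) : a.d j.pt (j.horLift x) =
      (a.db (π j.pt) x, jetCoords.fib a j (a.db (π j.pt) x)) := by
  refine Prod.ext ?_ ?_
  · refine (AdaptedChart.fst_d hj _).trans ?_
    exact congrArg (a.db (π j.pt)) (j.isSection x)
  · exact congrArg (fun v : BaseModel m => (a.d j.pt (j.horLift v)).2)
      (AdaptedChart.dbInv_db (a.mapsTo _ hj) x).symm

/-- Solutions of the field equations of a hyper-regular Lagrangian are semi-holonomic. -/
theorem IsHyperRegular.dExtPt_eq (hh : IsHyperRegular vol L) (hvol : IsVolumeForm vol)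
    (hL : ContMDiff 𝓘(ℝ, JetModel m N) 𝓘(ℝ, ℝ) ∞ L) {j : J1 m N π}
    {l : BaseModel m →L[ℝ] MomModel m N}
    (hl : ∀ x, dMap m (MomModel m N) (extBase π) (extLegendre vol L j) (l x) = x)
    (hΩ : ∀ (Z : Fin m → BaseModel m) (w : JetModel m N),
      mfderiv 𝓘(ℝ, JetModel m N) 𝓘(ℝ, TotalModel m N) (FirstJet.pt : J1 m N π → E) j w = 0 →
      multisymplecticForm π (extLegendre vol L j)
        (Fin.snoc (α := fun _ => MomModel m N) (fun i => l (Z i)) (dLegendre vol L j w)) = 0)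
    (x : BaseModel m) : dExtPt (extLegendre vol L j) (l x) = j.horLift x := by
  have : Nonempty (J1 m N π) := ⟨j⟩
  obtain ⟨a, hj', hΩa⟩ := multisymplecticForm_snoc (extLegendre vol L j)
  have hj : j.pt ∈ a.tot.source := hj'
  obtain ⟨p, hp⟩ : ∃ p, p = jetCoords_compatible.chart a j := ⟨_, rfl⟩
  have hΛ : ContDiffAt ℝ ∞ (lagCoord L a) p := by
    rw [hp]
    exact contDiffAt_lagCoord_chart hL hj
  have hΦ : DifferentiableAt ℝ (cartanCoord (volCoord vol a) (lagCoord L a)) p := by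
    rw [hp]
    exact (contDiffAt_cartanCoord_chart hvol.smooth hL hj).differentiableAt (by simp)
  have hν : volCoord vol a p.1.1 ≠ 0 := by
    rw [hp, jetCoords_compatible.chart_apply]
    exact volCoord_ne_zero hvol.ne_zero hj
  -- Here `T` is the projection of `l` to `E`, read in the chart. As `l` is a section over `M`, `T`
  -- is the graph of a map `k`, and the claim becomes that `k` is the fibre coordinate of `j`.
  obtain ⟨T, hT⟩ : ∃ T : BaseModel m →L[ℝ] TotalModel m N,
      ∀ x, T x = a.d j.pt (dExtPt (extLegendre vol L j) (l x)) :=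
    ⟨(a.d j.pt).comp ((dExtPt (extLegendre vol L j)).comp l), fun _ => rfl⟩
  have hT1 : ∀ x, (T x).1 = a.db (π j.pt) x := by
    intro x
    rw [hT]
    refine (AdaptedChart.fst_d hj _).trans (congrArg (a.db (π j.pt)) ?_)
    exact (dMap_extBase (extLegendre vol L j) (l x)).symm.trans (hl x)
  obtain ⟨k, hk⟩ : ∃ k : BaseModel m →L[ℝ] EuclideanSpace ℝ (Fin N),
      ∀ x, k x = (T (a.dbInv (π j.pt) x)).2 :=
    ⟨(ContinuousLinearMap.snd ℝ _ _).comp (T.comp (a.dbInv (π j.pt))), fun _ => rfl⟩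
  have hT2 : ∀ x, T (a.dbInv (π j.pt) x) = (x, k x) := fun x =>
    Prod.ext ((hT1 _).trans (AdaptedChart.db_dbInv (a.mapsTo _ hj) x)) (hk x).symm
  have h1 : ∀ (B : BaseModel m →L[ℝ] EuclideanSpace ℝ (Fin N)) (w : Fin m → BaseModel m),
      fderiv ℝ (cartanCoord (volCoord vol a) (lagCoord L a)) p (0, B)
        (fun i => (w i, k (w i))) = 0 := by
    intro B w
    obtain ⟨u, hu, hu0⟩ := exists_vertical hj B
    have h2 := hΩ (fun i => a.dbInv (π j.pt) (w i)) u hu0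
    have h3 := hΩa (fun i => l (a.dbInv (π j.pt) (w i))) (dLegendre vol L j u)
      (extProj m N (fderiv ℝ (cartanCoord (volCoord vol a) (lagCoord L a)) p (0, B)))
      (fun i => (w i, k (w i))) ((dExtPt_dLegendre hvol.smooth hL j u).trans hu0)
      (by
        refine (mfderiv_fib_extLegendre hvol.smooth hL hj u).trans ?_
        rw [hp]
        exact congrArg (fun v : JetModel m N => extProj m N (fderiv ℝ
          (cartanCoord (volCoord vol a) (lagCoord L a)) (jetCoords_compatible.chart a j) v)) hu)
      (fun i => (hT _).symm.trans (hT2 (w i)))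
    rw [extIncl_extProj_fderiv_cartanCoord hΛ hΦ] at h3
    have h4 := neg_eq_zero.1 (h3.symm.trans h2)
    exact (mul_eq_zero.1 h4).resolve_left (pow_ne_zero _ (by norm_num))
  have h5 := fderiv_cartanCoord_sub_eq_zero hΛ hΦ hν h1
  have h9 : restProj m N (fderiv ℝ (cartanCoord (volCoord vol a) (lagCoord L a))
      (jetCoords_compatible.chart a j) (0, k - p.2)) = 0 := by
    rw [← hp, h5, map_zero]
  -- The direction `k - v` is realised by a tangent vector of `J¹E`, vertical over `E`. It is
  -- annihilated by the differential of the Legendre map and is therefore zero.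
  obtain ⟨u, hu, hu0⟩ := exists_vertical hj (k - p.2)
  have h6 : mfderiv 𝓘(ℝ, JetModel m N) 𝓘(ℝ, TotalModel m N × RestModel m N) (legendre vol L) j u =
      0 := by
    refine restCoords_compatible.eq_zero_of_mfderiv (a := a) (z := legendre vol L j) hj ?_ ?_
    · exact (mfderiv_rest_pt_legendre hvol.smooth hL j u).trans hu0
    · refine (mfderiv_fib_legendre hvol.smooth hL hj u).trans ?_
      exact (congrArg (fun v : JetModel m N => restProj m N (fderiv ℝ
          (cartanCoord (volCoord vol a) (lagCoord L a)) (jetCoords_compatible.chart a j) v))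
          hu).trans h9
  have h7 : u = 0 := hh.mfderiv_injective j (h6.trans (map_zero _).symm)
  have h8 : k - p.2 = 0 := by
    let R : JetModel m N →L[ℝ] JetModel m N := mfderiv 𝓘(ℝ, JetModel m N) 𝓘(ℝ, JetModel m N)
      (jetCoords_compatible.chart a) j
    have h9 : R u = (0, k - p.2) := hu
    rw [h7, map_zero] at h9
    exact (congrArg Prod.snd h9).symm
  have h10 : jetCoords.fib a j = k := by
    rw [sub_eq_zero] at h8
    rw [h8, hp, jetCoords_compatible.chart_apply]
  have h11 : T x = (a.db (π j.pt) x, jetCoords.fib a j (a.db (π j.pt) x)) := by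
    rw [h10, ← hT2]
    exact congrArg T (AdaptedChart.dbInv_db (a.mapsTo _ hj) x).symm
  have h12 : a.d j.pt (dExtPt (extLegendre vol L j) (l x)) = a.d j.pt (j.horLift x) :=
    (hT x).symm.trans (h11.trans (AdaptedChart.d_horLift hj x).symm)
  exact (AdaptedChart.dInv_d hj _).symm.trans ((congrArg (a.dInv j.pt) h12).trans
    (AdaptedChart.dInv_d hj _))

end HyperRegular

end FieldTheory

end

noncomputable section

namespace FieldTheory

/-! ### Semi-holonomy -/

section Determinant

variable {m : ℕ}

variable (m) in
/-- The standard volume form of the base model space. -/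
def detForm : BaseModel m [⋀^Fin m]→L[ℝ] ℝ :=
  { (EuclideanSpace.basisFun (Fin m) ℝ).toBasis.det with
    cont := (contDiff_multilinear
      (EuclideanSpace.basisFun (Fin m) ℝ).toBasis.det.toMultilinearMap).continuous }

theorem detForm_apply (v : Fin m → BaseModel m) :
    detForm m v = (EuclideanSpace.basisFun (Fin m) ℝ).toBasis.det v := rfl

theorem detForm_single : detForm m (fun i => EuclideanSpace.single i (1 : ℝ)) = 1 := by
  rw [detForm_apply]
  have h : (fun i => EuclideanSpace.single i (1 : ℝ)) =
      (EuclideanSpace.basisFun (Fin m) ℝ).toBasis := by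
    funext i
    simp
  rw [h, Module.Basis.det_self]

theorem detForm_ne_zero : detForm m ≠ 0 := by
  intro h
  have h1 := detForm_single (m := m)
  rw [h] at h1
  exact zero_ne_one h1

theorem ιMulti_linear {V : Type*} [AddCommGroup V] [Module ℝ V] (T : BaseModel m →ₗ[ℝ] V)
    (b : Fin m → BaseModel m) : exteriorPower.ιMulti ℝ m (fun i => T (b i)) =
      detForm m b • exteriorPower.ιMulti ℝ m (fun i => T (EuclideanSpace.single i (1 : ℝ))) := by
  have h1 : ∀ i, T (b i) = ∑ k, b i k • T (EuclideanSpace.single k (1 : ℝ)) := by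
    intro i
    conv_lhs => rw [← (EuclideanSpace.basisFun (Fin m) ℝ).toBasis.sum_repr (b i)]
    simp
  have h2 : detForm m b = (Matrix.of fun i k => b i k).det := by
    rw [detForm_apply, Module.Basis.det_apply, ← Matrix.det_transpose]
    congr 1
  simp only [h1]
  rw [h2]
  exact ιMulti_sum_smul (Matrix.of fun i k => b i k) _

end Determinant

section Contractions

variable {m : ℕ} {V : Type*} [NormedAddCommGroup V] [NormedSpace ℝ V]

/-- Each of the `m` fixed arguments reproduces `Ξ` and the last one is killed. Against the factor `m
- 1` in the field equation for connections, the difference is exactly one copy of `Ξ`, which must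
vanish. -/
theorem tensorContraction_snoc (Ξ : V [⋀^Fin (m + 1)]→L[ℝ] ℝ) (A : V →L[ℝ] V) {x : Fin m → V}
    {w : V} (hx : ∀ i, A (x i) = x i) (hw : A w = 0) :
    tensorContraction Ξ A (Fin.snoc (α := fun _ => V) x w) =
      m * Ξ (Fin.snoc (α := fun _ => V) x w) := by
  unfold tensorContraction
  rw [Fin.sum_univ_castSucc]
  have h1 : ∀ i : Fin m, Function.update (Fin.snoc (α := fun _ => V) x w) i.castSucc
      (A (Fin.snoc (α := fun _ => V) x w i.castSucc)) = Fin.snoc (α := fun _ => V) x w := by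
    intro i
    rw [Fin.snoc_castSucc, hx, Function.update_eq_iff]
    simp
  simp only [h1]
  have h2 : Ξ (Function.update (Fin.snoc (α := fun _ => V) x w) (Fin.last m)
      (A (Fin.snoc (α := fun _ => V) x w (Fin.last m)))) = 0 :=
    Ξ.map_coord_zero (Fin.last m) (by rw [Function.update_self, Fin.snoc_last, hw])
  rw [h2]
  simp

/-- A transverse decomposable `m`-vector is a multiple of the one defined by a linear section. -/
theorem MVAt.exists_section {H' : Type*} [NormedAddCommGroup H'] [NormedSpace ℝ H']
    {T : V →L[ℝ] BaseModel m} {Ξ : V [⋀^Fin (m + 1)]→L[ℝ] ℝ} {R : H' →L[ℝ] V} {A : ⋀[ℝ]^m V}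
    (hA : MVAt T Ξ R A) : ∃ (l : BaseModel m →L[ℝ] V) (c : ℝ), c ≠ 0 ∧ (∀ x, T (l x) = x) ∧
      A = c • exteriorPower.ιMulti ℝ m (fun i => l (EuclideanSpace.single i (1 : ℝ))) ∧
      ∀ (Z : Fin m → BaseModel m) (w : H'), Ξ (Fin.snoc (α := fun _ => V) (fun i => l (Z i)) (R w)) = 0 := by
  obtain ⟨x, rfl⟩ := hA.decomposable
  have h1 : detForm m (fun i => T (x i)) ≠ 0 := by
    have h2 := hA.transverse (detForm m) detForm_ne_zero
    unfold mvPair at h2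
    rw [exteriorPower.alternatingMapLinearEquiv_apply_ιMulti] at h2
    exact h2
  -- Transversality makes the projections `T xᵢ` a basis of the base; the section `l` is the linear
  -- map that sends them back to the `xᵢ`.
  have h2 := ((EuclideanSpace.basisFun (Fin m) ℝ).toBasis.is_basis_iff_det).2 (isUnit_iff_ne_zero.2 h1)
  let b : Module.Basis (Fin m) ℝ (BaseModel m) := Module.Basis.mk h2.1 h2.2.ge
  have hb : ∀ i, b i = T (x i) := fun i => Module.Basis.mk_apply _ _ i
  let l : BaseModel m →ₗ[ℝ] V := b.constr ℝ x
  have hl : ∀ i, l (T (x i)) = x i := fun i => by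
    rw [← hb]
    exact b.constr_basis ℝ x i
  have hx : exteriorPower.ιMulti ℝ m x = detForm m (fun i => T (x i)) •
      exteriorPower.ιMulti ℝ m (fun i => l (EuclideanSpace.single i (1 : ℝ))) := by
    rw [← ιMulti_linear]
    simp only [hl]
  refine ⟨LinearMap.toContinuousLinearMap l, _, h1, ?_, hx, ?_⟩
  · have h3 : T.toLinearMap ∘ₗ l = LinearMap.id := b.ext fun i => by
      rw [hb]
      show T (l (T (x i))) = _
      rw [hl]
      rfl
    exact fun x => LinearMap.congr_fun h3 x
  · intro Z w
    rw [← mvContraction_ιMulti_eq_zero_iff]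
    have h4 := hA.fieldEq w
    rw [hx, mvContraction_smul] at h4
    have h5 := (mul_eq_zero.1 h4).resolve_left h1
    -- For arbitrary `Z` the product of the `l (Z i)` is a determinant times that of the `l eᵢ`, so
    -- the equation for one frame implies it for all arguments.
    refine (congrArg (fun B => mvContraction Ξ B (R w)) (ιMulti_linear l Z)).trans ?_
    rw [mvContraction_smul, h5, mul_zero]

theorem mvPush_eq_smul_ιMulti {V' : Type*} [NormedAddCommGroup V'] [NormedSpace ℝ V']
    {T : V →L[ℝ] V'} {l : BaseModel m →L[ℝ] V} {l' : BaseModel m →L[ℝ] V'} {c : ℝ}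
    {b : Fin m → BaseModel m} {A : ⋀[ℝ]^m V}
    (hA : A = c • exteriorPower.ιMulti ℝ m (fun i => l (b i))) (h : ∀ x, T (l x) = l' x) :
    mvPush (H₁ := V) (H₂ := V') T A = c • exteriorPower.ιMulti ℝ m (fun i => l' (b i)) := by
  subst hA
  refine (mvPush_smul (H₁ := V) (H₂ := V') _ _ _).trans (congrArg (c • ·) ?_)
  refine (mvPush_ιMulti (H₁ := V) (H₂ := V') _ _).trans ?_
  exact congrArg (exteriorPower.ιMulti ℝ m) (funext fun i => h _)

/-- The `m`-vector `A` is mapped to a nonzero multiple of the exterior product of the images of the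
standard basis vectors. The instances are explicit so that tangent spaces can be replaced by model
spaces. -/
def IsMultivectorOver (V W : Type*) (_ : AddCommGroup V) (_ : Module ℝ V) (_ : AddCommGroup W)
    (_ : Module ℝ W) (T : V →ₗ[ℝ] W) (l : BaseModel m → W) (A : ⋀[ℝ]^m V) : Prop :=
  ∃ c : ℝ, c ≠ 0 ∧ exteriorPower.map m T A =
    c • exteriorPower.ιMulti ℝ m (fun i => l (EuclideanSpace.single i (1 : ℝ)))

theorem isMultivectorOver_of_eq {V' : Type*} [NormedAddCommGroup V'] [NormedSpace ℝ V']
    {T : V →L[ℝ] V'} {l : BaseModel m →L[ℝ] V} {l' : BaseModel m →L[ℝ] V'} {c : ℝ} (hc : c ≠ 0)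
    {A : ⋀[ℝ]^m V} (hA : A = c • exteriorPower.ιMulti ℝ m
      (fun i => l (EuclideanSpace.single i (1 : ℝ)))) (h : ∀ x, T (l x) = l' x) :
    IsMultivectorOver V V' NormedAddCommGroup.toAddCommGroup NormedSpace.toModule
      NormedAddCommGroup.toAddCommGroup NormedSpace.toModule T.toLinearMap l' A :=
  ⟨c, hc, mvPush_eq_smul_ιMulti hA h⟩

end Contractions

section SemiHolonomy

variable {m N : ℕ} {M : Type*} [TopologicalSpace M] [ChartedSpace (BaseModel m) M]
  [IsManifold 𝓘(ℝ, BaseModel m) ∞ M]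
  {E : Type*} [TopologicalSpace E] [ChartedSpace (TotalModel m N) E]
  [IsManifold 𝓘(ℝ, TotalModel m N) ∞ E]
  {π : E → M} [IsFiberedManifold m N π] {vol : DiffForm (BaseModel m) M m} {L : J1 m N π → ℝ}
  {S : Set (J1 m N π)}

theorem IsHyperRegular.jetSemiHolonomic (hh : IsHyperRegular vol L) (hvol : IsVolumeForm vol)
    (hL : ContMDiff 𝓘(ℝ, JetModel m N) 𝓘(ℝ, ℝ) ∞ L)
    {Y : J1 m N π → FirstJet m (MomModel m N) (extBase (m := m) (N := N) π)}
    (hY : JetStructural vol L S Y) (hE : JetFieldEq vol L S Y) : JetSemiHolonomic S Y := by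
  intro j hj
  have hpt : (Y j).pt = extLegendre vol L j := IsJetFieldOn.pt_eq hY hj
  refine ⟨congrArg ExtMomentum.pt hpt, ?_⟩
  let D : ExtMomentum m N π → MomModel m N →L[ℝ] TotalModel m N := dExtPt
  let B : ExtMomentum m N π → MomModel m N →L[ℝ] BaseModel m := dMap m (MomModel m N) (extBase π)
  refine Eq.trans (b := (D (extLegendre vol L j)).comp (Y j).modelLin)
    (congrArg (fun q => (D q).comp (Y j).modelLin) hpt) ?_
  refine ContinuousLinearMap.ext fun x => ?_
  refine hh.dExtPt_eq hvol hL (l := (Y j).modelLin) (fun x => ?_) (fun Z w _ => hE j hj Z w) x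
  exact (congrArg (fun q => B q ((Y j).modelLin x)) hpt.symm).trans ((Y j).isSection x)

theorem IsHyperRegular.isMultivectorOver (hh : IsHyperRegular vol L) (hvol : IsVolumeForm vol)
    (hL : ContMDiff 𝓘(ℝ, JetModel m N) 𝓘(ℝ, ℝ) ∞ L) {j : J1 m N π} {A : ModelMV m (MomModel m N)}
    (hA : ExtMVAt vol L j A) : IsMultivectorOver (MomModel m N) (TotalModel m N)
      NormedAddCommGroup.toAddCommGroup NormedSpace.toModule NormedAddCommGroup.toAddCommGroup
      NormedSpace.toModule (dExtPt (extLegendre vol L j)).toLinearMap j.horLift A :=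
  (MVAt.exists_section hA).elim fun _ h => h.elim fun _ h =>
    isMultivectorOver_of_eq (V := MomModel m N) (V' := TotalModel m N) h.1 h.2.2.1
      (hh.dExtPt_eq hvol hL h.2.1 (fun Z w _ => h.2.2.2 Z w))

/-- The field equation is tested only on the range of the differential of the extended Legendre map,
so the values of `D` can be used as its arguments because of `hr`. With a vertical last argument,
`tensorContraction_snoc` then gives the equation for the linear section `D j`. -/
theorem IsHyperRegular.connSemiHolonomic (hh : IsHyperRegular vol L) (hvol : IsVolumeForm vol)
    (hL : ContMDiff 𝓘(ℝ, JetModel m N) 𝓘(ℝ, ℝ) ∞ L) {D : ExtConn vol L}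
    (hs : ∀ j ∈ S, ∀ x : BaseModel m,
      dMap m (MomModel m N) (extBase π) (extLegendre vol L j) (D j x) = x)
    (hr : ∀ j ∈ S, ∀ x : BaseModel m, ∃ u, dLegendre vol L j u = D j x)
    (hE : ConnFieldEq vol L S D) : ConnSemiHolonomic vol L S D := by
  intro j hj
  let T : MomModel m N →L[ℝ] BaseModel m := dMap m (MomModel m N) (extBase π) (extLegendre vol L j)
  let D₁ : BaseModel m →L[ℝ] MomModel m N := D j
  let F : JetModel m N →L[ℝ] MomModel m N := dLegendre vol L j
  have hs' : ∀ x, T (D₁ x) = x := hs j hj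
  refine ContinuousLinearMap.ext fun x => ?_
  refine hh.dExtPt_eq hvol hL (l := D₁) hs' (fun Z w hw => ?_) x
  choose u hu using fun i => hr j hj (Z i)
  have h1 := hE j hj (Fin.snoc (α := fun _ => JetModel m N) u w)
  have h2 : (fun i => F (Fin.snoc (α := fun _ => JetModel m N) u w i)) =
      Fin.snoc (α := fun _ => MomModel m N) (fun i => D₁ (Z i)) (F w) :=
    (comp_snoc (fun v => F v) u w).trans
      (congrArg (fun y => Fin.snoc (α := fun _ => MomModel m N) y (F w)) (funext hu))
  have h3 : T (F w) = 0 := by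
    refine (dMap_extBase (extLegendre vol L j) (F w)).trans ?_
    refine (congrArg (dProj m N π j.pt) ((dExtPt_dLegendre hvol.smooth hL j w).trans hw)).trans ?_
    exact map_zero _
  let Ξ : MomModel m N [⋀^Fin (m + 1)]→L[ℝ] ℝ := multisymplecticForm π (extLegendre vol L j)
  have h4 : tensorContraction Ξ (D₁.comp T)
      (fun i => F (Fin.snoc (α := fun _ => JetModel m N) u w i)) =
      ((m : ℝ) - 1) * Ξ (fun i => F (Fin.snoc (α := fun _ => JetModel m N) u w i)) := h1
  rw [h2, tensorContraction_snoc Ξ (D₁.comp T)] at h4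
  · have h5 : Ξ (Fin.snoc (α := fun _ => MomModel m N) (fun i => D₁ (Z i)) (F w)) = 0 := by
      linarith
    exact h5
  · intro i
    show D₁ (T (D₁ (Z i))) = _
    rw [hs']
  · show D₁ (T (F w)) = 0
    rw [h3, map_zero]

end SemiHolonomy

end FieldTheory

end

noncomputable section

namespace FieldTheory

/-! ### The zero Lagrangian on the trivial bundle -/

section FibreConnected

variable {m N : ℕ} {M : Type*} [TopologicalSpace M] [ChartedSpace (BaseModel m) M]
  {E : Type*} [TopologicalSpace E] [ChartedSpace (TotalModel m N) E] {π : E → M}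
  {Z W : Type*} [NormedAddCommGroup W] [NormedSpace ℝ W]
  {c : FibreCoords m N π Z W} [TopologicalSpace Z] [ChartedSpace (TotalModel m N × W) Z]

/-- In an adapted chart the fibre is the continuous image of the vector space `W`. -/
theorem FibreCoords.Compatible.isConnected_fibre [IsFiberedManifold m N π]
    (hc : c.Compatible) (z : Z) : IsConnected (c.pt ⁻¹' {c.pt z}) := by
  have : Nonempty Z := ⟨z⟩
  set a := adaptedAt m N π (c.pt z)
  have hz : c.pt z ∈ a.tot.source := mem_adaptedAt _
  have ht : a.tot (c.pt z) ∈ a.tot.target := a.tot.map_source hz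
  have h1 : c.pt ⁻¹' {c.pt z} = range (fun w : W => (hc.chart a).symm (a.tot (c.pt z), w)) := by
    ext z'
    constructor
    · intro h
      have h' : c.pt z' = c.pt z := h
      refine ⟨c.fib a z', ?_⟩
      have h2 : (a.tot (c.pt z), c.fib a z') = hc.chart a z' := by
        rw [hc.chart_apply, h']
      refine (congrArg (hc.chart a).symm h2).trans ((hc.chart a).left_inv ?_)
      exact hc.mem_chart_source.2 (h' ▸ hz)
    · rintro ⟨w, rfl⟩
      exact (hc.pt_chart_symm (u := (a.tot (c.pt z), w)) ht).trans (a.tot.left_inv hz)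
  rw [h1]
  have : Nonempty W := ⟨0⟩
  refine isConnected_range ?_
  refine continuous_iff_continuousAt.2 fun w => ?_
  have h3 := (hc.contMDiffAt_chart_symm (u := (a.tot (c.pt z), w)) ht).continuousAt
  exact h3.comp (f := fun w : W => (a.tot (c.pt z), w)) (by fun_prop)

end FibreConnected

theorem polarForm_zero {B V : Type*} [NormedAddCommGroup B] [NormedSpace ℝ B]
    [NormedAddCommGroup V] [NormedSpace ℝ V] {k : ℕ} (f : B [⋀^Fin k]→L[ℝ] ℝ) (q : V →L[ℝ] B) :
    polarForm 0 f q 0 = 0 := by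
  ext v
  rw [polarForm_apply, zero_mul, zero_add]
  exact Finset.sum_eq_zero fun i _ => f.map_coord_zero i (Function.update_self ..)

section ZeroLagrangian

variable {m N : ℕ}

theorem mfderiv_trivialBundle (y w : TotalModel m N) :
    mfderiv 𝓘(ℝ, TotalModel m N) 𝓘(ℝ, BaseModel m) (trivialBundle m N) y w = w.1 := by
  rw [mfderiv_eq_fderiv]
  exact DFunLike.congr_fun (fderiv_fst (𝕜 := ℝ) (p := y)) w

/-- The jet at `y` with the fibre coordinate `v`. -/
def productJet (y : TotalModel m N) (v : BaseModel m →L[ℝ] EuclideanSpace ℝ (Fin N)) :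
    J1 m N (trivialBundle m N) where
  pt := y
  lin := ((ContinuousLinearMap.id ℝ (BaseModel m)).prod v : BaseModel m →L[ℝ] TotalModel m N)
  isSection x := mfderiv_trivialBundle y ((x, v x) : TotalModel m N)

theorem cartanAt_zero (vol : DiffForm (BaseModel m) (BaseModel m) m)
    (j : J1 m N (trivialBundle m N)) : cartanAt vol (fun _ => 0) j = 0 := by
  have h1 : fibreDeriv (fun _ => 0) j = 0 := fderiv_const_apply 0
  have h2 : momentum (fun _ => 0) j = 0 := by
    unfold momentum
    rw [h1]
    refine Finset.sum_eq_zero fun i _ => ?_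
    ext
    simp
  unfold cartanAt
  rw [h2]
  exact polarForm_zero (B := BaseModel m) (V := TotalModel m N) _ _

/-- The zero section of the extended multimomentum bundle. -/
def zeroExt (y : TotalModel m N) : ExtMomentum m N (trivialBundle m N) := ⟨y, 0⟩

/-- The zero section of the restricted multimomentum bundle. -/
def zeroRest (y : TotalModel m N) : RestMomentum m N (trivialBundle m N) := ⟨y, 0⟩

theorem extLegendre_zero (vol : DiffForm (BaseModel m) (BaseModel m) m)
    (j : J1 m N (trivialBundle m N)) : extLegendre vol (fun _ => 0) j = zeroExt j.pt :=
  congrArg (ExtMomentum.mk j.pt) (Subtype.ext (cartanAt_zero vol j))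

theorem legendre_zero (vol : DiffForm (BaseModel m) (BaseModel m) m)
    (j : J1 m N (trivialBundle m N)) : legendre vol (fun _ => 0) j = zeroRest j.pt := by
  unfold legendre
  rw [extLegendre_zero]
  exact congrArg (RestMomentum.mk j.pt) (map_zero _)

/-- Off the chart domain the coordinate has the default value `0`, so the identity needs no
condition on `y`. -/
theorem fib_zeroExt (a : AdaptedChart m N (trivialBundle m N)) (y : TotalModel m N) :
    extCoords.fib a (zeroExt y) = 0 := by
  by_cases h : (zeroExt y).pt ∈ a.tot.source
  · refine (dif_pos h).trans ?_
    exact (congrArg (extEquiv m N) (map_zero (pullOne m (a.dInv (zeroExt y).pt)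
      (AdaptedChart.vert_dInv h)))).trans (map_zero _)
  · exact dif_neg h

theorem fib_zeroRest (a : AdaptedChart m N (trivialBundle m N)) (y : TotalModel m N) :
    restCoords.fib a (zeroRest y) = 0 := by
  by_cases h : (zeroRest y).pt ∈ a.tot.source
  · refine (dif_pos h).trans ?_
    exact (congrArg (restEquiv m N) (map_zero (pullQuot m (a.dInv (zeroRest y).pt)
      (AdaptedChart.vert_dInv h)))).trans (map_zero _)
  · exact dif_neg h

theorem contMDiff_zeroExt : ContMDiff 𝓘(ℝ, TotalModel m N) 𝓘(ℝ, MomModel m N) ∞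
    (zeroExt (m := m) (N := N)) := fun y => by
  refine extCoords_compatible.contMDiffAt_of_coords (a := FibreCoords.adaptedAt m N _ y) (FibreCoords.mem_adaptedAt y)
    contMDiffAt_id ?_
  simp only [fib_zeroExt]
  exact contMDiffAt_const

theorem contMDiff_zeroRest : ContMDiff 𝓘(ℝ, TotalModel m N) 𝓘(ℝ, TotalModel m N × RestModel m N) ∞
    (zeroRest (m := m) (N := N)) := fun y => by
  refine restCoords_compatible.contMDiffAt_of_coords (a := FibreCoords.adaptedAt m N _ y) (FibreCoords.mem_adaptedAt y)
    contMDiffAt_id ?_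
  simp only [fib_zeroRest]
  exact contMDiffAt_const

theorem mfderiv_pt_zeroRest (y w : TotalModel m N) :
    mfderiv 𝓘(ℝ, TotalModel m N × RestModel m N) 𝓘(ℝ, TotalModel m N)
      (RestMomentum.pt : RestMomentum m N (trivialBundle m N) → _) (zeroRest y)
      (mfderiv 𝓘(ℝ, TotalModel m N) 𝓘(ℝ, TotalModel m N × RestModel m N) zeroRest y w) = w := by
  have h := mfderiv_comp y (contMDiff_rest_pt.mdifferentiableAt (by simp) (x := zeroRest y))
    (contMDiff_zeroRest.mdifferentiableAt (by simp) (x := y))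
  have h1 : mfderiv 𝓘(ℝ, TotalModel m N) 𝓘(ℝ, TotalModel m N)
      ((RestMomentum.pt : RestMomentum m N (trivialBundle m N) → _) ∘ zeroRest) y w = w :=
    DFunLike.congr_fun (mfderiv_id (I := 𝓘(ℝ, TotalModel m N)) (x := y)) w
  exact (DFunLike.congr_fun h w).symm.trans h1

theorem dExtPt_zeroExt (y w : TotalModel m N) :
    dExtPt (zeroExt y)
      (mfderiv 𝓘(ℝ, TotalModel m N) 𝓘(ℝ, MomModel m N) zeroExt y w) = w := by
  have h := mfderiv_comp y (contMDiff_ext_pt.mdifferentiableAt (by simp) (x := zeroExt y))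
    (contMDiff_zeroExt.mdifferentiableAt (by simp) (x := y))
  have h1 : mfderiv 𝓘(ℝ, TotalModel m N) 𝓘(ℝ, TotalModel m N)
      ((ExtMomentum.pt : ExtMomentum m N (trivialBundle m N) → _) ∘ zeroExt) y w = w :=
    DFunLike.congr_fun (mfderiv_id (I := 𝓘(ℝ, TotalModel m N)) (x := y)) w
  exact (DFunLike.congr_fun h w).symm.trans h1

theorem mfderiv_fib_zeroExt (a : AdaptedChart m N (trivialBundle m N)) {y : TotalModel m N}
    (hy : y ∈ a.tot.source) (w : TotalModel m N) :
    mfderiv 𝓘(ℝ, MomModel m N) 𝓘(ℝ, ExtModel m N) (extCoords.fib a) (zeroExt y)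
      (mfderiv 𝓘(ℝ, TotalModel m N) 𝓘(ℝ, MomModel m N) zeroExt y w) = 0 := by
  have h := mfderiv_comp y ((extCoords_compatible.contMDiffAt_fib (a := a)
    (z := zeroExt y) hy).mdifferentiableAt (by simp))
    (contMDiff_zeroExt.mdifferentiableAt (by simp) (x := y))
  have h1 : extCoords.fib a ∘ zeroExt = fun _ : TotalModel m N => (0 : ExtModel m N) :=
    funext (fib_zeroExt a)
  rw [h1, mfderiv_const] at h
  exact (DFunLike.congr_fun h w).symm

/-- A class outside the zero section has a nonzero fibre coordinate, and this coordinate is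
continuous near it. -/
theorem isClosed_range_zeroRest : IsClosed (range (zeroRest (m := m) (N := N))) := by
  refine isOpen_compl_iff.1 (isOpen_iff_mem_nhds.2 fun q hq => ?_)
  set a := FibreCoords.adaptedAt m N (trivialBundle m N) q.pt
  have ha : q.pt ∈ a.tot.source := FibreCoords.mem_adaptedAt _
  have h1 : restCoords.fib a q ≠ 0 := by
    intro h
    have h0 : zeroRest q.pt ∈ {z : RestMomentum m N (trivialBundle m N) |
      restCoords.pt z ∈ a.tot.source} := ha
    exact hq ⟨q.pt, (restCoords.bijOn a).injOn h0 ha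
      (Prod.ext rfl ((fib_zeroRest a q.pt).trans h.symm))⟩
  have h2 : ContinuousAt (restCoords.fib a) q :=
    (restCoords_compatible.contMDiffAt_fib (a := a) (z := q) ha).continuousAt
  filter_upwards [h2.eventually_ne h1] with q' hq'
  rintro ⟨y, rfl⟩
  exact hq' (fib_zeroRest a y)

theorem isClosedEmbedding_zeroRest :
    Topology.IsClosedEmbedding (zeroRest (m := m) (N := N)) where
  toIsEmbedding := Function.LeftInverse.isEmbedding (f := RestMomentum.pt) (fun _ => rfl)
    contMDiff_rest_pt.continuous contMDiff_zeroRest.continuous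
  isClosed_range := isClosed_range_zeroRest

variable (m N) in
-- For `L = 0` the Legendre map is the projection `J¹E → E` followed by the zero section: `P` is `E`
-- itself, `FL0` is the projection, and its fibres are connected as affine spaces.
theorem isAlmostRegular_zero (vol : DiffForm (BaseModel m) (BaseModel m) m) :
    IsAlmostRegular (G := TotalModel m N) vol (fun _ => 0) (zeroRest (m := m) (N := N))
      FirstJet.pt where
  smooth_emb := contMDiff_zeroRest
  isClosedEmbedding := isClosedEmbedding_zeroRest
  immersion y := Function.LeftInverse.injective (mfderiv_pt_zeroRest y)
  range_eq := by
    ext q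
    constructor
    · rintro ⟨y, rfl⟩
      exact ⟨productJet y 0, legendre_zero vol _⟩
    · rintro ⟨j, rfl⟩
      exact ⟨j.pt, (legendre_zero vol j).symm⟩
  factor j := (legendre_zero vol j).symm
  smooth_leg := contMDiff_jet_pt
  submersion := mfderiv_jet_pt_surjective
  connected_fibre j := by
    have h : legendre vol (fun _ => 0) ⁻¹' {legendre vol (fun _ => 0) j} =
        FirstJet.pt ⁻¹' {j.pt} := by
      ext k
      rw [mem_preimage, mem_singleton_iff, legendre_zero, legendre_zero]
      exact isClosedEmbedding_zeroRest.injective.eq_iff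
    rw [h]
    exact jetCoords_compatible.isConnected_fibre j

variable (m N) in
theorem isVolumeForm_detForm : IsVolumeForm (M := BaseModel m) (fun _ => detForm m) where
  smooth x₀ := by
    have h1 : formInChart (H := BaseModel m) (X := BaseModel m) (fun _ => detForm m) x₀ =
        fun _ => detForm m := by
      funext u
      ext v
      show detForm m (fun i => mfderiv 𝓘(ℝ, BaseModel m) 𝓘(ℝ, BaseModel m)
        (chartAt (BaseModel m) x₀).symm u (v i)) = detForm m v
      congr 1
      funext i
      exact DFunLike.congr_fun (mfderiv_id (I := 𝓘(ℝ, BaseModel m)) (x := u)) (v i)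
    rw [h1]
    exact contDiffOn_const
  ne_zero _ := detForm_ne_zero

variable (m N) in
/-- The zero Lagrangian with the standard volume form. -/
theorem isAlmostRegular_zero_detForm : IsAlmostRegular (G := TotalModel m N)
    (fun _ : BaseModel m => detForm m) (fun _ => 0) (zeroRest (m := m) (N := N)) FirstJet.pt :=
  isAlmostRegular_zero m N _

theorem hamSection_zero : (isAlmostRegular_zero_detForm m N).hamSection = zeroExt := by
  funext y
  exact ((isAlmostRegular_zero_detForm m N).hamSection_leg (isVolumeForm_detForm m)
    contMDiff_const (productJet y 0)).trans (extLegendre_zero _ _)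

theorem dHam_zero (y w : TotalModel m N) : (isAlmostRegular_zero_detForm m N).dHam y w =
    mfderiv 𝓘(ℝ, TotalModel m N) 𝓘(ℝ, MomModel m N) zeroExt y w := by
  let D : (TotalModel m N → ExtMomentum m N (trivialBundle m N)) →
      TotalModel m N →L[ℝ] MomModel m N := fun f =>
    mfderiv 𝓘(ℝ, TotalModel m N) 𝓘(ℝ, MomModel m N) f y
  exact congrArg (fun f => D f w) hamSection_zero

/-- The image of `h̃` is the zero section, whose tangent vectors have no fibre component. Thus the
field equations on `P` are void for `L = 0`. -/
theorem hamForm_zero (y : TotalModel m N) :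
    (isAlmostRegular_zero_detForm m N).hamForm y = 0 := by
  let Ω : ExtMomentum m N (trivialBundle m N) → MomModel m N [⋀^Fin (m + 1)]→L[ℝ] ℝ :=
    multisymplecticForm (trivialBundle m N)
  let D : (TotalModel m N → ExtMomentum m N (trivialBundle m N)) →
      TotalModel m N →L[ℝ] MomModel m N := fun f =>
    mfderiv 𝓘(ℝ, TotalModel m N) 𝓘(ℝ, MomModel m N) f y
  ext v
  refine (congrArg (fun f => Ω (f y) (fun i => D f (v i))) hamSection_zero).trans ?_
  exact multisymplecticForm_eq_zero fun a ha i => mfderiv_fib_zeroExt a ha (v i)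

end ZeroLagrangian

end FieldTheory

end

noncomputable section

namespace FieldTheory

/-! ### Fields that are not semi-holonomic -/

section NonSemiHolonomic

variable {m N : ℕ}

/-- The `m`-vector defined by a linear map on the base model space. -/
def liftMV {V : Type*} [NormedAddCommGroup V] [NormedSpace ℝ V] (l : BaseModel m →L[ℝ] V) :
    ModelMV m V :=
  exteriorPower.ιMulti ℝ m (fun i => l (EuclideanSpace.single i (1 : ℝ)))

theorem mvPair_liftMV {V : Type*} [NormedAddCommGroup V] [NormedSpace ℝ V]
    {β : BaseModel m [⋀^Fin m]→L[ℝ] ℝ} (hβ : β ≠ 0) {T : V →L[ℝ] BaseModel m}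
    {l : BaseModel m →L[ℝ] V} (hT : ∀ x, T (l x) = x) : mvPair β T (liftMV l) ≠ 0 := by
  unfold mvPair liftMV
  rw [exteriorPower.alternatingMapLinearEquiv_apply_ιMulti]
  show β (fun i => T (l (EuclideanSpace.single i (1 : ℝ)))) ≠ 0
  simp only [hT]
  intro h
  apply hβ
  ext v
  have h1 := β.toAlternatingMap.eq_smul_basis_det (EuclideanSpace.basisFun (Fin m) ℝ).toBasis
  have h2 : β (EuclideanSpace.basisFun (Fin m) ℝ).toBasis = 0 := by
    refine Eq.trans (congrArg β (funext fun i => ?_)) h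
    simp
  have h3 := congrArg (fun f => f v) h1
  refine h3.trans ?_
  show β (EuclideanSpace.basisFun (Fin m) ℝ).toBasis * _ = 0
  rw [h2, zero_mul]

theorem mvAt_liftMV {V W : Type*} [NormedAddCommGroup V] [NormedSpace ℝ V]
    [NormedAddCommGroup W] [NormedSpace ℝ W] {T : V →L[ℝ] BaseModel m}
    {Ξ : V [⋀^Fin (m + 1)]→L[ℝ] ℝ} {R : W →L[ℝ] V} {l : BaseModel m →L[ℝ] V}
    (hT : ∀ x, T (l x) = x) (hΞ : Ξ = 0) : MVAt T Ξ R (liftMV l) where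
  ne_zero h0 := by
    refine mvPair_liftMV detForm_ne_zero hT ?_
    rw [h0]
    exact map_zero _
  decomposable := ⟨_, rfl⟩
  transverse _ hβ := mvPair_liftMV hβ hT
  fieldEq w := by
    unfold liftMV
    exact (mvContraction_ιMulti_eq_zero_iff _ _ _).2 (DFunLike.congr_fun hΞ _)

/-- The horizontal lift `x ↦ (x, 0)` of the trivial bundle. -/
def flatLift (m N : ℕ) : BaseModel m →L[ℝ] TotalModel m N :=
  ContinuousLinearMap.inl ℝ (BaseModel m) (EuclideanSpace ℝ (Fin N))

/-- The linear map `x ↦ x₀ f₀`. -/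
def tiltMap (hm : 0 < m) (hN : 0 < N) : BaseModel m →L[ℝ] EuclideanSpace ℝ (Fin N) :=
  (EuclideanSpace.proj ⟨0, hm⟩ : BaseModel m →L[ℝ] ℝ).smulRight
    (EuclideanSpace.single ⟨0, hN⟩ (1 : ℝ))

theorem tiltMap_single (hm : 0 < m) (hN : 0 < N) :
    tiltMap hm hN (EuclideanSpace.single ⟨0, hm⟩ (1 : ℝ)) =
      EuclideanSpace.single ⟨0, hN⟩ (1 : ℝ) := by
  simp [tiltMap]

/-- The jet field of the flat connection. -/
def flatJet (y : TotalModel m N) : FirstJet m (TotalModel m N) (hamBase (zeroRest (m := m) (N := N)))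
    where
  pt := y
  lin := flatLift m N
  isSection x := mfderiv_trivialBundle y (flatLift m N x)

/-- The flat connection. -/
def flatConn : IsAlmostRegular.HamConn (G := TotalModel m N) (zeroRest (m := m) (N := N)) :=
  fun _ => flatLift m N

/-- The `m`-vector field of the flat connection. -/
def flatMV : TotalModel m N → ModelMV m (TotalModel m N) := fun _ => liftMV (flatLift m N)

theorem contMDiffAt_flatLift (n : TotalModel m N) :
    ContMDiffAt 𝓘(ℝ, TotalModel m N) 𝓘(ℝ, BaseModel m →L[ℝ] TotalModel m N) ∞
      (inTangentCoordinates 𝓘(ℝ, BaseModel m) 𝓘(ℝ, TotalModel m N) (fun y : TotalModel m N => y.1)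
        (fun y : TotalModel m N => y) (fun _ => flatLift m N) n) n := by
  have h : inTangentCoordinates 𝓘(ℝ, BaseModel m) 𝓘(ℝ, TotalModel m N)
      (fun y : TotalModel m N => y.1) (fun y : TotalModel m N => y) (fun _ => flatLift m N) n =
      fun _ => flatLift m N :=
    inTangentCoordinates_model_space (fun y : TotalModel m N => y.1) (fun y : TotalModel m N => y)
      (fun _ => flatLift m N) n
  rw [h]
  exact contMDiffAt_const

theorem hdwJet_flatJet : (isAlmostRegular_zero_detForm m N).HDWJet univ flatJet where
  jetField y _ := by
    refine ⟨univ, isOpen_univ, trivial, flatJet, fun _ _ => rfl, fun n _ => ?_, fun _ _ => rfl⟩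
    exact contMDiffAt_flatLift n
  fieldEq y _ Z w := by
    rw [hamForm_zero]
    rfl

theorem hdwConn_flatConn : (isAlmostRegular_zero_detForm m N).HDWConn univ flatConn where
  connection y _ := by
    refine ⟨univ, isOpen_univ, trivial, flatConn, fun n _ => ?_, fun n _ ξ hξ v => ?_,
      fun _ _ => rfl⟩
    · exact contMDiffAt_flatLift n
    · let ξ' : TotalModel m N →L[ℝ] ℝ := ξ
      let T : TotalModel m N →L[ℝ] BaseModel m := dMap m (TotalModel m N) (hamBase zeroRest) n
      have hT : ∀ w, T w = w.1 := mfderiv_trivialBundle n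
      let v' : TotalModel m N := v
      have h2 : T (flatLift m N (T v') - v') = 0 := by
        rw [hT, hT]
        exact sub_self v'.1
      have h1 : ξ' (flatLift m N (T v') - v') = 0 := hξ _ h2
      rw [map_sub, sub_eq_zero] at h1
      exact h1
  fieldEq y _ w := by
    rw [hamForm_zero]
    simp [tensorContraction]

theorem hamMVAt_flatMV (y : TotalModel m N) :
    (isAlmostRegular_zero_detForm m N).HamMVAt y (flatMV y) :=
  mvAt_liftMV (fun x => mfderiv_trivialBundle y (flatLift m N x)) (hamForm_zero y)

theorem hdwMV_flatMV : (isAlmostRegular_zero_detForm m N).HDWMV univ flatMV := by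
  refine (isAlmostRegular_zero_detForm m N).hdwMV_of_hamMVAt ?_ fun y _ => hamMVAt_flatMV y
  refine isLocallyDecomposableOn_iff.2 fun y _ => ⟨univ, isOpen_univ, trivial, fun i _ =>
    flatLift m N (EuclideanSpace.single i (1 : ℝ)), fun i => ?_, fun _ _ => rfl⟩
  exact fun n _ => (contMDiffAt_tangentBundle_model contMDiffAt_id contMDiffAt_const).contMDiffWithinAt

theorem dExtPt_dHam_zero (y w : TotalModel m N) :
    dExtPt ((isAlmostRegular_zero_detForm m N).hamSection y)
      ((isAlmostRegular_zero_detForm m N).dHam y w) = w := by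
  let D : ExtMomentum m N (trivialBundle m N) → MomModel m N →L[ℝ] TotalModel m N := dExtPt
  let w' : MomModel m N := (isAlmostRegular_zero_detForm m N).dHam y w
  refine (congrArg (fun f => D (f y) w') hamSection_zero).trans ?_
  exact (congrArg (D (zeroExt y)) (dHam_zero y w)).trans (dExtPt_zeroExt y w)

/-- They differ on the first basis vector, where the tilted jet has the nonzero fibre component
`f₀`. Both `m` and `N` must be positive for such a jet to exist. -/
theorem flatLift_ne (hm : 0 < m) (hN : 0 < N) :
    flatLift m N ≠ (productJet (0 : TotalModel m N) (tiltMap hm hN)).horLift := by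
  intro h
  have h1 := congrArg Prod.snd (DFunLike.congr_fun h (EuclideanSpace.single ⟨0, hm⟩ (1 : ℝ)))
  have h2 : (0 : EuclideanSpace ℝ (Fin N)) = tiltMap hm hN (EuclideanSpace.single ⟨0, hm⟩ (1 : ℝ)) := h1
  rw [tiltMap_single] at h2
  have h3 := congrArg (fun v : EuclideanSpace ℝ (Fin N) => v ⟨0, hN⟩) h2
  simp at h3

/-- Over the origin the image of the flat field projects to the flat lift whatever the jet is,
whereas semi-holonomy at the tilted jet would require the tilted lift. -/
theorem not_jetSemiHolonomic_flatJet (hm : 0 < m) (hN : 0 < N)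
    {Y : J1 m N (trivialBundle m N) → FirstJet m (MomModel m N) (extBase (trivialBundle m N))}
    (hY : (isAlmostRegular_zero_detForm m N).JetRel univ flatJet Y) : ¬ JetSemiHolonomic univ Y := by
  intro h
  set j := productJet (0 : TotalModel m N) (tiltMap hm hN)
  obtain ⟨h1, h2⟩ := hY j trivial
  obtain ⟨-, h3⟩ := h j trivial
  let D : ExtMomentum m N (trivialBundle m N) → MomModel m N →L[ℝ] TotalModel m N := dExtPt
  let R : TotalModel m N →L[ℝ] MomModel m N := (isAlmostRegular_zero_detForm m N).dHam j.pt
  have h4 : (D (Y j).pt).comp (Y j).modelLin = j.horLift := h3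
  have h5 : (Y j).modelLin = R.comp (flatLift m N) := h2
  refine flatLift_ne hm hN (Eq.trans ?_ h4)
  rw [h5]
  refine ContinuousLinearMap.ext fun x => ?_
  exact ((congrArg (fun q => D q (R (flatLift m N x))) h1).trans
    (dExtPt_dHam_zero j.pt (flatLift m N x))).symm

theorem not_connSemiHolonomic_flatConn (hm : 0 < m) (hN : 0 < N)
    {D' : ExtConn (fun _ : BaseModel m => detForm m) (fun _ : J1 m N (trivialBundle m N) => 0)}
    (hD : (isAlmostRegular_zero_detForm m N).ConnRel univ flatConn D') :
    ¬ ConnSemiHolonomic (fun _ => detForm m) (fun _ => 0) univ D' := by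
  intro h
  set j := productJet (0 : TotalModel m N) (tiltMap hm hN)
  let D : ExtMomentum m N (trivialBundle m N) → MomModel m N →L[ℝ] TotalModel m N := dExtPt
  let R : TotalModel m N →L[ℝ] MomModel m N := (isAlmostRegular_zero_detForm m N).dHam j.pt
  let l : BaseModel m →L[ℝ] MomModel m N := D' j
  have h1 : l = R.comp (flatLift m N) := hD j trivial
  have h2 : (D (extLegendre (fun _ => detForm m) (fun _ => 0) j)).comp l = j.horLift := h j trivial
  have h3 : (isAlmostRegular_zero_detForm m N).hamSection j.pt =
      extLegendre (fun _ => detForm m) (fun _ => 0) j :=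
    (congrFun hamSection_zero j.pt).trans (extLegendre_zero _ j).symm
  refine flatLift_ne hm hN (Eq.trans ?_ h2)
  rw [h1, ← h3]
  refine ContinuousLinearMap.ext fun x => ?_
  exact (dExtPt_dHam_zero j.pt (flatLift m N x)).symm

theorem detForm_eq_of_ιMulti_eq {V : Type*} [NormedAddCommGroup V] [NormedSpace ℝ V]
    {l l' : BaseModel m →L[ℝ] V} {c : ℝ} (h : liftMV l = c • liftMV l') (T : V →L[ℝ] BaseModel m) :
    detForm m (fun i => T (l (EuclideanSpace.single i (1 : ℝ)))) =
      c * detForm m (fun i => T (l' (EuclideanSpace.single i (1 : ℝ)))) := by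
  have h1 := congrArg (mvPair (detForm m) T) h
  rw [mvPair_smul] at h1
  unfold mvPair liftMV at h1
  rw [exteriorPower.alternatingMapLinearEquiv_apply_ιMulti,
    exteriorPower.alternatingMapLinearEquiv_apply_ιMulti] at h1
  exact h1

/-- Proportionality, not only equality, has to be excluded, so an `m`-form is used that vanishes on
the tilted `m`-vector but not on the flat one. -/
theorem ιMulti_flatLift_ne (hm : 0 < m) (hN : 0 < N) (c : ℝ) :
    liftMV (V := TotalModel m N) (flatLift m N) ≠ c • liftMV (V := TotalModel m N)
      ((ContinuousLinearMap.id ℝ (BaseModel m)).prod (tiltMap hm hN)) := by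
  intro h
  -- The projection `(x, y) ↦ x - y₀ e₀` is the identity on flat vectors and kills the first tilted
  -- vector `(e₀, f₀)`.
  have h2 := detForm_eq_of_ιMulti_eq h (ContinuousLinearMap.fst ℝ _ _ -
    (((EuclideanSpace.proj ⟨0, hN⟩ : EuclideanSpace ℝ (Fin N) →L[ℝ] ℝ).comp
      (ContinuousLinearMap.snd ℝ _ _)).smulRight (EuclideanSpace.single ⟨0, hm⟩ (1 : ℝ))))
  have h3 : ∀ x : BaseModel m, (flatLift m N x) = (x, 0) := fun _ => rfl
  refine zero_ne_one (α := ℝ) ((h2.trans ?_).symm.trans ?_)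
  · exact (congrArg (c * ·) ((detForm m).map_coord_zero ⟨0, hm⟩ (by simp [tiltMap_single]))).trans
      (mul_zero c)
  · simp [h3, detForm_single]

set_option maxHeartbeats 4000000 in
theorem not_mvSemiHolonomic_flatMV (hm : 0 < m) (hN : 0 < N)
    {K : MVField (MomModel m N) m (extLegendre (fun _ : BaseModel m => detForm m)
      (fun _ : J1 m N (trivialBundle m N) => 0))}
    (hK : (isAlmostRegular_zero_detForm m N).MVRel univ flatMV K) :
    ¬ MVSemiHolonomic (fun _ => detForm m) (fun _ => 0) univ K := by
  intro h
  set j := productJet (0 : TotalModel m N) (tiltMap hm hN)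
  let D : ExtMomentum m N (trivialBundle m N) → MomModel m N →L[ℝ] TotalModel m N := dExtPt
  let R : TotalModel m N →L[ℝ] MomModel m N := (isAlmostRegular_zero_detForm m N).dHam j.pt
  obtain ⟨c, -, hc⟩ := h j trivial
  have h1 : K j = mvPush (H₁ := TotalModel m N) (H₂ := MomModel m N) R (flatMV j.pt) := hK j trivial
  have h3 : (isAlmostRegular_zero_detForm m N).hamSection j.pt =
      extLegendre (fun _ => detForm m) (fun _ => 0) j :=
    (congrFun hamSection_zero j.pt).trans (extLegendre_zero _ j).symm
  refine ιMulti_flatLift_ne hm hN c (Eq.trans ?_ hc)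
  refine Eq.trans ?_ (congrArg (mvPush (H₁ := MomModel m N) (H₂ := TotalModel m N)
    (D (extLegendre (fun _ => detForm m) (fun _ => 0) j))) h1).symm
  refine Eq.trans ?_ (congrArg (fun q => mvPush (H₁ := MomModel m N) (H₂ := TotalModel m N) (D q)
    (mvPush (H₁ := TotalModel m N) (H₂ := MomModel m N) R (flatMV j.pt))) h3)
  refine Eq.trans ?_ (mvPush_comp (H₁ := TotalModel m N) (H₂ := MomModel m N)
    (H₃ := TotalModel m N) _ R _)
  have h5 : (D ((isAlmostRegular_zero_detForm m N).hamSection j.pt)).comp R =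
      ContinuousLinearMap.id ℝ (TotalModel m N) :=
    ContinuousLinearMap.ext fun x => dExtPt_dHam_zero j.pt x
  rw [h5]
  exact (mvPush_id (H₁ := TotalModel m N) _).symm

end NonSemiHolonomic

end FieldTheory

end

noncomputable section

namespace FieldTheory

/-! ### Last transfers and assembly of the theorem -/

section Assembly

variable {m N : ℕ} {M : Type*} [TopologicalSpace M] [ChartedSpace (BaseModel m) M]
  [IsManifold 𝓘(ℝ, BaseModel m) ∞ M]
  {E : Type*} [TopologicalSpace E] [ChartedSpace (TotalModel m N) E]
  [IsManifold 𝓘(ℝ, TotalModel m N) ∞ E]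
  {π : E → M} [IsFiberedManifold m N π] {vol : DiffForm (BaseModel m) M m} {L : J1 m N π → ℝ}
  {S : Set (J1 m N π)}
  {G : Type*} [NormedAddCommGroup G] [NormedSpace ℝ G] [FiniteDimensional ℝ G]
  {P : Type*} [TopologicalSpace P] [ChartedSpace G P] [IsManifold 𝓘(ℝ, G) ∞ P]
  {j0 : P → RestMomentum m N π} {FL0 : J1 m N π → P}

set_option maxHeartbeats 4000000 in
theorem mvFieldEq_of_extMVAt {K : MVField (MomModel m N) m (extLegendre vol L)}
    (hK : ∀ j ∈ S, ExtMVAt vol L j (K j)) : MVFieldEq vol L S K :=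
  fun j hj => (hK j hj).fieldEq

set_option maxHeartbeats 4000000 in
theorem IsHyperRegular.mvSemiHolonomic (hh : IsHyperRegular vol L) (hvol : IsVolumeForm vol)
    (hL : ContMDiff 𝓘(ℝ, JetModel m N) 𝓘(ℝ, ℝ) ∞ L)
    {K : MVField (MomModel m N) m (extLegendre vol L)} (hK : ∀ j ∈ S, ExtMVAt vol L j (K j)) :
    MVSemiHolonomic vol L S K := fun j hj =>
  have h1 : IsMultivectorOver (TangentSpace 𝓘(ℝ, MomModel m N) (extLegendre vol L j))
      (TangentSpace 𝓘(ℝ, TotalModel m N) (extLegendre vol L j).pt) inferInstance inferInstance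
      inferInstance inferInstance (dExtPt (extLegendre vol L j)).toLinearMap j.horLift (K j) :=
    hh.isMultivectorOver hvol hL (hK j hj)
  h1

namespace IsAlmostRegular

variable (h : IsAlmostRegular (G := G) vol L j0 FL0)

omit [IsManifold 𝓘(ℝ, BaseModel m) ∞ M] [IsManifold 𝓘(ℝ, TotalModel m N) ∞ E]
  [IsManifold 𝓘(ℝ, G) ∞ P] [FiniteDimensional ℝ G] in
set_option maxHeartbeats 4000000 in
theorem exists_mvRel (S : Set (J1 m N π)) (X : MVField G m (id : P → P)) : ∃ K, h.MVRel S X K :=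
  ⟨fun j => exteriorPower.map m (h.dHam (FL0 j)).toLinearMap (X (FL0 j)), fun _ _ => rfl⟩

omit [IsManifold 𝓘(ℝ, BaseModel m) ∞ M] [IsManifold 𝓘(ℝ, TotalModel m N) ∞ E]
  [FiniteDimensional ℝ G] in
set_option maxHeartbeats 4000000 in
theorem mvEquivOn_of_rel {X X' : MVField G m (id : P → P)}
    {K K' : MVField (MomModel m N) m (extLegendre vol L)} (hR : h.MVRel S X K)
    (hXX : MVEquivOn G id (FL0 '' S) X X') (hR' : h.MVRel S X' K') :
    MVEquivOn (JetModel m N) (extLegendre vol L) S K K' :=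
  mvEquivOn_iff.2 (h.equivOn_of_rel hR.model (mvEquivOn_iff.1 hXX) hR'.model)

/-- The image of a connection on `P` is a section over `M`, and its values `T h̃ (D x)` lie in the
range of the differential of the extended Legendre map because `D x` lifts through the submersion
`FL0`. -/
theorem connSemiHolonomic_of_rel (hh : IsHyperRegular vol L) (hvol : IsVolumeForm vol)
    (hL : ContMDiff 𝓘(ℝ, JetModel m N) 𝓘(ℝ, ℝ) ∞ L) {D : HamConn (G := G) j0}
    (hC : IsConnectionOn G (hamBase j0) id (FL0 '' S) D) {D' : ExtConn vol L}
    (hR : h.ConnRel S D D') (hE : ConnFieldEq vol L S D') : ConnSemiHolonomic vol L S D' := by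
  refine hh.connSemiHolonomic hvol hL (fun j hj x => ?_) (fun j hj x => ?_) hE
  · obtain ⟨U, -, hU, D₁, -, h2, h3⟩ := hC (FL0 j) (mem_image_of_mem _ hj)
    let R : G →L[ℝ] MomModel m N := h.dHam (FL0 j)
    let l : BaseModel m →L[ℝ] G := D (FL0 j)
    let l₁ : BaseModel m →L[ℝ] G := D₁ (FL0 j)
    let T : ExtMomentum m N π → MomModel m N →L[ℝ] BaseModel m := dMap m (MomModel m N) (extBase π)
    have h4 : l = l₁ := h3 _ ⟨hU, mem_image_of_mem _ hj⟩
    have h5 : (D' j : BaseModel m →L[ℝ] MomModel m N) = R.comp l := hR j hj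
    refine (congrArg (fun A : BaseModel m →L[ℝ] MomModel m N => T (extLegendre vol L j) (A x))
      (h5.trans (congrArg (R.comp ·) h4))).trans ?_
    refine (congrArg (fun q => T q (R (l₁ x))) (h.hamSection_leg hvol hL j)).symm.trans ?_
    exact (h.dMap_dHam hvol hL (FL0 j) (l₁ x)).trans
      (h.dMap_connection (D := l₁) (h2 _ hU) x)
  · obtain ⟨u, hu⟩ := h.submersion j (D (FL0 j) x)
    refine ⟨u, (h.dLegendre_eq hvol hL j u).trans ?_⟩
    let R : G →L[ℝ] MomModel m N := h.dHam (FL0 j)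
    let l : BaseModel m →L[ℝ] G := D (FL0 j)
    have h5 : (D' j : BaseModel m →L[ℝ] MomModel m N) = R.comp l := hR j hj
    exact (congrArg R hu).trans (DFunLike.congr_fun h5 x).symm

end IsAlmostRegular

end Assembly

end FieldTheory

end

theorem mainTheorem3 {m N : ℕ} (hm : 0 < m)
    {M : Type*} [TopologicalSpace M] [ChartedSpace (BaseModel m) M]
    [IsManifold 𝓘(ℝ, BaseModel m) ∞ M]
    {E : Type*} [TopologicalSpace E] [ChartedSpace (TotalModel m N) E]
    [IsManifold 𝓘(ℝ, TotalModel m N) ∞ E]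
    {π : E → M} [IsFiberedManifold m N π]
    (vol : DiffForm (BaseModel m) M m) (hvol : IsVolumeForm vol)
    (L : J1 m N π → ℝ)
    (hL : ContMDiff 𝓘(ℝ, JetModel m N) 𝓘(ℝ, ℝ) ∞ L)
    {G : Type*} [NormedAddCommGroup G] [NormedSpace ℝ G] [FiniteDimensional ℝ G]
    {P : Type*} [TopologicalSpace P] [ChartedSpace G P] [IsManifold 𝓘(ℝ, G) ∞ P]
    (j0 : P → RestMomentum m N π) (FL0 : J1 m N π → P)
    (h : IsAlmostRegular (G := G) vol L j0 FL0) :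
    ((∀ (S : Set (J1 m N π)) (Y : J1 m N π →
          FirstJet m (MomModel m N) (extBase π))
        (Ψ : P → FirstJet m G (hamBase j0)),
        JetStructural vol L S Y → JetFieldEq vol L S Y →
        JetSemiHolonomic S Y →
        IsJetFieldOn G (hamBase j0) id (FL0 '' S) Ψ →
        h.JetRel S Ψ Y →
        h.HDWJet (FL0 '' S) Ψ) ∧
      (∀ (C : Set P) (Ψ : P → FirstJet m G (hamBase j0)),
        h.HDWJet C Ψ → ∀ S : Set (J1 m N π), FL0 '' S = C →
        (∃ Y, h.JetRel S Ψ Y) ∧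
        ∀ Y, h.JetRel S Ψ Y →
          JetStructural vol L S Y ∧ JetFieldEq vol L S Y ∧
          (IsHyperRegular vol L → JetSemiHolonomic S Y))) ∧
    ((∀ (S : Set (J1 m N π))
        (K : MVField (MomModel m N) m (extLegendre vol L))
        (X : MVField G m (id : P → P)),
        MVStructural vol L S K → MVFieldEq vol L S K →
        MVSemiHolonomic vol L S K →
        IsSmoothMVOn G id (FL0 '' S) X → (∀ p ∈ FL0 '' S, X p ≠ 0) →
        (∃ K' X', MVEquivOn (JetModel m N)
            (extLegendre vol L) S K K' ∧
          MVEquivOn G id (FL0 '' S) X X' ∧ h.MVRel S X' K') →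
        ∀ X', MVEquivOn G id (FL0 '' S) X X' → h.HDWMV (FL0 '' S) X') ∧
      (∀ (C : Set P) (X : MVField G m (id : P → P)),
        h.HDWMV C X → ∀ S : Set (J1 m N π), FL0 '' S = C →
        (∃ K, h.MVRel S X K) ∧
        (∀ K K' X', h.MVRel S X K → MVEquivOn G id C X X' → h.MVRel S X' K' →
          MVEquivOn (JetModel m N) (extLegendre vol L) S K K') ∧
        ∀ K K', h.MVRel S X K → MVEquivOn (JetModel m N)
            (extLegendre vol L) S K K' →
          MVStructural vol L S K' ∧ MVFieldEq vol L S K' ∧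
          (IsHyperRegular vol L → MVSemiHolonomic vol L S K'))) ∧
    ((∀ (S : Set (J1 m N π)) (D' : ExtConn vol L)
        (D : IsAlmostRegular.HamConn (G := G) j0),
        ConnStructural vol L S D' → ConnFieldEq vol L S D' →
        ConnSemiHolonomic vol L S D' →
        IsConnectionOn G (hamBase j0) id (FL0 '' S) D →
        h.ConnRel S D D' →
        h.HDWConn (FL0 '' S) D) ∧
      (∀ (C : Set P) (D : IsAlmostRegular.HamConn (G := G) j0),
        h.HDWConn C D → ∀ S : Set (J1 m N π), FL0 '' S = C →
        (∃ D', h.ConnRel S D D') ∧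
        ∀ D', h.ConnRel S D D' →
          ConnStructural vol L S D' ∧ ConnFieldEq vol L S D' ∧
          (IsHyperRegular vol L → ConnSemiHolonomic vol L S D'))) ∧
    (0 < N → ∃ (vol' : DiffForm (BaseModel m) (BaseModel m) m)
      (L' : J1 m N (trivialBundle m N) → ℝ)
      (i0 : TotalModel m N →
        RestMomentum m N (trivialBundle m N))
      (F0 : J1 m N (trivialBundle m N) → TotalModel m N)
      (h' : IsAlmostRegular (G := TotalModel m N) vol' L' i0 F0),
      IsVolumeForm vol' ∧
      ContMDiff 𝓘(ℝ, JetModel m N) 𝓘(ℝ, ℝ) ∞ L' ∧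
      (∃ Ψ, h'.HDWJet univ Ψ ∧
        ∀ Y, h'.JetRel univ Ψ Y → ¬ JetSemiHolonomic univ Y) ∧
      (∃ X, h'.HDWMV univ X ∧
        ∀ K, h'.MVRel univ X K → ¬ MVSemiHolonomic vol' L' univ K) ∧
      ∃ D, h'.HDWConn univ D ∧
        ∀ D', h'.ConnRel univ D D' → ¬ ConnSemiHolonomic vol' L' univ D') := by
  refine ⟨⟨?_, ?_⟩, ⟨?_, ?_⟩, ⟨?_, ?_⟩, ?_⟩
  · intro S Y Ψ _ hY2 _ hΨ hR
    exact ⟨hΨ, (h.jetFieldEq_iff hvol hL hΨ hR).1 hY2⟩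
  · rintro C Ψ hΨ S rfl
    refine ⟨⟨h.pushJet hvol hL Ψ, h.pushJet_rel hvol hL S Ψ⟩, fun Y hY => ?_⟩
    have h1 := h.jetStructural_of_rel hvol hL hΨ.jetField hY
    have h2 := (h.jetFieldEq_iff hvol hL hΨ.jetField hY).2 hΨ.fieldEq
    exact ⟨h1, h2, fun hh => hh.jetSemiHolonomic hvol hL h1 h2⟩
  · rintro S K X hK1 hK2 - hX - ⟨K', X', hKK, hXX, hR⟩ X₂ hX₂
    exact h.hdwMV_of_rel hvol hL hm hK1 hK2 hX hKK hXX hR hX₂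
  · rintro C X hX S rfl
    refine ⟨h.exists_mvRel S X, fun K K' X' hR hXX hR' => h.mvEquivOn_of_rel hR hXX hR',
      fun K K' hR hKK => ?_⟩
    obtain ⟨h1, h2⟩ := h.mvStructural_of_rel hvol hL hm hX hR hKK
    exact ⟨h1, mvFieldEq_of_extMVAt h2, fun hh => hh.mvSemiHolonomic hvol hL h2⟩
  · intro S D' D _ hD2 _ hD hR
    exact ⟨hD, (h.connFieldEq_iff hvol hL hR).1 hD2⟩
  · rintro C D hD S rfl
    refine ⟨⟨h.pushConn hvol hL D, fun _ _ => rfl⟩, fun D' hR => ?_⟩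
    have h1 := h.connStructural_of_rel hvol hL hD.connection hR
    have h2 := (h.connFieldEq_iff hvol hL hR).2 hD.fieldEq
    exact ⟨h1, h2, fun hh => h.connSemiHolonomic_of_rel hh hvol hL hD.connection hR h2⟩
  · intro hN
    exact ⟨_, _, _, _, isAlmostRegular_zero_detForm m N, isVolumeForm_detForm m, contMDiff_const,
      ⟨flatJet, hdwJet_flatJet, fun _ => not_jetSemiHolonomic_flatJet hm hN⟩,
      ⟨flatMV, hdwMV_flatMV, fun _ => not_mvSemiHolonomic_flatMV hm hN⟩,
      ⟨flatConn, hdwConn_flatConn, fun _ => not_connSemiHolonomic_flatConn hm hN⟩⟩
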